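/- Consider the first-come-first-served M/G/1 queue: customers arrive in a Poisson process of rate $\lambda>0$, and service times are i.i.d. with a distribution $G$ on $[0,\infty)$ with moments $g_k=\int x^k\,dG(x)$, where $g_1>0$ and $g_3<\infty$. Put $\rho=\lambda g_1$ and assume $\rho<1$. Let $c^2=g_2/g_1^2-1$ be the squared coefficient of variation ($c\ge 0$) and $\gamma=(2g_1^3-3g_1g_2+g_3)/(g_2-g_1^2)^{3/2}$ the skewness coefficient of $G$ (with $\gamma c^3:=0$ when $G$ is deterministic). Let $Q(t)$ be the number of customers in the system at time $t$, let $R(t)$ be the remaining service time of the customer in service ($R(t)=0$ if $Q(t)=0$), let $D(t)$ be the number of service completions during $[0,t]$, and let $v(t)=\mathrm{Var}\,D(t)$. The initial state is independent of the arrival epochs after time $0$ and of the service times of all customers except the one in service at time $0$. For a given law of the initial state, we say that Assumption 1 holds with y-intercept $\bar b$ if there is a real $\bar v$ with $v(t)=\bar v t+\bar b+o(1)$ as $t\to\infty$. The process $(Q(t),R(t))$ has a stationary law, and the number of customers has a finite variance $\sigma_\pi^2$ under it. Put $$\bar b_e=L_e\frac{\rho}{(1-\rho)^2},\qquad L_e=\frac{(3c^4-4\gamma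 c^3+6c^2-1)\rho^3+(4\gamma c^3-12c^2+4)\rho^2+(6c^2-6)\rho}{6}.$$ 1. If Assumption 1 holds for the stationary queue, then its y-intercept is $\bar b_e$. 2. Let the number $Q(0)$ of initial customers have an arbitrary distribution $\theta$ with finite variance, the initial customers having i.i.d. service times with distribution $G$, independent of $Q(0)$, with the first service starting at time $0$. If Assumption 1 holds for this queue, then its y-intercept is $$\bar b_\theta=\mathrm{Var}\,Q(0)-\sigma_\pi^2+\bar b_e .$$ The same formula holds, whenever Assumption 1 does, if the customer in service at time $0$ has instead an arbitrary remaining service time $R(0)\ge 0$ with a finite second moment, which may depend on $Q(0)$. 3. In particular, if Assumption 1 holds for the queue that starts empty, then its y-intercept is $$\bar b_0=-(1-L_0)\frac{\rho}{(1-\rho)^2},\qquad L_0=\frac{(3c^4-4\gamma c^3+6c^2-1)\rho^3+(4\gamma c^3-6c^2-2)\rho^2+(-6c^2+6)\rho}{12}.$$ -/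

import Mathlib

open MeasureTheory ProbabilityTheory Filter Topology

noncomputable section

namespace MG1

/-! ### The single-server queue, path by path -/

/-- State of the queue: number of customers in the system, and remaining service time of the
customer in service (taken to be `0` when the system is empty). -/
abbrev State := ℕ × ℝ

/-- Everything that drives the queue: the initial state `(q, r)`, the sequence of interarrival
times, and the sequence of service times. -/
abbrev Input := State × (ℕ → ℝ) × (ℕ → ℝ)

/-- Number of customers present initially. -/
def initialNumber (ω : Input) : ℕ := ω.1.1

/-- Epoch of the `j`-th exogenous arrival, `j = 0, 1, 2, …`. -/
def arrivalEpoch (ω : Input) (j : ℕ) : ℝ := ∑ i ∈ Finset.range (j + 1), ω.2.1 i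

/-- Customers are numbered `0, 1, 2, …` in order of service (first come, first served), the
initial customers `0, …, q - 1` first.  Epoch from which customer `n` is present: `0` for the
initial customers, the arrival epoch for the others. -/
def entryTime (ω : Input) (n : ℕ) : ℝ :=
  if n < initialNumber ω then 0 else arrivalEpoch ω (n - initialNumber ω)

/-- Service time, counted from time `0`, of customer `n`: if customers are present initially then
customer `0` is in service at time `0` and needs the remaining time `r`. -/
def serviceTime (ω : Input) (n : ℕ) : ℝ :=
  if n = 0 ∧ 0 < initialNumber ω then ω.1.2 else ω.2.2 n

/-- Departure epoch of customer `n`: service starts as soon as both the customer is present and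
the preceding customer has left. -/
def departureTime (ω : Input) : ℕ → ℝ
  | 0 => entryTime ω 0 + serviceTime ω 0
  | n + 1 => max (departureTime ω n) (entryTime ω (n + 1)) + serviceTime ω (n + 1)

/-- `D(t)`: number of service completions during `[0, t]`. -/
def departures (ω : Input) (t : ℝ) : ℕ := {n | departureTime ω n ≤ t}.ncard

/-- `Q(t)`: number of customers in the system at time `t`. -/
def queueLength (ω : Input) (t : ℝ) : ℕ :=
  {n | entryTime ω n ≤ t ∧ t < departureTime ω n}.ncard

/-- State at time `t`.  When the system is not empty at time `t`, the customer in service is the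
one numbered `D(t)`, because exactly the customers `0, …, D(t) - 1` have left. -/
def stateAt (ω : Input) (t : ℝ) : State :=
  (queueLength ω t,
    if queueLength ω t = 0 then 0 else departureTime ω (departures ω t) - t)

/-! ### The M/G/1 queue -/

/-- Law of the input of the M/G/1 queue with arrival rate `lam` (Poisson arrivals, that is,
independent exponential interarrival times), service time distribution `G` and law `ν` of the
initial state; initial state, interarrival times and service times are independent. -/
def law (lam : ℝ) (G : Measure ℝ) (ν : Measure State) : Measure Input :=
  ν.prod ((Measure.infinitePi fun _ : ℕ => expMeasure lam).prod
    (Measure.infinitePi fun _ : ℕ => G))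

/-- Variance curve `v(t) = Var D(t)`. -/
def varianceCurve (lam : ℝ) (G : Measure ℝ) (ν : Measure State) (t : ℝ) : ℝ :=
  variance (fun ω : Input => (departures ω t : ℝ)) (law lam G ν)

/-- `v(t) = vbar * t + b + o(1)` as `t → ∞`. -/
def HasLinearAsymptote (v : ℝ → ℝ) (vbar b : ℝ) : Prop :=
  Tendsto (fun t : ℝ => v t - (vbar * t + b)) atTop (𝓝 0)

/-- `π` is a stationary law of the M/G/1 queue: started with law `π`, the state of the queue has
law `π` at all times. -/
structure IsStationary (lam : ℝ) (G : Measure ℝ) (π : Measure State) : Prop where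
  isProbabilityMeasure : IsProbabilityMeasure π
  map_stateAt : ∀ t : ℝ, 0 ≤ t → (law lam G π).map (fun ω => stateAt ω t) = π

/-- Variance of the number of customers under a law `ν` of the state. -/
def numberVariance (ν : Measure State) : ℝ := variance (fun s : State => (s.1 : ℝ)) ν

/-! ### Parameters -/

/-- `k`-th moment `g_k` of the service time distribution. -/
def g (G : Measure ℝ) (k : ℕ) : ℝ := ∫ x, x ^ k ∂G

/-- Traffic intensity `ρ = λ / μ = λ g₁`. -/
def rho (lam : ℝ) (G : Measure ℝ) : ℝ := lam * g G 1

/-- Coefficient of variation: `c² = g₂ / g₁² - 1`. -/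
def cv (G : Measure ℝ) : ℝ := Real.sqrt (g G 2 / g G 1 ^ 2 - 1)

/-- Skewness coefficient `γ`.  For deterministic service times it is `0 / 0 = 0`, and then `γ c³`
is `0`, which is the correct value `(2 g₁³ - 3 g₁ g₂ + g₃) / g₁³` of this product. -/
def skew (G : Measure ℝ) : ℝ :=
  (2 * g G 1 ^ 3 - 3 * g G 1 * g G 2 + g G 3) / (g G 2 - g G 1 ^ 2) ^ (3 / 2 : ℝ)

def Le (lam : ℝ) (G : Measure ℝ) : ℝ :=
  ((3 * cv G ^ 4 - 4 * skew G * cv G ^ 3 + 6 * cv G ^ 2 - 1) * rho lam G ^ 3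
    + (4 * skew G * cv G ^ 3 - 12 * cv G ^ 2 + 4) * rho lam G ^ 2
    + (6 * cv G ^ 2 - 6) * rho lam G) / 6

/-- The y-intercept `L_e ρ / (1 - ρ)²` of the stationary queue. -/
def be (lam : ℝ) (G : Measure ℝ) : ℝ := Le lam G * (rho lam G / (1 - rho lam G) ^ 2)

def L0 (lam : ℝ) (G : Measure ℝ) : ℝ :=
  ((3 * cv G ^ 4 - 4 * skew G * cv G ^ 3 + 6 * cv G ^ 2 - 1) * rho lam G ^ 3
    + (4 * skew G * cv G ^ 3 - 6 * cv G ^ 2 - 2) * rho lam G ^ 2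
    + (-6 * cv G ^ 2 + 6) * rho lam G) / 12

end MG1

end

noncomputable section
namespace MG1
open scoped ENNReal

/-! ### Sequences of i.i.d. variables -/

/-! Flow balance gives D(t) = Q(0) + A(t) - Q(t), with A the Poisson arrival count
(`Good.queueLength_add`). Since A is independent of Q(0), Var D(t) = Var Q(0) + λt + Var Q(t) - 2
Cov(Q(0), Q(t)) - 2 Cov(A(t), Q(t)). A linear asymptote is assumed, so only its intercept has to be
identified, and all terms may be averaged over an independent exponential time of rate θ tending to
0 (`eq_of_hasLinearAsymptote`). Convergence of the moments at fixed times is never needed.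

The averages are explicit. Under first come, first served the later customers present form a block
of consecutive arrivals ending with the latest one, so their number, its square and its products
with A(t) and with t are sums over customers (`custSum`). `lintegral_abel_custSum` turns their
averages into integrals against the discounted occupation measure of the chain (index, arrival
epoch, sojourn time), where sojourn times follow Lindley's recursion `load`. The transforms of this
measure satisfy kernel identities (`occK_identity`, `occC_identity`), each with one unknown
constant. On the curve θ = η(χ) the kernel vanishes at α = χ, which determines the constant.
Second-order expansions as χ tends to 0 give `tendsto_occB_sub`, `tendsto_occD` and
`tendsto_occC_sub`; the limits do not depend on the law of the initial work, as long as its second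
moment is finite.

Three facts finish the intercept. The initial customers do not matter in the limit (`tendsto_tail`).
The queue started empty with the same arrivals and services has fewer customers but the same
limiting second moment, so the two numbers become close in L² (`tendsto_diff_sq`); as the empty
queue is independent of Q(0), the term Cov(Q(0), Q(t)) disappears (`tendsto_number_mul_queue`). The
mean of the empty queue increases in time, which controls the average of the squared mean
(`tendsto_queueMean_sq`). The result, `intercept`, is b = Var Q(0) + V - 2C with V and C explicit.

A stationary law exists because the queue started empty has tight workload and couples with every
other start, so its laws converge uniformly over measurable sets (`exists_isStationary`). The
workload of any stationary law has the Pollaczek-Khinchine transform, hence a second moment, and its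
number of customers has variance V (`IsStationary.numberVariance_eq`). The stationary intercept is
therefore 2V - 2C, which algebra identifies with `be` (`be_eq`), and the intercept V - 2C of the
empty start is rewritten by `intercept_empty`. -/

/-- Law of an i.i.d. sequence with common law `μ`. -/
abbrev iid (μ : Measure ℝ) : Measure (ℕ → ℝ) := Measure.infinitePi fun _ : ℕ => μ

/-- The first `n` terms of `σ`, followed by `σ'`. -/
def splice (n : ℕ) (σ σ' : ℕ → ℝ) : ℕ → ℝ := fun i => if i < n then σ i else σ' (i - n)

lemma splice_lt {n i : ℕ} (h : i < n) (σ σ' : ℕ → ℝ) : splice n σ σ' i = σ i := by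
  simp [splice, h]

lemma splice_add (n i : ℕ) (σ σ' : ℕ → ℝ) : splice n σ σ' (n + i) = σ' i := by
  simp [splice]

@[fun_prop]
lemma measurable_splice (n : ℕ) :
    Measurable fun p : (ℕ → ℝ) × (ℕ → ℝ) => splice n p.1 p.2 := by
  refine measurable_pi_lambda _ fun i => ?_
  by_cases h : i < n
  · simp only [splice, h, if_true]; fun_prop
  · simp only [splice, h, if_false]; fun_prop

/-- It suffices to test boxes. The coordinates below `n` are tested on the first factor and the
others, reindexed, on the second, so the mass of a box factorizes. All later arguments of the form
"the sequence starts afresh" rest on this cut. -/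
lemma measurePreserving_splice (μ : Measure ℝ) [IsProbabilityMeasure μ] (n : ℕ) :
    MeasurePreserving (fun p : (ℕ → ℝ) × (ℕ → ℝ) => splice n p.1 p.2)
      ((iid μ).prod (iid μ)) (iid μ) := by
  refine ⟨measurable_splice n, Measure.eq_infinitePi _ fun s t ht => ?_⟩
  have hpre : (fun p : (ℕ → ℝ) × (ℕ → ℝ) => splice n p.1 p.2) ⁻¹' (Set.pi s t) =
      (Set.pi (s.filter (· < n) : Finset ℕ) t) ×ˢ
        (Set.pi ((s.filter (n ≤ ·)).image (· - n) : Finset ℕ) fun j => t (n + j)) := by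
    ext p
    simp only [Set.mem_preimage, Set.mem_pi, Finset.mem_coe, Set.mem_prod, Finset.mem_filter,
      Finset.mem_image]
    constructor
    · intro h
      refine ⟨fun i hi => ?_, ?_⟩
      · simpa [splice, hi.2] using h i hi.1
      · rintro j ⟨i, ⟨hi, hni⟩, rfl⟩
        have := h i hi
        rw [show n + (i - n) = i by omega]
        simpa [splice, not_lt.2 hni] using this
    · rintro ⟨h1, h2⟩ i hi
      by_cases hin : i < n
      · simpa [splice, hin] using h1 i ⟨hi, hin⟩
      · have := h2 (i - n) ⟨i, ⟨hi, not_lt.1 hin⟩, rfl⟩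
        rw [show n + (i - n) = i by omega] at this
        simpa [splice, hin] using this
  rw [Measure.map_apply (measurable_splice n) (MeasurableSet.pi s.countable_toSet fun i _ => ht i),
    hpre, Measure.prod_prod, Measure.infinitePi_pi _ (fun i _ => ht i),
    Measure.infinitePi_pi _ (fun i _ => ht (n + i)), Finset.prod_image]
  · rw [← Finset.prod_filter_mul_prod_filter_not s (· < n)]
    congr 1
    simp only [not_lt]
    refine Finset.prod_congr rfl fun i hi => ?_
    rw [show n + (i - n) = i by have := (Finset.mem_filter.1 hi).2; omega]
  · intro i hi j hj hij
    simp only [Finset.coe_filter, Set.mem_ofPred_eq] at hi hj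
    simp only at hij
    omega

lemma lintegral_splice (μ : Measure ℝ) [IsProbabilityMeasure μ] (n : ℕ) {F : (ℕ → ℝ) → ℝ≥0∞}
    (hF : Measurable F) :
    ∫⁻ σ, F σ ∂(iid μ) = ∫⁻ σ, ∫⁻ σ', F (splice n σ σ') ∂(iid μ) ∂(iid μ) := by
  rw [← (measurePreserving_splice μ n).lintegral_comp hF, lintegral_prod _ (by fun_prop)]

lemma measurePreserving_eval (μ : Measure ℝ) [IsProbabilityMeasure μ] (n : ℕ) :
    MeasurePreserving (fun σ : ℕ → ℝ => σ n) (iid μ) μ :=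
  measurePreserving_eval_infinitePi _ n

lemma lintegral_eval (μ : Measure ℝ) [IsProbabilityMeasure μ] (n : ℕ) {f : ℝ → ℝ≥0∞}
    (hf : Measurable f) : ∫⁻ σ, f (σ n) ∂(iid μ) = ∫⁻ x, f x ∂μ :=
  (measurePreserving_eval μ n).lintegral_comp hf

/-- Cutting at `n` represents the sequence as a splice of two independent copies, and the shift
recovers the second one. -/
lemma measurePreserving_shift (μ : Measure ℝ) [IsProbabilityMeasure μ] (n : ℕ) :
    MeasurePreserving (fun σ : ℕ → ℝ => fun i => σ (n + i)) (iid μ) (iid μ) := by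
  refine ⟨by fun_prop, ?_⟩
  conv_lhs => rw [← (measurePreserving_splice μ n).map_eq]
  rw [Measure.map_map (by fun_prop) (by fun_prop)]
  have : ((fun σ : ℕ → ℝ => fun i => σ (n + i)) ∘ fun p : (ℕ → ℝ) × (ℕ → ℝ) =>
      splice n p.1 p.2) = Prod.snd := by
    ext p i; simp [splice_add]
  rw [this, Measure.map_snd_prod]; simp

/-- Prepend a term to a sequence. -/
def cons (x : ℝ) (σ : ℕ → ℝ) : ℕ → ℝ := fun i => if i = 0 then x else σ (i - 1)

@[fun_prop]
lemma measurable_cons : Measurable fun p : ℝ × (ℕ → ℝ) => cons p.1 p.2 := by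
  refine measurable_pi_lambda _ fun i => ?_
  by_cases h : i = 0
  · simp only [cons, h, if_true]; fun_prop
  · simp only [cons, h, if_false]; fun_prop

lemma lintegral_cons (μ : Measure ℝ) [IsProbabilityMeasure μ] {F : (ℕ → ℝ) → ℝ≥0∞}
    (hF : Measurable F) :
    ∫⁻ σ, F σ ∂(iid μ) = ∫⁻ x, ∫⁻ σ, F (cons x σ) ∂(iid μ) ∂μ := by
  rw [lintegral_splice μ 1 hF, ← lintegral_eval μ 0 (f := fun x => ∫⁻ σ, F (cons x σ) ∂(iid μ))]
  · refine lintegral_congr fun σ => lintegral_congr fun σ' => ?_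
    congr 1
    ext i
    by_cases h : i = 0 <;> simp [splice, cons, h]
  · exact Measurable.lintegral_prod_right' (f := fun p : ℝ × (ℕ → ℝ) => F (cons p.1 p.2))
      (by fun_prop)

lemma ae_iid (μ : Measure ℝ) [IsProbabilityMeasure μ] {p : ℝ → Prop} (h : ∀ᵐ x ∂μ, p x) :
    ∀ᵐ σ ∂(iid μ), ∀ i, p (σ i) :=
  ae_all_iff.2 fun i => (measurePreserving_eval μ i).quasiMeasurePreserving.ae h

lemma iid_slln (μ : Measure ℝ) [IsProbabilityMeasure μ] (h : Integrable (fun x => x) μ) :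
    ∀ᵐ σ ∂(iid μ), Tendsto (fun n : ℕ => (∑ i ∈ Finset.range n, σ i) / (n : ℝ)) atTop
      (𝓝 (∫ x, x ∂μ)) := by
  have hmp := fun i => measurePreserving_eval μ i
  have hind : iIndepFun (β := fun _ => ℝ) (fun (i : ℕ) (σ : ℕ → ℝ) => σ i) (iid μ) :=
    iIndepFun_infinitePi (Ω := fun _ : ℕ => ℝ) (𝓧 := fun _ => ℝ) (P := fun _ : ℕ => μ) (X := fun _ x => x) (fun _ => by fun_prop)
  have hint : Integrable (fun σ : ℕ → ℝ => σ 0) (iid μ) := (hmp 0).integrable_comp_of_integrable h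
  have := strong_law_ae_real (μ := iid μ) (fun (i : ℕ) (σ : ℕ → ℝ) => σ i) hint
    (fun i j hij => hind.indepFun hij) (fun i => ⟨(hmp i).measurable.aemeasurable, (hmp 0).measurable.aemeasurable, by
      rw [(hmp i).map_eq, (hmp 0).map_eq]⟩)
  have e : ∫ σ, σ 0 ∂(iid μ) = ∫ x, x ∂μ := by
    conv_rhs => rw [← (hmp 0).map_eq]
    rw [integral_map (hmp 0).measurable.aemeasurable (by fun_prop)]
  rw [e] at this
  exact this

/-! ### The exponential law -/

lemma lintegral_expMeasure (r : ℝ) (f : ℝ → ℝ≥0∞) (hf : Measurable f) :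
    ∫⁻ x, f x ∂(expMeasure r) =
      ∫⁻ x in Set.Ioi 0, ENNReal.ofReal (r * Real.exp (-(r * x))) * f x := by
  have : expMeasure r = volume.withDensity (exponentialPDF r) := rfl
  rw [this, lintegral_withDensity_eq_lintegral_mul₀ (by
    unfold exponentialPDF; fun_prop) (by fun_prop), ← lintegral_indicator measurableSet_Ioi]
  refine lintegral_congr_ae ?_
  have h0 : ∀ᵐ x : ℝ, x ≠ 0 := by simp [ae_iff]
  filter_upwards [h0] with x hx
  by_cases h : 0 < x
  · simp [Set.indicator, h, exponentialPDF_of_nonneg h.le]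
  · have : x < 0 := lt_of_le_of_ne (not_lt.1 h) hx
    simp [Set.indicator, h, exponentialPDF_of_neg this]

lemma integral_expMeasure {r : ℝ} (hr : 0 < r) (f : ℝ → ℝ) :
    ∫ x, f x ∂(expMeasure r) = ∫ x in Set.Ioi 0, r * Real.exp (-(r * x)) * f x := by
  have : expMeasure r = volume.withDensity (exponentialPDF r) := rfl
  rw [this, integral_withDensity_eq_integral_toReal_smul (by
    unfold exponentialPDF; fun_prop) (by simp [exponentialPDF]),
    ← integral_indicator measurableSet_Ioi]
  refine integral_congr_ae ?_
  have h0 : ∀ᵐ x : ℝ, x ≠ 0 := by simp [ae_iff]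
  filter_upwards [h0] with x hx
  by_cases h : 0 < x
  · have := mul_nonneg hr.le (Real.exp_nonneg (-(r * x)))
    simp [Set.indicator, h, exponentialPDF_of_nonneg h.le, this]
  · have : x < 0 := lt_of_le_of_ne (not_lt.1 h) hx
    simp [Set.indicator, h, exponentialPDF_of_neg this]

lemma ae_expMeasure_pos (r : ℝ) : ∀ᵐ x ∂(expMeasure r), 0 < x := by
  rw [ae_iff, ← setLIntegral_one, ← lintegral_indicator (by measurability),
    lintegral_expMeasure _ _ (by measurability)]
  simp only [not_lt]
  refine (setLIntegral_congr_fun measurableSet_Ioi fun x hx => ?_).trans (lintegral_zero)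
  simp only [Set.mem_Ioi] at hx
  simp [Set.indicator, hx]

lemma integrable_expMeasure_iff {r : ℝ} (hr : 0 < r) (f : ℝ → ℝ) :
    Integrable f (expMeasure r) ↔
      IntegrableOn (fun x => Real.exp (-(r * x)) * f x) (Set.Ioi 0) := by
  have : expMeasure r = volume.withDensity (exponentialPDF r) := rfl
  rw [this, integrable_withDensity_iff_integrable_smul' (by
    unfold exponentialPDF; fun_prop) (by simp [exponentialPDF]),
    IntegrableOn, ← integrable_const_mul_iff (c := r) (by simp [hr.ne'])
      (fun x => Real.exp (-(r * x)) * f x), ← IntegrableOn,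
    ← integrable_indicator_iff measurableSet_Ioi]
  refine integrable_congr ?_
  have h0 : ∀ᵐ x : ℝ, x ≠ 0 := by simp [ae_iff]
  filter_upwards [h0] with x hx
  by_cases h : 0 < x
  · have := mul_nonneg hr.le (Real.exp_nonneg (-(r * x)))
    simp [Set.indicator, h, exponentialPDF_of_nonneg h.le, this, mul_assoc]
  · have : x < 0 := lt_of_le_of_ne (not_lt.1 h) hx
    simp [Set.indicator, h, exponentialPDF_of_neg this]

lemma integrable_pow_expMeasure {r : ℝ} (hr : 0 < r) (n : ℕ) :
    Integrable (fun x => x ^ n) (expMeasure r) := by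
  rw [integrable_expMeasure_iff hr]
  have := integrableOn_rpow_mul_exp_neg_mul_rpow (s := n) (p := 1) (b := r)
    (by have : (0:ℝ) ≤ n := n.cast_nonneg
        linarith) zero_lt_one hr
  refine this.congr_fun (fun x hx => ?_) measurableSet_Ioi
  simp [mul_comm]

lemma integral_pow_expMeasure {r : ℝ} (hr : 0 < r) (n : ℕ) :
    ∫ x, x ^ n ∂(expMeasure r) = n.factorial / r ^ n := by
  rw [integral_expMeasure hr]
  have := Real.integral_rpow_mul_exp_neg_mul_Ioi (a := n + 1) (r := r) (by positivity) hr
  rw [Real.Gamma_nat_eq_factorial] at this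
  have e : ∫ x in Set.Ioi (0:ℝ), r * Real.exp (-(r * x)) * x ^ n =
      r * ∫ t in Set.Ioi (0:ℝ), t ^ ((n:ℝ) + 1 - 1) * Real.exp (-(r * t)) := by
    rw [← integral_const_mul]
    refine setIntegral_congr_fun measurableSet_Ioi fun x hx => ?_
    simp; ring
  rw [e, this]
  have : (1 / r) ^ ((n:ℝ) + 1) = (1 / r) ^ (n + 1) := by
    rw [← Real.rpow_natCast]; push_cast; rfl
  rw [this, div_pow, pow_succ r]; field_simp; simp

/-! ### Counting the terms of a monotone sequence -/

/-- The indices counted form a finite initial segment, so counting is the generalized inverse of the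
sequence. Arrival and departure counts are handled almost only through this equivalence. -/
lemma lt_ncard_iff {f : ℕ → ℝ} (hf : Monotone f) (hf' : Tendsto f atTop atTop) (t : ℝ) (n : ℕ) :
    n < {k | f k ≤ t}.ncard ↔ f n ≤ t := by
  have hex : ∃ N, t < f N := (hf'.eventually_gt_atTop t).exists
  classical
  have hset : {k | f k ≤ t} = ((Finset.range (Nat.find hex) : Finset ℕ) : Set ℕ) := by
    ext k
    simp only [Set.mem_ofPred_eq, Finset.coe_range, Set.mem_Iio, Nat.lt_find_iff, not_lt]
    exact ⟨fun h m hm => (hf hm).trans h, fun h => h k le_rfl⟩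
  rw [hset, Set.ncard_coe_finset, Finset.card_range, Nat.lt_find_iff]
  simp only [not_lt]
  exact ⟨fun h => h n le_rfl, fun h m hm => (hf hm).trans h⟩

/-! ### Arrival epochs and workload -/

/-- Partial sums: the `n`-th arrival (counted from one) occurs at `epoch a n`. -/
def epoch (a : ℕ → ℝ) (n : ℕ) : ℝ := ∑ i ∈ Finset.range n, a i

/-- Workload just after the `n`-th arrival (counted from one), starting from workload `w`. -/
def load (w : ℝ) (a s : ℕ → ℝ) : ℕ → ℝ
  | 0 => w
  | n + 1 => max (load w a s n - a n) 0 + s n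

/-- Number of arrivals up to time `t`. -/
def arrivals (a : ℕ → ℝ) (t : ℝ) : ℕ := {j | epoch a (j + 1) ≤ t}.ncard

/-- Positive interarrival times with diverging sum. -/
structure GoodArr (a : ℕ → ℝ) : Prop where
  pos : ∀ i, 0 < a i
  tendsto : Tendsto (epoch a) atTop atTop

lemma epoch_zero (a : ℕ → ℝ) : epoch a 0 = 0 := by simp [epoch]

lemma epoch_succ (a : ℕ → ℝ) (n : ℕ) : epoch a (n + 1) = epoch a n + a n := by
  simp [epoch, Finset.sum_range_succ]

lemma GoodArr.mono {a : ℕ → ℝ} (h : GoodArr a) : StrictMono (epoch a) :=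
  strictMono_nat_of_lt_succ fun n => by rw [epoch_succ]; linarith [h.pos n]

lemma GoodArr.nonneg {a : ℕ → ℝ} (h : GoodArr a) (n : ℕ) : 0 ≤ epoch a n := by
  rw [← epoch_zero a]; exact h.mono.monotone (Nat.zero_le n)

lemma GoodArr.lt_arrivals_iff {a : ℕ → ℝ} (h : GoodArr a) (t : ℝ) (n : ℕ) :
    n < arrivals a t ↔ epoch a (n + 1) ≤ t :=
  lt_ncard_iff (f := fun j => epoch a (j + 1)) (fun i j hij => h.mono.monotone (by omega))
    (h.tendsto.comp (tendsto_add_atTop_nat 1)) t n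

lemma GoodArr.epoch_arrivals_le {a : ℕ → ℝ} (h : GoodArr a) {t : ℝ} (ht : 0 ≤ t) :
    epoch a (arrivals a t) ≤ t := by
  cases hA : arrivals a t with
  | zero => simpa [epoch_zero] using ht
  | succ n => exact (h.lt_arrivals_iff t n).1 (by omega)

lemma GoodArr.lt_epoch_arrivals {a : ℕ → ℝ} (h : GoodArr a) (t : ℝ) :
    t < epoch a (arrivals a t + 1) :=
  not_le.1 fun h' => lt_irrefl _ ((h.lt_arrivals_iff t _).2 h')

lemma GoodArr.arrivals_eq_iff {a : ℕ → ℝ} (h : GoodArr a) {t : ℝ} (ht : 0 ≤ t) (n : ℕ) :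
    arrivals a t = n ↔ epoch a n ≤ t ∧ t < epoch a (n + 1) := by
  constructor
  · rintro rfl; exact ⟨h.epoch_arrivals_le ht, h.lt_epoch_arrivals t⟩
  · rintro ⟨h1, h2⟩
    refine le_antisymm (not_lt.1 fun h' => ?_) (not_lt.1 fun h' => ?_)
    · exact absurd ((h.lt_arrivals_iff t n).1 h') (not_le.2 h2)
    · have := h.mono.monotone (show arrivals a t + 1 ≤ n from h')
      exact absurd (h.lt_epoch_arrivals t) (not_lt.2 (this.trans h1))

lemma load_mono {w w' : ℝ} (h : w ≤ w') (a s : ℕ → ℝ) (n : ℕ) :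
    load w a s n ≤ load w' a s n := by
  induction n with
  | zero => exact h
  | succ n ih => simp only [load]; gcongr

/-- Lindley's recursion in absolute time: arrival epoch plus load is a departure epoch, and it obeys
the recursion that defines `departureTime`. -/
lemma epoch_add_load_succ (w : ℝ) (a s : ℕ → ℝ) (n : ℕ) :
    epoch a (n + 1) + load w a s (n + 1) =
      max (epoch a n + load w a s n) (epoch a (n + 1)) + s n := by
  rw [load, ← add_assoc, ← max_add_add_left]
  congr 2
  · rw [epoch_succ]; ring
  · ring

lemma epoch_add_load_mono (w : ℝ) (a : ℕ → ℝ) {s : ℕ → ℝ} (hs : ∀ i, 0 ≤ s i) :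
    Monotone fun n => epoch a n + load w a s n :=
  monotone_nat_of_le_succ fun n => by
    rw [epoch_add_load_succ]
    linarith [le_max_left (epoch a n + load w a s n) (epoch a (n + 1)), hs n]

/-- If the work brought in by time `epoch a (j + 1)` does not exceed that time, then the system
has emptied before, and the initial work has no influence any more. -/
lemma load_coupling {w : ℝ} {a s : ℕ → ℝ} (hw : 0 ≤ w) {j : ℕ}
    (hj : w + epoch s j ≤ epoch a (j + 1)) :
    ∃ i ≤ j, load w a s i ≤ a i ∧ ∀ n, i < n → load w a s n = load 0 a s n := by
  have hex : ∃ i ≤ j, load w a s i ≤ a i := by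
    by_contra! hcon
    -- As long as the system never empties, the maximum in `load` is inactive and the load is
    -- initial work plus services minus elapsed time. At index `j` this contradicts the assumption
    -- on the work brought in.
    have key : ∀ i ≤ j, load w a s i = w - epoch a i + epoch s i := by
      intro i
      induction i with
      | zero => intro _; simp [load, epoch_zero]
      | succ i ih =>
        intro hi
        have := hcon i (by omega)
        rw [load, max_eq_left (by linarith), ih (by omega), epoch_succ, epoch_succ]; ring
    have := hcon j le_rfl
    rw [key j le_rfl] at this
    rw [epoch_succ] at hj
    linarith
  obtain ⟨i, hi, hia⟩ := hex
  refine ⟨i, hi, hia, fun n hn => ?_⟩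
  obtain ⟨k, rfl⟩ := Nat.exists_eq_add_of_lt hn
  induction k with
  | zero =>
    -- Starting from less work, the other chain is empty as well at this arrival; both maxima are
    -- `0` and the recursions agree from here on.
    have := load_mono hw a s i
    simp only [load]
    rw [max_eq_right (by linarith), max_eq_right (by linarith)]
  | succ k ih =>
    have e : i + (k + 1) + 1 = (i + k + 1) + 1 := by ring
    rw [e]
    show max (load w a s (i + k + 1) - _) 0 + _ = max (load 0 a s (i + k + 1) - _) 0 + _
    rw [ih (by omega)]

/-! ### Paths of the queue -/

/-- Inputs with positive interarrival times of diverging sum and nonnegative service times. -/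
structure Good (ω : Input) : Prop where
  arr : GoodArr ω.2.1
  serv : ∀ i, 0 ≤ ω.2.2 i

lemma arrivalEpoch_eq (ω : Input) (j : ℕ) : arrivalEpoch ω j = epoch ω.2.1 (j + 1) := rfl

lemma departureTime_succ (ω : Input) (n : ℕ) : departureTime ω (n + 1) =
    max (departureTime ω n) (entryTime ω (n + 1)) + ω.2.2 (n + 1) := by
  simp [departureTime, serviceTime]

lemma Good.dep_mono {ω : Input} (h : Good ω) : Monotone (departureTime ω) :=
  monotone_nat_of_le_succ fun n => by
    rw [departureTime_succ]
    linarith [le_max_left (departureTime ω n) (entryTime ω (n + 1)), h.serv (n + 1)]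

lemma Good.entry_le_dep {ω : Input} (h : Good ω) (n : ℕ) :
    entryTime ω (n + 1) ≤ departureTime ω (n + 1) := by
  rw [departureTime_succ]
  linarith [le_max_right (departureTime ω n) (entryTime ω (n + 1)), h.serv (n + 1)]

lemma entryTime_add (ω : Input) (j : ℕ) :
    entryTime ω (ω.1.1 + j) = epoch ω.2.1 (j + 1) := by
  simp [entryTime, initialNumber, arrivalEpoch_eq]

lemma entryTime_of_lt {ω : Input} {n : ℕ} (h : n < ω.1.1) : entryTime ω n = 0 := by
  simp [entryTime, initialNumber, h]

lemma Good.dep_tendsto {ω : Input} (h : Good ω) : Tendsto (departureTime ω) atTop atTop := by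
  rw [← tendsto_add_atTop_iff_nat (ω.1.1 + 1)]
  refine tendsto_atTop_mono (f := fun j => epoch ω.2.1 (j + 1 + 1)) (fun j => ?_) ?_
  · have := h.entry_le_dep (ω.1.1 + j)
    rw [add_assoc, entryTime_add] at this
    rw [show j + (ω.1.1 + 1) = ω.1.1 + j + 1 by ring]
    exact this
  · exact h.arr.tendsto.comp (tendsto_add_atTop_nat 2)

lemma Good.lt_departures_iff {ω : Input} (h : Good ω) (t : ℝ) (n : ℕ) :
    n < departures ω t ↔ departureTime ω n ≤ t :=
  lt_ncard_iff h.dep_mono h.dep_tendsto t n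

lemma Good.entry_le_iff {ω : Input} (h : Good ω) {t : ℝ} (ht : 0 ≤ t) (n : ℕ) :
    entryTime ω n ≤ t ↔ n < ω.1.1 + arrivals ω.2.1 t := by
  rcases lt_or_ge n ω.1.1 with hn | hn
  · rw [entryTime_of_lt hn]; exact ⟨fun _ => by omega, fun _ => ht⟩
  · obtain ⟨j, rfl⟩ := Nat.exists_eq_add_of_le hn
    rw [entryTime_add, ← h.arr.lt_arrivals_iff]; omega

/-- `Good` puts no sign on the residual service time, so the customer in service at time `0` might
formally depart before `0`. Its entry epoch is `0`, which is covered by `0 ≤ t`. -/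
lemma Good.entry_le_of_dep_le {ω : Input} (h : Good ω) {t : ℝ} (ht : 0 ≤ t) {n : ℕ}
    (hn : departureTime ω n ≤ t) : entryTime ω n ≤ t := by
  cases n with
  | succ n => exact (h.entry_le_dep n).trans hn
  | zero =>
    rcases Nat.eq_zero_or_pos ω.1.1 with hq | hq
    · have : departureTime ω 0 = entryTime ω 0 + ω.2.2 0 := by
        simp [departureTime, serviceTime, initialNumber, hq]
      linarith [h.serv 0]
    · rw [entryTime_of_lt hq]; exact ht

lemma Good.departures_le {ω : Input} (h : Good ω) {t : ℝ} (ht : 0 ≤ t) :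
    departures ω t ≤ ω.1.1 + arrivals ω.2.1 t := by
  by_contra! hc
  have := (h.lt_departures_iff t _).1 hc
  exact lt_irrefl _ ((h.entry_le_iff ht _).1 (h.entry_le_of_dep_le ht this))

lemma Good.queue_set {ω : Input} (h : Good ω) {t : ℝ} (ht : 0 ≤ t) :
    {n | entryTime ω n ≤ t ∧ t < departureTime ω n} =
      ((Finset.Ico (departures ω t) (ω.1.1 + arrivals ω.2.1 t) : Finset ℕ) : Set ℕ) := by
  ext n
  simp only [Set.mem_ofPred_eq, Finset.coe_Ico, Set.mem_Ico]
  rw [h.entry_le_iff ht, ← not_le (b := t), ← h.lt_departures_iff, not_lt, and_comm]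

lemma Good.queueLength_eq {ω : Input} (h : Good ω) {t : ℝ} (ht : 0 ≤ t) :
    queueLength ω t = ω.1.1 + arrivals ω.2.1 t - departures ω t := by
  rw [queueLength, h.queue_set ht, Set.ncard_coe_finset, Nat.card_Ico]

/-- Flow balance. It converts the variance of the departures into second moments of initial number,
arrivals and queue length. -/
lemma Good.queueLength_add {ω : Input} (h : Good ω) {t : ℝ} (ht : 0 ≤ t) :
    queueLength ω t + departures ω t = ω.1.1 + arrivals ω.2.1 t := by
  have := h.departures_le ht
  rw [h.queueLength_eq ht]; omega

/-! ### The path after time `t` -/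

/-- Interarrival times as seen from time `t`. -/
def resArr (a : ℕ → ℝ) (t : ℝ) : ℕ → ℝ := fun j =>
  if j = 0 then epoch a (arrivals a t + 1) - t else a (arrivals a t + j)

/-- Number of service times used up to time `t`. -/
def usedServ (ω : Input) (t : ℝ) : ℕ := departures ω t + if queueLength ω t = 0 then 0 else 1

/-- State at time `t`, residual interarrival times, and services not yet started. -/
def shiftInput (t : ℝ) (ω : Input) : Input :=
  (stateAt ω t, resArr ω.2.1 t, fun n => ω.2.2 (usedServ ω t + n))

/-- Insert a void service time for the customer in service. -/
def ins (ω : Input) : Input := (ω.1, ω.2.1, if ω.1.1 = 0 then ω.2.2 else cons 0 ω.2.2)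

lemma ins_serv (ω : Input) (i : ℕ) : (ins ω).2.2 i =
    if ω.1.1 = 0 then ω.2.2 i else if i = 0 then 0 else ω.2.2 (i - 1) := by
  by_cases h : ω.1.1 = 0 <;> simp [ins, h, cons]

lemma epoch_resArr (a : ℕ → ℝ) (t : ℝ) (j : ℕ) :
    epoch (resArr a t) (j + 1) = epoch a (arrivals a t + j + 1) - t := by
  induction j with
  | zero => simp [epoch_succ (resArr a t), epoch_zero, resArr]
  | succ j ih =>
    rw [epoch_succ, ih, show arrivals a t + (j + 1) + 1 = (arrivals a t + j + 1) + 1 by ring,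
      epoch_succ a (arrivals a t + j + 1)]
    simp only [resArr, Nat.add_eq_zero_iff, one_ne_zero, and_false, if_false]
    rw [show arrivals a t + (j + 1) = arrivals a t + j + 1 by ring]; ring

lemma GoodArr.resArr {a : ℕ → ℝ} (h : GoodArr a) (t : ℝ) : GoodArr (resArr a t) := by
  refine ⟨fun i => ?_, ?_⟩
  · unfold MG1.resArr
    split_ifs
    · linarith [h.lt_epoch_arrivals t]
    · exact h.pos _
  · rw [← tendsto_add_atTop_iff_nat 1]
    simp_rw [epoch_resArr]
    refine tendsto_atTop_add_const_right _ _ (h.tendsto.comp ?_)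
    exact tendsto_atTop_mono (fun j => show j ≤ _ by omega) tendsto_id

lemma Good.shift {ω : Input} (h : Good ω) (t : ℝ) : Good (ins (shiftInput t ω)) := by
  refine ⟨h.arr.resArr t, fun i => ?_⟩
  rw [ins_serv]
  split_ifs
  · exact h.serv _
  · exact le_rfl
  · exact h.serv _

/-- The path after `t` is itself a path of the queue, with customers renumbered from the one in
service. The padding `ins` is needed because `serviceTime` skips entry `0` of the service sequence
when somebody is in service, whereas `shiftInput` lists only services not yet started. -/
lemma Good.dep_shift {ω : Input} (h : Good ω) {t : ℝ} (ht : 0 ≤ t) (n : ℕ) :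
    departureTime (ins (shiftInput t ω)) n = departureTime ω (departures ω t + n) - t := by
  have hQ := h.queueLength_add ht
  have hq' : (ins (shiftInput t ω)).1.1 = queueLength ω t := rfl
  have ha' : (ins (shiftInput t ω)).2.1 = resArr ω.2.1 t := rfl
  have hentry : ∀ n, queueLength ω t ≤ n → entryTime (ins (shiftInput t ω)) n =
      entryTime ω (departures ω t + n) - t := by
    intro n hn
    obtain ⟨j, rfl⟩ := Nat.exists_eq_add_of_le hn
    have h1 := entryTime_add (ins (shiftInput t ω)) j
    rw [hq', ha', epoch_resArr] at h1
    have h2 := entryTime_add ω (arrivals ω.2.1 t + j)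
    rw [h1, show departures ω t + (queueLength ω t + j) = ω.1.1 + (arrivals ω.2.1 t + j) by omega,
      h2]
  have hserv : ∀ n, (ins (shiftInput t ω)).2.2 (n + 1) = ω.2.2 (departures ω t + (n + 1)) := by
    intro n
    rw [ins_serv]
    show (if queueLength ω t = 0 then ω.2.2 (usedServ ω t + (n + 1)) else
      ω.2.2 (usedServ ω t + n)) = _
    rw [usedServ]
    split_ifs with hz
    · simp
    · rw [add_assoc, add_comm 1]
  induction n with
  | zero =>
    by_cases hz : queueLength ω t = 0
    · have hs : serviceTime (ins (shiftInput t ω)) 0 = ω.2.2 (departures ω t) := by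
        simp [serviceTime, initialNumber, ins, shiftInput, stateAt, hz, usedServ]
      rw [departureTime, hs, hentry 0 (by omega), Nat.add_zero]
      cases hD : departures ω t with
      | zero =>
        have hq0 : ω.1.1 = 0 := by omega
        simp [departureTime, serviceTime, initialNumber, hq0]; ring
      | succ d =>
        -- The system is empty at `t`: customer `d` has left by then and customer `d + 1` enters
        -- later, so its service starts at its entry.
        rw [departureTime_succ, max_eq_right]
        · ring
        · have h1 := (h.lt_departures_iff t d).1 (by omega)
          have h2 : ¬ entryTime ω (d + 1) ≤ t := by
            rw [h.entry_le_iff ht]; omega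
          linarith
    · have hs : serviceTime (ins (shiftInput t ω)) 0 = departureTime ω (departures ω t) - t := by
        simp [serviceTime, initialNumber, ins, shiftInput, stateAt, hz, Nat.pos_of_ne_zero hz]
      rw [departureTime, hs, entryTime_of_lt (by rw [hq']; omega)]; simp
  | succ n ih =>
    rw [departureTime_succ, ih, hserv, ← add_assoc (departures ω t), departureTime_succ]
    -- For a customer already waiting at `t` the shifted input replaces the entry epoch by `0`. This
    -- is harmless, because its predecessor leaves only after `t` and both maxima select that
    -- departure.
    by_cases hn : n + 1 < queueLength ω t
    · have h1 : t < departureTime ω (departures ω t + n) :=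
        not_le.1 fun h' => by
          have := (h.lt_departures_iff t _).2 h'; omega
      have h2 : entryTime ω (departures ω t + n + 1) ≤ t := by
        rw [h.entry_le_iff ht]; omega
      rw [entryTime_of_lt (by rw [hq']; exact hn), max_eq_left (by linarith),
        max_eq_left (by linarith)]
      ring
    · rw [hentry (n + 1) (by omega), ← add_assoc, max_sub_sub_right]; ring

lemma Good.departures_shift {ω : Input} (h : Good ω) {t s : ℝ} (ht : 0 ≤ t) :
    departures (ins (shiftInput t ω)) s = departures ω (t + s) - departures ω t := by
  refine eq_of_forall_lt_iff fun n => ?_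
  rw [(h.shift t).lt_departures_iff, h.dep_shift ht, sub_le_iff_le_add, add_comm s,
    ← h.lt_departures_iff]
  omega

lemma GoodArr.arrivals_mono {a : ℕ → ℝ} (h : GoodArr a) : Monotone (arrivals a) :=
  fun s t hst => by
    by_contra! hc
    exact lt_irrefl _ ((h.lt_arrivals_iff t _).2 (((h.lt_arrivals_iff s _).1 hc).trans hst))

lemma GoodArr.arrivals_resArr {a : ℕ → ℝ} (h : GoodArr a) (t s : ℝ) :
    arrivals (MG1.resArr a t) s = arrivals a (t + s) - arrivals a t := by
  refine eq_of_forall_lt_iff fun n => ?_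
  rw [(h.resArr t).lt_arrivals_iff, epoch_resArr, sub_le_iff_le_add, add_comm s,
    ← h.lt_arrivals_iff]
  omega

lemma Good.departures_mono {ω : Input} (h : Good ω) : Monotone (departures ω) :=
  fun s t hst => by
    by_contra! hc
    exact lt_irrefl _ ((h.lt_departures_iff t _).2 (((h.lt_departures_iff s _).1 hc).trans hst))

/-- The flow property of paths, behind the semigroup property `stateLaw_stateLaw`. -/
lemma Good.stateAt_shift {ω : Input} (h : Good ω) {t s : ℝ} (ht : 0 ≤ t) (hs : 0 ≤ s) :
    stateAt (ins (shiftInput t ω)) s = stateAt ω (t + s) := by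
  have h1 := h.queueLength_add ht
  have h2 := h.queueLength_add (add_nonneg ht hs)
  have h3 := (h.shift t).queueLength_add hs
  have h4 := h.departures_mono (show t ≤ t + s by linarith)
  have h5 := h.arr.arrivals_mono (show t ≤ t + s by linarith)
  rw [h.departures_shift ht] at h3
  have h6 : arrivals (ins (shiftInput t ω)).2.1 s = _ := h.arr.arrivals_resArr t s
  have h7 : (ins (shiftInput t ω)).1.1 = queueLength ω t := rfl
  rw [h6, h7] at h3
  have hQ : queueLength (ins (shiftInput t ω)) s = queueLength ω (t + s) := by omega
  rw [stateAt, stateAt, hQ, h.departures_shift ht, h.dep_shift ht, Nat.add_sub_cancel' h4]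
  congr 1
  split_ifs
  · rfl
  · ring

/-! ### Workload -/

/-- Work in the system at time `0`. -/
def initialWork (ω : Input) : ℝ := if ω.1.1 = 0 then 0 else departureTime ω (ω.1.1 - 1)

/-- Service times of the exogenous customers, in order of arrival. -/
def newServ (ω : Input) : ℕ → ℝ := fun j => ω.2.2 (ω.1.1 + j)

/-- Workload at time `t`, for initial workload `w`. -/
def workAt (w : ℝ) (a s : ℕ → ℝ) (t : ℝ) : ℝ :=
  max (load w a s (arrivals a t) - (t - epoch a (arrivals a t))) 0

/-- The exogenous customers feel the initial ones only through the total initial work, so the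
Lindley recursion started from `initialWork` describes them. -/
lemma Good.dep_eq_load {ω : Input} (h : Good ω) (j : ℕ) : departureTime ω (ω.1.1 + j) =
    epoch ω.2.1 (j + 1) + load (initialWork ω) ω.2.1 (newServ ω) (j + 1) := by
  induction j with
  | zero =>
    rw [epoch_add_load_succ, epoch_zero, load, zero_add, Nat.add_zero]
    cases hq : ω.1.1 with
    | zero =>
      have := h.arr.pos 0
      simp [departureTime, serviceTime, initialWork, hq, initialNumber, newServ, entryTime,
        arrivalEpoch_eq, epoch_succ, epoch_zero, this.le]
    | succ q =>
      have := entryTime_add ω 0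
      rw [hq] at this
      rw [departureTime_succ, show q + 1 = q + 1 + 0 from rfl, this]
      simp [initialWork, hq, newServ]
  | succ j ih =>
    rw [epoch_add_load_succ, ← ih, ← add_assoc, departureTime_succ, add_assoc, entryTime_add]
    rfl

/-- Both descriptions of the remaining work are the departure epoch of the last customer to have
entered, minus `t`, or `0` if that customer has left. This is the latest arrival, or the last
initial customer when nobody has arrived. -/
lemma Good.initialWork_shift {ω : Input} (h : Good ω) {t : ℝ} (ht : 0 ≤ t) :
    initialWork (ins (shiftInput t ω)) = workAt (initialWork ω) ω.2.1 (newServ ω) t := by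
  have hQ := h.queueLength_add ht
  have hD := fun n => h.lt_departures_iff t n
  have hq' : (ins (shiftInput t ω)).1.1 = queueLength ω t := rfl
  rw [initialWork, hq', h.dep_shift ht, workAt]
  have key : ∀ k, arrivals ω.2.1 t = k + 1 → epoch ω.2.1 (k + 1) +
      load (initialWork ω) ω.2.1 (newServ ω) (k + 1) = departureTime ω (ω.1.1 + k) :=
    fun k _ => (h.dep_eq_load k).symm
  split_ifs with hz
  · symm
    refine max_eq_right ?_
    cases hA : arrivals ω.2.1 t with
    | zero =>
      rw [epoch_zero, load, initialWork]
      split_ifs with hq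
      · linarith
      · have := (hD (ω.1.1 - 1)).1 (by omega)
        linarith
    | succ k =>
      have h1 := key k hA
      have := (hD (ω.1.1 + k)).1 (by omega)
      linarith
  · cases hA : arrivals ω.2.1 t with
    | zero =>
      have hq : ω.1.1 ≠ 0 := by omega
      have h1 := mt (hD (ω.1.1 - 1)).2 (by omega)
      rw [epoch_zero, load, initialWork, if_neg hq, max_eq_left (by linarith),
        show departures ω t + (queueLength ω t - 1) = ω.1.1 - 1 by omega]
      ring
    | succ k =>
      have h1 := key k hA
      have h2 := mt (hD (ω.1.1 + k)).2 (by omega)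
      rw [show departures ω t + (queueLength ω t - 1) = ω.1.1 + k by omega,
        max_eq_left (by linarith)]
      linarith

/-! ### Comparison with the queue that starts empty -/

/-- The same arrivals and services, without the initial customers. -/
def emptied (ω : Input) : Input := ((0, 0), ω.2.1, newServ ω)

lemma Good.emptied {ω : Input} (h : Good ω) : Good (emptied ω) := ⟨h.arr, fun _ => h.serv _⟩

lemma initialWork_emptied (ω : Input) : initialWork (emptied ω) = 0 := by
  simp [initialWork, emptied]

lemma newServ_emptied (ω : Input) : newServ (emptied ω) = newServ ω := by
  ext j; simp [newServ, emptied]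

lemma Good.dep_emptied {ω : Input} (h : Good ω) (j : ℕ) : departureTime (MG1.emptied ω) j =
    epoch ω.2.1 (j + 1) + load 0 ω.2.1 (newServ ω) (j + 1) := by
  have := h.emptied.dep_eq_load j
  rw [initialWork_emptied, newServ_emptied] at this
  simpa [MG1.emptied] using this

/-- Under the last hypothesis the system has emptied before some arrival no later than `t`
(`load_coupling`). After that the two queues have the same departure epochs, with customer numbers
differing by the number of initial customers, hence the same state. -/
lemma Good.stateAt_emptied {ω : Input} (h : Good ω) {K t : ℝ} (ht : 0 ≤ t)
    (hw : 0 ≤ initialWork ω) (hK : initialWork ω ≤ K)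
    (hj : ∃ j, epoch ω.2.1 (j + 1) ≤ t ∧ K + epoch (newServ ω) j ≤ epoch ω.2.1 (j + 1)) :
    stateAt ω t = stateAt (MG1.emptied ω) t := by
  obtain ⟨j, hjt, hj⟩ := hj
  obtain ⟨i, hij, hia, hn⟩ := load_coupling (a := ω.2.1) (s := newServ ω) hw (j := j)
    (by linarith)
  have hti : epoch ω.2.1 (i + 1) ≤ t := (h.arr.mono.monotone (by omega)).trans hjt
  have hdep : ∀ k, i ≤ k → departureTime (MG1.emptied ω) k = departureTime ω (ω.1.1 + k) := by
    intro k hk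
    rw [h.dep_emptied, h.dep_eq_load, hn (k + 1) (by omega)]
  -- Everybody ahead of exogenous customer `i` has left by `t`, so only departure epochs on which
  -- the two queues agree matter for the state.
  have hD1 : ω.1.1 + i ≤ departures ω t := by
    rcases Nat.eq_zero_or_pos (ω.1.1 + i) with hz | hp
    · omega
    · have : departureTime ω (ω.1.1 + i - 1) ≤ t := by
        refine le_trans ?_ hti
        cases i with
        | zero =>
          rw [epoch_succ, epoch_zero, zero_add]
          simpa [load, initialWork, show ω.1.1 ≠ 0 by omega] using hia
        | succ k =>
          rw [show ω.1.1 + (k + 1) - 1 = ω.1.1 + k by omega, h.dep_eq_load, epoch_succ _ (k + 1)]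
          linarith
      have := (h.lt_departures_iff t _).2 this
      omega
  have hD2 : i ≤ departures (MG1.emptied ω) t := by
    cases i with
    | zero => omega
    | succ k =>
      refine (h.emptied.lt_departures_iff t k).2 ?_
      have := load_mono hw ω.2.1 (newServ ω) (k + 1)
      rw [epoch_succ] at hti
      rw [h.dep_emptied]
      linarith
  have hD : departures ω t = ω.1.1 + departures (MG1.emptied ω) t := by
    obtain ⟨d, hd⟩ := Nat.exists_eq_add_of_le hD1
    have : d = departures (MG1.emptied ω) t - i := by
      refine eq_of_forall_lt_iff fun n => ?_
      have h1 := h.lt_departures_iff t (ω.1.1 + (i + n))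
      have h2 := h.emptied.lt_departures_iff t (i + n)
      rw [hdep _ (by omega), ← h1, hd] at h2
      omega
    omega
  have hq := h.queueLength_add ht
  have hq' := h.emptied.queueLength_add ht
  have e1 : (MG1.emptied ω).1.1 = 0 := rfl
  have e2 : (MG1.emptied ω).2.1 = ω.2.1 := rfl
  rw [e1, e2] at hq'
  have hQ : queueLength ω t = queueLength (MG1.emptied ω) t := by omega
  rw [stateAt, stateAt, hQ, hdep _ hD2, hD]

lemma workAt_mono {w w' : ℝ} (h : w ≤ w') (a s : ℕ → ℝ) (t : ℝ) :
    workAt w a s t ≤ workAt w' a s t := by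
  have := load_mono h a s (arrivals a t)
  unfold workAt; gcongr

/-! ### Old and new customers -/

/-- Number of exogenous customers in the system at time `t`. -/
def newQueue (w : ℝ) (a s : ℕ → ℝ) (t : ℝ) : ℕ :=
  {j | epoch a (j + 1) ≤ t ∧ t < epoch a (j + 1) + load w a s (j + 1)}.ncard

/-- Number of initial customers still in the system at time `t`. -/
def oldQueue (ω : Input) (t : ℝ) : ℕ := {n | n < ω.1.1 ∧ t < departureTime ω n}.ncard

lemma GoodArr.finite_newQueue {a : ℕ → ℝ} (h : GoodArr a) (w : ℝ) (s : ℕ → ℝ) (t : ℝ) :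
    {j | epoch a (j + 1) ≤ t ∧ t < epoch a (j + 1) + load w a s (j + 1)}.Finite :=
  (Set.finite_Iio (arrivals a t)).subset fun j hj => (h.lt_arrivals_iff t j).2 hj.1

lemma Good.queueLength_eq_add {ω : Input} (h : Good ω) {t : ℝ} (ht : 0 ≤ t) :
    queueLength ω t = oldQueue ω t + newQueue (initialWork ω) ω.2.1 (newServ ω) t := by
  have hset : {n | entryTime ω n ≤ t ∧ t < departureTime ω n} =
      {n | n < ω.1.1 ∧ t < departureTime ω n} ∪ (fun j => ω.1.1 + j) ''
        {j | epoch ω.2.1 (j + 1) ≤ t ∧ t < epoch ω.2.1 (j + 1) +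
          load (initialWork ω) ω.2.1 (newServ ω) (j + 1)} := by
    ext n
    simp only [Set.mem_ofPred_eq, Set.mem_union, Set.mem_image]
    rcases lt_or_ge n ω.1.1 with hn | hn
    · rw [entryTime_of_lt hn]
      constructor
      · exact fun h' => Or.inl ⟨hn, h'.2⟩
      · rintro (h' | ⟨j, -, rfl⟩)
        · exact ⟨ht, h'.2⟩
        · omega
    · obtain ⟨j, rfl⟩ := Nat.exists_eq_add_of_le hn
      rw [entryTime_add, h.dep_eq_load]
      constructor
      · exact fun h' => Or.inr ⟨j, h', rfl⟩
      · rintro (h' | ⟨k, hk, hkj⟩)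
        · omega
        · obtain rfl : k = j := by omega
          exact hk
  rw [queueLength, hset, Set.ncard_union_eq (hs := (Set.finite_Iio ω.1.1).subset fun n hn => hn.1)
    (ht := (h.arr.finite_newQueue _ _ t).image _),
    Set.ncard_image_of_injective _ (add_right_injective _)]
  · rfl
  · rw [Set.disjoint_left]
    rintro _ h1 ⟨j, -, rfl⟩
    exact absurd h1.1 (by simp)

lemma oldQueue_le (ω : Input) (t : ℝ) : oldQueue ω t ≤ ω.1.1 := by
  have := Set.ncard_le_ncard (s := {n | n < ω.1.1 ∧ t < departureTime ω n})
    (t := ((Finset.range ω.1.1 : Finset ℕ) : Set ℕ)) (fun n hn => by simpa using hn.1)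
    (Finset.finite_toSet _)
  rwa [Set.ncard_coe_finset, Finset.card_range] at this

lemma Good.oldQueue_eq_zero {ω : Input} (h : Good ω) {t : ℝ} (ht : initialWork ω ≤ t) :
    oldQueue ω t = 0 := by
  have : {n | n < ω.1.1 ∧ t < departureTime ω n} = ∅ := by
    ext n
    simp only [Set.mem_ofPred_eq, Set.mem_empty_iff_false, iff_false, not_and, not_lt]
    intro hn
    refine (h.dep_mono (show n ≤ ω.1.1 - 1 by omega)).trans ?_
    rwa [initialWork, if_neg (by omega)] at ht
  rw [oldQueue, this, Set.ncard_empty]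

lemma GoodArr.newQueue_le_arrivals {a : ℕ → ℝ} (h : GoodArr a) (w : ℝ) (s : ℕ → ℝ) (t : ℝ) :
    newQueue w a s t ≤ arrivals a t := by
  have := Set.ncard_le_ncard (s := {j | epoch a (j + 1) ≤ t ∧ t < epoch a (j + 1) +
    load w a s (j + 1)}) (t := ((Finset.range (arrivals a t) : Finset ℕ) : Set ℕ))
    (fun n hn => by simpa using (h.lt_arrivals_iff t n).2 hn.1) (Finset.finite_toSet _)
  rwa [Set.ncard_coe_finset, Finset.card_range] at this

lemma GoodArr.newQueue_mono {a : ℕ → ℝ} (h : GoodArr a) {w w' : ℝ} (hw : w ≤ w') (s : ℕ → ℝ)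
    (t : ℝ) : newQueue w a s t ≤ newQueue w' a s t :=
  Set.ncard_le_ncard (fun j hj => ⟨hj.1, hj.2.trans_le (by
    have := load_mono hw a s (j + 1); linarith)⟩) (h.finite_newQueue w' s t)

/-! ### Measurability -/

section Measurability

variable {Ω : Type*} [MeasurableSpace Ω]

lemma measurable_index {β : Type*} [MeasurableSpace β] {f : ℕ → Ω → β} {N : Ω → ℕ}
    (hf : ∀ n, Measurable (f n)) (hN : Measurable N) : Measurable fun x => f (N x) x :=
  (measurable_from_prod_countable_right (f := fun p : ℕ × Ω => f p.1 p.2) hf).comp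
    (hN.prodMk measurable_id)

/-- A nonzero value of `ncard` means that the set is one of countably many finite sets. The value
`0` also covers infinite sets and is obtained as the complement of all others. -/
lemma measurable_ncard {p : ℕ → Ω → Prop} (hp : ∀ n, Measurable (p n)) :
    Measurable fun x => {n | p n x}.ncard := by
  have hs : ∀ F : Finset ℕ, MeasurableSet {x | {n | p n x} = (F : Set ℕ)} := by
    intro F
    have : {x | {n | p n x} = (F : Set ℕ)} = ⋂ n, {x | p n x ↔ n ∈ F} := by
      ext x; simp [Set.ext_iff]
    rw [this]
    refine MeasurableSet.iInter fun n => ?_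
    by_cases h : n ∈ F
    · simpa [h] using hp n
    · simpa [h] using (hp n).not
  have hpos : ∀ k, k ≠ 0 → MeasurableSet ((fun x => {n | p n x}.ncard) ⁻¹' {k}) := by
    intro k hk
    have : (fun x => {n | p n x}.ncard) ⁻¹' {k} =
        ⋃ F : Finset ℕ, ⋃ _ : F.card = k, {x | {n | p n x} = (F : Set ℕ)} := by
      ext x
      simp only [Set.mem_preimage, Set.mem_singleton_iff, Set.mem_iUnion, exists_prop,
        Set.mem_ofPred_eq]
      constructor
      · intro h
        have hfin : {n | p n x}.Finite := Set.finite_of_ncard_ne_zero (h ▸ hk)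
        exact ⟨hfin.toFinset, by rw [← h, Set.ncard_eq_toFinset_card _ hfin], by simp⟩
      · rintro ⟨F, hF, h⟩
        rw [h, Set.ncard_coe_finset, hF]
    rw [this]
    exact MeasurableSet.iUnion fun F => MeasurableSet.iUnion fun _ => hs F
  refine measurable_to_countable' fun k => ?_
  rcases eq_or_ne k 0 with rfl | hk
  · have : (fun x => {n | p n x}.ncard) ⁻¹' {0} =
        (⋃ k : ℕ, ⋃ _ : k ≠ 0, (fun x => {n | p n x}.ncard) ⁻¹' {k})ᶜ := by
      ext x; simp; exact ⟨fun h i hi h' => hi (h' ▸ h), fun h => by_contra fun h' => h _ h' rfl⟩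
    rw [this]
    exact (MeasurableSet.iUnion fun k => MeasurableSet.iUnion fun h => hpos k h).compl
  · exact hpos k hk

end Measurability

@[fun_prop]
lemma measurable_epoch (n : ℕ) : Measurable fun a : ℕ → ℝ => epoch a n := by
  unfold epoch; fun_prop

@[fun_prop]
lemma measurable_load (n : ℕ) :
    Measurable fun p : ℝ × (ℕ → ℝ) × (ℕ → ℝ) => load p.1 p.2.1 p.2.2 n := by
  induction n with
  | zero => exact measurable_fst
  | succ n ih => simp only [load]; fun_prop

@[fun_prop]
lemma measurable_arrivals : Measurable fun p : (ℕ → ℝ) × ℝ => arrivals p.1 p.2 :=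
  measurable_ncard fun n => measurableSet_setOfPred.1 (measurableSet_le (by fun_prop) (by fun_prop))

@[fun_prop]
lemma measurable_newQueue :
    Measurable fun p : (ℝ × (ℕ → ℝ) × (ℕ → ℝ)) × ℝ => newQueue p.1.1 p.1.2.1 p.1.2.2 p.2 := by
  refine measurable_ncard fun n => Measurable.and ?_ ?_
  · refine measurableSet_setOfPred.1 (measurableSet_le (f := fun p : (ℝ × (ℕ → ℝ) × (ℕ → ℝ)) × ℝ => epoch p.1.2.1 (n + 1))
      (by fun_prop) (by fun_prop))
  · refine measurableSet_setOfPred.1 (measurableSet_lt (by fun_prop) (Measurable.add (by fun_prop) ?_))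
    exact (measurable_load (n + 1)).comp measurable_fst

@[fun_prop]
lemma measurable_entryTime (n : ℕ) : Measurable fun ω : Input => entryTime ω n := by
  unfold entryTime initialNumber
  refine Measurable.ite (measurableSet_lt measurable_const (by fun_prop)) measurable_const ?_
  simp only [arrivalEpoch_eq]
  exact measurable_index (f := fun k (ω : Input) => epoch ω.2.1 (n - k + 1))
    (fun k => by fun_prop) (by fun_prop)

@[fun_prop]
lemma measurable_serviceTime (n : ℕ) : Measurable fun ω : Input => serviceTime ω n := by
  unfold serviceTime initialNumber
  refine Measurable.ite ?_ (by fun_prop) (by fun_prop)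
  exact (MeasurableSet.const (n = 0)).inter
    (measurableSet_lt (f := fun _ : Input => 0) (g := fun ω => ω.1.1) measurable_const (by fun_prop))

@[fun_prop]
lemma measurable_departureTime (n : ℕ) : Measurable fun ω : Input => departureTime ω n := by
  induction n with
  | zero => simp only [departureTime]; fun_prop
  | succ n ih => simp only [departureTime]; fun_prop

@[fun_prop]
lemma measurable_departures : Measurable fun p : Input × ℝ => departures p.1 p.2 :=
  measurable_ncard fun n => measurableSet_setOfPred.1 (measurableSet_le (by fun_prop) (by fun_prop))

@[fun_prop]
lemma measurable_queueLength : Measurable fun p : Input × ℝ => queueLength p.1 p.2 :=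
  measurable_ncard fun n => (measurableSet_setOfPred.1 (measurableSet_le (by fun_prop)
    (by fun_prop))).and (measurableSet_setOfPred.1 (measurableSet_lt (by fun_prop) (by fun_prop)))

@[fun_prop]
lemma measurable_oldQueue : Measurable fun p : Input × ℝ => oldQueue p.1 p.2 :=
  measurable_ncard fun n => (measurableSet_setOfPred.1 (measurableSet_lt (by fun_prop)
    (by fun_prop))).and (measurableSet_setOfPred.1 (measurableSet_lt (by fun_prop) (by fun_prop)))

@[fun_prop]
lemma measurable_stateAt : Measurable fun p : Input × ℝ => stateAt p.1 p.2 := by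
  unfold stateAt
  refine measurable_queueLength.prodMk (Measurable.ite ?_ measurable_const ?_)
  · exact measurable_queueLength (measurableSet_singleton 0)
  · refine Measurable.sub ?_ measurable_snd
    exact measurable_index (f := fun k (p : Input × ℝ) => departureTime p.1 k)
      (fun k => by fun_prop) measurable_departures

lemma measurable_stateAt_const (t : ℝ) : Measurable fun ω : Input => stateAt ω t :=
  measurable_stateAt.comp (f := fun ω : Input => (ω, t)) (by fun_prop)

@[fun_prop]
lemma measurable_initialWork : Measurable initialWork := by
  unfold initialWork
  refine Measurable.ite (measurableSet_eq_fun (by fun_prop) measurable_const) measurable_const ?_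
  exact measurable_index (f := fun k (ω : Input) => departureTime ω (k - 1))
    (fun k => by fun_prop) (by fun_prop)

@[fun_prop]
lemma measurable_newServ : Measurable newServ := by
  refine measurable_pi_lambda _ fun j => ?_
  exact measurable_index (f := fun k (ω : Input) => ω.2.2 (k + j))
    (fun k => by fun_prop) (by fun_prop)

@[fun_prop]
lemma measurable_workAt :
    Measurable fun p : (ℝ × (ℕ → ℝ) × (ℕ → ℝ)) × ℝ => workAt p.1.1 p.1.2.1 p.1.2.2 p.2 := by
  have hA : Measurable fun p : (ℝ × (ℕ → ℝ) × (ℕ → ℝ)) × ℝ => arrivals p.1.2.1 p.2 :=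
    measurable_arrivals.comp (f := fun p : (ℝ × (ℕ → ℝ) × (ℕ → ℝ)) × ℝ => (p.1.2.1, p.2))
      (by fun_prop)
  unfold workAt
  refine Measurable.max (Measurable.sub ?_ (Measurable.sub measurable_snd ?_)) measurable_const
  · exact measurable_index (f := fun k (p : (ℝ × (ℕ → ℝ) × (ℕ → ℝ)) × ℝ) =>
      load p.1.1 p.1.2.1 p.1.2.2 k) (fun k => (measurable_load k).comp measurable_fst) hA
  · exact measurable_index (f := fun k (p : (ℝ × (ℕ → ℝ) × (ℕ → ℝ)) × ℝ) =>
      epoch p.1.2.1 k) (fun k => by fun_prop) hA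

lemma measurable_arrivals_const (t : ℝ) : Measurable fun a : ℕ → ℝ => arrivals a t :=
  measurable_arrivals.comp (f := fun a : ℕ → ℝ => (a, t)) (by fun_prop)

lemma measurable_resArr (t : ℝ) : Measurable fun a : ℕ → ℝ => resArr a t := by
  refine measurable_pi_lambda _ fun j => ?_
  unfold resArr
  split_ifs
  · exact (measurable_index (f := fun k (a : ℕ → ℝ) => epoch a (k + 1)) (fun k => by fun_prop)
      (measurable_arrivals_const t)).sub measurable_const
  · exact measurable_index (f := fun k (a : ℕ → ℝ) => a (k + j)) (fun k => by fun_prop)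
      (measurable_arrivals_const t)

lemma measurable_usedServ (t : ℝ) : Measurable fun ω : Input => usedServ ω t := by
  unfold usedServ
  refine Measurable.add (measurable_departures.comp (f := fun ω : Input => (ω, t)) (by fun_prop))
    (Measurable.ite ?_ measurable_const measurable_const)
  exact (measurable_queueLength.comp (f := fun ω : Input => (ω, t)) (by fun_prop))
    (measurableSet_singleton 0)

lemma measurable_shiftInput (t : ℝ) : Measurable (shiftInput t) := by
  unfold shiftInput
  refine (measurable_stateAt_const t).prodMk (Measurable.prodMk ?_ ?_)
  · exact (measurable_resArr t).comp (by fun_prop)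
  · refine measurable_pi_lambda _ fun j => ?_
    exact measurable_index (f := fun k (ω : Input) => ω.2.2 (k + j)) (fun k => by fun_prop)
      (measurable_usedServ t)

lemma measurable_ins : Measurable ins := by
  unfold ins
  refine measurable_fst.prodMk (Measurable.prodMk (by fun_prop) (Measurable.ite ?_ ?_ ?_))
  · exact measurableSet_eq_fun (by fun_prop) measurable_const
  · fun_prop
  · exact measurable_cons.comp (f := fun ω : Input => ((0 : ℝ), ω.2.2)) (by fun_prop)

/-! ### Almost all inputs are good -/

variable {lam : ℝ} {G : Measure ℝ}

lemma ae_goodArr (hlam : 0 < lam) : ∀ᵐ a ∂(iid (expMeasure lam)), GoodArr a := by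
  have := isProbabilityMeasure_expMeasure hlam
  have h1 := ae_iid (expMeasure lam) (ae_expMeasure_pos lam)
  have hint : Integrable (fun x => x) (expMeasure lam) := by
    simpa using integrable_pow_expMeasure hlam 1
  have h2 := iid_slln (expMeasure lam) hint
  have hm : ∫ x, x ∂(expMeasure lam) = 1 / lam := by
    simpa using integral_pow_expMeasure hlam 1
  rw [hm] at h2
  filter_upwards [h1, h2] with a ha1 ha2
  refine ⟨ha1, ?_⟩
  have := ha2.pos_mul_atTop (by positivity) tendsto_natCast_atTop_atTop
  refine this.congr' ?_
  filter_upwards [eventually_ne_atTop 0] with n hn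
  have : (n : ℝ) ≠ 0 := by exact_mod_cast hn
  rw [epoch]; field_simp

lemma ae_good [IsProbabilityMeasure G] (hlam : 0 < lam) (hG : ∀ᵐ x ∂G, 0 ≤ x)
    (ν : Measure State) [SFinite ν] : ∀ᵐ ω ∂(law lam G ν), Good ω := by
  have := isProbabilityMeasure_expMeasure hlam
  have h1 : ∀ᵐ ω ∂(law lam G ν), GoodArr ω.2.1 :=
    (Measure.quasiMeasurePreserving_snd (μ := ν)).ae
      (Measure.quasiMeasurePreserving_fst.ae (ae_goodArr hlam))
  have h2 : ∀ᵐ ω ∂(law lam G ν), ∀ i, 0 ≤ ω.2.2 i :=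
    (Measure.quasiMeasurePreserving_snd (μ := ν)).ae
      (Measure.quasiMeasurePreserving_snd.ae (ae_iid G hG))
  filter_upwards [h1, h2] with ω h1 h2
  exact ⟨h1, h2⟩

instance isProbabilityMeasure_law [IsProbabilityMeasure G] [Fact (0 < lam)] (ν : Measure State)
    [IsProbabilityMeasure ν] : IsProbabilityMeasure (law lam G ν) := by
  have := isProbabilityMeasure_expMeasure (Fact.out : 0 < lam)
  unfold law; infer_instance

variable {lam : ℝ} {G : Measure ℝ}

/-! ### The Markov property -/

/-- An i.i.d. sequence starts afresh after a random index that does not look ahead. -/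
lemma lintegral_iid_stopping {β : Type*} [MeasurableSpace β] (μ : Measure ℝ)
    [IsProbabilityMeasure μ] {S : Set (ℕ → ℝ)} (hS : ∀ᵐ σ ∂(iid μ), σ ∈ S)
    (hSs : ∀ n, ∀ σ ∈ S, ∀ σ' ∈ S, splice n σ σ' ∈ S) {N : (ℕ → ℝ) → ℕ} (hN : Measurable N)
    {Y : (ℕ → ℝ) → β} (hY : Measurable Y)
    (hdet : ∀ σ ∈ S, ∀ σ' ∈ S, (∀ i < N σ, σ' i = σ i) → N σ' = N σ ∧ Y σ' = Y σ)
    {f : β → ℝ≥0∞} (hf : Measurable f) {g : (ℕ → ℝ) → ℝ≥0∞} (hg : Measurable g) :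
    ∫⁻ σ, f (Y σ) * g (fun i => σ (N σ + i)) ∂(iid μ) =
      (∫⁻ σ, f (Y σ) ∂(iid μ)) * ∫⁻ σ, g σ ∂(iid μ) := by
  have hind : ∀ n, Measurable (Set.indicator (N ⁻¹' {n}) (1 : (ℕ → ℝ) → ℝ≥0∞)) := fun n =>
    measurable_one.indicator (hN (measurableSet_singleton n))
  have hshift : ∀ n, Measurable fun σ : ℕ → ℝ => g (fun i => σ (n + i)) := fun n => by fun_prop
  have hsum : ∀ (F : ℕ → (ℕ → ℝ) → ℝ≥0∞) (σ : ℕ → ℝ), F (N σ) σ =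
      ∑' n, Set.indicator (N ⁻¹' {n}) 1 σ * F n σ := by
    intro F σ
    rw [tsum_eq_single (N σ)]
    · simp
    · intro n hn
      simp [Set.indicator, hn.symm]
  have hm1 : ∀ n, Measurable fun σ => Set.indicator (N ⁻¹' {n}) 1 σ *
      (f (Y σ) * g (fun i => σ (n + i))) := fun n =>
    (hind n).mul ((hf.comp hY).mul (hshift n))
  have hm2 : ∀ n, Measurable fun σ => Set.indicator (N ⁻¹' {n}) 1 σ * f (Y σ) := fun n =>
    (hind n).mul (hf.comp hY)
  -- On `N = n` the sequence is cut at `n`: the event and `Y` are functions of the first part, while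
  -- the shifted sequence is the independent second part.
  have key : ∀ n, ∫⁻ σ, Set.indicator (N ⁻¹' {n}) 1 σ * (f (Y σ) * g (fun i => σ (n + i)))
      ∂(iid μ) = (∫⁻ σ, Set.indicator (N ⁻¹' {n}) 1 σ * f (Y σ) ∂(iid μ)) *
        ∫⁻ σ, g σ ∂(iid μ) := by
    intro n
    rw [lintegral_splice μ n (hm1 n), ← lintegral_mul_const _ (hm2 n)]
    refine lintegral_congr_ae ?_
    filter_upwards [hS] with σ hσ
    rw [← lintegral_const_mul _ hg]
    refine lintegral_congr_ae ?_
    filter_upwards [hS] with σ' hσ'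
    have hsp := hSs n σ hσ σ' hσ'
    simp only [splice_add]
    by_cases h : N σ = n
    · obtain ⟨h1, h2⟩ := hdet σ hσ _ hsp (fun i hi => splice_lt (h ▸ hi) σ σ')
      simp [Set.indicator, h, h1, h2]
    · have h1 : N (splice n σ σ') ≠ n := fun h1 => by
        have := (hdet _ hsp σ hσ (fun i hi => (splice_lt (h1 ▸ hi) σ σ').symm)).1
        exact h (this.trans h1)
      simp [Set.indicator, h, h1]
  rw [lintegral_congr (hsum fun n σ => f (Y σ) * g (fun i => σ (n + i))),
    lintegral_tsum fun n => (hm1 n).aemeasurable,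
    lintegral_congr (hsum fun _ σ => f (Y σ)),
    lintegral_tsum fun n => (hm2 n).aemeasurable, ← ENNReal.tsum_mul_right]
  exact tsum_congr key

/-- Translating by `c` multiplies the exponential density by a constant. With `f = 1` this is the
tail probability. -/
lemma lintegral_expMeasure_memoryless {r c : ℝ} (hc : 0 ≤ c) {f : ℝ → ℝ≥0∞}
    (hf : Measurable f) :
    ∫⁻ x, Set.indicator (Set.Ioi c) (fun x => f (x - c)) x ∂(expMeasure r) =
      ENNReal.ofReal (Real.exp (-(r * c))) * ∫⁻ x, f x ∂(expMeasure r) := by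
  have hm : Measurable fun x => Set.indicator (Set.Ioi c) (fun x => f (x - c)) x :=
    (by fun_prop : Measurable fun x => f (x - c)).indicator measurableSet_Ioi
  rw [lintegral_expMeasure _ _ hm, lintegral_expMeasure _ _ hf, ← lintegral_const_mul _ (by fun_prop),
    ← lintegral_indicator measurableSet_Ioi, ← lintegral_indicator measurableSet_Ioi,
    ← lintegral_add_right_eq_self _ c]
  refine lintegral_congr fun x => ?_
  by_cases hx : 0 < x
  · have h1 : 0 < x + c := by linarith
    simp only [Set.indicator, Set.mem_Ioi, h1, hx, if_true, lt_add_iff_pos_left,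
      add_sub_cancel_right]
    rw [← mul_assoc, ← ENNReal.ofReal_mul (Real.exp_nonneg _), ← mul_assoc, mul_comm _ r,
      mul_assoc, ← Real.exp_add]
    congr 5; ring
  · simp [Set.indicator, hx]

/-- Subtract `c` from the first term of a sequence. -/
def subHead (c : ℝ) (a : ℕ → ℝ) : ℕ → ℝ := fun j => if j = 0 then a 0 - c else a j

@[fun_prop]
lemma measurable_subHead : Measurable fun p : ℝ × (ℕ → ℝ) => subHead p.1 p.2 := by
  refine measurable_pi_lambda _ fun i => ?_
  unfold subHead
  split_ifs <;> fun_prop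

lemma lintegral_memoryless (hlam : 0 < lam) {c : ℝ} (hc : 0 ≤ c) {g : (ℕ → ℝ) → ℝ≥0∞}
    (hg : Measurable g) :
    ∫⁻ a, (if c < a 0 then g (subHead c a) else 0) ∂(iid (expMeasure lam)) =
      ENNReal.ofReal (Real.exp (-(lam * c))) * ∫⁻ a, g a ∂(iid (expMeasure lam)) := by
  have := isProbabilityMeasure_expMeasure hlam
  have hm : Measurable fun a : ℕ → ℝ => if c < a 0 then g (subHead c a) else 0 := by
    refine Measurable.ite (measurableSet_lt measurable_const (by fun_prop)) ?_ measurable_const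
    exact hg.comp (measurable_subHead.comp (f := fun a : ℕ → ℝ => (c, a)) (by fun_prop))
  rw [lintegral_cons _ hm, lintegral_cons _ hg, ← lintegral_expMeasure_memoryless hc]
  · refine lintegral_congr fun x => ?_
    by_cases hx : c < x
    · have : ∀ σ, subHead c (cons x σ) = cons (x - c) σ := fun σ => by
        ext j; by_cases hj : j = 0 <;> simp [subHead, cons, hj]
      simp [Set.indicator, cons, hx, this]
    · simp [Set.indicator, cons, hx]
  · exact Measurable.lintegral_prod_right' (f := fun p : ℝ × (ℕ → ℝ) => g (cons p.1 p.2))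
      (by fun_prop)

lemma epoch_splice_le {k n : ℕ} (h : k ≤ n) (a a' : ℕ → ℝ) :
    epoch (splice n a a') k = epoch a k :=
  Finset.sum_congr rfl fun i hi => splice_lt (by have := Finset.mem_range.1 hi; omega) a a'

lemma epoch_splice_add (n j : ℕ) (a a' : ℕ → ℝ) :
    epoch (splice n a a') (n + j) = epoch a n + epoch a' j := by
  rw [epoch, Finset.sum_range_add]
  congr 1
  · exact epoch_splice_le le_rfl a a'
  · exact Finset.sum_congr rfl fun i _ => splice_add n i a a'

lemma GoodArr.splice {a a' : ℕ → ℝ} (h : GoodArr a) (h' : GoodArr a') (n : ℕ) :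
    GoodArr (splice n a a') := by
  refine ⟨fun i => ?_, ?_⟩
  · unfold MG1.splice
    split_ifs
    · exact h.pos _
    · exact h'.pos _
  · rw [← tendsto_add_atTop_iff_nat n]
    simp_rw [fun j => add_comm j n, epoch_splice_add]
    exact tendsto_atTop_add_const_left _ _ h'.tendsto

lemma goodArr_const {c : ℝ} (hc : 0 < c) : GoodArr fun _ => c := by
  refine ⟨fun _ => hc, ?_⟩
  have : epoch (fun _ => c) = fun n : ℕ => (n : ℝ) * c := by ext n; simp [epoch]
  rw [this]
  exact tendsto_natCast_atTop_atTop.atTop_mul_const hc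

/-- The arrivals after time `t` are independent of those before, and have the original law. -/
lemma lintegral_resArr (hlam : 0 < lam) {t : ℝ} (ht : 0 ≤ t) {g h : (ℕ → ℝ) → ℝ≥0∞}
    (hg : Measurable g) (hh : Measurable h)
    (hdet : ∀ a a', GoodArr a → GoodArr a' → arrivals a t = arrivals a' t →
      (∀ i < arrivals a t, a i = a' i) → h a = h a') :
    ∫⁻ a, g (resArr a t) * h a ∂(iid (expMeasure lam)) =
      (∫⁻ a, g a ∂(iid (expMeasure lam))) * ∫⁻ a, h a ∂(iid (expMeasure lam)) := by
  have := isProbabilityMeasure_expMeasure hlam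
  have hgood := ae_goodArr hlam
  have hN := measurable_arrivals_const t
  set I : ℕ → (ℕ → ℝ) → ℝ≥0∞ := fun k => Set.indicator ((fun a => arrivals a t) ⁻¹' {k}) 1
  have hI : ∀ k, Measurable (I k) := fun k =>
    measurable_one.indicator (hN (measurableSet_singleton k))
  have hsum : ∀ (F : (ℕ → ℝ) → ℝ≥0∞) (a : ℕ → ℝ), F a = ∑' k, I k a * F a := by
    intro F a
    rw [tsum_eq_single (arrivals a t)]
    · simp [I]
    · intro n hn
      simp [I, hn.symm]
  have hm1 : ∀ k (g : (ℕ → ℝ) → ℝ≥0∞), Measurable g →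
      Measurable fun a => I k a * (g (resArr a t) * h a) := fun k g hg =>
    (hI k).mul ((hg.comp (measurable_resArr t)).mul hh)
  have hm2 : ∀ k, Measurable fun a => I k a * h a := fun k => (hI k).mul hh
  -- With exactly `k` arrivals by `t`, the cut at `k` leaves the event that the next gap exceeds `t
  -- - epoch a k`; lack of memory releases the residual sequence as a fresh copy at the price of an
  -- exponential weight. Since `h` reads only the first `k` gaps, its argument may be completed by
  -- the constant `t + 1`, which adds no arrival by `t`.
  have gen : ∀ k (g : (ℕ → ℝ) → ℝ≥0∞), Measurable g →
      ∫⁻ a, I k a * (g (resArr a t) * h a) ∂(iid (expMeasure lam)) =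
        (∫⁻ a, g a ∂(iid (expMeasure lam))) * ∫⁻ a, (if epoch a k ≤ t then
          h (splice k a fun _ => t + 1) * ENNReal.ofReal (Real.exp (-(lam * (t - epoch a k))))
          else 0) ∂(iid (expMeasure lam)) := by
    intro k g hg
    have hm : Measurable fun a : ℕ → ℝ => (if epoch a k ≤ t then h (splice k a fun _ => t + 1) *
        ENNReal.ofReal (Real.exp (-(lam * (t - epoch a k)))) else 0) := by
      refine Measurable.ite (measurableSet_le (by fun_prop) measurable_const) ?_ measurable_const
      refine Measurable.mul (hh.comp ?_) (by fun_prop)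
      exact (measurable_splice k).comp (f := fun a : ℕ → ℝ => (a, fun _ : ℕ => t + 1))
        (by fun_prop)
    rw [lintegral_splice _ k (hm1 k g hg),
      ← lintegral_const_mul _ hm]
    refine lintegral_congr_ae ?_
    filter_upwards [hgood] with a ha
    by_cases hk : epoch a k ≤ t
    · rw [if_pos hk, mul_comm, mul_assoc,
        ← lintegral_memoryless hlam (sub_nonneg.2 hk) hg, ← lintegral_const_mul]
      swap
      · refine Measurable.ite (measurableSet_lt measurable_const (by fun_prop)) ?_
          measurable_const
        exact hg.comp (measurable_subHead.comp (f := fun a' : ℕ → ℝ => (t - epoch a k, a'))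
          (by fun_prop))
      refine lintegral_congr_ae ?_
      filter_upwards [hgood] with a' ha'
      have hs := ha.splice ha' k
      have hiff := hs.arrivals_eq_iff ht k
      rw [epoch_splice_le le_rfl, epoch_splice_add k 1, epoch_succ a', epoch_zero, zero_add]
        at hiff
      by_cases hlt : t - epoch a k < a' 0
      · have hA : arrivals (MG1.splice k a a') t = k := hiff.2 ⟨hk, by linarith⟩
        have hz := ha.splice (goodArr_const (show 0 < t + 1 by linarith)) k
        have hAz : arrivals (MG1.splice k a fun _ => t + 1) t = k := by
          rw [hz.arrivals_eq_iff ht, epoch_splice_le le_rfl, epoch_splice_add k 1, epoch_succ,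
            epoch_zero]
          exact ⟨hk, by have := ha.nonneg k; linarith⟩
        have h1 : h (MG1.splice k a a') = h (MG1.splice k a fun _ => t + 1) := by
          refine hdet _ _ hs hz (hA.trans hAz.symm) fun i hi => ?_
          rw [hA] at hi
          rw [splice_lt hi, splice_lt hi]
        have h2 : resArr (MG1.splice k a a') t = subHead (t - epoch a k) a' := by
          ext j
          unfold resArr subHead
          rw [hA]
          split_ifs
          · rw [epoch_splice_add k 1, epoch_succ, epoch_zero]; ring
          · exact splice_add k j a a'
        have h3 : I k (MG1.splice k a a') = 1 := by simp [I, hA]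
        rw [if_pos hlt, h1, h2, h3]; ring
      · have hA : arrivals (MG1.splice k a a') t ≠ k := fun h => hlt (by
          have := (hiff.1 h).2; linarith)
        have h3 : I k (MG1.splice k a a') = 0 := by simp [I, hA]
        rw [if_neg hlt, h3]; simp
    · rw [if_neg hk, mul_zero]
      refine (lintegral_congr_ae ?_).trans lintegral_zero
      filter_upwards [hgood] with a' ha'
      have hA : arrivals (MG1.splice k a a') t ≠ k := fun h => hk (by
        have := (((ha.splice ha' k).arrivals_eq_iff ht k).1 h).1
        rwa [epoch_splice_le le_rfl] at this)
      have h3 : I k (MG1.splice k a a') = 0 := by simp [I, hA]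
      rw [h3, zero_mul]
  -- With `g = 1` the same formula evaluates the other factor, so the exponential weights need not
  -- be summed explicitly.
  have gen1 := fun k => gen k (fun _ => 1) measurable_const
  simp only [lintegral_one, measure_univ, one_mul] at gen1
  rw [lintegral_congr (hsum fun a => g (resArr a t) * h a), lintegral_tsum fun k =>
    (hm1 k g hg).aemeasurable, lintegral_congr (hsum h),
    lintegral_tsum fun k => (hm2 k).aemeasurable, ← ENNReal.tsum_mul_left]
  refine tsum_congr fun k => ?_
  rw [gen k g hg, gen1 k]

lemma departureTime_congr {x : State} {a a' σ σ' : ℕ → ℝ} {n : ℕ}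
    (ha : ∀ i ≤ n, entryTime (x, a, σ) i = entryTime (x, a', σ') i)
    (hσ : ∀ i ≤ n, σ i = σ' i) : departureTime (x, a, σ) n = departureTime (x, a', σ') n := by
  induction n with
  | zero => simp [departureTime, serviceTime, ha 0 le_rfl, hσ 0 le_rfl, initialNumber]
  | succ n ih =>
    rw [departureTime_succ, departureTime_succ, ih (fun i hi => ha i (by omega))
      (fun i hi => hσ i (by omega)), ha _ le_rfl]
    simp only [hσ (n + 1) le_rfl]

/-- The number of services used by time `t` is a stopping index: changing services not yet started
changes neither it nor the state. This is the determinacy required by `lintegral_iid_stopping`. -/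
lemma stateAt_det_serv {x : State} {a σ σ' : ℕ → ℝ} {t : ℝ} (ht : 0 ≤ t)
    (h : Good (x, a, σ)) (h' : Good (x, a, σ'))
    (heq : ∀ i < usedServ (x, a, σ) t, σ' i = σ i) :
    usedServ (x, a, σ') t = usedServ (x, a, σ) t ∧
      stateAt (x, a, σ') t = stateAt (x, a, σ) t := by
  have hdep : ∀ n < usedServ (x, a, σ) t,
      departureTime (x, a, σ') n = departureTime (x, a, σ) n := fun n hn =>
    departureTime_congr (fun i _ => rfl) (fun i hi => heq i (by omega))
  have hq := h.queueLength_add ht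
  have hq' := h'.queueLength_add ht
  have hle := h'.departures_le ht
  simp only at hq hq' hle
  have hD : departures (x, a, σ') t = departures (x, a, σ) t := by
    refine le_antisymm (not_lt.1 fun hlt => ?_) (not_lt.1 fun hlt => ?_)
    · by_cases hz : queueLength (x, a, σ) t = 0
      · omega
      · have h1 := (h'.lt_departures_iff t _).1 hlt
        rw [hdep _ (by rw [usedServ, if_neg hz]; omega), ← h.lt_departures_iff] at h1
        exact lt_irrefl _ h1
    · have h1 := (h.lt_departures_iff t _).1 hlt
      rw [← hdep _ (by rw [usedServ]; omega), ← h'.lt_departures_iff] at h1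
      exact lt_irrefl _ h1
  have hQ : queueLength (x, a, σ') t = queueLength (x, a, σ) t := by omega
  refine ⟨by rw [usedServ, usedServ, hD, hQ], ?_⟩
  rw [stateAt, stateAt, hQ, hD]
  congr 1
  split_ifs with hz
  · rfl
  · rw [hdep _ (by rw [usedServ, if_neg hz]; omega)]

/-- The counterpart for arrivals, required by `lintegral_resArr`: the state at `t` ignores the gaps
after the last arrival before `t`. -/
lemma stateAt_det_arr {x : State} {a a' σ : ℕ → ℝ} {t : ℝ} (ht : 0 ≤ t)
    (h : Good (x, a, σ)) (h' : Good (x, a', σ)) (hA : arrivals a t = arrivals a' t)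
    (heq : ∀ i < arrivals a t, a i = a' i) : stateAt (x, a, σ) t = stateAt (x, a', σ) t := by
  have hentry : ∀ n < x.1 + arrivals a t,
      entryTime (x, a, σ) n = entryTime (x, a', σ) n := by
    intro n hn
    unfold entryTime initialNumber
    simp only [arrivalEpoch_eq]
    split_ifs with hnq
    · rfl
    · exact Finset.sum_congr rfl fun i hi => heq i (by have := Finset.mem_range.1 hi; omega)
  have hdep : ∀ n < x.1 + arrivals a t,
      departureTime (x, a, σ) n = departureTime (x, a', σ) n := fun n hn =>
    departureTime_congr (fun i hi => hentry i (by omega)) (fun _ _ => rfl)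
  have hq := h.queueLength_add ht
  have hq' := h'.queueLength_add ht
  have hle := h.departures_le ht
  have hle' := h'.departures_le ht
  simp only at hq hq' hle hle'
  have hD : departures (x, a, σ) t = departures (x, a', σ) t := by
    refine eq_of_forall_lt_iff fun n => ?_
    by_cases hn : n < x.1 + arrivals a t
    · rw [h.lt_departures_iff, h'.lt_departures_iff, hdep n hn]
    · omega
  have hQ : queueLength (x, a, σ) t = queueLength (x, a', σ) t := by omega
  rw [stateAt, stateAt, ← hQ, ← hD]
  congr 1
  split_ifs with hz
  · rfl
  · rw [hdep _ (by omega)]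

lemma lintegral_law (hlam : 0 < lam) [IsProbabilityMeasure G] (ν : Measure State)
    {f : Input → ℝ≥0∞} (hf : Measurable f) : ∫⁻ ω, f ω ∂(law lam G ν) =
      ∫⁻ x, ∫⁻ a, ∫⁻ σ, f (x, a, σ) ∂(iid G) ∂(iid (expMeasure lam)) ∂ν := by
  have := isProbabilityMeasure_expMeasure hlam
  rw [law, lintegral_prod _ hf.aemeasurable]
  refine lintegral_congr fun x => ?_
  rw [lintegral_prod _ (by fun_prop)]

/-- Law of the state at time `t`. -/
def stateLaw (lam : ℝ) (G : Measure ℝ) (ν : Measure State) (t : ℝ) : Measure State :=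
  (law lam G ν).map fun ω => stateAt ω t

/-- Markov property at time `t`. -/
theorem map_shiftInput (hlam : 0 < lam) [IsProbabilityMeasure G] (hG : ∀ᵐ x ∂G, 0 ≤ x)
    (ν : Measure State) [IsProbabilityMeasure ν] {t : ℝ} (ht : 0 ≤ t) :
    (law lam G ν).map (shiftInput t) = law lam G (stateLaw lam G ν t) := by
  have := isProbabilityMeasure_expMeasure hlam
  have : Fact (0 < lam) := ⟨hlam⟩
  have : IsProbabilityMeasure (stateLaw lam G ν t) :=
    Measure.isProbabilityMeasure_map (measurable_stateAt_const t).aemeasurable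
  have : IsProbabilityMeasure ((law lam G ν).map (shiftInput t)) :=
    Measure.isProbabilityMeasure_map (measurable_shiftInput t).aemeasurable
  have hserv := ae_iid G hG
  have hgood := ae_goodArr hlam
  -- Boxes determine the law. For a fixed initial state and fixed arrivals the unused services are
  -- split off by the stopping index, and then the residual arrivals are split off from the earlier
  -- ones.
  have rect : ∀ B : Set State, MeasurableSet B → ∀ C : Set (ℕ → ℝ), MeasurableSet C →
      ∀ E : Set (ℕ → ℝ), MeasurableSet E →
      (law lam G ν).map (shiftInput t) (B ×ˢ C ×ˢ E) =
        stateLaw lam G ν t B * (iid (expMeasure lam) C * iid G E) := by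
    intro B hB C hC E hE
    have m1 : Measurable (Set.indicator B (1 : State → ℝ≥0∞)) := measurable_one.indicator hB
    have m2 : Measurable (Set.indicator C (1 : (ℕ → ℝ) → ℝ≥0∞)) := measurable_one.indicator hC
    have m3 : Measurable (Set.indicator E (1 : (ℕ → ℝ) → ℝ≥0∞)) := measurable_one.indicator hE
    have mst := measurable_stateAt_const t
    have lhs : (law lam G ν).map (shiftInput t) (B ×ˢ C ×ˢ E) =
        ∫⁻ ω, Set.indicator B 1 (stateAt ω t) * Set.indicator C 1 (resArr ω.2.1 t) *
          Set.indicator E 1 (fun n => ω.2.2 (usedServ ω t + n)) ∂(law lam G ν) := by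
      rw [← lintegral_indicator_one (hB.prod (hC.prod hE)), lintegral_map
        (measurable_one.indicator (hB.prod (hC.prod hE))) (measurable_shiftInput t)]
      refine lintegral_congr fun ω => ?_
      have hmem : shiftInput t ω ∈ B ×ˢ C ×ˢ E ↔ stateAt ω t ∈ B ∧ resArr ω.2.1 t ∈ C ∧
          (fun n => ω.2.2 (usedServ ω t + n)) ∈ E := by
        rw [Set.mem_prod, Set.mem_prod]; rfl
      by_cases h : shiftInput t ω ∈ B ×ˢ C ×ˢ E
      · obtain ⟨h1, h2, h3⟩ := hmem.1 h
        rw [Set.indicator_of_mem h, Set.indicator_of_mem h1, Set.indicator_of_mem h2,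
          Set.indicator_of_mem h3]
        simp
      · rw [Set.indicator_of_notMem h]
        by_cases h1 : stateAt ω t ∈ B
        · by_cases h2 : resArr ω.2.1 t ∈ C
          · rw [Set.indicator_of_notMem fun h3 => h (hmem.2 ⟨h1, h2, h3⟩), mul_zero]
          · rw [Set.indicator_of_notMem h2, mul_zero, zero_mul]
        · rw [Set.indicator_of_notMem h1, zero_mul, zero_mul]
    have hX : stateLaw lam G ν t B =
        ∫⁻ ω, Set.indicator B 1 (stateAt ω t) ∂(law lam G ν) := by
      rw [← lintegral_indicator_one hB, stateLaw, lintegral_map m1 mst]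
    have mS : Measurable fun ω : Input => fun n => ω.2.2 (usedServ ω t + n) :=
      (measurable_snd.comp measurable_snd).comp (measurable_shiftInput t)
    have mP : Measurable fun ω : Input => Set.indicator B 1 (stateAt ω t) *
        Set.indicator C 1 (resArr ω.2.1 t) *
          Set.indicator E (1 : (ℕ → ℝ) → ℝ≥0∞) (fun n => ω.2.2 (usedServ ω t + n)) :=
      ((m1.comp mst).mul (m2.comp ((measurable_resArr t).comp (f := fun ω : Input => ω.2.1)
        (by fun_prop)))).mul (m3.comp mS)
    have mX : Measurable fun ω : Input => Set.indicator B (1 : State → ℝ≥0∞) (stateAt ω t) :=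
      m1.comp mst
    rw [lhs, lintegral_law hlam ν mP, hX, lintegral_law hlam ν mX,
      ← lintegral_indicator_one hC, ← lintegral_indicator_one hE,
      ← lintegral_mul_const]
    swap
    · exact Measurable.lintegral_prod_right' (f := fun p : State × (ℕ → ℝ) =>
        ∫⁻ σ, Set.indicator B 1 (stateAt (p.1, p.2, σ) t) ∂(iid G))
        (Measurable.lintegral_prod_right' (f := fun p : (State × (ℕ → ℝ)) × (ℕ → ℝ) =>
          Set.indicator B 1 (stateAt (p.1.1, p.1.2, p.2) t))
          (m1.comp (mst.comp (f := fun p : (State × (ℕ → ℝ)) × (ℕ → ℝ) =>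
            (p.1.1, p.1.2, p.2)) (by fun_prop))))
    refine lintegral_congr fun x => ?_
    have inner : ∀ᵐ a ∂(iid (expMeasure lam)), ∫⁻ σ, Set.indicator B 1 (stateAt (x, a, σ) t) *
        Set.indicator C 1 (resArr a t) *
          Set.indicator E 1 (fun n => σ (usedServ (x, a, σ) t + n)) ∂(iid G) =
        Set.indicator C 1 (resArr a t) * (∫⁻ σ, Set.indicator B 1 (stateAt (x, a, σ) t) ∂(iid G)) *
          ∫⁻ σ, Set.indicator E 1 σ ∂(iid G) := by
      filter_upwards [hgood] with a ha
      have hst := lintegral_iid_stopping G (S := {σ | ∀ i, 0 ≤ σ i}) hserv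
        (fun n σ hσ σ' hσ' i => by
          unfold splice; split_ifs; exacts [hσ i, hσ' _])
        (N := fun σ => usedServ (x, a, σ) t)
        ((measurable_usedServ t).comp (f := fun σ => ((x, a, σ) : Input)) (by fun_prop))
        (Y := fun σ => stateAt (x, a, σ) t)
        (mst.comp (f := fun σ => ((x, a, σ) : Input)) (by fun_prop))
        (fun σ hσ σ' hσ' h => stateAt_det_serv ht ⟨ha, hσ⟩ ⟨ha, hσ'⟩ h) m1 m3
      rw [mul_assoc, ← hst, ← lintegral_const_mul']
      · refine lintegral_congr fun σ => ?_
        ring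
      · simp only [Set.indicator]; split_ifs <;> simp
    rw [lintegral_congr_ae inner, lintegral_mul_const, lintegral_resArr hlam ht m2]
    · ring
    · exact Measurable.lintegral_prod_right' (f := fun p : (ℕ → ℝ) × (ℕ → ℝ) =>
          Set.indicator B 1 (stateAt (x, p.1, p.2) t)) (m1.comp (mst.comp
            (f := fun p : (ℕ → ℝ) × (ℕ → ℝ) => ((x, p.1, p.2) : Input)) (by fun_prop)))
    · intro a a' ha ha' hA heq
      refine lintegral_congr_ae ?_
      filter_upwards [hserv] with σ hσ
      rw [stateAt_det_arr ht ⟨ha, hσ⟩ ⟨ha', hσ⟩ hA heq]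
    · refine Measurable.mul (m2.comp (measurable_resArr t)) ?_
      exact Measurable.lintegral_prod_right' (f := fun p : (ℕ → ℝ) × (ℕ → ℝ) =>
          Set.indicator B 1 (stateAt (x, p.1, p.2) t)) (m1.comp (mst.comp
            (f := fun p : (ℕ → ℝ) × (ℕ → ℝ) => ((x, p.1, p.2) : Input)) (by fun_prop)))
  refine Measure.ext_prod₃ fun {B C E} hB hC hE => ?_
  rw [rect B hB C hC E hE, law, Measure.prod_prod, Measure.prod_prod]

/-- A void service time in place of that of the customer in service changes nothing. -/
lemma lintegral_ins (hlam : 0 < lam) [IsProbabilityMeasure G] (ν : Measure State)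
    {f : Input → ℝ≥0∞} (hf : Measurable f) (hinv : ∀ ω : Input, ω.1.1 ≠ 0 →
      f (ω.1, ω.2.1, cons 0 fun i => ω.2.2 (1 + i)) = f ω) :
    ∫⁻ ω, f (ins ω) ∂(law lam G ν) = ∫⁻ ω, f ω ∂(law lam G ν) := by
  have hm : Measurable fun ω => f (ins ω) := hf.comp measurable_ins
  rw [lintegral_law hlam ν hm, lintegral_law hlam ν hf]
  refine lintegral_congr fun x => lintegral_congr fun a => ?_
  by_cases hx : x.1 = 0
  · simp [ins, hx]
  · simp only [ins, if_neg hx]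
    rw [← (measurePreserving_shift G 1).lintegral_comp]
    · exact lintegral_congr fun σ => hinv (x, a, σ) hx
    · exact hf.comp (measurable_const.prodMk (measurable_const.prodMk
        (measurable_cons.comp (f := fun σ : ℕ → ℝ => ((0 : ℝ), σ)) (by fun_prop))))

/-- With somebody in service at time `0`, entry `0` of the service sequence is never read. This and
the next lemmas provide the invariance asked for by `lintegral_ins`. -/
lemma departureTime_cons (ω : Input) (h : ω.1.1 ≠ 0) (n : ℕ) :
    departureTime (ω.1, ω.2.1, cons 0 fun i => ω.2.2 (1 + i)) n = departureTime ω n := by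
  induction n with
  | zero => simp [departureTime, serviceTime, initialNumber, Nat.pos_of_ne_zero h, entryTime]
  | succ n ih =>
    rw [departureTime_succ, departureTime_succ, ih]
    simp [cons, entryTime, initialNumber, arrivalEpoch_eq, add_comm 1]
    rfl

lemma stateAt_cons (ω : Input) (h : ω.1.1 ≠ 0) (t : ℝ) :
    stateAt (ω.1, ω.2.1, cons 0 fun i => ω.2.2 (1 + i)) t = stateAt ω t := by
  have := departureTime_cons ω h
  simp only [stateAt, queueLength, departures, this]
  rfl

lemma initialWork_cons (ω : Input) (h : ω.1.1 ≠ 0) :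
    initialWork (ω.1, ω.2.1, cons 0 fun i => ω.2.2 (1 + i)) = initialWork ω := by
  simp only [initialWork, departureTime_cons ω h]

lemma newServ_cons (ω : Input) (h : ω.1.1 ≠ 0) :
    newServ (ω.1, ω.2.1, cons 0 fun i => ω.2.2 (1 + i)) = newServ ω := by
  ext j
  simp only [newServ, cons, Nat.add_eq_zero_iff, h, false_and, if_false]
  exact congrArg ω.2.2 (by omega)

/-- Markov property, for functionals of the path after time `t`. -/
lemma lintegral_markov (hlam : 0 < lam) [IsProbabilityMeasure G] (hG : ∀ᵐ x ∂G, 0 ≤ x)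
    (ν : Measure State) [IsProbabilityMeasure ν] {t : ℝ} (ht : 0 ≤ t) {f : Input → ℝ≥0∞}
    (hf : Measurable f) (hinv : ∀ ω : Input, ω.1.1 ≠ 0 →
      f (ω.1, ω.2.1, cons 0 fun i => ω.2.2 (1 + i)) = f ω) :
    ∫⁻ ω, f (ins (shiftInput t ω)) ∂(law lam G ν) =
      ∫⁻ ω, f ω ∂(law lam G (stateLaw lam G ν t)) := by
  have hm : Measurable fun ω => f (ins ω) := hf.comp measurable_ins
  rw [← lintegral_ins hlam _ hf hinv, ← map_shiftInput hlam hG ν ht,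
    lintegral_map hm (measurable_shiftInput t)]

lemma stateLaw_stateLaw (hlam : 0 < lam) [IsProbabilityMeasure G] (hG : ∀ᵐ x ∂G, 0 ≤ x)
    (ν : Measure State) [IsProbabilityMeasure ν] {s t : ℝ} (hs : 0 ≤ s) (ht : 0 ≤ t) :
    stateLaw lam G (stateLaw lam G ν s) t = stateLaw lam G ν (s + t) := by
  ext B hB
  have m1 : Measurable (Set.indicator B (1 : State → ℝ≥0∞)) := measurable_one.indicator hB
  have key : ∀ (μ : Measure State) (u : ℝ), stateLaw lam G μ u B =
      ∫⁻ ω, Set.indicator B (1 : State → ℝ≥0∞) (stateAt ω u) ∂(law lam G μ) := fun μ u => by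
    rw [← lintegral_indicator_one hB, stateLaw, lintegral_map m1 (measurable_stateAt_const u)]
  have hm : Measurable fun ω : Input => Set.indicator B (1 : State → ℝ≥0∞) (stateAt ω t) :=
    m1.comp (measurable_stateAt_const t)
  rw [key, key, ← lintegral_markov hlam hG ν hs hm
      (fun ω h => by simp only [stateAt_cons ω h])]
  refine lintegral_congr_ae ?_
  filter_upwards [ae_good hlam hG ν] with ω hω
  simp only [hω.stateAt_shift hs ht]

/-! ### Moments of the Poisson arrival process -/

lemma integral_exp_neg_Ioi_zero {b : ℝ} (hb : 0 < b) :
    ∫ x in Set.Ioi (0 : ℝ), Real.exp (-(b * x)) = 1 / b := by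
  have h := integral_exp_mul_Ioi (a := -b) (by linarith) 0
  simp only [neg_mul, mul_zero, Real.exp_zero] at h
  rw [h, neg_div_neg_eq]

lemma ae_ne_expMeasure (r c : ℝ) : ∀ᵐ x ∂(expMeasure r), x ≠ c :=
  (withDensity_absolutelyContinuous _ _).ae_le (Measure.ae_ne volume c)

lemma integral_exp_expMeasure {r θ : ℝ} (hr : 0 < r) (hθ : 0 ≤ θ) :
    ∫ x, Real.exp (-(θ * x)) ∂(expMeasure r) = r / (r + θ) := by
  rw [integral_expMeasure hr]
  have : ∀ x : ℝ, r * Real.exp (-(r * x)) * Real.exp (-(θ * x)) =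
      r * Real.exp (-((r + θ) * x)) := fun x => by
    rw [mul_assoc, ← Real.exp_add]; congr 2; ring
  simp_rw [this]
  rw [integral_const_mul, integral_exp_neg_Ioi_zero (by linarith)]
  ring

lemma lintegral_exp_expMeasure {r θ : ℝ} (hr : 0 < r) (hθ : 0 ≤ θ) :
    ∫⁻ x, ENNReal.ofReal (Real.exp (-(θ * x))) ∂(expMeasure r) = ENNReal.ofReal (r / (r + θ)) := by
  have := isProbabilityMeasure_expMeasure hr
  rw [← integral_exp_expMeasure hr hθ, ofReal_integral_eq_lintegral_ofReal]
  · refine Integrable.of_bound (by fun_prop) 1 ?_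
    filter_upwards [ae_expMeasure_pos r] with x hx
    rw [Real.norm_eq_abs, abs_of_pos (Real.exp_pos _), Real.exp_le_one_iff]
    nlinarith
  · exact ae_of_all _ fun x => (Real.exp_pos _).le

lemma epoch_cons (x : ℝ) (a : ℕ → ℝ) (n : ℕ) : epoch (cons x a) (n + 1) = x + epoch a n := by
  rw [epoch, Finset.sum_range_succ', add_comm]
  simp [cons, epoch]

lemma lintegral_exp_epoch (hlam : 0 < lam) {θ : ℝ} (hθ : 0 ≤ θ) (n : ℕ) :
    ∫⁻ a, ENNReal.ofReal (Real.exp (-(θ * epoch a n))) ∂(iid (expMeasure lam)) =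
      ENNReal.ofReal (lam / (lam + θ)) ^ n := by
  have := isProbabilityMeasure_expMeasure hlam
  induction n with
  | zero => simp [epoch_zero]
  | succ n ih =>
    rw [lintegral_cons _ (by fun_prop)]
    have h : ∀ x : ℝ, ∫⁻ a, ENNReal.ofReal (Real.exp (-(θ * epoch (cons x a) (n + 1))))
        ∂(iid (expMeasure lam)) = ENNReal.ofReal (Real.exp (-(θ * x))) *
          ENNReal.ofReal (lam / (lam + θ)) ^ n := fun x => by
      rw [← ih, ← lintegral_const_mul _ (by fun_prop)]
      refine lintegral_congr fun a => ?_
      rw [epoch_cons, ← ENNReal.ofReal_mul (Real.exp_nonneg _), ← Real.exp_add]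
      congr 2; ring
    rw [lintegral_congr h, lintegral_mul_const _ (by fun_prop), lintegral_exp_expMeasure hlam hθ,
      pow_succ']

lemma GoodArr.setOf_arrivals {a : ℕ → ℝ} (h : GoodArr a) (t : ℝ) (j : ℕ) :
    epoch a (j + 1) ≤ t ↔ j ∈ Finset.range (arrivals a t) := by
  rw [Finset.mem_range, h.lt_arrivals_iff]

/-- Sums over the arrivals up to time `t`. -/
lemma GoodArr.tsum_arrivals {a : ℕ → ℝ} (h : GoodArr a) (t : ℝ) (c : ℕ → ℝ≥0∞) :
    ∑' j, (if epoch a (j + 1) ≤ t then c j else 0) = ∑ j ∈ Finset.range (arrivals a t), c j := by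
  simp_rw [h.setOf_arrivals]
  rw [tsum_eq_sum (s := Finset.range (arrivals a t)) fun j hj => by simp [hj]]
  exact Finset.sum_congr rfl fun j hj => by simp [hj]

/-- Turns the square of a count into a sum over the counted objects, so that second moments become
sums over customers. -/
lemma sum_odd_eq_sq (n : ℕ) : ∑ j ∈ Finset.range n, (2 * (j : ℝ≥0∞) + 1) = (n : ℝ≥0∞) ^ 2 := by
  have : ∑ j ∈ Finset.range n, (2 * j + 1) = n ^ 2 := by
    induction n with
    | zero => simp
    | succ n ih => rw [Finset.sum_range_succ, ih]; ring
  exact_mod_cast this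

lemma lintegral_tsum_arrivals {t : ℝ} (c : ℕ → ℝ≥0∞) (μ : Measure (ℕ → ℝ)) :
    ∫⁻ a, ∑' j, (if epoch a (j + 1) ≤ t then c j else 0) ∂μ =
      ∑' j, c j * μ {a | epoch a (j + 1) ≤ t} := by
  rw [lintegral_tsum fun j => (Measurable.ite (measurableSet_le (by fun_prop) (by fun_prop))
    measurable_const measurable_const).aemeasurable]
  refine tsum_congr fun j => ?_
  rw [← lintegral_indicator_const (measurableSet_le (by fun_prop) (by fun_prop))]
  exact lintegral_congr fun a => by simp [Set.indicator]

/-- Chernoff's bound with exponent `1`, summed over the arrivals; it is used only for finiteness. -/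
lemma tsum_mul_epoch_le (hlam : 0 < lam) (c : ℕ → ℝ≥0∞) (t : ℝ) :
    ∑' j, c j * iid (expMeasure lam) {a | epoch a (j + 1) ≤ t} ≤
      ENNReal.ofReal (Real.exp t) * ∑' j, c j * ENNReal.ofReal (lam / (lam + 1)) ^ (j + 1) := by
  rw [← ENNReal.tsum_mul_left]
  refine ENNReal.tsum_le_tsum fun j => ?_
  rw [← lintegral_exp_epoch hlam zero_le_one, mul_left_comm,
    ← lintegral_const_mul _ (by fun_prop),
    ← lintegral_indicator_one (measurableSet_le (by fun_prop) (by fun_prop))]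
  gcongr with a
  by_cases h : epoch a (j + 1) ≤ t
  · rw [← ENNReal.ofReal_mul (Real.exp_nonneg _), ← Real.exp_add]
    simp only [Set.indicator, Set.mem_ofPred_eq, h, if_true, Pi.one_apply]
    rw [ENNReal.one_le_ofReal, Real.one_le_exp_iff]
    linarith
  · simp [Set.indicator, h]

lemma ratio_lt_one (hlam : 0 < lam) {θ : ℝ} (hθ : 0 < θ) : lam / (lam + θ) < 1 := by
  rw [div_lt_one (by linarith)]; linarith

lemma tsum_geom (hlam : 0 < lam) {θ : ℝ} (hθ : 0 < θ) :
    ∑' j : ℕ, ENNReal.ofReal (lam / (lam + θ)) ^ (j + 1) = ENNReal.ofReal (lam / θ) := by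
  have h0 : 0 ≤ lam / (lam + θ) := by positivity
  have h1 := ratio_lt_one hlam hθ
  simp_rw [← ENNReal.ofReal_pow h0]
  have hs := (hasSum_geometric_of_lt_one h0 h1).mul_left (lam / (lam + θ))
  simp_rw [← pow_succ'] at hs
  rw [← ENNReal.ofReal_tsum_of_nonneg (fun n => by positivity) hs.summable, hs.tsum_eq]
  have : 1 - lam / (lam + θ) = θ / (lam + θ) := by field_simp; ring
  rw [this]
  congr 1
  field_simp

lemma tsum_odd_geom (hlam : 0 < lam) {θ : ℝ} (hθ : 0 < θ) :
    ∑' j : ℕ, (2 * (j : ℝ≥0∞) + 1) * ENNReal.ofReal (lam / (lam + θ)) ^ (j + 1) =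
      ENNReal.ofReal (2 * lam ^ 2 / θ ^ 2 + lam / θ) := by
  have h0 : 0 ≤ lam / (lam + θ) := by positivity
  have h1 := ratio_lt_one hlam hθ
  have hs := (((hasSum_coe_mul_geometric_of_norm_lt_one (r := lam / (lam + θ))
    (by rwa [Real.norm_eq_abs, abs_of_nonneg h0])).mul_left 2).add
    (hasSum_geometric_of_lt_one h0 h1)).mul_left (lam / (lam + θ))
  have he : ∀ j : ℕ, (2 * (j : ℝ≥0∞) + 1) * ENNReal.ofReal (lam / (lam + θ)) ^ (j + 1) =
      ENNReal.ofReal (lam / (lam + θ) * (2 * ((j : ℝ) * (lam / (lam + θ)) ^ j) +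
        (lam / (lam + θ)) ^ j)) := fun j => by
    rw [← ENNReal.ofReal_pow h0, show lam / (lam + θ) * (2 * ((j : ℝ) * (lam / (lam + θ)) ^ j) +
        (lam / (lam + θ)) ^ j) = (2 * (j : ℝ) + 1) * (lam / (lam + θ)) ^ (j + 1) by ring,
      ENNReal.ofReal_mul (by positivity), ENNReal.ofReal_add (by positivity) (by norm_num),
      ENNReal.ofReal_mul (by norm_num)]
    simp
  simp_rw [he]
  rw [← ENNReal.ofReal_tsum_of_nonneg (fun n => by positivity) hs.summable, hs.tsum_eq]
  congr 1
  have : 1 - lam / (lam + θ) = θ / (lam + θ) := by field_simp; ring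
  rw [this]
  field_simp

lemma lintegral_arrivals_eq (hlam : 0 < lam) (t : ℝ) :
    ∫⁻ a, (arrivals a t : ℝ≥0∞) ∂(iid (expMeasure lam)) =
      ∑' j, 1 * iid (expMeasure lam) {a | epoch a (j + 1) ≤ t} := by
  rw [← lintegral_tsum_arrivals]
  refine lintegral_congr_ae ?_
  filter_upwards [ae_goodArr hlam] with a ha
  rw [ha.tsum_arrivals]; simp

lemma lintegral_arrivals_sq_eq (hlam : 0 < lam) (t : ℝ) :
    ∫⁻ a, (arrivals a t : ℝ≥0∞) ^ 2 ∂(iid (expMeasure lam)) =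
      ∑' j : ℕ, (2 * (j : ℝ≥0∞) + 1) * iid (expMeasure lam) {a | epoch a (j + 1) ≤ t} := by
  rw [← lintegral_tsum_arrivals]
  refine lintegral_congr_ae ?_
  filter_upwards [ae_goodArr hlam] with a ha
  rw [ha.tsum_arrivals, sum_odd_eq_sq]

lemma lintegral_arrivals_sq_lt_top (hlam : 0 < lam) (t : ℝ) :
    ∫⁻ a, (arrivals a t : ℝ≥0∞) ^ 2 ∂(iid (expMeasure lam)) < ∞ := by
  rw [lintegral_arrivals_sq_eq hlam]
  refine (tsum_mul_epoch_le hlam _ t).trans_lt ?_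
  rw [tsum_odd_geom hlam one_pos]
  exact ENNReal.mul_lt_top ENNReal.ofReal_lt_top ENNReal.ofReal_lt_top

lemma lintegral_arrivals_lt_top (hlam : 0 < lam) (t : ℝ) :
    ∫⁻ a, (arrivals a t : ℝ≥0∞) ∂(iid (expMeasure lam)) < ∞ := by
  rw [lintegral_arrivals_eq hlam]
  refine (tsum_mul_epoch_le hlam _ t).trans_lt ?_
  simp only [one_mul]
  rw [tsum_geom hlam one_pos]
  exact ENNReal.mul_lt_top ENNReal.ofReal_lt_top ENNReal.ofReal_lt_top

/-- Abel mean of a function over the arrivals so far. -/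
lemma lintegral_abel_epoch (hlam : 0 < lam) {θ : ℝ} (hθ : 0 < θ) (c : ℕ → ℝ≥0∞) :
    ∫⁻ t, (∑' j, c j * iid (expMeasure lam) {a | epoch a (j + 1) ≤ t}) ∂(expMeasure θ) =
      ∑' j, c j * ENNReal.ofReal (lam / (lam + θ)) ^ (j + 1) := by
  have := isProbabilityMeasure_expMeasure hlam
  have := isProbabilityMeasure_expMeasure hθ
  have hS : ∀ j, MeasurableSet {p : ℝ × (ℕ → ℝ) | epoch p.2 (j + 1) ≤ p.1} := fun j =>
    measurableSet_le (by fun_prop) (by fun_prop)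
  have hm : ∀ j, Measurable fun t : ℝ => iid (expMeasure lam) {a | epoch a (j + 1) ≤ t} :=
    fun j => measurable_measure_prodMk_left (hS j)
  rw [lintegral_tsum fun j => ((hm j).const_mul _).aemeasurable]
  refine tsum_congr fun j => ?_
  rw [lintegral_const_mul _ (hm j)]
  congr 1
  rw [← lintegral_exp_epoch hlam hθ.le]
  have h1 : ∀ t : ℝ, iid (expMeasure lam) {a | epoch a (j + 1) ≤ t} =
      ∫⁻ a, Set.indicator {p : ℝ × (ℕ → ℝ) | epoch p.2 (j + 1) ≤ p.1} 1 (t, a)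
        ∂(iid (expMeasure lam)) := fun t => by
    rw [← lintegral_indicator_one (measurableSet_le (by fun_prop) (by fun_prop))]
    rfl
  simp_rw [h1]
  -- For a given arrival sequence, the exponential time exceeds the epoch with probability `exp (-(θ
  -- * epoch))`.
  rw [lintegral_lintegral_swap (f := fun (t : ℝ) (a : ℕ → ℝ) =>
    Set.indicator {p : ℝ × (ℕ → ℝ) | epoch p.2 (j + 1) ≤ p.1} (1 : ℝ × (ℕ → ℝ) → ℝ≥0∞) (t, a))
    (measurable_one.indicator (hS j)).aemeasurable]
  refine lintegral_congr_ae ?_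
  filter_upwards [ae_goodArr hlam] with a ha
  have h2 := lintegral_expMeasure_memoryless (r := θ) (ha.nonneg (j + 1))
    (f := fun _ => 1) measurable_const
  simp only [lintegral_one, measure_univ, mul_one] at h2
  rw [← h2]
  have hne := ae_ne_expMeasure θ (epoch a (j + 1))
  refine lintegral_congr_ae ?_
  filter_upwards [hne] with t ht
  by_cases h : epoch a (j + 1) ≤ t
  · simp [Set.indicator, h, lt_of_le_of_ne h ht.symm]
  · simp [Set.indicator, h, not_lt.2 (not_le.1 h).le]

/-- A nonnegative additive function on the half-line is linear. -/
lemma additive_linear {h : ℝ → ℝ} (h0 : ∀ t, 0 ≤ t → 0 ≤ h t)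
    (hadd : ∀ s t, 0 ≤ s → 0 ≤ t → h (s + t) = h s + h t) {t : ℝ} (ht : 0 ≤ t) :
    h t = h 1 * t := by
  have hmono : ∀ s t, 0 ≤ s → s ≤ t → h s ≤ h t := fun s t hs hst => by
    have := hadd s (t - s) hs (by linarith)
    rw [add_sub_cancel] at this
    have := h0 (t - s) (by linarith)
    linarith
  have hz : h 0 = 0 := by have := hadd 0 0 le_rfl le_rfl; simp at this; exact this
  have hmul : ∀ (n : ℕ) t, 0 ≤ t → h (n * t) = n * h t := fun n t ht => by
    induction n with
    | zero => simp [hz]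
    | succ n ih =>
      push_cast
      rw [add_mul, add_mul, one_mul, one_mul, hadd _ _ (by positivity) ht, ih]
  have hnat : ∀ n : ℕ, h n = n * h 1 := fun n => by simpa using hmul n 1 zero_le_one
  have hb : ∀ u, 0 ≤ u → |h u - h 1 * u| ≤ h 1 := fun u hu => by
    have h1 := hmono _ _ (Nat.cast_nonneg _) (Nat.floor_le hu)
    have h2 := hmono _ _ hu (Nat.lt_floor_add_one u).le
    have h3 := hnat (⌊u⌋₊ + 1)
    push_cast at h3
    rw [hnat] at h1
    rw [h3] at h2
    have h4 := Nat.floor_le hu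
    have h5 := (Nat.lt_floor_add_one u).le
    have h6 := h0 1 zero_le_one
    rw [abs_le]; constructor <;> nlinarith
  -- The deviation from linearity is bounded by `h 1`, yet replacing `t` by `n * t` multiplies it by
  -- `n`.
  by_contra hne
  have hpos : 0 < |h t - h 1 * t| := abs_pos.2 (sub_ne_zero.2 hne)
  obtain ⟨n, hn⟩ := exists_nat_gt (h 1 / |h t - h 1 * t|)
  rw [div_lt_iff₀ hpos] at hn
  have := hb (n * t) (by positivity)
  rw [hmul n t ht, show (n : ℝ) * h t - h 1 * (n * t) = n * (h t - h 1 * t) by ring, abs_mul,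
    Nat.abs_cast] at this
  linarith

lemma lintegral_id_expMeasure {r : ℝ} (hr : 0 < r) :
    ∫⁻ x, ENNReal.ofReal x ∂(expMeasure r) = ENNReal.ofReal (1 / r) := by
  have h := integral_pow_expMeasure hr 1
  have hi := integrable_pow_expMeasure hr 1
  simp only [pow_one, Nat.factorial_one, Nat.cast_one] at h hi
  rw [← h, ofReal_integral_eq_lintegral_ofReal hi]
  filter_upwards [ae_expMeasure_pos r] with x hx using hx.le

/-- The mean number of arrivals is `λ t`. -/
theorem lintegral_arrivals (hlam : 0 < lam) {t : ℝ} (ht : 0 ≤ t) :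
    ∫⁻ a, (arrivals a t : ℝ≥0∞) ∂(iid (expMeasure lam)) = ENNReal.ofReal (lam * t) := by
  have := isProbabilityMeasure_expMeasure hlam
  set H : ℝ → ℝ≥0∞ := fun t => ∫⁻ a, (arrivals a t : ℝ≥0∞) ∂(iid (expMeasure lam)) with hH
  have htop : ∀ t, H t ≠ ∞ := fun t => (lintegral_arrivals_lt_top hlam t).ne
  have hm : ∀ s, Measurable fun a : ℕ → ℝ => (arrivals a s : ℝ≥0∞) := fun s =>
    (measurable_from_nat (f := fun n : ℕ => (n : ℝ≥0∞))).comp (measurable_arrivals_const s)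
  -- Arrivals after `s` form a fresh copy of the process, so the mean is additive and therefore
  -- linear.
  have hadd : ∀ s t, 0 ≤ s → 0 ≤ t → H (s + t) = H s + H t := by
    intro s t hs ht
    have h1 := lintegral_resArr hlam hs (g := fun a => (arrivals a t : ℝ≥0∞)) (h := fun _ => 1)
      (hm t) measurable_const (fun _ _ _ _ _ _ => rfl)
    simp only [mul_one, lintegral_one, measure_univ] at h1
    simp only [hH]
    rw [← h1, ← lintegral_add_left (hm s)]
    refine lintegral_congr_ae ?_
    filter_upwards [ae_goodArr hlam] with a ha
    rw [ha.arrivals_resArr, ← Nat.cast_add]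
    congr 1
    have := ha.arrivals_mono (show s ≤ s + t by linarith)
    omega
  have hlin : ∀ t, 0 ≤ t → (H t).toReal = (H 1).toReal * t := fun t ht =>
    additive_linear (h := fun t => (H t).toReal) (fun _ _ => ENNReal.toReal_nonneg)
      (fun s t hs ht => by
        simp only [hadd s t hs ht, ENNReal.toReal_add (htop s) (htop t)]) ht
  have hlin' : ∀ t, 0 ≤ t → H t = H 1 * ENNReal.ofReal t := fun t ht => by
    rw [← ENNReal.ofReal_toReal (htop t), hlin t ht, ENNReal.ofReal_mul ENNReal.toReal_nonneg,
      ENNReal.ofReal_toReal (htop 1)]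
  -- Knowing linearity, the slope can be read off from the average over a rate-one exponential time.
  have habel := lintegral_abel_epoch hlam one_pos (fun _ => 1)
  simp_rw [← lintegral_arrivals_eq hlam, one_mul] at habel
  have h1 : H 1 = ENNReal.ofReal lam := by
    rw [tsum_geom hlam one_pos, div_one] at habel
    rw [← habel, ← mul_one (H 1)]
    conv_lhs => rw [← ENNReal.ofReal_one, show (1 : ℝ) = 1 / 1 by norm_num,
      ← lintegral_id_expMeasure one_pos]
    simp only [div_one]
    rw [← lintegral_const_mul _ (by fun_prop)]
    refine lintegral_congr_ae ?_
    filter_upwards [ae_expMeasure_pos 1] with t ht using (hlin' t ht.le).symm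
  change H t = _
  rw [hlin' t ht, h1, ENNReal.ofReal_mul hlam.le]

/-- Abel mean of the second moment of the number of arrivals. -/
lemma lintegral_abel_arrivals_sq (hlam : 0 < lam) {θ : ℝ} (hθ : 0 < θ) :
    ∫⁻ t, ∫⁻ a, (arrivals a t : ℝ≥0∞) ^ 2 ∂(iid (expMeasure lam)) ∂(expMeasure θ) =
      ENNReal.ofReal (2 * lam ^ 2 / θ ^ 2 + lam / θ) := by
  simp_rw [lintegral_arrivals_sq_eq hlam]
  rw [lintegral_abel_epoch hlam hθ, tsum_odd_geom hlam hθ]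

/-! ### The workload chain seen by the arriving customers -/

/-- Law of the interarrival and service times. -/
def seqLaw (lam : ℝ) (G : Measure ℝ) : Measure ((ℕ → ℝ) × (ℕ → ℝ)) :=
  (iid (expMeasure lam)).prod (iid G)

instance isProbabilityMeasure_seqLaw [IsProbabilityMeasure G] [Fact (0 < lam)] :
    IsProbabilityMeasure (seqLaw lam G) := by
  have := isProbabilityMeasure_expMeasure (Fact.out : 0 < lam)
  unfold seqLaw; infer_instance

/-- Arrival epoch and sojourn time of the `n`-th customer. -/
def chainState (n : ℕ) (z : ℝ × (ℕ → ℝ) × (ℕ → ℝ)) : ℝ × ℝ :=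
  (epoch z.2.1 n, load z.1 z.2.1 z.2.2 n)

/-- Remove the first `n` terms of both sequences. -/
def shiftSeq (n : ℕ) (p : (ℕ → ℝ) × (ℕ → ℝ)) : (ℕ → ℝ) × (ℕ → ℝ) :=
  (fun i => p.1 (n + i), fun i => p.2 (n + i))

@[fun_prop]
lemma measurable_chainState (n : ℕ) : Measurable (chainState n) := by
  unfold chainState; fun_prop

@[fun_prop]
lemma measurable_shiftSeq (n : ℕ) : Measurable (shiftSeq n) := by
  unfold shiftSeq; fun_prop

lemma lintegral_seqLaw (hlam : 0 < lam) [IsProbabilityMeasure G]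
    {H : (ℕ → ℝ) × (ℕ → ℝ) → ℝ≥0∞} (hH : Measurable H) :
    ∫⁻ p, H p ∂(seqLaw lam G) = ∫⁻ a, ∫⁻ s, H (a, s) ∂(iid G) ∂(iid (expMeasure lam)) := by
  have := isProbabilityMeasure_expMeasure hlam
  rw [seqLaw, lintegral_prod _ hH.aemeasurable]

lemma lintegral_seqLaw_splice (hlam : 0 < lam) [IsProbabilityMeasure G] (n : ℕ)
    {H : (ℕ → ℝ) × (ℕ → ℝ) → ℝ≥0∞} (hH : Measurable H) :
    ∫⁻ p, H p ∂(seqLaw lam G) = ∫⁻ p, ∫⁻ p', H (splice n p.1 p'.1, splice n p.2 p'.2)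
      ∂(seqLaw lam G) ∂(seqLaw lam G) := by
  have := isProbabilityMeasure_expMeasure hlam
  have : Fact (0 < lam) := ⟨hlam⟩
  have hm : Measurable fun q : ((ℕ → ℝ) × (ℕ → ℝ)) × ((ℕ → ℝ) × (ℕ → ℝ)) =>
      H (splice n q.1.1 q.2.1, splice n q.1.2 q.2.2) := by
    refine hH.comp (Measurable.prodMk ?_ ?_)
    · exact (measurable_splice n).comp (f := fun q : ((ℕ → ℝ) × (ℕ → ℝ)) × ((ℕ → ℝ) × (ℕ → ℝ)) =>
        (q.1.1, q.2.1)) (by fun_prop)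
    · exact (measurable_splice n).comp (f := fun q : ((ℕ → ℝ) × (ℕ → ℝ)) × ((ℕ → ℝ) × (ℕ → ℝ)) =>
        (q.1.2, q.2.2)) (by fun_prop)
  have hm1 : Measurable fun a => ∫⁻ s, H (a, s) ∂(iid G) := hH.lintegral_prod_right'
  rw [lintegral_seqLaw hlam hH, lintegral_seqLaw hlam hm.lintegral_prod_right',
    lintegral_splice _ n hm1]
  refine lintegral_congr fun a => ?_
  have h1 : ∀ a', ∫⁻ s, H (splice n a a', s) ∂(iid G) =
      ∫⁻ s, ∫⁻ s', H (splice n a a', splice n s s') ∂(iid G) ∂(iid G) := fun a' =>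
    lintegral_splice _ n (hH.comp (by fun_prop))
  have h2 : ∀ s, ∫⁻ p', H (splice n a p'.1, splice n s p'.2) ∂(seqLaw lam G) =
      ∫⁻ a', ∫⁻ s', H (splice n a a', splice n s s') ∂(iid G) ∂(iid (expMeasure lam)) :=
    fun s => lintegral_seqLaw hlam (hm.comp (f := fun p' : (ℕ → ℝ) × (ℕ → ℝ) => ((a, s), p'))
      (by fun_prop))
  simp_rw [h1]
  rw [lintegral_congr h2]
  refine lintegral_lintegral_swap (f := fun a' s =>
    ∫⁻ s', H (splice n a a', splice n s s') ∂(iid G)) (Measurable.aemeasurable ?_)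
  exact Measurable.lintegral_prod_right' (f := fun q : ((ℕ → ℝ) × (ℕ → ℝ)) × (ℕ → ℝ) =>
    H (splice n a q.1.1, splice n q.1.2 q.2)) (hm.comp
      (f := fun q : ((ℕ → ℝ) × (ℕ → ℝ)) × (ℕ → ℝ) => ((a, q.1.2), (q.1.1, q.2))) (by fun_prop))

lemma load_splice {k n : ℕ} (h : k ≤ n) (w : ℝ) (a a' s s' : ℕ → ℝ) :
    load w (splice n a a') (splice n s s') k = load w a s k := by
  induction k with
  | zero => rfl
  | succ k ih =>
    rw [load, load, ih (by omega), splice_lt (by omega), splice_lt (by omega)]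

lemma chainState_splice (n : ℕ) (w : ℝ) (p p' : (ℕ → ℝ) × (ℕ → ℝ)) :
    chainState n (w, splice n p.1 p'.1, splice n p.2 p'.2) = chainState n (w, p) := by
  simp only [chainState, epoch_splice_le le_rfl, load_splice le_rfl]

lemma shiftSeq_splice (n : ℕ) (p p' : (ℕ → ℝ) × (ℕ → ℝ)) :
    shiftSeq n (splice n p.1 p'.1, splice n p.2 p'.2) = p' := by
  simp only [shiftSeq, splice_add]

/-- The future of the chain is independent of its past. -/
theorem lintegral_chain (hlam : 0 < lam) [IsProbabilityMeasure G] (μ : Measure ℝ) [SFinite μ]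
    (n : ℕ) {F : (ℝ × ℝ) × (ℕ → ℝ) × (ℕ → ℝ) → ℝ≥0∞} (hF : Measurable F) :
    ∫⁻ z, F (chainState n z, shiftSeq n z.2) ∂(μ.prod (seqLaw lam G)) =
      ∫⁻ z, ∫⁻ p, F (chainState n z, p) ∂(seqLaw lam G) ∂(μ.prod (seqLaw lam G)) := by
  have : Fact (0 < lam) := ⟨hlam⟩
  have hm : Measurable fun z : ℝ × (ℕ → ℝ) × (ℕ → ℝ) => F (chainState n z, shiftSeq n z.2) :=
    hF.comp (by fun_prop)
  have hm' : Measurable fun z : ℝ × (ℕ → ℝ) × (ℕ → ℝ) =>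
      ∫⁻ p, F (chainState n z, p) ∂(seqLaw lam G) :=
    Measurable.lintegral_prod_right' (f := fun q : (ℝ × (ℕ → ℝ) × (ℕ → ℝ)) × _ =>
      F (chainState n q.1, q.2)) (hF.comp (by fun_prop))
  rw [lintegral_prod _ hm.aemeasurable, lintegral_prod _ hm'.aemeasurable]
  refine lintegral_congr fun w => ?_
  have hw : Measurable fun p => F (chainState n (w, p), shiftSeq n p) :=
    hm.comp (f := fun p => (w, p)) (by fun_prop)
  rw [lintegral_seqLaw_splice hlam n hw]
  simp only [chainState_splice, shiftSeq_splice]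

/-- Occupation measure of the chain (index, arrival epoch, sojourn time). -/
def occ (lam : ℝ) (G μ : Measure ℝ) : Measure (ℕ × ℝ × ℝ) :=
  Measure.sum fun n => (μ.prod (seqLaw lam G)).map fun z => (n, chainState n z)

/-- The same, without the initial state. -/
def newOcc (lam : ℝ) (G μ : Measure ℝ) : Measure (ℕ × ℝ × ℝ) :=
  Measure.sum fun n => (μ.prod (seqLaw lam G)).map fun z => (n + 1, chainState (n + 1) z)

/-- One transition of the chain. -/
def chainStep (q : (ℕ × ℝ × ℝ) × ℝ × ℝ) : ℕ × ℝ × ℝ :=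
  (q.1.1 + 1, q.1.2.1 + q.2.1, max (q.1.2.2 - q.2.1) 0 + q.2.2)

@[fun_prop]
lemma measurable_chainStep : Measurable chainStep := by
  unfold chainStep
  refine Measurable.prodMk ?_ (by fun_prop)
  exact (measurable_from_nat (f := fun n : ℕ => n + 1)).comp (by fun_prop)

instance sFinite_occ [IsProbabilityMeasure G] [Fact (0 < lam)] (μ : Measure ℝ) [SFinite μ] :
    SFinite (occ lam G μ) := by unfold occ; infer_instance

lemma lintegral_occ (μ : Measure ℝ) {F : ℕ × ℝ × ℝ → ℝ≥0∞} (hF : Measurable F) :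
    ∫⁻ y, F y ∂(occ lam G μ) =
      ∑' n, ∫⁻ z, F (n, chainState n z) ∂(μ.prod (seqLaw lam G)) := by
  rw [occ, lintegral_sum_measure]
  exact tsum_congr fun n => lintegral_map hF (by fun_prop)

lemma lintegral_newOcc (μ : Measure ℝ) {F : ℕ × ℝ × ℝ → ℝ≥0∞} (hF : Measurable F) :
    ∫⁻ y, F y ∂(newOcc lam G μ) =
      ∑' n, ∫⁻ z, F (n + 1, chainState (n + 1) z) ∂(μ.prod (seqLaw lam G)) := by
  rw [newOcc, lintegral_sum_measure]
  exact tsum_congr fun n => lintegral_map hF (by fun_prop)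

lemma occ_eq_add (hlam : 0 < lam) [IsProbabilityMeasure G] (μ : Measure ℝ) [SFinite μ] :
    occ lam G μ = μ.map (fun w => ((0 : ℕ), (0 : ℝ), w)) + newOcc lam G μ := by
  have : Fact (0 < lam) := ⟨hlam⟩
  refine Measure.ext_of_lintegral _ fun F hF => ?_
  rw [lintegral_occ μ hF, lintegral_add_measure, lintegral_newOcc μ hF,
    lintegral_map hF (by fun_prop), tsum_eq_zero_add' ENNReal.summable]
  congr 1
  rw [lintegral_prod _ (by fun_prop)]
  simp [chainState, epoch_zero, load]

/-- Applying one transition to every visit of the chain gives every visit except the initial one,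
because each transition uses fresh gap and service. Together with `occ_eq_add` this is the renewal
equation that yields all transform identities. -/
theorem newOcc_eq_map (hlam : 0 < lam) [IsProbabilityMeasure G] (μ : Measure ℝ) [SFinite μ] :
    newOcc lam G μ = ((occ lam G μ).prod ((expMeasure lam).prod G)).map chainStep := by
  have : Fact (0 < lam) := ⟨hlam⟩
  have := isProbabilityMeasure_expMeasure hlam
  refine Measure.ext_of_lintegral _ fun F hF => ?_
  have hm : Measurable fun q => F (chainStep q) := hF.comp measurable_chainStep
  rw [lintegral_map hF measurable_chainStep, lintegral_prod _ hm.aemeasurable,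
    lintegral_occ μ hm.lintegral_prod_right', lintegral_newOcc μ hF]
  refine tsum_congr fun n => ?_
  have hK : Measurable fun q : (ℝ × ℝ) × (ℕ → ℝ) × (ℕ → ℝ) =>
      F (chainStep ((n, q.1), q.2.1 0, q.2.2 0)) := hm.comp (by fun_prop)
  have h1 := lintegral_chain (G := G) hlam μ n hK
  have h2 : ∀ z : ℝ × (ℕ → ℝ) × (ℕ → ℝ),
      chainStep ((n, chainState n z), (shiftSeq n z.2).1 0, (shiftSeq n z.2).2 0) =
        (n + 1, chainState (n + 1) z) := fun z => by
    simp [chainStep, chainState, shiftSeq, epoch_succ, load]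
  simp only [h2] at h1
  rw [h1]
  refine lintegral_congr fun z => ?_
  have hz : Measurable fun p : (ℕ → ℝ) × (ℕ → ℝ) =>
      F (chainStep ((n, chainState n z), p.1 0, p.2 0)) :=
    hK.comp (f := fun p => (chainState n z, p)) (by fun_prop)
  have hy : Measurable fun y : ℝ × ℝ => F (chainStep ((n, chainState n z), y)) :=
    hm.comp (by fun_prop)
  rw [lintegral_seqLaw hlam hz,
    lintegral_prod _ hy.aemeasurable]
  have h3 : ∀ x : ℝ, ∫⁻ s, F (chainStep ((n, chainState n z), x, s 0)) ∂(iid G) =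
      ∫⁻ y, F (chainStep ((n, chainState n z), x, y)) ∂G := fun x =>
    lintegral_eval G 0 (f := fun y => F (chainStep ((n, chainState n z), x, y)))
      (hm.comp (by fun_prop))
  have h4 := lintegral_eval (expMeasure lam) 0
    (f := fun x => ∫⁻ y, F (chainStep ((n, chainState n z), x, y)) ∂G)
    (Measurable.lintegral_prod_right' (f := fun q : ℝ × ℝ =>
      F (chainStep ((n, chainState n z), q.1, q.2))) (hm.comp (by fun_prop)))
  rw [← h4]
  exact lintegral_congr fun a => h3 (a 0)

/-! ### Customers in the system as sums over the chain -/

lemma GoodArr.shift {a : ℕ → ℝ} (h : GoodArr a) (n : ℕ) : GoodArr fun i => a (n + i) := by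
  have he : ∀ k, epoch (fun i => a (n + i)) k = epoch a (n + k) - epoch a n := fun k => by
    rw [epoch, epoch, epoch, Finset.sum_range_add]; ring
  refine ⟨fun i => h.pos _, ?_⟩
  rw [show epoch (fun i => a (n + i)) = fun k => epoch a (n + k) + (- epoch a n) by
    ext k; rw [he]; ring]
  refine tendsto_atTop_add_const_right _ _ (h.tendsto.comp ?_)
  exact tendsto_atTop_mono (fun k => Nat.le_add_left k n) tendsto_id

lemma epoch_shift (a : ℕ → ℝ) (n k : ℕ) :
    epoch (fun i => a (n + i)) k = epoch a (n + k) - epoch a n := by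
  rw [epoch, epoch, epoch, Finset.sum_range_add]; ring

lemma GoodArr.arrivals_shift {a : ℕ → ℝ} (h : GoodArr a) {t : ℝ} {n : ℕ} :
    arrivals (fun i => a (n + i)) (t - epoch a n) = arrivals a t - n := by
  refine eq_of_forall_lt_iff fun k => ?_
  rw [(h.shift n).lt_arrivals_iff, epoch_shift, sub_le_sub_iff_right, lt_tsub_iff_left,
    h.lt_arrivals_iff]
  rfl

/-- Customers leave in order of arrival, so those present at any time form a block of consecutive
indices ending with the latest arrival. -/
lemma GoodArr.exists_Ico {a : ℕ → ℝ} (h : GoodArr a) {w : ℝ} {s : ℕ → ℝ} (hs : ∀ i, 0 ≤ s i)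
    (t : ℝ) : ∃ d, ∀ j, (epoch a (j + 1) ≤ t ∧ t < epoch a (j + 1) + load w a s (j + 1)) ↔
      j ∈ Finset.Ico d (arrivals a t) := by
  have hmono : Monotone fun n => epoch a (n + 1) + load w a s (n + 1) := fun i j hij =>
    epoch_add_load_mono w a hs (by omega)
  have ht : Tendsto (fun n => epoch a (n + 1) + load w a s (n + 1)) atTop atTop := by
    refine tendsto_atTop_mono (fun n => ?_) ((tendsto_add_atTop_iff_nat 1).2 h.tendsto)
    have : 0 ≤ load w a s (n + 1) := by
      rw [load]; have := hs n; positivity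
    linarith
  refine ⟨{k | epoch a (k + 1) + load w a s (k + 1) ≤ t}.ncard, fun j => ?_⟩
  rw [Finset.mem_Ico, h.lt_arrivals_iff, and_comm]
  refine and_congr_left fun _ => ?_
  rw [← not_iff_not, not_lt, not_le, lt_ncard_iff hmono ht]

open Classical in
lemma GoodArr.tsum_customers {a : ℕ → ℝ} (h : GoodArr a) {w : ℝ} {s : ℕ → ℝ}
    (hs : ∀ i, 0 ≤ s i) (t : ℝ) : ∃ d ≤ arrivals a t, newQueue w a s t = arrivals a t - d ∧
      ∀ c : ℕ → ℝ≥0∞, ∑' j, (if epoch a (j + 1) ≤ t ∧ t < epoch a (j + 1) + load w a s (j + 1)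
        then c j else 0) = ∑ i ∈ Finset.range (arrivals a t - d), c (d + i) := by
  obtain ⟨d, hd⟩ := h.exists_Ico (w := w) hs t
  have hset : {j | epoch a (j + 1) ≤ t ∧ t < epoch a (j + 1) + load w a s (j + 1)} =
      ((Finset.Ico d (arrivals a t) : Finset ℕ) : Set ℕ) := by
    ext j; exact hd j
  have hq : newQueue w a s t = arrivals a t - d := by
    rw [newQueue, hset, Set.ncard_coe_finset, Nat.card_Ico]
  have hc : ∀ c : ℕ → ℝ≥0∞, ∑' j, (if epoch a (j + 1) ≤ t ∧ t < epoch a (j + 1) +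
      load w a s (j + 1) then c j else 0) = ∑ i ∈ Finset.range (arrivals a t - d), c (d + i) := by
    intro c
    simp_rw [hd]
    rw [tsum_eq_sum (s := Finset.Ico d (arrivals a t)) fun j hj => by simp [hj],
      ← Finset.sum_Ico_eq_sum_range]
    exact Finset.sum_congr rfl fun j hj => by simp [hj]
  rcases le_total d (arrivals a t) with hle | hle
  · exact ⟨d, hle, hq, hc⟩
  · refine ⟨arrivals a t, le_rfl, by rw [hq]; omega, fun c => ?_⟩
    rw [hc, Nat.sub_eq_zero_of_le hle]; simp

open Classical in
/-- Sum over the customers present at time `t` that arrived after time `0`, of a function of index,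
arrival epoch and age, plus `c` times the number of later arrivals. -/
def custSum (W : ℕ → ℝ → ℝ → ℝ≥0∞) (c : ℝ≥0∞) (z : ℝ × (ℕ → ℝ) × (ℕ → ℝ)) (t : ℝ) : ℝ≥0∞ :=
  ∑' j, if (chainState (j + 1) z).1 ≤ t ∧ t < (chainState (j + 1) z).1 + (chainState (j + 1) z).2
    then W (j + 1) (chainState (j + 1) z).1 (t - (chainState (j + 1) z).1) +
      c * arrivals (shiftSeq (j + 1) z.2).1 (t - (chainState (j + 1) z).1) else 0

lemma newQueue_eq_custSum {w : ℝ} {a s : ℕ → ℝ} (h : GoodArr a) (hs : ∀ i, 0 ≤ s i) (t : ℝ) :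
    (newQueue w a s t : ℝ≥0∞) = custSum (fun _ _ _ => 1) 0 (w, a, s) t := by
  obtain ⟨d, hd, hq, hc⟩ := h.tsum_customers (w := w) hs t
  simp only [custSum, chainState, zero_mul, add_zero]
  rw [hc, hq]; simp

/-- All arrivals after a customer still present are present too. A customer followed by `m` later
arrivals gets weight `1 + 2 * m`, and the odd numbers add up to the square. -/
lemma newQueue_sq_eq_custSum {w : ℝ} {a s : ℕ → ℝ} (h : GoodArr a) (hs : ∀ i, 0 ≤ s i) (t : ℝ) :
    (newQueue w a s t : ℝ≥0∞) ^ 2 = custSum (fun _ _ _ => 1) 2 (w, a, s) t := by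
  obtain ⟨d, hd, hq, hc⟩ := h.tsum_customers (w := w) hs t
  simp only [custSum, chainState, shiftSeq, h.arrivals_shift]
  rw [hc fun j => 1 + 2 * ((arrivals a t - (j + 1) : ℕ) : ℝ≥0∞), hq, ← sum_odd_eq_sq,
    ← Finset.sum_range_reflect]
  refine Finset.sum_congr rfl fun i hi => ?_
  have := Finset.mem_range.1 hi
  rw [show arrivals a t - d - 1 - i = arrivals a t - (d + i + 1) by omega, add_comm]

/-- Each present customer is counted once for every arrival so far, namely its own index plus the
number of arrivals after it. -/
lemma arrivals_mul_newQueue_eq_custSum {w : ℝ} {a s : ℕ → ℝ} (h : GoodArr a)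
    (hs : ∀ i, 0 ≤ s i) (t : ℝ) : (arrivals a t : ℝ≥0∞) * newQueue w a s t =
      custSum (fun n _ _ => n) 1 (w, a, s) t := by
  obtain ⟨d, hd, hq, hc⟩ := h.tsum_customers (w := w) hs t
  simp only [custSum, chainState, shiftSeq, h.arrivals_shift, one_mul]
  rw [hc fun j => ((j + 1 : ℕ) : ℝ≥0∞) + ((arrivals a t - (j + 1) : ℕ) : ℝ≥0∞), hq,
    Finset.sum_congr rfl fun i hi => ?_, Finset.sum_const, Finset.card_range, nsmul_eq_mul, mul_comm]
  have := Finset.mem_range.1 hi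
  rw [← Nat.cast_add]
  congr 1; omega

lemma time_mul_newQueue_eq_custSum {w : ℝ} {a s : ℕ → ℝ} (h : GoodArr a) (hs : ∀ i, 0 ≤ s i)
    (t : ℝ) : ENNReal.ofReal t * newQueue w a s t =
      custSum (fun _ T u => ENNReal.ofReal (T + u)) 0 (w, a, s) t := by
  obtain ⟨d, hd, hq, hc⟩ := h.tsum_customers (w := w) hs t
  simp only [custSum, chainState, zero_mul, add_zero, add_sub_cancel]
  rw [hc fun _ => ENNReal.ofReal t, hq]; simp [mul_comm]

/-! ### Abel means of functionals of the queue -/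

open Classical in
/-- Contribution of one customer to `custSum`. -/
def custTerm (W : ℕ → ℝ → ℝ → ℝ≥0∞) (c : ℝ≥0∞) (n : ℕ) (y : ℝ × ℝ)
    (p : (ℕ → ℝ) × (ℕ → ℝ)) (t : ℝ) : ℝ≥0∞ :=
  if y.1 ≤ t ∧ t < y.1 + y.2 then W n y.1 (t - y.1) + c * arrivals p.1 (t - y.1) else 0

open Classical in
/-- The same as a function of the age. -/
def ageTerm (W : ℕ → ℝ → ℝ → ℝ≥0∞) (c : ℝ≥0∞) (n : ℕ) (y : ℝ × ℝ)
    (p : (ℕ → ℝ) × (ℕ → ℝ)) (u : ℝ) : ℝ≥0∞ :=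
  if u < y.2 then W n y.1 u + c * arrivals p.1 u else 0

lemma custSum_eq (W : ℕ → ℝ → ℝ → ℝ≥0∞) (c : ℝ≥0∞) (z : ℝ × (ℕ → ℝ) × (ℕ → ℝ)) (t : ℝ) :
    custSum W c z t =
      ∑' j, custTerm W c (j + 1) (chainState (j + 1) z) (shiftSeq (j + 1) z.2) t := rfl

@[fun_prop]
lemma measurable_arrivals_cast :
    Measurable fun p : (ℕ → ℝ) × ℝ => (arrivals p.1 p.2 : ℝ≥0∞) :=
  (measurable_from_nat (f := fun n : ℕ => (n : ℝ≥0∞))).comp measurable_arrivals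

section
variable {W : ℕ → ℝ → ℝ → ℝ≥0∞} (hW : ∀ n, Measurable fun q : ℝ × ℝ => W n q.1 q.2) (c : ℝ≥0∞)
include hW

lemma measurable_custTerm (n : ℕ) : Measurable
    fun q : ((ℝ × ℝ) × (ℕ → ℝ) × (ℕ → ℝ)) × ℝ => custTerm W c n q.1.1 q.1.2 q.2 := by
  unfold custTerm
  have h1 : Measurable fun q : ((ℝ × ℝ) × (ℕ → ℝ) × (ℕ → ℝ)) × ℝ => q.1.1.1 ≤ q.2 :=
    measurableSet_setOfPred.1 (measurableSet_le (by fun_prop) (by fun_prop))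
  have h2 : Measurable fun q : ((ℝ × ℝ) × (ℕ → ℝ) × (ℕ → ℝ)) × ℝ => q.2 < q.1.1.1 + q.1.1.2 :=
    measurableSet_setOfPred.1 (measurableSet_lt (by fun_prop) (by fun_prop))
  refine Measurable.ite (measurableSet_setOfPred.2 (h1.and h2)) (Measurable.add ?_
    (Measurable.const_mul ?_ c)) measurable_const
  · exact (hW n).comp (f := fun q : ((ℝ × ℝ) × (ℕ → ℝ) × (ℕ → ℝ)) × ℝ =>
      (q.1.1.1, q.2 - q.1.1.1)) (by fun_prop)
  · exact measurable_arrivals_cast.comp (f := fun q : ((ℝ × ℝ) × (ℕ → ℝ) × (ℕ → ℝ)) × ℝ =>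
      (q.1.2.1, q.2 - q.1.1.1)) (by fun_prop)

lemma measurable_ageTerm (n : ℕ) : Measurable
    fun q : ((ℝ × ℝ) × (ℕ → ℝ) × (ℕ → ℝ)) × ℝ => ageTerm W c n q.1.1 q.1.2 q.2 := by
  unfold ageTerm
  refine Measurable.ite (measurableSet_lt (by fun_prop) (by fun_prop))
    (Measurable.add ?_ (Measurable.const_mul ?_ c)) measurable_const
  · exact (hW n).comp (f := fun q : ((ℝ × ℝ) × (ℕ → ℝ) × (ℕ → ℝ)) × ℝ =>
      (q.1.1.1, q.2)) (by fun_prop)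
  · exact measurable_arrivals_cast.comp (f := fun q : ((ℝ × ℝ) × (ℕ → ℝ) × (ℕ → ℝ)) × ℝ =>
      (q.1.2.1, q.2)) (by fun_prop)

/-- Lack of memory of the exponential time: it outlives the arrival epoch with the discount as
probability, and its excess, the age of the customer, is again exponential. -/
lemma lintegral_custTerm (θ : ℝ) (n : ℕ) {y : ℝ × ℝ} (hy : 0 ≤ y.1) (p : (ℕ → ℝ) × (ℕ → ℝ)) :
    ∫⁻ t, custTerm W c n y p t ∂(expMeasure θ) = ENNReal.ofReal (Real.exp (-(θ * y.1))) *
      ∫⁻ u, ageTerm W c n y p u ∂(expMeasure θ) := by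
  have hm : Measurable fun u => ageTerm W c n y p u := (measurable_ageTerm hW c n).comp
    (f := fun u => ((y, p), u)) (by fun_prop)
  rw [← lintegral_expMeasure_memoryless hy hm]
  refine lintegral_congr_ae ?_
  filter_upwards [ae_ne_expMeasure θ y.1] with t ht
  by_cases h : y.1 ≤ t
  · have h' : y.1 < t := lt_of_le_of_ne h ht.symm
    simp only [custTerm, Set.indicator, Set.mem_Ioi, h', if_true, h, true_and,
      ageTerm, sub_lt_iff_lt_add']
  · have h' : ¬ y.1 < t := fun h' => h h'.le
    simp [custTerm, Set.indicator, h', h]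

/-- At age `u` the fresh arrivals after the customer have mean `lam * u`, which replaces their
random number. -/
lemma lintegral_ageTerm (hlam : 0 < lam) [IsProbabilityMeasure G] (θ : ℝ) (n : ℕ) (y : ℝ × ℝ) :
    ∫⁻ p, ∫⁻ u, ageTerm W c n y p u ∂(expMeasure θ) ∂(seqLaw lam G) =
      ∫⁻ u, (if u < y.2 then W n y.1 u + c * ENNReal.ofReal (lam * u) else 0) ∂(expMeasure θ) := by
  have : Fact (0 < lam) := ⟨hlam⟩
  have := isProbabilityMeasure_expMeasure hlam
  have hm := measurable_ageTerm hW c n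
  have : SFinite (expMeasure θ) := by unfold expMeasure gammaMeasure; infer_instance
  rw [lintegral_lintegral_swap (f := fun p u => ageTerm W c n y p u)
    (hm.comp (f := fun q : ((ℕ → ℝ) × (ℕ → ℝ)) × ℝ => ((y, q.1), q.2)) (by fun_prop)).aemeasurable]
  refine lintegral_congr_ae ?_
  filter_upwards [ae_expMeasure_pos θ] with u hu
  by_cases h : u < y.2
  · simp only [ageTerm, h, if_true]
    have ha : Measurable fun a : ℕ → ℝ => (arrivals a u : ℝ≥0∞) :=
      measurable_arrivals_cast.comp (f := fun a : ℕ → ℝ => (a, u)) (by fun_prop)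
    have hp : Measurable fun p : (ℕ → ℝ) × (ℕ → ℝ) => (arrivals p.1 u : ℝ≥0∞) :=
      ha.comp measurable_fst
    rw [lintegral_add_left measurable_const, lintegral_const, measure_univ, mul_one,
      lintegral_const_mul _ hp, lintegral_seqLaw hlam hp]
    simp only [lintegral_const, measure_univ, mul_one]
    rw [lintegral_arrivals hlam hu.le]
  · simp [ageTerm, h]

/-- Later arrivals are independent of the epoch and sojourn time of a customer (`lintegral_chain`).
Hence the average needs only the occupation measure of the chain. -/
theorem lintegral_abel_custSum (hlam : 0 < lam) [IsProbabilityMeasure G] (μ : Measure ℝ)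
    [SFinite μ] (hW' : Measurable fun q : (ℕ × ℝ) × ℝ => W q.1.1 q.1.2 q.2) (θ : ℝ) :
    ∫⁻ z, ∫⁻ t, custSum W c z t ∂(expMeasure θ) ∂(μ.prod (seqLaw lam G)) =
      ∫⁻ y, ENNReal.ofReal (Real.exp (-(θ * y.2.1))) * ∫⁻ u, (if u < y.2.2 then
        W y.1 y.2.1 u + c * ENNReal.ofReal (lam * u) else 0) ∂(expMeasure θ)
        ∂(newOcc lam G μ) := by
  have : Fact (0 < lam) := ⟨hlam⟩
  have : SFinite (expMeasure θ) := by unfold expMeasure gammaMeasure; infer_instance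
  have := isProbabilityMeasure_expMeasure hlam
  have hmt := fun n => measurable_custTerm hW c n
  have hma := fun n => measurable_ageTerm hW c n
  have hi : Measurable fun q : (ℕ × ℝ × ℝ) × ℝ => if q.2 < q.1.2.2 then
      W q.1.1 q.1.2.1 q.2 + c * ENNReal.ofReal (lam * q.2) else 0 := by
    refine Measurable.ite (measurableSet_lt (by fun_prop) (by fun_prop)) (Measurable.add ?_
      (by fun_prop)) measurable_const
    exact hW'.comp (f := fun q : (ℕ × ℝ × ℝ) × ℝ => ((q.1.1, q.1.2.1), q.2)) (by fun_prop)
  have hI : Measurable fun y : ℕ × ℝ × ℝ => ENNReal.ofReal (Real.exp (-(θ * y.2.1))) *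
      ∫⁻ u, (if u < y.2.2 then W y.1 y.2.1 u + c * ENNReal.ofReal (lam * u) else 0)
        ∂(expMeasure θ) :=
    Measurable.mul (by fun_prop) hi.lintegral_prod_right'
  rw [lintegral_newOcc μ hI]
  simp only [custSum_eq]
  have hz : ∀ n, Measurable fun q : (ℝ × (ℕ → ℝ) × (ℕ → ℝ)) × ℝ =>
      custTerm W c (n + 1) (chainState (n + 1) q.1) (shiftSeq (n + 1) q.1.2) q.2 := fun n =>
    (hmt (n + 1)).comp (f := fun q : (ℝ × (ℕ → ℝ) × (ℕ → ℝ)) × ℝ =>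
      ((chainState (n + 1) q.1, shiftSeq (n + 1) q.1.2), q.2)) (by fun_prop)
  have hz' : ∀ z n, Measurable fun t =>
      custTerm W c (n + 1) (chainState (n + 1) z) (shiftSeq (n + 1) z.2) t := fun z n =>
    (hz n).comp (f := fun t => (z, t)) (by fun_prop)
  rw [lintegral_congr fun z => lintegral_tsum fun n => (hz' z n).aemeasurable,
    lintegral_tsum fun n => ((hz n).lintegral_prod_right').aemeasurable]
  refine tsum_congr fun n => ?_
  have hK : Measurable fun q : (ℝ × ℝ) × (ℕ → ℝ) × (ℕ → ℝ) =>
      ENNReal.ofReal (Real.exp (-(θ * q.1.1))) * ∫⁻ u, ageTerm W c (n + 1) q.1 q.2 u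
        ∂(expMeasure θ) :=
    Measurable.mul (by fun_prop) (hma (n + 1)).lintegral_prod_right'
  have hgood : ∀ᵐ z ∂(μ.prod (seqLaw lam G)), GoodArr z.2.1 := by
    have h1 : ∀ᵐ p ∂(seqLaw lam G), GoodArr p.1 :=
      Measure.quasiMeasurePreserving_fst.ae (ae_goodArr hlam)
    exact Measure.quasiMeasurePreserving_snd.ae h1
  have h1 := lintegral_chain (G := G) hlam μ (n + 1) hK
  refine Eq.trans ?_ (h1.trans ?_)
  · refine lintegral_congr_ae ?_
    filter_upwards [hgood] with z hz
    exact lintegral_custTerm hW c θ (n + 1) (hz.nonneg _) _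
  · refine lintegral_congr fun z => ?_
    simp only
    rw [lintegral_const_mul _ (Measurable.lintegral_prod_right' (f := fun q : _ × ℝ =>
      ageTerm W c (n + 1) (chainState (n + 1) z) q.1 q.2) ((hma (n + 1)).comp
        (f := fun q : ((ℕ → ℝ) × (ℕ → ℝ)) × ℝ => ((chainState (n + 1) z, q.1), q.2))
          (by fun_prop))), lintegral_ageTerm hW c hlam]

end

/-- Abel mean over an interval of an affine function. -/
lemma lintegral_affine_expMeasure {θ A B Y : ℝ} (hθ : 0 < θ) (hA : 0 ≤ A) (hB : 0 ≤ B)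
    (hY : 0 ≤ Y) :
    ∫⁻ u, (if u < Y then ENNReal.ofReal (A + B * u) else 0) ∂(expMeasure θ) =
      ENNReal.ofReal (A * (1 - Real.exp (-(θ * Y))) +
        B * ((1 - Real.exp (-(θ * Y)) - θ * Y * Real.exp (-(θ * Y))) / θ)) := by
  have hm : Measurable fun u : ℝ => if u < Y then ENNReal.ofReal (A + B * u) else 0 :=
    Measurable.ite (measurableSet_lt (by fun_prop) (by fun_prop)) (by fun_prop) measurable_const
  rw [lintegral_expMeasure _ _ hm, ← lintegral_indicator measurableSet_Ioi]
  have h1 : ∀ u : ℝ, Set.indicator (Set.Ioi 0) (fun u => ENNReal.ofReal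
      (θ * Real.exp (-(θ * u))) * (if u < Y then ENNReal.ofReal (A + B * u) else 0)) u =
      Set.indicator (Set.Ioo 0 Y) (fun u => ENNReal.ofReal
        (θ * Real.exp (-(θ * u)) * (A + B * u))) u := fun u => by
    by_cases h0 : 0 < u <;> by_cases hu : u < Y <;>
      simp [Set.indicator, h0, hu, ENNReal.ofReal_mul (mul_pos hθ (Real.exp_pos _)).le]
  have hc : Continuous fun u : ℝ => θ * Real.exp (-(θ * u)) * (A + B * u) := by fun_prop
  rw [lintegral_congr h1, lintegral_indicator measurableSet_Ioo,
    ← Measure.restrict_congr_set Ioo_ae_eq_Ioc.symm, ← ofReal_integral_eq_lintegral_ofReal]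
  · rw [← intervalIntegral.integral_of_le hY]
    have hd : ∀ x ∈ Set.uIcc 0 Y, HasDerivAt
        (fun x => -(A + B * x + B / θ) * Real.exp (-(θ * x)))
        (θ * Real.exp (-(θ * x)) * (A + B * x)) x := fun x _ => by
      have h2 : HasDerivAt (fun x => Real.exp (-(θ * x))) (Real.exp (-(θ * x)) * -(θ * 1)) x :=
        (((hasDerivAt_id x).const_mul θ).neg).exp
      have h3 : HasDerivAt (fun x => -(A + B * x + B / θ)) (-(B * 1)) x :=
        ((((hasDerivAt_id x).const_mul B).const_add A).add_const (B / θ)).neg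
      refine (h3.mul h2).congr_deriv ?_
      have : B / θ * θ = B := div_mul_cancel₀ _ hθ.ne'
      linear_combination Real.exp (-(θ * x)) * this
    rw [intervalIntegral.integral_eq_sub_of_hasDerivAt hd (hc.intervalIntegrable _ _)]
    congr 1
    simp only [mul_zero, neg_zero, Real.exp_zero]
    field_simp
    ring_nf
  · exact (hc.integrableOn_Icc).mono_set Set.Ioc_subset_Icc_self
  · refine (ae_restrict_mem measurableSet_Ioc).mono fun u hu => ?_
    have := hu.1
    positivity

lemma measurable_nonneg_nonneg : Measurable fun y : ℕ × ℝ × ℝ => 0 ≤ y.2.1 ∧ 0 ≤ y.2.2 :=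
  Measurable.and
    (measurableSet_setOfPred.1 (measurableSet_le measurable_const (by fun_prop)))
    (measurableSet_setOfPred.1 (measurableSet_le measurable_const (by fun_prop)))

lemma ae_newOcc (hlam : 0 < lam) [IsProbabilityMeasure G] (hG : ∀ᵐ x ∂G, 0 ≤ x) (μ : Measure ℝ)
    [SFinite μ] : ∀ᵐ y ∂(newOcc lam G μ), 0 ≤ y.2.1 ∧ 0 ≤ y.2.2 := by
  have : Fact (0 < lam) := ⟨hlam⟩
  have := isProbabilityMeasure_expMeasure hlam
  have hp := measurable_nonneg_nonneg
  rw [newOcc, Measure.ae_sum_iff' (measurableSet_setOfPred.2 hp)]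
  intro n
  rw [ae_map_iff (by fun_prop) (measurableSet_setOfPred.2 hp)]
  have h1 : ∀ᵐ p ∂(seqLaw lam G), GoodArr p.1 :=
    Measure.quasiMeasurePreserving_fst.ae (ae_goodArr hlam)
  have h2 : ∀ᵐ p ∂(seqLaw lam G), ∀ i, 0 ≤ p.2 i :=
    Measure.quasiMeasurePreserving_snd.ae (ae_iid G hG)
  filter_upwards [Measure.quasiMeasurePreserving_snd.ae h1,
    Measure.quasiMeasurePreserving_snd.ae h2] with z hz1 hz2
  refine ⟨hz1.nonneg _, ?_⟩
  simp only [chainState, load]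
  have := hz2 n
  positivity

lemma newOcc_le_occ (hlam : 0 < lam) [IsProbabilityMeasure G] (μ : Measure ℝ) [SFinite μ] :
    newOcc lam G μ ≤ occ lam G μ := by
  rw [occ_eq_add hlam]
  exact Measure.le_add_left le_rfl

lemma ae_occ (hlam : 0 < lam) [IsProbabilityMeasure G] (hG : ∀ᵐ x ∂G, 0 ≤ x) (μ : Measure ℝ)
    [SFinite μ] (hμ : ∀ᵐ w ∂μ, 0 ≤ w) : ∀ᵐ y ∂(occ lam G μ), 0 ≤ y.2.1 ∧ 0 ≤ y.2.2 := by
  have hp := measurableSet_setOfPred.2 measurable_nonneg_nonneg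
  rw [occ_eq_add hlam, ae_add_measure_iff, ae_map_iff (by fun_prop) hp]
  exact ⟨hμ.mono fun w hw => ⟨le_rfl, hw⟩, ae_newOcc hlam hG μ⟩

lemma lintegral_occ_exp (hlam : 0 < lam) [IsProbabilityMeasure G] (μ : Measure ℝ)
    [IsProbabilityMeasure μ] {θ : ℝ} (hθ : 0 ≤ θ) (c : ℕ → ℝ≥0∞) :
    ∫⁻ y, c y.1 * ENNReal.ofReal (Real.exp (-(θ * y.2.1))) ∂(occ lam G μ) =
      ∑' n, c n * ENNReal.ofReal (lam / (lam + θ)) ^ n := by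
  have : Fact (0 < lam) := ⟨hlam⟩
  have := isProbabilityMeasure_expMeasure hlam
  have hm : Measurable fun y : ℕ × ℝ × ℝ => c y.1 * ENNReal.ofReal (Real.exp (-(θ * y.2.1))) :=
    ((measurable_from_nat (f := c)).comp measurable_fst).mul (by fun_prop)
  rw [lintegral_occ μ hm]
  refine tsum_congr fun n => ?_
  simp only [chainState]
  rw [lintegral_const_mul _ (by fun_prop), lintegral_prod _ (by fun_prop)]
  simp only [lintegral_const, measure_univ, mul_one]
  rw [lintegral_seqLaw hlam (by fun_prop)]
  simp only [lintegral_const, measure_univ, mul_one]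
  rw [lintegral_exp_epoch hlam hθ]

/-- Everything of linear growth is integrable against the discounted occupation measure. -/
lemma integrable_occ (hlam : 0 < lam) [IsProbabilityMeasure G] (hG : ∀ᵐ x ∂G, 0 ≤ x)
    (μ : Measure ℝ) [IsProbabilityMeasure μ] (hμ : ∀ᵐ w ∂μ, 0 ≤ w) {θ : ℝ} (hθ : 0 < θ) :
    Integrable (fun y : ℕ × ℝ × ℝ => (1 + y.1 + y.2.1) * Real.exp (-(θ * y.2.1)))
      (occ lam G μ) := by
  have hc : Measurable fun y : ℕ × ℝ × ℝ => (y.1 : ℝ) :=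
    (measurable_from_nat (f := fun n : ℕ => (n : ℝ))).comp measurable_fst
  have h0 : 0 ≤ lam / (lam + θ / 2) := by positivity
  have h1 := ratio_lt_one hlam (half_pos hθ)
  -- Half of the discount absorbs the factor linear in the epoch, as `T * exp (-(θ / 2 * T)) ≤ 2 /
  -- θ`; the other half makes the sum over the index a weighted geometric series.
  have hdom : Integrable (fun y : ℕ × ℝ × ℝ => (1 + 2 / θ) *
      ((1 + (y.1 : ℝ)) * Real.exp (-(θ / 2 * y.2.1)))) (occ lam G μ) := by
    refine Integrable.const_mul ⟨by fun_prop, ?_⟩ _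
    rw [hasFiniteIntegral_iff_ofReal (ae_of_all _ fun y => by positivity)]
    have h2 : ∀ y : ℕ × ℝ × ℝ, ENNReal.ofReal ((1 + (y.1 : ℝ)) * Real.exp (-(θ / 2 * y.2.1))) =
        ENNReal.ofReal (1 + (y.1 : ℝ)) * ENNReal.ofReal (Real.exp (-(θ / 2 * y.2.1))) :=
      fun y => ENNReal.ofReal_mul (by positivity)
    rw [lintegral_congr h2, lintegral_occ_exp hlam μ (half_pos hθ).le
      (fun n => ENNReal.ofReal (1 + (n : ℝ)))]
    have h3 : ∀ n : ℕ, ENNReal.ofReal (1 + (n : ℝ)) * ENNReal.ofReal (lam / (lam + θ / 2)) ^ n =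
        ENNReal.ofReal ((1 + (n : ℝ)) * (lam / (lam + θ / 2)) ^ n) := fun n => by
      rw [ENNReal.ofReal_mul (by positivity), ENNReal.ofReal_pow h0]
    simp_rw [h3]
    have hs : Summable fun n : ℕ => (1 + (n : ℝ)) * (lam / (lam + θ / 2)) ^ n := by
      simp_rw [add_mul, one_mul]
      exact (summable_geometric_of_lt_one h0 h1).add
        (hasSum_coe_mul_geometric_of_norm_lt_one
          (by rwa [Real.norm_eq_abs, abs_of_nonneg h0])).summable
    exact hs.tsum_ofReal_lt_top
  refine hdom.mono' (by fun_prop) ?_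
  filter_upwards [ae_occ hlam hG μ hμ] with y hy
  rw [Real.norm_eq_abs, abs_of_nonneg (by have := hy.1; positivity)]
  have hT := hy.1
  have e1 : Real.exp (-(θ * y.2.1)) = Real.exp (-(θ / 2 * y.2.1)) * Real.exp (-(θ / 2 * y.2.1)) := by
    rw [← Real.exp_add]; congr 1; ring
  have e2 : Real.exp (-(θ / 2 * y.2.1)) ≤ 1 := by
    rw [Real.exp_le_one_iff]; have := mul_nonneg hθ.le hT; linarith
  have e3 : y.2.1 * Real.exp (-(θ / 2 * y.2.1)) ≤ 2 / θ := by
    have h4 := Real.add_one_le_exp (θ / 2 * y.2.1)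
    rw [Real.exp_neg, ← div_eq_mul_inv, div_le_div_iff₀ (Real.exp_pos _) hθ]
    nlinarith
  have e4 := Real.exp_pos (-(θ / 2 * y.2.1))
  set E := Real.exp (-(θ / 2 * y.2.1))
  rw [e1]
  have hn : (0 : ℝ) ≤ y.1 := Nat.cast_nonneg _
  have h5 : (1 + (y.1 : ℝ) + y.2.1) * E ≤ (1 + (y.1 : ℝ)) * (1 + 2 / θ) := by
    have : (1 + (y.1 : ℝ)) * E ≤ (1 + y.1) * 1 := by gcongr
    have h6 : 0 ≤ 2 / θ := by positivity
    nlinarith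
  calc (1 + (y.1 : ℝ) + y.2.1) * (E * E) = ((1 + (y.1 : ℝ) + y.2.1) * E) * E := by ring
    _ ≤ ((1 + (y.1 : ℝ)) * (1 + 2 / θ)) * E := by gcongr
    _ = _ := by ring

/-! ### Transforms of the chain -/

/-- Laplace transform. -/
def lap (μ : Measure ℝ) (α : ℝ) : ℝ := ∫ x, Real.exp (-(α * x)) ∂μ

/-- Transform of the discounted occupation measure. -/
def occB (lam : ℝ) (G μ : Measure ℝ) (θ α : ℝ) : ℝ :=
  ∫ y, Real.exp (-(θ * y.2.1)) * Real.exp (-(α * y.2.2)) ∂(newOcc lam G μ)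

/-- Transform of the discounted occupation measure, weighted by the centred index. -/
def occC (lam : ℝ) (G μ : Measure ℝ) (θ α : ℝ) : ℝ :=
  ∫ y, (y.1 - lam * y.2.1) * (Real.exp (-(θ * y.2.1)) * Real.exp (-(α * y.2.2)))
    ∂(newOcc lam G μ)

/-- Transform of one transition. -/
def stepK (lam θ α Y : ℝ) : ℝ :=
  ∫ a, Real.exp (-(θ * a)) * Real.exp (-(α * max (Y - a) 0)) ∂(expMeasure lam)

/-- Transform of one transition, weighted by the interarrival time. -/
def stepJ (lam θ α Y : ℝ) : ℝ :=
  ∫ a, a * (Real.exp (-(θ * a)) * Real.exp (-(α * max (Y - a) 0))) ∂(expMeasure lam)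

lemma exp_neg_mul_le_one {a x : ℝ} (ha : 0 ≤ a) (hx : 0 ≤ x) : Real.exp (-(a * x)) ≤ 1 := by
  rw [Real.exp_le_one_iff]
  have := mul_nonneg ha hx
  linarith

lemma stepK_integrable (hlam : 0 < lam) {θ α : ℝ} (hθ : 0 ≤ θ) (hα : 0 ≤ α) (Y : ℝ) :
    Integrable (fun a => Real.exp (-(θ * a)) * Real.exp (-(α * max (Y - a) 0)))
      (expMeasure lam) := by
  have := isProbabilityMeasure_expMeasure hlam
  refine Integrable.of_bound (by fun_prop) 1 ?_
  filter_upwards [ae_expMeasure_pos lam] with a ha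
  rw [Real.norm_eq_abs, abs_of_nonneg (by positivity)]
  exact mul_le_one₀ (exp_neg_mul_le_one hθ ha.le) (Real.exp_nonneg _)
    (exp_neg_mul_le_one hα (le_max_right _ _))

lemma stepJ_integrable (hlam : 0 < lam) {θ α : ℝ} (hθ : 0 ≤ θ) (hα : 0 ≤ α) (Y : ℝ) :
    Integrable (fun a => a * (Real.exp (-(θ * a)) * Real.exp (-(α * max (Y - a) 0))))
      (expMeasure lam) := by
  have h1 := integrable_pow_expMeasure hlam 1
  simp only [pow_one] at h1
  refine h1.mono' (by fun_prop) ?_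
  filter_upwards [ae_expMeasure_pos lam] with a ha
  rw [Real.norm_eq_abs, abs_of_nonneg (by positivity)]
  exact mul_le_of_le_one_right ha.le (mul_le_one₀ (exp_neg_mul_le_one hθ ha.le)
    (Real.exp_nonneg _) (exp_neg_mul_le_one hα (le_max_right _ _)))

/-- Integrals of an exponential law split at a level. -/
lemma integral_expMeasure_split (hlam : 0 < lam) {Y : ℝ} (hY : 0 ≤ Y) {f : ℝ → ℝ}
    (hf : Integrable f (expMeasure lam)) :
    ∫ a, f a ∂(expMeasure lam) = (∫ a in (0 : ℝ)..Y, lam * Real.exp (-(lam * a)) * f a) +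
      ∫ a in Set.Ioi Y, lam * Real.exp (-(lam * a)) * f a := by
  have hi : IntegrableOn (fun x => lam * Real.exp (-(lam * x)) * f x) (Set.Ioi 0) := by
    have := ((integrable_expMeasure_iff hlam f).1 hf).const_mul lam
    simp_rw [← mul_assoc] at this
    exact this
  rw [integral_expMeasure hlam, intervalIntegral.integral_of_le hY, ← Set.Ioc_union_Ioi_eq_Ioi hY,
    setIntegral_union (Set.Ioc_disjoint_Ioi le_rfl) measurableSet_Ioi
      (hi.mono_set Set.Ioc_subset_Ioi_self) (hi.mono_set (Set.Ioi_subset_Ioi hY))]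

lemma integral_exp_tail {b : ℝ} (hb : 0 < b) (Y : ℝ) :
    ∫ a in Set.Ioi Y, Real.exp (-(b * a)) = Real.exp (-(b * Y)) / b := by
  have h := integral_exp_mul_Ioi (a := -b) (by linarith) Y
  simp only [neg_mul] at h
  rw [h, neg_div_neg_eq]

lemma integral_id_mul_exp_tail {b : ℝ} (hb : 0 < b) {Y : ℝ} (hY : 0 ≤ Y) :
    ∫ a in Set.Ioi Y, a * Real.exp (-(b * a)) = Real.exp (-(b * Y)) * (Y / b + 1 / b ^ 2) := by
  have hd : ∀ x : ℝ, HasDerivAt (fun x => -(x / b + 1 / b ^ 2) * Real.exp (-(b * x)))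
      (x * Real.exp (-(b * x))) x := fun x => by
    have h2 : HasDerivAt (fun x => Real.exp (-(b * x))) (Real.exp (-(b * x)) * -(b * 1)) x :=
      (((hasDerivAt_id x).const_mul b).neg).exp
    have h3 : HasDerivAt (fun x => -(x / b + 1 / b ^ 2)) (-(1 / b)) x :=
      (((hasDerivAt_id x).div_const b).add_const (1 / b ^ 2)).neg
    refine (h3.mul h2).congr_deriv ?_
    field_simp
    ring
  have ht : Tendsto (fun x => -(x / b + 1 / b ^ 2) * Real.exp (-(b * x))) atTop (𝓝 0) := by
    have hbx : Tendsto (fun x : ℝ => b * x) atTop atTop := tendsto_id.const_mul_atTop hb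
    have t1 := (Real.tendsto_pow_mul_exp_neg_atTop_nhds_zero 1).comp hbx
    have t0 := (Real.tendsto_pow_mul_exp_neg_atTop_nhds_zero 0).comp hbx
    have := ((t1.add t0).const_mul (-(1 / b ^ 2)))
    simp only [add_zero, mul_zero] at this
    refine this.congr fun x => ?_
    simp only [Function.comp, pow_one, pow_zero]
    field_simp
  have hi : IntegrableOn (fun a => a * Real.exp (-(b * a))) (Set.Ioi Y) := by
    have := (integrable_expMeasure_iff hb _).1 (integrable_pow_expMeasure hb 1)
    refine (this.mono_set (Set.Ioi_subset_Ioi hY)).congr_fun (fun x _ => ?_) measurableSet_Ioi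
    simp only [pow_one]; ring
  rw [integral_Ioi_of_hasDerivAt_of_tendsto' (fun x _ => hd x) hi ht]
  ring

/-- The factor `γ` stays on the left so that the degenerate case `γ = 0`, that is `α = lam + θ`,
needs no separate treatment. -/
lemma integral_exp_head {γ κ : ℝ} {Y : ℝ} :
    γ * ∫ a in (0 : ℝ)..Y, Real.exp (-(γ * a) + κ) = Real.exp κ - Real.exp (-(γ * Y) + κ) := by
  have hd : ∀ x : ℝ, HasDerivAt (fun x => -Real.exp (-(γ * x) + κ))
      (γ * Real.exp (-(γ * x) + κ)) x := fun x => by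
    have h2 : HasDerivAt (fun x => Real.exp (-(γ * x) + κ))
      (Real.exp (-(γ * x) + κ) * -(γ * 1)) x :=
      ((((hasDerivAt_id x).const_mul γ).neg).add_const κ).exp
    exact h2.neg.congr_deriv (by ring)
  rw [← intervalIntegral.integral_const_mul, intervalIntegral.integral_eq_sub_of_hasDerivAt
    (fun x _ => hd x) (Continuous.intervalIntegrable (by fun_prop) _ _)]
  simp
  ring

lemma integral_id_mul_exp_head {γ κ : ℝ} {Y : ℝ} :
    γ * (∫ a in (0 : ℝ)..Y, a * Real.exp (-(γ * a) + κ)) =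
      (∫ a in (0 : ℝ)..Y, Real.exp (-(γ * a) + κ)) - Y * Real.exp (-(γ * Y) + κ) := by
  have hd : ∀ x : ℝ, HasDerivAt (fun x => -(x * Real.exp (-(γ * x) + κ)))
      (γ * (x * Real.exp (-(γ * x) + κ)) - Real.exp (-(γ * x) + κ)) x := fun x => by
    have h2 : HasDerivAt (fun x => Real.exp (-(γ * x) + κ))
      (Real.exp (-(γ * x) + κ) * -(γ * 1)) x :=
      ((((hasDerivAt_id x).const_mul γ).neg).add_const κ).exp
    refine ((hasDerivAt_id x).mul h2).neg.congr_deriv ?_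
    simp only [id]
    ring
  have h := intervalIntegral.integral_eq_sub_of_hasDerivAt (a := 0) (b := Y)
    (fun x _ => hd x) (Continuous.intervalIntegrable (by fun_prop) _ _)
  rw [intervalIntegral.integral_sub (Continuous.intervalIntegrable (by fun_prop) _ _)
    (Continuous.intervalIntegrable (by fun_prop) _ _), intervalIntegral.integral_const_mul] at h
  simp only [zero_mul, neg_zero, sub_zero] at h
  linarith

section step
variable (hlam : 0 < lam) {θ α Y : ℝ} (hθ : 0 ≤ θ) (hα : 0 ≤ α) (hY : 0 ≤ Y)
include hlam hθ hα hY

lemma stepK_split : stepK lam θ α Y =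
    lam * (∫ a in (0 : ℝ)..Y, Real.exp (-((lam + θ - α) * a) + -(α * Y))) +
      lam / (lam + θ) * Real.exp (-((lam + θ) * Y)) := by
  rw [stepK, integral_expMeasure_split hlam hY (stepK_integrable hlam hθ hα Y)]
  congr 1
  · rw [← intervalIntegral.integral_const_mul]
    refine intervalIntegral.integral_congr fun a ha => ?_
    rw [Set.uIcc_of_le hY] at ha
    rw [max_eq_left (by linarith [ha.2]), mul_assoc, ← Real.exp_add, ← Real.exp_add]
    congr 2; ring
  · rw [setIntegral_congr_fun (g := fun a => lam * Real.exp (-((lam + θ) * a))) measurableSet_Ioi,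
      integral_const_mul, integral_exp_tail (by linarith)]
    · ring
    · intro a ha
      simp only
      rw [max_eq_right (by linarith [Set.mem_Ioi.1 ha]), mul_zero, neg_zero, Real.exp_zero, mul_one,
        mul_assoc, ← Real.exp_add]
      congr 2; ring

lemma stepJ_split : stepJ lam θ α Y =
    lam * (∫ a in (0 : ℝ)..Y, a * Real.exp (-((lam + θ - α) * a) + -(α * Y))) +
      lam * (Real.exp (-((lam + θ) * Y)) * (Y / (lam + θ) + 1 / (lam + θ) ^ 2)) := by
  rw [stepJ, integral_expMeasure_split hlam hY (stepJ_integrable hlam hθ hα Y)]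
  congr 1
  · rw [← intervalIntegral.integral_const_mul]
    refine intervalIntegral.integral_congr fun a ha => ?_
    rw [Set.uIcc_of_le hY] at ha
    rw [max_eq_left (by linarith [ha.2]), mul_assoc, mul_left_comm (Real.exp _) a, ← Real.exp_add,
      ← Real.exp_add]
    congr 3; ring
  · rw [setIntegral_congr_fun (g := fun a => lam * (a * Real.exp (-((lam + θ) * a))))
      measurableSet_Ioi, integral_const_mul, integral_id_mul_exp_tail (by linarith) hY]
    intro a ha
    simp only
    rw [max_eq_right (by linarith [Set.mem_Ioi.1 ha]), mul_zero, neg_zero, Real.exp_zero, mul_one,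
      mul_assoc, mul_left_comm (Real.exp _) a, ← Real.exp_add]
    congr 3; ring

/-- Below `Y` the integrand is a pure exponential, beyond `Y` the workload stays at zero. The second
exponential on the right does not involve `α`; integrated over the chain it leaves a single unknown
constant. -/
lemma stepK_eq : (lam + θ - α) * stepK lam θ α Y = lam * Real.exp (-(α * Y)) -
    α * (lam / (lam + θ) * Real.exp (-((lam + θ) * Y))) := by
  have h := integral_exp_head (γ := lam + θ - α) (κ := -(α * Y)) (Y := Y)
  rw [show -((lam + θ - α) * Y) + -(α * Y) = -((lam + θ) * Y) by ring] at h
  rw [stepK_split hlam hθ hα hY, mul_add, mul_left_comm, h]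
  have : lam + θ ≠ 0 := by positivity
  field_simp
  ring

lemma stepJ_eq : (lam + θ - α) * stepJ lam θ α Y = stepK lam θ α Y -
    α * (lam * (Real.exp (-((lam + θ) * Y)) * (Y / (lam + θ) + 1 / (lam + θ) ^ 2))) := by
  have h := integral_id_mul_exp_head (γ := lam + θ - α) (κ := -(α * Y)) (Y := Y)
  rw [show -((lam + θ - α) * Y) + -(α * Y) = -((lam + θ) * Y) by ring] at h
  rw [stepK_split hlam hθ hα hY, stepJ_split hlam hθ hα hY, mul_add, mul_left_comm, h]
  have : lam + θ ≠ 0 := by positivity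
  field_simp
  ring

end step

lemma stepK_nonneg (lam θ α Y : ℝ) : 0 ≤ stepK lam θ α Y := integral_nonneg fun a => by positivity

lemma stepK_le_one (hlam : 0 < lam) {θ α : ℝ} (hθ : 0 ≤ θ) (hα : 0 ≤ α) (Y : ℝ) :
    stepK lam θ α Y ≤ 1 := by
  have := isProbabilityMeasure_expMeasure hlam
  refine (integral_mono_ae (stepK_integrable hlam hθ hα Y) (integrable_const 1) ?_).trans
    (by simp)
  filter_upwards [ae_expMeasure_pos lam] with a ha
  exact mul_le_one₀ (exp_neg_mul_le_one hθ ha.le) (Real.exp_nonneg _)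
    (exp_neg_mul_le_one hα (le_max_right _ _))

lemma stepK_bound (hlam : 0 < lam) {θ α : ℝ} (hθ : 0 ≤ θ) (hα : 0 ≤ α) (Y : ℝ) :
    |stepK lam θ α Y| ≤ 1 := by
  rw [abs_of_nonneg (stepK_nonneg _ _ _ _)]
  exact stepK_le_one hlam hθ hα Y

lemma exp_bound {α : ℝ} (hα : 0 ≤ α) (Y : ℝ) (hY : 0 ≤ Y) : |Real.exp (-(α * Y))| ≤ 1 := by
  rw [abs_of_pos (Real.exp_pos _)]
  exact exp_neg_mul_le_one hα hY

@[fun_prop]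
lemma measurable_stepK (hlam : 0 < lam) (θ α : ℝ) : Measurable (stepK lam θ α) := by
  have := isProbabilityMeasure_expMeasure hlam
  refine StronglyMeasurable.measurable ?_
  exact StronglyMeasurable.integral_prod_right (f := fun Y a : ℝ =>
    Real.exp (-(θ * a)) * Real.exp (-(α * max (Y - a) 0)))
    (Measurable.stronglyMeasurable (by fun_prop))

@[fun_prop]
lemma measurable_index_cast : Measurable fun y : ℕ × ℝ × ℝ => (y.1 : ℝ) :=
  (measurable_from_nat (f := fun n : ℕ => (n : ℝ))).comp measurable_fst

lemma integral_occ_eq (hlam : 0 < lam) [IsProbabilityMeasure G] (μ : Measure ℝ)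
    [IsProbabilityMeasure μ] {H : ℕ × ℝ × ℝ → ℝ} (hH : Integrable H (occ lam G μ)) :
    ∫ y, H y ∂(occ lam G μ) = (∫ w, H (0, 0, w) ∂μ) + ∫ y, H y ∂(newOcc lam G μ) := by
  have h := hH
  rw [occ_eq_add hlam] at h ⊢
  have h1 := (integrable_add_measure.1 h).1
  rw [integral_add_measure h1 (integrable_add_measure.1 h).2,
    integral_map (by fun_prop) h1.aestronglyMeasurable]

lemma integral_newOcc_step (hlam : 0 < lam) [IsProbabilityMeasure G] (μ : Measure ℝ)
    [IsProbabilityMeasure μ] {H : ℕ × ℝ × ℝ → ℝ} (hH : Integrable H (newOcc lam G μ)) :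
    ∫ y, H y ∂(newOcc lam G μ) =
      ∫ y, ∫ a, ∫ s, H (chainStep (y, a, s)) ∂G ∂(expMeasure lam) ∂(occ lam G μ) := by
  have : Fact (0 < lam) := ⟨hlam⟩
  have := isProbabilityMeasure_expMeasure hlam
  rw [newOcc_eq_map hlam] at hH ⊢
  have hi := (integrable_map_measure hH.aestronglyMeasurable
    measurable_chainStep.aemeasurable).1 hH
  have hi' : Integrable (fun q => H (chainStep q))
      ((occ lam G μ).prod ((expMeasure lam).prod G)) := hi
  rw [integral_map measurable_chainStep.aemeasurable hH.aestronglyMeasurable, integral_prod _ hi']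
  refine integral_congr_ae ?_
  filter_upwards [hi'.prod_right_ae] with y hy
  rw [integral_prod _ hy]

section transforms
variable (hlam : 0 < lam) [IsProbabilityMeasure G] (hG : ∀ᵐ x ∂G, 0 ≤ x)
    (μ : Measure ℝ) [IsProbabilityMeasure μ] (hμ : ∀ᵐ w ∂μ, 0 ≤ w) {θ : ℝ} (hθ : 0 < θ)
include hlam hG hμ hθ

lemma integrable_occ_of_bound {H : ℕ × ℝ × ℝ → ℝ} (hH : Measurable H) (c : ℝ)
    (hb : ∀ y : ℕ × ℝ × ℝ, 0 ≤ y.2.1 → 0 ≤ y.2.2 →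
      |H y| ≤ c * ((1 + y.1 + y.2.1) * Real.exp (-(θ * y.2.1)))) :
    Integrable H (occ lam G μ) := by
  refine ((integrable_occ hlam hG μ hμ hθ).const_mul c).mono' hH.aestronglyMeasurable ?_
  filter_upwards [ae_occ hlam hG μ hμ] with y hy
  exact hb y hy.1 hy.2

/-- Weights of linear growth in index and epoch, times a bounded function of the sojourn time. -/
lemma integrable_occ_weight (b₀ b₁ b₂ c : ℝ) {φ : ℝ → ℝ} (hφ : Measurable φ)
    (hb : ∀ Y, 0 ≤ Y → |φ Y| ≤ c) :
    Integrable (fun y : ℕ × ℝ × ℝ =>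
      (b₀ + b₁ * y.1 + b₂ * y.2.1) * (Real.exp (-(θ * y.2.1)) * φ y.2.2)) (occ lam G μ) := by
  refine integrable_occ_of_bound hlam hG μ hμ hθ (by fun_prop) ((|b₀| + |b₁| + |b₂|) * c)
    fun y hT hY => ?_
  have hc : 0 ≤ c := (abs_nonneg _).trans (hb _ hY)
  have hn : (0 : ℝ) ≤ y.1 := Nat.cast_nonneg _
  have h1 : |b₀ + b₁ * y.1 + b₂ * y.2.1| ≤ (|b₀| + |b₁| + |b₂|) * (1 + y.1 + y.2.1) := by
    refine (abs_add_three _ _ _).trans ?_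
    rw [abs_mul, abs_mul, abs_of_nonneg hn, abs_of_nonneg hT]
    have := abs_nonneg b₀; have := abs_nonneg b₁; have := abs_nonneg b₂
    have := mul_nonneg (abs_nonneg b₀) hn; have := mul_nonneg (abs_nonneg b₀) hT
    have := mul_nonneg (abs_nonneg b₁) hT; have := mul_nonneg (abs_nonneg b₂) hn
    nlinarith
  rw [abs_mul, abs_mul, abs_of_pos (Real.exp_pos _)]
  calc _ ≤ ((|b₀| + |b₁| + |b₂|) * (1 + y.1 + y.2.1)) * (Real.exp (-(θ * y.2.1)) * c) := by
        gcongr; exact hb _ hY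
    _ = _ := by ring

lemma integrable_occB {α : ℝ} (hα : 0 ≤ α) : Integrable (fun y : ℕ × ℝ × ℝ =>
    Real.exp (-(θ * y.2.1)) * Real.exp (-(α * y.2.2))) (occ lam G μ) := by
  have := integrable_occ_weight hlam hG μ hμ hθ 1 0 0 1 (φ := fun Y => Real.exp (-(α * Y)))
    (by fun_prop) fun Y hY => exp_bound hα Y hY
  simpa using this

lemma integrable_occC {α : ℝ} (hα : 0 ≤ α) : Integrable (fun y : ℕ × ℝ × ℝ =>
    (y.1 - lam * y.2.1) * (Real.exp (-(θ * y.2.1)) * Real.exp (-(α * y.2.2))))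
      (occ lam G μ) := by
  have := integrable_occ_weight hlam hG μ hμ hθ 0 1 (-lam) 1 (φ := fun Y => Real.exp (-(α * Y)))
    (by fun_prop) fun Y hY => exp_bound hα Y hY
  refine this.congr (ae_of_all _ fun y => ?_)
  simp only; ring

/-- Discounted transform of the chain after an exponential lapse of time. -/
def occK (lam : ℝ) (G μ : Measure ℝ) (θ α : ℝ) : ℝ :=
  ∫ y, Real.exp (-(θ * y.2.1)) * stepK lam θ α y.2.2 ∂(occ lam G μ)

/-- The service time added at the end of a transition is independent of the rest and contributes the
factor `lap G α`. -/
lemma occB_eq {α : ℝ} (hα : 0 ≤ α) : occB lam G μ θ α = lap G α * occK lam G μ θ α := by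
  rw [occB, integral_newOcc_step hlam μ
    ((integrable_occB hlam hG μ hμ hθ hα).mono_measure (newOcc_le_occ hlam μ)), occK,
    ← integral_const_mul]
  refine integral_congr_ae (ae_of_all _ fun y => ?_)
  simp only [chainStep]
  have : ∀ a s : ℝ, Real.exp (-(θ * (y.2.1 + a))) * Real.exp (-(α * (max (y.2.2 - a) 0 + s))) =
      Real.exp (-(θ * y.2.1)) * (Real.exp (-(θ * a)) * Real.exp (-(α * max (y.2.2 - a) 0))) *
        Real.exp (-(α * s)) := fun a s => by
    simp only [← Real.exp_add]; congr 1; ring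
  simp_rw [this]
  simp only [integral_const_mul, integral_mul_const]
  rw [lap, stepK]; ring

lemma integrable_occK {α : ℝ} (hα : 0 ≤ α) : Integrable (fun y : ℕ × ℝ × ℝ =>
    Real.exp (-(θ * y.2.1)) * stepK lam θ α y.2.2) (occ lam G μ) := by
  have := integrable_occ_weight hlam hG μ hμ hθ 1 0 0 1 (φ := stepK lam θ α)
    (measurable_stepK hlam θ α) fun Y _ => stepK_bound hlam hθ.le hα Y
  simpa using this

/-- First transform identity. -/
theorem occK_identity : ∃ p : ℝ, ∀ α, 0 ≤ α →
    (θ - (α - lam * (1 - lap G α))) * occK lam G μ θ α = lam * (lap μ α - α * p) := by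
  -- The constant is the boundary term of `stepK_eq` integrated over all visits. Its value is
  -- unknown at this point, but it is the same for all `α`.
  refine ⟨(∫ y, Real.exp (-(θ * y.2.1)) * Real.exp (-((lam + θ) * y.2.2)) ∂(occ lam G μ)) /
    (lam + θ), fun α hα => ?_⟩
  have hβ : 0 ≤ lam + θ := by positivity
  have h1 : (lam + θ - α) * occK lam G μ θ α =
      lam * (∫ y, Real.exp (-(θ * y.2.1)) * Real.exp (-(α * y.2.2)) ∂(occ lam G μ)) -
      α * (lam / (lam + θ)) * ∫ y, Real.exp (-(θ * y.2.1)) * Real.exp (-((lam + θ) * y.2.2))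
        ∂(occ lam G μ) := by
    rw [occK, ← integral_const_mul, ← integral_const_mul, ← integral_const_mul, ← integral_sub
      ((integrable_occB hlam hG μ hμ hθ hα).const_mul _)
      ((integrable_occB hlam hG μ hμ hθ hβ).const_mul _)]
    refine integral_congr_ae ?_
    filter_upwards [ae_occ hlam hG μ hμ] with y hy
    have := stepK_eq hlam hθ.le hα hy.2
    linear_combination Real.exp (-(θ * y.2.1)) * this
  rw [integral_occ_eq hlam μ (integrable_occB hlam hG μ hμ hθ hα)] at h1
  have h2 := occB_eq hlam hG μ hμ hθ hα
  rw [occB] at h2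
  rw [h2] at h1
  simp only [mul_zero, neg_zero, Real.exp_zero, one_mul] at h1
  rw [lap] at *
  rw [lap]
  linear_combination h1

/-- Second transform identity. -/
theorem occC_identity : ∃ K : ℝ, ∀ α, 0 ≤ α →
    (θ - (α - lam * (1 - lap G α))) * occC lam G μ θ α =
      lam * lap G α * (lap μ α + occB lam G μ θ α) - lam * occB lam G μ θ α -
        α * lap G α * K := by
  -- These are the boundary terms of `stepK_eq` and `stepJ_eq`. Only their boundedness in the
  -- sojourn time matters: it makes the constant `K`, free of `α`, an integral of integrable
  -- functions.
  set κ₀ : ℝ → ℝ := fun Y => lam / (lam + θ) * Real.exp (-((lam + θ) * Y)) with hκ₀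
  set κ₁ : ℝ → ℝ := fun Y => lam * (Real.exp (-((lam + θ) * Y)) *
    (Y / (lam + θ) + 1 / (lam + θ) ^ 2)) with hκ₁
  have hβ : 0 < lam + θ := by positivity
  have hb₀ : ∀ Y, 0 ≤ Y → |κ₀ Y| ≤ lam / (lam + θ) := fun Y hY => by
    rw [hκ₀, abs_of_nonneg (by positivity)]
    exact mul_le_of_le_one_right (by positivity) (exp_neg_mul_le_one hβ.le hY)
  have hb₁ : ∀ Y, 0 ≤ Y → |κ₁ Y| ≤ lam * (1 / (lam + θ) ^ 2 + 1 / (lam + θ) ^ 2) := fun Y hY => by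
    rw [hκ₁, abs_of_nonneg (by positivity)]
    have h1 : Y / (lam + θ) * Real.exp (-((lam + θ) * Y)) ≤ 1 / (lam + θ) ^ 2 := by
      have := Real.add_one_le_exp ((lam + θ) * Y)
      rw [Real.exp_neg, ← div_eq_mul_inv, div_div, div_le_div_iff₀ (by positivity) (by positivity)]
      nlinarith
    have h2 : 1 / (lam + θ) ^ 2 * Real.exp (-((lam + θ) * Y)) ≤ 1 / (lam + θ) ^ 2 :=
      mul_le_of_le_one_right (by positivity) (exp_neg_mul_le_one hβ.le hY)
    refine mul_le_mul_of_nonneg_left ?_ hlam.le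
    linarith
  have i1 := integrable_occ_weight hlam hG μ hμ hθ 1 1 (-lam) _ (φ := κ₀) (by fun_prop) hb₀
  have i2 := integrable_occ_weight hlam hG μ hμ hθ (-lam) 0 0 _ (φ := κ₁) (by fun_prop) hb₁
  obtain ⟨K, hK⟩ : ∃ K, K = ∫ y, ((1 + 1 * (y.1 : ℝ) + -lam * y.2.1) *
    (Real.exp (-(θ * y.2.1)) * κ₀ y.2.2) + (-lam + 0 * (y.1 : ℝ) + 0 * y.2.1) *
      (Real.exp (-(θ * y.2.1)) * κ₁ y.2.2)) ∂(occ lam G μ) := ⟨_, rfl⟩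
  refine ⟨K, fun α hα => ?_⟩
  -- One transition with gap `a` changes the centred index by `1 - lam * a`; the two summands give
  -- `stepK` and `stepJ`.
  have hstep : occC lam G μ θ α = lap G α * ∫ y, ((y.1 + 1 - lam * y.2.1) *
      (Real.exp (-(θ * y.2.1)) * stepK lam θ α y.2.2) -
        lam * (Real.exp (-(θ * y.2.1)) * stepJ lam θ α y.2.2)) ∂(occ lam G μ) := by
    rw [occC, integral_newOcc_step hlam μ
      ((integrable_occC hlam hG μ hμ hθ hα).mono_measure (newOcc_le_occ hlam μ)),
      ← integral_const_mul]
    refine integral_congr_ae (ae_of_all _ fun y => ?_)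
    simp only [chainStep]
    have : ∀ a s : ℝ, (((y.1 + 1 : ℕ) : ℝ) - lam * (y.2.1 + a)) * (Real.exp (-(θ * (y.2.1 + a))) *
        Real.exp (-(α * (max (y.2.2 - a) 0 + s)))) =
        Real.exp (-(θ * y.2.1)) * ((y.1 + 1 - lam * y.2.1) * (Real.exp (-(θ * a)) *
          Real.exp (-(α * max (y.2.2 - a) 0))) - lam * (a * (Real.exp (-(θ * a)) *
          Real.exp (-(α * max (y.2.2 - a) 0))))) * Real.exp (-(α * s)) := fun a s => by
      have e : Real.exp (-(θ * (y.2.1 + a))) * Real.exp (-(α * (max (y.2.2 - a) 0 + s))) =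
          Real.exp (-(θ * y.2.1)) * (Real.exp (-(θ * a)) * Real.exp (-(α * max (y.2.2 - a) 0))) *
            Real.exp (-(α * s)) := by
        simp only [← Real.exp_add]; congr 1; ring
      rw [e]; push_cast; ring
    simp_rw [this]
    simp only [integral_const_mul, integral_mul_const]
    rw [integral_sub ((stepK_integrable hlam hθ.le hα _).const_mul _)
      ((stepJ_integrable hlam hθ.le hα _).const_mul _), integral_const_mul, integral_const_mul,
      lap, stepK, stepJ]
    ring
  have hI : (lam + θ - α) * ∫ y, ((y.1 + 1 - lam * y.2.1) *
      (Real.exp (-(θ * y.2.1)) * stepK lam θ α y.2.2) -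
        lam * (Real.exp (-(θ * y.2.1)) * stepJ lam θ α y.2.2)) ∂(occ lam G μ) =
      lam * (∫ y, (y.1 - lam * y.2.1) * (Real.exp (-(θ * y.2.1)) * Real.exp (-(α * y.2.2)))
        ∂(occ lam G μ)) + lam * (∫ y, Real.exp (-(θ * y.2.1)) * Real.exp (-(α * y.2.2))
        ∂(occ lam G μ)) - lam * occK lam G μ θ α -
      α * K := by
    have j1 := (integrable_occC hlam hG μ hμ hθ hα).const_mul lam
    have j2 := (integrable_occB hlam hG μ hμ hθ hα).const_mul lam
    have j3 := (integrable_occK hlam hG μ hμ hθ hα).const_mul lam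
    have j4 : Integrable (fun y : ℕ × ℝ × ℝ => α *
        ((1 + 1 * (y.1 : ℝ) + -lam * y.2.1) * (Real.exp (-(θ * y.2.1)) * κ₀ y.2.2) +
        (-lam + 0 * (y.1 : ℝ) + 0 * y.2.1) * (Real.exp (-(θ * y.2.1)) * κ₁ y.2.2)))
        (occ lam G μ) := (i1.add i2).const_mul α
    have j12 : Integrable (fun y : ℕ × ℝ × ℝ => lam * ((y.1 - lam * y.2.1) *
        (Real.exp (-(θ * y.2.1)) * Real.exp (-(α * y.2.2)))) + lam * (Real.exp (-(θ * y.2.1)) *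
          Real.exp (-(α * y.2.2)))) (occ lam G μ) := j1.add j2
    have e := integral_sub (j12.sub j3) j4
    simp only [Pi.sub_apply] at e
    rw [hK, occK, ← integral_const_mul, ← integral_const_mul, ← integral_const_mul,
      ← integral_const_mul, ← integral_const_mul, ← integral_add j1 j2,
      ← integral_sub j12 j3, ← e]
    refine integral_congr_ae ?_
    filter_upwards [ae_occ hlam hG μ hμ] with y hy
    have h1 := stepK_eq hlam hθ.le hα hy.2
    have h2 := stepJ_eq hlam hθ.le hα hy.2
    simp only [hκ₀, hκ₁]
    linear_combination (y.1 + 1 - lam * y.2.1) * Real.exp (-(θ * y.2.1)) * h1 -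
      lam * Real.exp (-(θ * y.2.1)) * h2
  rw [integral_occ_eq hlam μ (integrable_occC hlam hG μ hμ hθ hα),
    integral_occ_eq hlam μ (integrable_occB hlam hG μ hμ hθ hα)] at hI
  simp only [mul_zero, neg_zero, Real.exp_zero, one_mul, Nat.cast_zero, sub_zero, zero_mul,
    integral_zero, zero_add] at hI
  have hB := occB_eq hlam hG μ hμ hθ hα
  have hB' : (∫ y, Real.exp (-(θ * y.2.1)) * Real.exp (-(α * y.2.2)) ∂(newOcc lam G μ)) =
    occB lam G μ θ α := rfl
  have hC' : (∫ y, (y.1 - lam * y.2.1) * (Real.exp (-(θ * y.2.1)) * Real.exp (-(α * y.2.2)))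
    ∂(newOcc lam G μ)) = occC lam G μ θ α := rfl
  have hf' : (∫ w, Real.exp (-(α * w)) ∂μ) = lap μ α := rfl
  rw [hB', hC', hf'] at hI
  linear_combination (lam + θ - α) * hstep + lap G α * hI + lam * hB

end transforms

/-! ### Abel means of the number of new customers -/

lemma integral_eq_of_lintegral_ofReal {β γ : Type*} [MeasurableSpace β] [MeasurableSpace γ]
    {M : Measure β} {N : Measure γ} {f : β → ℝ} {h : γ → ℝ} (hf : Measurable f)
    (hf0 : ∀ᵐ x ∂M, 0 ≤ f x) (hh : Integrable h N) (hh0 : ∀ᵐ y ∂N, 0 ≤ h y)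
    (heq : ∫⁻ x, ENNReal.ofReal (f x) ∂M = ∫⁻ y, ENNReal.ofReal (h y) ∂N) :
    Integrable f M ∧ ∫ x, f x ∂M = ∫ y, h y ∂N := by
  refine ⟨⟨hf.aestronglyMeasurable, ?_⟩, ?_⟩
  · rw [hasFiniteIntegral_iff_ofReal hf0, heq]
    exact (hasFiniteIntegral_iff_ofReal hh0).1 hh.2
  · rw [integral_eq_lintegral_of_nonneg_ae hf0 hf.aestronglyMeasurable, heq,
      integral_eq_lintegral_of_nonneg_ae hh0 hh.aestronglyMeasurable]

/-- Workload, interarrival times, service times and an independent exponential time. -/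
def abelSeq (lam : ℝ) (G μ : Measure ℝ) (θ : ℝ) : Measure ((ℝ × (ℕ → ℝ) × (ℕ → ℝ)) × ℝ) :=
  (μ.prod (seqLaw lam G)).prod (expMeasure θ)

lemma ae_seqLaw (hlam : 0 < lam) [IsProbabilityMeasure G] (hG : ∀ᵐ x ∂G, 0 ≤ x) :
    ∀ᵐ p ∂(seqLaw lam G), GoodArr p.1 ∧ ∀ i, 0 ≤ p.2 i := by
  have := isProbabilityMeasure_expMeasure hlam
  filter_upwards [Measure.quasiMeasurePreserving_fst.ae (ae_goodArr hlam),
    Measure.quasiMeasurePreserving_snd.ae (ae_iid G hG)] with p h1 h2 using ⟨h1, h2⟩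

lemma ae_abelSeq (hlam : 0 < lam) [IsProbabilityMeasure G] (hG : ∀ᵐ x ∂G, 0 ≤ x)
    (μ : Measure ℝ) [SFinite μ] {θ : ℝ} (hθ : 0 < θ) :
    ∀ᵐ p ∂(abelSeq lam G μ θ), GoodArr p.1.2.1 ∧ (∀ i, 0 ≤ p.1.2.2 i) ∧ 0 < p.2 := by
  have : Fact (0 < lam) := ⟨hlam⟩
  have := isProbabilityMeasure_expMeasure hθ
  have h1 : ∀ᵐ z ∂(μ.prod (seqLaw lam G)), GoodArr z.2.1 ∧ ∀ i, 0 ≤ z.2.2 i :=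
    Measure.quasiMeasurePreserving_snd.ae (ae_seqLaw hlam hG)
  filter_upwards [Measure.quasiMeasurePreserving_fst.ae h1,
    Measure.quasiMeasurePreserving_snd.ae (ae_expMeasure_pos θ)] with p h1 h2
    using ⟨h1.1, h1.2, h2⟩

section abel
variable (hlam : 0 < lam) [IsProbabilityMeasure G] (hG : ∀ᵐ x ∂G, 0 ≤ x)
    (μ : Measure ℝ) [IsProbabilityMeasure μ] (hμ : ∀ᵐ w ∂μ, 0 ≤ w) {θ : ℝ} (hθ : 0 < θ)
include hlam hG hμ hθ

/-- Real-valued form for weights affine in index, arrival epoch and age. The signs allow the passage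
through integrals of nonnegative functions, which provides integrability along with the value. -/
lemma abel_custSum {b₀ b₁ b₂ b₃ c : ℝ} (h₀ : 0 ≤ b₀) (h₁ : 0 ≤ b₁) (h₂ : 0 ≤ b₂) (h₃ : 0 ≤ b₃)
    (hc : 0 ≤ c) {f : (ℝ × (ℕ → ℝ) × (ℕ → ℝ)) × ℝ → ℝ} (hf : Measurable f)
    (hf0 : ∀ᵐ p ∂(abelSeq lam G μ θ), 0 ≤ f p)
    (heq : ∀ᵐ p ∂(abelSeq lam G μ θ), ENNReal.ofReal (f p) = custSum
      (fun n T u => ENNReal.ofReal (b₀ + b₁ * n + b₂ * T + b₃ * u)) (ENNReal.ofReal c) p.1 p.2) :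
    Integrable (fun y : ℕ × ℝ × ℝ => (b₀ + b₁ * y.1 + b₂ * y.2.1) * (Real.exp (-(θ * y.2.1)) *
        (1 - Real.exp (-(θ * y.2.2)))) + ((b₃ + c * lam) + 0 * y.1 + 0 * y.2.1) *
          (Real.exp (-(θ * y.2.1)) * ((1 - Real.exp (-(θ * y.2.2)) -
            θ * y.2.2 * Real.exp (-(θ * y.2.2))) / θ))) (newOcc lam G μ) ∧
    Integrable f (abelSeq lam G μ θ) ∧ ∫ p, f p ∂(abelSeq lam G μ θ) =
      ∫ y, ((b₀ + b₁ * y.1 + b₂ * y.2.1) * (Real.exp (-(θ * y.2.1)) *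
        (1 - Real.exp (-(θ * y.2.2)))) + ((b₃ + c * lam) + 0 * y.1 + 0 * y.2.1) *
          (Real.exp (-(θ * y.2.1)) * ((1 - Real.exp (-(θ * y.2.2)) -
            θ * y.2.2 * Real.exp (-(θ * y.2.2))) / θ))) ∂(newOcc lam G μ) := by
  have : Fact (0 < lam) := ⟨hlam⟩
  have := isProbabilityMeasure_expMeasure hθ
  have hm0 : ∀ Y, 0 ≤ Y → 0 ≤ 1 - Real.exp (-(θ * Y)) := fun Y hY => by
    linarith [exp_neg_mul_le_one hθ.le hY]
  have hm1 : ∀ Y, 0 ≤ 1 - Real.exp (-(θ * Y)) - θ * Y * Real.exp (-(θ * Y)) := fun Y => by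
    have h1 := Real.add_one_le_exp (θ * Y)
    have h2 : Real.exp (θ * Y) * Real.exp (-(θ * Y)) = 1 := by rw [← Real.exp_add]; simp
    have h3 := Real.exp_pos (-(θ * Y))
    nlinarith
  have i1 := integrable_occ_weight hlam hG μ hμ hθ b₀ b₁ b₂ 1
    (φ := fun Y => 1 - Real.exp (-(θ * Y))) (by fun_prop) fun Y hY => by
      rw [abs_of_nonneg (hm0 Y hY)]; linarith [Real.exp_pos (-(θ * Y))]
  have i2 := integrable_occ_weight hlam hG μ hμ hθ (b₃ + c * lam) 0 0 (1 / θ)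
    (φ := fun Y => (1 - Real.exp (-(θ * Y)) - θ * Y * Real.exp (-(θ * Y))) / θ) (by fun_prop)
    fun Y hY => by
      rw [abs_of_nonneg (div_nonneg (hm1 Y) hθ.le)]
      gcongr
      have := Real.exp_pos (-(θ * Y))
      have : 0 ≤ θ * Y * Real.exp (-(θ * Y)) := by positivity
      linarith
  have hi := (i1.add i2).mono_measure (newOcc_le_occ hlam μ)
  refine ⟨hi, integral_eq_of_lintegral_ofReal hf hf0 hi ?_ ?_⟩
  · filter_upwards [ae_newOcc hlam hG μ] with y hy
    have := hm0 _ hy.2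
    have := div_nonneg (hm1 y.2.2) hθ.le
    have := hy.1
    positivity
  · have hW : Measurable fun q : (ℕ × ℝ) × ℝ =>
        ENNReal.ofReal (b₀ + b₁ * q.1.1 + b₂ * q.1.2 + b₃ * q.2) := by
      have : Measurable fun q : (ℕ × ℝ) × ℝ => (q.1.1 : ℝ) :=
        (measurable_from_nat (f := fun n : ℕ => (n : ℝ))).comp (by fun_prop)
      fun_prop
    rw [lintegral_congr_ae heq]
    have hl := lintegral_abel_custSum (G := G)
      (W := fun n T u => ENNReal.ofReal (b₀ + b₁ * n + b₂ * T + b₃ * u)) (fun n => hW.comp (f := fun q : ℝ × ℝ =>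
      ((n, q.1), q.2)) (by fun_prop)) (ENNReal.ofReal c) hlam μ hW θ
    have hm : AEMeasurable (fun p : (ℝ × (ℕ → ℝ) × (ℕ → ℝ)) × ℝ => custSum
        (fun n T u => ENNReal.ofReal (b₀ + b₁ * n + b₂ * T + b₃ * u)) (ENNReal.ofReal c) p.1 p.2)
        (abelSeq lam G μ θ) := (hf.ennreal_ofReal.aemeasurable).congr heq
    rw [abelSeq, lintegral_prod _ hm, hl]
    refine lintegral_congr_ae ?_
    filter_upwards [ae_newOcc hlam hG μ] with y hy
    have hA : 0 ≤ b₀ + b₁ * y.1 + b₂ * y.2.1 := by have := hy.1; positivity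
    have h1 := lintegral_affine_expMeasure hθ hA (B := b₃ + c * lam) (by positivity) hy.2
    have h2 : ∫⁻ u, (if u < y.2.2 then ENNReal.ofReal (b₀ + b₁ * y.1 + b₂ * y.2.1 + b₃ * u) +
        ENNReal.ofReal c * ENNReal.ofReal (lam * u) else 0) ∂(expMeasure θ) =
        ∫⁻ u, (if u < y.2.2 then ENNReal.ofReal (b₀ + b₁ * y.1 + b₂ * y.2.1 +
          (b₃ + c * lam) * u) else 0) ∂(expMeasure θ) := by
      refine lintegral_congr_ae ?_
      filter_upwards [ae_expMeasure_pos θ] with u hu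
      have h3 : 0 ≤ b₀ + b₁ * y.1 + b₂ * y.2.1 + b₃ * u := by positivity
      rw [← ENNReal.ofReal_mul hc, ← ENNReal.ofReal_add h3 (by positivity)]
      congr 2; ring
    rw [h2, h1, ← ENNReal.ofReal_mul (Real.exp_nonneg _)]
    congr 1
    ring

/-- Number of new customers at the random time. -/
def abelQueue (p : (ℝ × (ℕ → ℝ) × (ℕ → ℝ)) × ℝ) : ℝ := newQueue p.1.1 p.1.2.1 p.1.2.2 p.2

/-- Number of arrivals up to the random time. -/
def abelArrivals (p : (ℝ × (ℕ → ℝ) × (ℕ → ℝ)) × ℝ) : ℝ := arrivals p.1.2.1 p.2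

omit hlam hG hμ hθ in
@[fun_prop]
lemma measurable_abelQueue : Measurable abelQueue :=
  (measurable_from_nat (f := fun n : ℕ => (n : ℝ))).comp measurable_newQueue

omit hlam hG hμ hθ in
@[fun_prop]
lemma measurable_abelArrivals : Measurable abelArrivals :=
  (measurable_from_nat (f := fun n : ℕ => (n : ℝ))).comp
    (measurable_arrivals.comp (f := fun p : (ℝ × (ℕ → ℝ) × (ℕ → ℝ)) × ℝ => (p.1.2.1, p.2))
      (by fun_prop))

/-- Minus the derivative of `occB` at the discount rate. -/
def occD (lam : ℝ) (G μ : Measure ℝ) (θ : ℝ) : ℝ :=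
  ∫ y, Real.exp (-(θ * y.2.1)) * (y.2.2 * Real.exp (-(θ * y.2.2))) ∂(newOcc lam G μ)

omit hlam hG hμ hθ in
lemma mul_exp_neg_le {θ Y : ℝ} (hθ : 0 < θ) : Y * Real.exp (-(θ * Y)) ≤ 1 / θ := by
  have := Real.add_one_le_exp (θ * Y)
  rw [Real.exp_neg, ← div_eq_mul_inv, div_le_div_iff₀ (Real.exp_pos _) hθ]
  nlinarith

lemma integrable_occD : Integrable (fun y : ℕ × ℝ × ℝ =>
    Real.exp (-(θ * y.2.1)) * (y.2.2 * Real.exp (-(θ * y.2.2)))) (newOcc lam G μ) := by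
  have := integrable_occ_weight hlam hG μ hμ hθ 1 0 0 (1 / θ)
    (φ := fun Y => Y * Real.exp (-(θ * Y))) (by fun_prop) fun Y hY => by
      rw [abs_of_nonneg (by positivity)]; exact mul_exp_neg_le hθ
  simpa using this.mono_measure (newOcc_le_occ hlam μ)

lemma integrable_newOccB {α : ℝ} (hα : 0 ≤ α) : Integrable (fun y : ℕ × ℝ × ℝ =>
    Real.exp (-(θ * y.2.1)) * Real.exp (-(α * y.2.2))) (newOcc lam G μ) :=
  (integrable_occB hlam hG μ hμ hθ hα).mono_measure (newOcc_le_occ hlam μ)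

lemma integrable_newOccC {α : ℝ} (hα : 0 ≤ α) : Integrable (fun y : ℕ × ℝ × ℝ =>
    (y.1 - lam * y.2.1) * (Real.exp (-(θ * y.2.1)) * Real.exp (-(α * y.2.2))))
      (newOcc lam G μ) :=
  (integrable_occC hlam hG μ hμ hθ hα).mono_measure (newOcc_le_occ hlam μ)

theorem abel_newQueue : Integrable abelQueue (abelSeq lam G μ θ) ∧
    ∫ p, abelQueue p ∂(abelSeq lam G μ θ) = occB lam G μ θ 0 - occB lam G μ θ θ := by
  have h := abel_custSum hlam hG μ hμ hθ (b₀ := 1) (b₁ := 0) (b₂ := 0) (b₃ := 0) (c := 0)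
    zero_le_one le_rfl le_rfl le_rfl le_rfl measurable_abelQueue
    (ae_of_all _ fun p => Nat.cast_nonneg _) ?_
  · refine ⟨h.2.1, h.2.2.trans ?_⟩
    rw [occB, occB, ← integral_sub (integrable_newOccB hlam hG μ hμ hθ le_rfl)
      (integrable_newOccB hlam hG μ hμ hθ hθ.le)]
    refine integral_congr_ae (ae_of_all _ fun y => ?_)
    simp
    ring
  · filter_upwards [ae_abelSeq hlam hG μ hθ] with p hp
    rw [abelQueue, ENNReal.ofReal_natCast, newQueue_eq_custSum hp.1 hp.2.1]
    simp

theorem abel_newQueue_sq : Integrable (fun p => abelQueue p ^ 2) (abelSeq lam G μ θ) ∧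
    ∫ p, abelQueue p ^ 2 ∂(abelSeq lam G μ θ) = occB lam G μ θ 0 - occB lam G μ θ θ +
      2 * lam / θ * (occB lam G μ θ 0 - occB lam G μ θ θ - θ * occD lam G μ θ) := by
  have h := abel_custSum hlam hG μ hμ hθ (b₀ := 1) (b₁ := 0) (b₂ := 0) (b₃ := 0) (c := 2)
    (f := fun p => abelQueue p ^ 2) zero_le_one le_rfl le_rfl le_rfl zero_le_two (by fun_prop)
    (ae_of_all _ fun p => sq_nonneg _) ?_
  · refine ⟨h.2.1, h.2.2.trans ?_⟩
    have i0 := integrable_newOccB hlam hG μ hμ hθ le_rfl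
    have i1 := integrable_newOccB hlam hG μ hμ hθ hθ.le
    have i2 := integrable_occD hlam hG μ hμ hθ
    have e1 := integral_sub i0 i1
    have e2 := integral_sub (i0.sub i1) (i2.const_mul θ)
    simp only [Pi.sub_apply] at e1 e2
    have e3 := integral_add (i0.sub i1) (((i0.sub i1).sub (i2.const_mul θ)).const_mul
      (2 * lam / θ))
    simp only [Pi.sub_apply] at e3
    rw [integral_const_mul, e2, integral_const_mul, e1] at e3
    rw [occB, occB, occD, ← e3]
    refine integral_congr_ae (ae_of_all _ fun y => ?_)
    simp only [zero_mul, add_zero, zero_add, neg_zero, Real.exp_zero, mul_one]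
    field_simp
  · filter_upwards [ae_abelSeq hlam hG μ hθ] with p hp
    rw [abelQueue, ENNReal.ofReal_pow (Nat.cast_nonneg _), ENNReal.ofReal_natCast,
      newQueue_sq_eq_custSum hp.1 hp.2.1]
    simp

/-- Taking the difference of the representations of A·Q and t·Q cancels the age terms, since later
arrivals come at rate `lam`. What remains is the index of the customer centred by `lam` times its
arrival epoch, hence `occC`. -/
theorem abel_arrivals_newQueue :
    Integrable (fun p => (abelArrivals p - lam * p.2) * abelQueue p) (abelSeq lam G μ θ) ∧
    ∫ p, (abelArrivals p - lam * p.2) * abelQueue p ∂(abelSeq lam G μ θ) =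
      occC lam G μ θ 0 - occC lam G μ θ θ := by
  have h := abel_custSum hlam hG μ hμ hθ (b₀ := 0) (b₁ := 1) (b₂ := 0) (b₃ := 0) (c := 1)
    (f := fun p => abelArrivals p * abelQueue p) le_rfl zero_le_one le_rfl le_rfl zero_le_one
    (by fun_prop) (ae_of_all _ fun p => mul_nonneg (Nat.cast_nonneg _) (Nat.cast_nonneg _)) ?_
  have h' := abel_custSum hlam hG μ hμ hθ (b₀ := 0) (b₁ := 0) (b₂ := 1) (b₃ := 1) (c := 0)
    (f := fun p => p.2 * abelQueue p) le_rfl le_rfl zero_le_one zero_le_one le_rfl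
    (by fun_prop) ?_ ?_
  · have e0 : (fun p : (ℝ × (ℕ → ℝ) × (ℕ → ℝ)) × ℝ => (abelArrivals p - lam * p.2) * abelQueue p) =
        fun p => abelArrivals p * abelQueue p - lam * (p.2 * abelQueue p) := by
      ext p; ring
    rw [e0]
    refine ⟨h.2.1.sub (h'.2.1.const_mul lam), ?_⟩
    have e1 := integral_sub h.1 (h'.1.const_mul lam)
    rw [integral_const_mul] at e1
    rw [integral_sub h.2.1 (h'.2.1.const_mul lam), integral_const_mul, h.2.2, h'.2.2, ← e1,
      occC, occC, ← integral_sub (integrable_newOccC hlam hG μ hμ hθ le_rfl)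
        (integrable_newOccC hlam hG μ hμ hθ hθ.le)]
    refine integral_congr_ae (ae_of_all _ fun y => ?_)
    simp only [zero_mul, add_zero, zero_add, neg_zero, Real.exp_zero, mul_one, one_mul]
    ring
  · filter_upwards [ae_abelSeq hlam hG μ hθ] with p hp
    exact mul_nonneg hp.2.2.le (Nat.cast_nonneg _)
  · filter_upwards [ae_abelSeq hlam hG μ hθ] with p hp
    rw [ENNReal.ofReal_mul hp.2.2.le, abelQueue, ENNReal.ofReal_natCast,
      time_mul_newQueue_eq_custSum hp.1 hp.2.1]
    simp
  · filter_upwards [ae_abelSeq hlam hG μ hθ] with p hp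
    rw [abelQueue, abelArrivals, ENNReal.ofReal_mul (Nat.cast_nonneg _), ENNReal.ofReal_natCast,
      ENNReal.ofReal_natCast, arrivals_mul_newQueue_eq_custSum hp.1 hp.2.1]
    simp

end abel

/-! ### Second-order expansions at `0+` -/

/-- `F x = c₀ + c₁ x + c₂ x² + o(x²)` as `x → 0+`. -/
def HasExp2 (F : ℝ → ℝ) (c₀ c₁ c₂ : ℝ) : Prop :=
  Tendsto (fun x => (F x - c₀ - c₁ * x) / x ^ 2) (𝓝[>] 0) (𝓝 c₂)

lemma tendsto_id_right : Tendsto (fun x : ℝ => x) (𝓝[>] 0) (𝓝 0) :=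
  tendsto_id.mono_left nhdsWithin_le_nhds

lemma eventually_pos_right : ∀ᶠ x : ℝ in 𝓝[>] 0, 0 < x := self_mem_nhdsWithin

namespace HasExp2

variable {F H : ℝ → ℝ} {c₀ c₁ c₂ d₀ d₁ d₂ : ℝ}

lemma of_remainder {r : ℝ → ℝ} (hr : Tendsto r (𝓝[>] 0) (𝓝 c₂))
    (h : ∀ x, 0 < x → F x = c₀ + c₁ * x + x ^ 2 * r x) : HasExp2 F c₀ c₁ c₂ := by
  refine hr.congr' ?_
  filter_upwards [eventually_pos_right] with x hx
  rw [h x hx]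
  field_simp
  ring

lemma congr (hF : HasExp2 F c₀ c₁ c₂) (h : ∀ x, 0 < x → H x = F x) : HasExp2 H c₀ c₁ c₂ := by
  refine Tendsto.congr' ?_ hF
  filter_upwards [eventually_pos_right] with x hx
  rw [h x hx]

lemma coeff (hF : HasExp2 F c₀ c₁ c₂) (h₀ : c₀ = d₀) (h₁ : c₁ = d₁) (h₂ : c₂ = d₂) :
    HasExp2 F d₀ d₁ d₂ := by subst h₀ h₁ h₂; exact hF

lemma const (c : ℝ) : HasExp2 (fun _ => c) c 0 0 :=
  of_remainder (r := fun _ => 0) tendsto_const_nhds fun x _ => by ring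

lemma id : HasExp2 (fun x => x) 0 1 0 :=
  of_remainder (r := fun _ => 0) tendsto_const_nhds fun x _ => by ring

lemma add (hF : HasExp2 F c₀ c₁ c₂) (hH : HasExp2 H d₀ d₁ d₂) :
    HasExp2 (fun x => F x + H x) (c₀ + d₀) (c₁ + d₁) (c₂ + d₂) :=
  (Tendsto.add hF hH).congr fun x => by ring

lemma sub (hF : HasExp2 F c₀ c₁ c₂) (hH : HasExp2 H d₀ d₁ d₂) :
    HasExp2 (fun x => F x - H x) (c₀ - d₀) (c₁ - d₁) (c₂ - d₂) :=
  (Tendsto.sub hF hH).congr fun x => by ring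

lemma mul (hF : HasExp2 F c₀ c₁ c₂) (hH : HasExp2 H d₀ d₁ d₂) :
    HasExp2 (fun x => F x * H x) (c₀ * d₀) (c₀ * d₁ + c₁ * d₀) (c₀ * d₂ + c₁ * d₁ + c₂ * d₀) := by
  set r := fun x => (F x - c₀ - c₁ * x) / x ^ 2 with hr
  set s := fun x => (H x - d₀ - d₁ * x) / x ^ 2 with hs
  have h0 := tendsto_id_right
  have hr' : Tendsto r (𝓝[>] 0) (𝓝 c₂) := hF
  have hs' : Tendsto s (𝓝[>] 0) (𝓝 d₂) := hH
  refine of_remainder (r := fun x => c₀ * s x + c₁ * d₁ + r x * d₀ +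
    x * (c₁ * s x + r x * d₁) + x ^ 2 * (r x * s x)) ?_ fun x hx => ?_
  · have := ((((hs'.const_mul c₀).add_const (c₁ * d₁)).add (hr'.mul_const d₀)).add
      (h0.mul ((hs'.const_mul c₁).add (hr'.mul_const d₁)))).add ((h0.pow 2).mul (hr'.mul hs'))
    simpa using this
  · have e1 : F x = c₀ + c₁ * x + x ^ 2 * r x := by simp only [hr]; field_simp; ring
    have e2 : H x = d₀ + d₁ * x + x ^ 2 * s x := by simp only [hs]; field_simp; ring
    rw [e1, e2]; ring

lemma const_mul (hF : HasExp2 F c₀ c₁ c₂) (c : ℝ) :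
    HasExp2 (fun x => c * F x) (c * c₀) (c * c₁) (c * c₂) :=
  ((const c).mul hF).coeff rfl (by ring) (by ring)

lemma tendsto (hF : HasExp2 F c₀ c₁ c₂) : Tendsto F (𝓝[>] 0) (𝓝 c₀) := by
  have h0 := tendsto_id_right
  have := (((h0.pow 2).mul hF).add (h0.const_mul c₁)).add_const c₀
  simp only [ne_eq, OfNat.ofNat_ne_zero, not_false_eq_true, zero_pow, zero_mul, mul_zero,
    add_zero, zero_add] at this
  refine this.congr' ?_
  filter_upwards [eventually_pos_right] with x hx
  field_simp
  ring

lemma tendsto_div (hF : HasExp2 F 0 c₁ c₂) : Tendsto (fun x => F x / x) (𝓝[>] 0) (𝓝 c₁) := by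
  have h0 := tendsto_id_right
  have := (h0.mul hF).add_const c₁
  simp only [zero_mul, zero_add] at this
  refine this.congr' ?_
  filter_upwards [eventually_pos_right] with x hx
  field_simp
  ring

lemma tendsto_div_sq (hF : HasExp2 F 0 0 c₂) :
    Tendsto (fun x => F x / x ^ 2) (𝓝[>] 0) (𝓝 c₂) :=
  Tendsto.congr (fun x => by ring) hF

lemma comp (hF : HasExp2 F c₀ c₁ c₂) (hH : HasExp2 H 0 d₁ d₂) (hpos : ∀ x, 0 < x → 0 < H x) :
    HasExp2 (fun x => F (H x)) c₀ (c₁ * d₁) (c₁ * d₂ + c₂ * d₁ ^ 2) := by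
  have ht : Tendsto H (𝓝[>] 0) (𝓝[>] 0) := tendsto_nhdsWithin_iff.2 ⟨hH.tendsto, by
    filter_upwards [eventually_pos_right] with x hx using hpos x hx⟩
  have hr := Tendsto.comp hF ht
  refine of_remainder (r := fun x => c₁ * ((H x - 0 - d₁ * x) / x ^ 2) +
    (F (H x) - c₀ - c₁ * H x) / H x ^ 2 * (H x / x) ^ 2) ?_ fun x hx => ?_
  · exact (Tendsto.const_mul c₁ hH).add (hr.mul (hH.tendsto_div.pow 2))
  · have := (hpos x hx).ne'
    field_simp
    ring

end HasExp2

/-! ### Expansions of Laplace transforms -/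

/-- Integrates an inequality from `0`. The alternating Taylor bounds for `exp (-x)` below are
climbed with it one degree at a time. -/
lemma nonneg_of_deriv_nonneg {f f' : ℝ → ℝ} (hd : ∀ x, HasDerivAt f (f' x) x) (h0 : f 0 = 0)
    (h : ∀ x, 0 ≤ x → 0 ≤ f' x) {x : ℝ} (hx : 0 ≤ x) : 0 ≤ f x := by
  have hm : MonotoneOn f (Set.Ici 0) := by
    refine monotoneOn_of_deriv_nonneg (convex_Ici 0)
      (fun y _ => (hd y).continuousAt.continuousWithinAt)
      (fun y _ => (hd y).differentiableAt.differentiableWithinAt) fun y hy => ?_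
    rw [(hd y).deriv]
    rw [interior_Ici] at hy
    exact h y (Set.mem_Ioi.1 hy).le
  have := hm Set.self_mem_Ici (Set.mem_Ici.2 hx) hx
  rwa [h0] at this

lemma hasDerivAt_exp_neg' (x : ℝ) : HasDerivAt (fun x => Real.exp (-x)) (-Real.exp (-x)) x := by
  simpa using (hasDerivAt_neg x).exp

lemma exp_neg_lower₁ {x : ℝ} : 0 ≤ Real.exp (-x) - 1 + x := by
  have := Real.add_one_le_exp (-x); linarith

lemma exp_neg_upper₂ {x : ℝ} (hx : 0 ≤ x) : 0 ≤ 1 - x + x ^ 2 / 2 - Real.exp (-x) := by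
  refine nonneg_of_deriv_nonneg (f := fun x => 1 - x + x ^ 2 / 2 - Real.exp (-x))
    (f' := fun x => Real.exp (-x) - 1 + x) (fun x => ?_) (by simp) (fun x _ => exp_neg_lower₁) hx
  have := (((hasDerivAt_id x).const_sub 1).add (((hasDerivAt_id x).pow 2).div_const 2)).sub
    (hasDerivAt_exp_neg' x)
  refine this.congr_deriv ?_
  simp; ring

lemma exp_neg_lower₃ {x : ℝ} (hx : 0 ≤ x) :
    0 ≤ Real.exp (-x) - 1 + x - x ^ 2 / 2 + x ^ 3 / 6 := by
  refine nonneg_of_deriv_nonneg (f := fun x => Real.exp (-x) - 1 + x - x ^ 2 / 2 + x ^ 3 / 6)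
    (f' := fun x => 1 - x + x ^ 2 / 2 - Real.exp (-x)) (fun x => ?_) (by simp)
    (fun x hx => exp_neg_upper₂ hx) hx
  have := ((((hasDerivAt_exp_neg' x).sub_const 1).add (hasDerivAt_id x)).sub
    (((hasDerivAt_id x).pow 2).div_const 2)).add (((hasDerivAt_id x).pow 3).div_const 6)
  refine this.congr_deriv ?_
  simp; ring

lemma exp_neg_upper₄ {x : ℝ} (hx : 0 ≤ x) :
    0 ≤ 1 - x + x ^ 2 / 2 - x ^ 3 / 6 + x ^ 4 / 24 - Real.exp (-x) := by
  refine nonneg_of_deriv_nonneg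
    (f := fun x => 1 - x + x ^ 2 / 2 - x ^ 3 / 6 + x ^ 4 / 24 - Real.exp (-x))
    (f' := fun x => Real.exp (-x) - 1 + x - x ^ 2 / 2 + x ^ 3 / 6) (fun x => ?_) (by simp)
    (fun x hx => exp_neg_lower₃ hx) hx
  have := (((((hasDerivAt_id x).const_sub 1).add (((hasDerivAt_id x).pow 2).div_const 2)).sub
    (((hasDerivAt_id x).pow 3).div_const 6)).add (((hasDerivAt_id x).pow 4).div_const 24)).sub
    (hasDerivAt_exp_neg' x)
  refine this.congr_deriv ?_
  simp; ring

/-- Normalized remainders of the exponential series. -/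
def rem₁ (z : ℝ) : ℝ := (1 - Real.exp (-z)) / z
def rem₂ (z : ℝ) : ℝ := (Real.exp (-z) - 1 + z) / z ^ 2
def rem₃ (z : ℝ) : ℝ := (1 - z + z ^ 2 / 2 - Real.exp (-z)) / z ^ 3

lemma rem₁_bounds {z : ℝ} (hz : 0 < z) : 1 - z / 2 ≤ rem₁ z ∧ 0 ≤ rem₁ z ∧ rem₁ z ≤ 1 := by
  have h1 := exp_neg_lower₁ (x := z); have h2 := exp_neg_upper₂ hz.le
  have h3 : Real.exp (-z) ≤ 1 := by rw [Real.exp_le_one_iff]; linarith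
  rw [rem₁, le_div_iff₀ hz, div_le_one hz]
  exact ⟨by nlinarith, div_nonneg (by linarith) hz.le, by linarith⟩

lemma rem₂_bounds {z : ℝ} (hz : 0 < z) :
    1 / 2 - z / 6 ≤ rem₂ z ∧ 0 ≤ rem₂ z ∧ rem₂ z ≤ 1 / 2 := by
  have h1 := exp_neg_lower₁ (x := z); have h2 := exp_neg_upper₂ hz.le
  have h3 := exp_neg_lower₃ hz.le
  have hz2 : 0 < z ^ 2 := by positivity
  rw [rem₂, le_div_iff₀ hz2, div_le_iff₀ hz2]
  exact ⟨by nlinarith, div_nonneg (by linarith) hz2.le, by linarith⟩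

lemma rem₃_bounds {z : ℝ} (hz : 0 < z) :
    1 / 6 - z / 24 ≤ rem₃ z ∧ 0 ≤ rem₃ z ∧ rem₃ z ≤ 1 / 6 := by
  have h2 := exp_neg_upper₂ hz.le
  have h3 := exp_neg_lower₃ hz.le; have h4 := exp_neg_upper₄ hz.le
  have hz3 : 0 < z ^ 3 := by positivity
  rw [rem₃, le_div_iff₀ hz3, div_le_iff₀ hz3]
  exact ⟨by nlinarith, div_nonneg (by linarith) hz3.le, by linarith⟩

@[fun_prop] lemma measurable_rem₁ : Measurable rem₁ := by unfold rem₁; fun_prop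
@[fun_prop] lemma measurable_rem₂ : Measurable rem₂ := by unfold rem₂; fun_prop
@[fun_prop] lemma measurable_rem₃ : Measurable rem₃ := by unfold rem₃; fun_prop

/-- Scaling limit under an integral. -/
lemma tendsto_integral_scaled {μ : Measure ℝ} (hμ : ∀ᵐ x ∂μ, 0 ≤ x) {k : ℕ} (hk : k ≠ 0)
    (hi : Integrable (fun x => x ^ k) μ) {φ : ℝ → ℝ} (hφ : Measurable φ) {c b : ℝ}
    (hb : ∀ z, 0 < z → c - z * b ≤ φ z ∧ 0 ≤ φ z ∧ φ z ≤ c) :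
    Tendsto (fun α => ∫ x, x ^ k * φ (α * x) ∂μ) (𝓝[>] 0) (𝓝 (c * ∫ x, x ^ k ∂μ)) := by
  rw [← integral_const_mul]
  have hc : 0 ≤ c := (hb 1 one_pos).2.1.trans (hb 1 one_pos).2.2
  refine tendsto_integral_filter_of_dominated_convergence (fun x => x ^ k * c) ?_ ?_
    (hi.mul_const c) ?_
  · exact Eventually.of_forall fun α => by fun_prop
  · filter_upwards [eventually_pos_right] with α hα
    filter_upwards [hμ] with x hx
    rw [Real.norm_eq_abs, abs_mul, abs_of_nonneg (pow_nonneg hx k)]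
    -- `φ` is controlled only at positive arguments; at `x = 0` the factor `x ^ k` vanishes because
    -- `k ≠ 0`.
    rcases hx.eq_or_lt with h | h
    · simp [← h, zero_pow hk]
    · have := hb _ (mul_pos hα h)
      rw [abs_of_nonneg this.2.1]
      exact mul_le_mul_of_nonneg_left this.2.2 (pow_nonneg hx k)
  · filter_upwards [hμ] with x hx
    rw [mul_comm c]
    rcases hx.eq_or_lt with h | h
    · simp [← h, zero_pow hk]
    · refine Tendsto.const_mul _ ?_
      have h0 := tendsto_id_right
      refine tendsto_of_tendsto_of_tendsto_of_le_of_le' (g := fun α => c - α * x * b)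
        (h := fun _ => c) ?_ tendsto_const_nhds ?_ ?_
      · have := ((h0.mul_const x).mul_const b).const_sub c
        simpa using this
      · filter_upwards [eventually_pos_right] with α hα using (hb _ (mul_pos hα h)).1
      · filter_upwards [eventually_pos_right] with α hα using (hb _ (mul_pos hα h)).2.2

/-- Minus the derivative of the Laplace transform. -/
def lapD (μ : Measure ℝ) (α : ℝ) : ℝ := ∫ x, x * Real.exp (-(α * x)) ∂μ

section laplace
variable {μ : Measure ℝ} [IsProbabilityMeasure μ] (hμ : ∀ᵐ x ∂μ, 0 ≤ x)
include hμ

lemma integrable_lap {α : ℝ} (hα : 0 ≤ α) : Integrable (fun x => Real.exp (-(α * x))) μ := by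
  refine Integrable.of_bound (by fun_prop) 1 ?_
  filter_upwards [hμ] with x hx
  exact exp_bound hα x hx

omit [IsProbabilityMeasure μ] in
lemma integrable_mul_exp {k : ℕ} (hi : Integrable (fun x => x ^ k) μ) {α : ℝ} (hα : 0 ≤ α) :
    Integrable (fun x => x ^ k * Real.exp (-(α * x))) μ := by
  refine hi.mono (by fun_prop) ?_
  filter_upwards [hμ] with x hx
  rw [norm_mul]
  exact mul_le_of_le_one_right (norm_nonneg _) (exp_bound hα x hx)

lemma lap_pos {α : ℝ} (hα : 0 ≤ α) : 0 < lap μ α := by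
  rw [lap, integral_pos_iff_support_of_nonneg (fun x => (Real.exp_pos _).le)
    (integrable_lap hμ hα)]
  have : Function.support (fun x : ℝ => Real.exp (-(α * x))) = Set.univ := by
    ext x; simp [(Real.exp_pos _).ne']
  rw [this]; simp

omit hμ in
lemma lap_zero : lap μ 0 = 1 := by simp [lap]

lemma hasExp2_lap (h1 : Integrable (fun x => x) μ) (h2 : Integrable (fun x => x ^ 2) μ) :
    HasExp2 (lap μ) 1 (-∫ x, x ∂μ) (1 / 2 * ∫ x, x ^ 2 ∂μ) := by
  refine HasExp2.of_remainder (tendsto_integral_scaled hμ two_ne_zero h2 measurable_rem₂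
    (c := 1 / 2) (b := 1 / 6) fun z hz => by
      have := rem₂_bounds hz; exact ⟨by linarith [this.1], this.2⟩) fun α hα => ?_
  have : ∀ x : ℝ, Real.exp (-(α * x)) = 1 - α * x + α ^ 2 * (x ^ 2 * rem₂ (α * x)) := fun x => by
    rw [rem₂]
    by_cases hx : x = 0
    · simp [hx]
    · field_simp; ring
  have hi : Integrable (fun x => α ^ 2 * (x ^ 2 * rem₂ (α * x))) μ := by
    have e : (fun x => α ^ 2 * (x ^ 2 * rem₂ (α * x))) =
      fun x => Real.exp (-(α * x)) - (1 - α * x) := by ext x; rw [this]; ring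
    rw [e]
    exact (integrable_lap hμ hα.le).sub ((integrable_const 1).sub (h1.const_mul α))
  have i1 : Integrable (fun x => 1 - α * x) μ := (integrable_const 1).sub (h1.const_mul α)
  rw [lap, integral_congr_ae (ae_of_all _ this), integral_add i1 hi,
    integral_sub (integrable_const 1) (h1.const_mul α), integral_const_mul α (fun x => x),
    integral_const_mul]
  simp only [integral_const, probReal_univ, smul_eq_mul, mul_one]
  ring

-- The factor `α` lowers the number of moments needed from three to two. This matters because the
-- lemma is applied to the initial work, for which two moments are assumed.
omit [IsProbabilityMeasure μ] in
lemma hasExp2_mul_lapD (h1 : Integrable (fun x => x) μ) (h2 : Integrable (fun x => x ^ 2) μ) :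
    HasExp2 (fun α => α * lapD μ α) 0 (∫ x, x ∂μ) (-∫ x, x ^ 2 ∂μ) := by
  have ht := (tendsto_integral_scaled hμ two_ne_zero h2 measurable_rem₁ (c := 1) (b := 1 / 2)
    fun z hz => by have := rem₁_bounds hz; exact ⟨by linarith [this.1], this.2⟩).neg
  rw [one_mul] at ht
  refine HasExp2.of_remainder ht fun α hα => ?_
  have : ∀ x : ℝ, x * Real.exp (-(α * x)) = x - α * (x ^ 2 * rem₁ (α * x)) := fun x => by
    rw [rem₁]
    by_cases hx : x = 0
    · simp [hx]
    · field_simp; ring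
  have hi : Integrable (fun x => α * (x ^ 2 * rem₁ (α * x))) μ := by
    have e : (fun x => α * (x ^ 2 * rem₁ (α * x))) =
      fun x => x - x ^ 1 * Real.exp (-(α * x)) := by ext x; rw [pow_one, this]; ring
    rw [e]
    exact h1.sub (integrable_mul_exp hμ (k := 1) (by simpa using h1) hα.le)
  rw [lapD, integral_congr_ae (ae_of_all _ this), integral_sub h1 hi, integral_const_mul]
  ring

/-- `(1 - Ĝ(α)) / α`. -/
def lapH (μ : Measure ℝ) (α : ℝ) : ℝ := (1 - lap μ α) / α

lemma hasExp2_lapH (h1 : Integrable (fun x => x) μ) (h2 : Integrable (fun x => x ^ 2) μ)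
    (h3 : Integrable (fun x => x ^ 3) μ) :
    HasExp2 (lapH μ) (∫ x, x ∂μ) (-(1 / 2 * ∫ x, x ^ 2 ∂μ)) (1 / 6 * ∫ x, x ^ 3 ∂μ) := by
  refine HasExp2.of_remainder (tendsto_integral_scaled hμ three_ne_zero h3 measurable_rem₃
    (c := 1 / 6) (b := 1 / 24) fun z hz => by
      have := rem₃_bounds hz; exact ⟨by linarith [this.1], this.2⟩) fun α hα => ?_
  have : ∀ x : ℝ, Real.exp (-(α * x)) =
      1 - α * x + α ^ 2 / 2 * x ^ 2 - α ^ 3 * (x ^ 3 * rem₃ (α * x)) := fun x => by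
    rw [rem₃]
    by_cases hx : x = 0
    · simp [hx]
    · field_simp; ring
  have i1 : Integrable (fun x => 1 - α * x) μ := (integrable_const 1).sub (h1.const_mul α)
  have i2 : Integrable (fun x => 1 - α * x + α ^ 2 / 2 * x ^ 2) μ :=
    i1.add (h2.const_mul (α ^ 2 / 2))
  have hi : Integrable (fun x => α ^ 3 * (x ^ 3 * rem₃ (α * x))) μ := by
    have e : (fun x => α ^ 3 * (x ^ 3 * rem₃ (α * x))) =
      fun x => (1 - α * x + α ^ 2 / 2 * x ^ 2) - Real.exp (-(α * x)) := by ext x; rw [this]; ring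
    rw [e]
    exact i2.sub (integrable_lap hμ hα.le)
  rw [lapH, lap, integral_congr_ae (ae_of_all _ this), integral_sub i2 hi,
    integral_add i1 (h2.const_mul (α ^ 2 / 2)), integral_sub (integrable_const 1) (h1.const_mul α),
    integral_const_mul α (fun x => x)]
  simp only [integral_const_mul, integral_const, probReal_univ, smul_eq_mul, mul_one]
  field_simp
  ring

omit [IsProbabilityMeasure μ] in
lemma hasExp2_lapD (h1 : Integrable (fun x => x) μ) (h2 : Integrable (fun x => x ^ 2) μ)
    (h3 : Integrable (fun x => x ^ 3) μ) :
    HasExp2 (lapD μ) (∫ x, x ∂μ) (-∫ x, x ^ 2 ∂μ) (1 / 2 * ∫ x, x ^ 3 ∂μ) := by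
  refine HasExp2.of_remainder (tendsto_integral_scaled hμ three_ne_zero h3 measurable_rem₂
    (c := 1 / 2) (b := 1 / 6) fun z hz => by
      have := rem₂_bounds hz; exact ⟨by linarith [this.1], this.2⟩) fun α hα => ?_
  have : ∀ x : ℝ, x * Real.exp (-(α * x)) =
      x - α * x ^ 2 + α ^ 2 * (x ^ 3 * rem₂ (α * x)) := fun x => by
    rw [rem₂]
    by_cases hx : x = 0
    · simp [hx]
    · field_simp; ring
  have i2 : Integrable (fun x => x - α * x ^ 2) μ := h1.sub (h2.const_mul α)
  have hi : Integrable (fun x => α ^ 2 * (x ^ 3 * rem₂ (α * x))) μ := by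
    have e : (fun x => α ^ 2 * (x ^ 3 * rem₂ (α * x))) =
      fun x => x ^ 1 * Real.exp (-(α * x)) - (x - α * x ^ 2) := by
        ext x; rw [pow_one, this]; ring
    rw [e]
    exact (integrable_mul_exp hμ (k := 1) (by simpa using h1) hα.le).sub i2
  rw [lapD, integral_congr_ae (ae_of_all _ this), integral_add i2 hi,
    integral_sub h1 (h2.const_mul α), integral_const_mul, integral_const_mul]
  ring

lemma hasDerivAt_lap (h1 : Integrable (fun x => x) μ) {α : ℝ} (hα : 0 < α) :
    HasDerivAt (lap μ) (-lapD μ α) α := by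
  have h := hasDerivAt_integral_of_dominated_loc_of_deriv_le (μ := μ) (x₀ := α)
    (F := fun α x => Real.exp (-(α * x))) (F' := fun α x => -(x * Real.exp (-(α * x))))
    (bound := fun x => |x|) (s := Set.Ioi 0) (Ioi_mem_nhds hα)
    (Eventually.of_forall fun a => by fun_prop) (integrable_lap hμ hα.le) (by fun_prop)
    ?_ h1.abs ?_
  · have h2 := h.2
    rw [integral_neg] at h2
    exact h2
  · filter_upwards [hμ] with x hx a ha
    rw [norm_neg, norm_mul]
    exact mul_le_of_le_one_right (norm_nonneg _) (exp_bound (Set.mem_Ioi.1 ha).le x hx)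
  · refine ae_of_all _ fun x a _ => ?_
    have : HasDerivAt (fun a => Real.exp (-(a * x))) (Real.exp (-(a * x)) * -(1 * x)) a :=
      (((hasDerivAt_id a).mul_const x).neg).exp
    exact this.congr_deriv (by ring)

lemma lap_le_one {α : ℝ} (hα : 0 ≤ α) : lap μ α ≤ 1 := by
  refine (integral_mono_ae (integrable_lap hμ hα) (integrable_const 1) ?_).trans (by simp)
  filter_upwards [hμ] with x hx using exp_neg_mul_le_one hα hx

lemma one_sub_lap_le (h1 : Integrable (fun x => x) μ) {α : ℝ} (hα : 0 ≤ α) :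
    1 - lap μ α ≤ α * ∫ x, x ∂μ := by
  have h := integral_mono (μ := μ) ((integrable_const 1).sub (h1.const_mul α))
    (integrable_lap hμ hα) (fun x => by
      have := Real.add_one_le_exp (-(α * x)); simp only [Pi.sub_apply]; linarith)
  simp only [Pi.sub_apply] at h
  rw [integral_sub (integrable_const 1) (h1.const_mul α), integral_const_mul] at h
  simp only [integral_const, probReal_univ, smul_eq_mul, mul_one] at h
  rw [lap]; linarith

omit [IsProbabilityMeasure μ] in
lemma lapD_le (h1 : Integrable (fun x => x) μ) {α : ℝ} (hα : 0 ≤ α) :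
    lapD μ α ≤ ∫ x, x ∂μ := by
  refine integral_mono_ae ?_ h1 ?_
  · simpa using integrable_mul_exp hμ (k := 1) (by simpa using h1) hα
  · filter_upwards [hμ] with x hx
    exact mul_le_of_le_one_right hx (exp_neg_mul_le_one hα hx)

lemma lap_lt_one (h1 : 0 < ∫ x, x ∂μ) {α : ℝ} (hα : 0 < α) : lap μ α < 1 := by
  refine lt_of_le_of_ne (lap_le_one hμ hα.le) fun heq => ?_
  have hz : ∫ x, (1 - Real.exp (-(α * x))) ∂μ = 0 := by
    rw [integral_sub (integrable_const 1) (integrable_lap hμ hα.le)]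
    change _ - lap μ α = 0
    rw [heq]; simp
  have hnn : 0 ≤ᵐ[μ] fun x => 1 - Real.exp (-(α * x)) := by
    filter_upwards [hμ] with x hx
    have := exp_neg_mul_le_one hα.le hx
    simp only [Pi.zero_apply]; linarith
  rw [integral_eq_zero_iff_of_nonneg_ae hnn ((integrable_const 1).sub
    (integrable_lap hμ hα.le))] at hz
  have : ∫ x, x ∂μ = 0 := by
    refine integral_eq_zero_of_ae ?_
    filter_upwards [hz] with x hx
    simp only [Pi.zero_apply] at hx ⊢
    have h3 : Real.exp (-(α * x)) = 1 := by linarith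
    rw [Real.exp_eq_one_iff, neg_eq_zero] at h3
    exact (mul_eq_zero.1 h3).resolve_left hα.ne'
  linarith

end laplace

/-! ### The transforms along the curve `θ = η(χ)` -/

/-- Exponent of the net input process. -/
def eta (lam : ℝ) (G : Measure ℝ) (χ : ℝ) : ℝ := χ - lam * (1 - lap G χ)

lemma mul_lapH (μ : Measure ℝ) {α : ℝ} (hα : 0 < α) : α * lapH μ α = 1 - lap μ α := by
  rw [lapH]; field_simp

lemma eta_eq (lam : ℝ) (G : Measure ℝ) {χ : ℝ} (hχ : 0 < χ) :
    eta lam G χ = χ * (1 - lam * lapH G χ) := by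
  rw [eta, ← mul_lapH G hχ]; ring

lemma lapH_le (hG : ∀ᵐ x ∂G, 0 ≤ x) [IsProbabilityMeasure G] (h1 : Integrable (fun x => x) G)
    {χ : ℝ} (hχ : 0 < χ) : lapH G χ ≤ ∫ x, x ∂G := by
  rw [lapH, div_le_iff₀ hχ, mul_comm]
  exact one_sub_lap_le hG h1 hχ.le

section transforms

variable (hlam : 0 < lam) [IsProbabilityMeasure G] (hG : ∀ᵐ x ∂G, 0 ≤ x)
    (μ : Measure ℝ) [IsProbabilityMeasure μ] (hμ : ∀ᵐ w ∂μ, 0 ≤ w) {θ : ℝ} (hθ : 0 < θ)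
include hlam hG hμ hθ

/-- No moment of the sojourn time is needed: for `a > α / 2` the derivative in `a` is dominated
through `Y * exp (-(a * Y)) ≤ 1 / a ≤ 2 / α`. -/
lemma hasDerivAt_occB {α : ℝ} (hα : 0 < α) : HasDerivAt (occB lam G μ θ)
    (-∫ y, Real.exp (-(θ * y.2.1)) * (y.2.2 * Real.exp (-(α * y.2.2))) ∂(newOcc lam G μ)) α := by
  have hb := ((integrable_occB hlam hG μ hμ hθ (le_refl 0)).mono_measure
    (newOcc_le_occ hlam μ)).mul_const (2 / α)
  have h := hasDerivAt_integral_of_dominated_loc_of_deriv_le (μ := newOcc lam G μ) (x₀ := α)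
    (F := fun α y => Real.exp (-(θ * y.2.1)) * Real.exp (-(α * y.2.2)))
    (F' := fun α y => Real.exp (-(θ * y.2.1)) * (Real.exp (-(α * y.2.2)) * -(1 * y.2.2)))
    (bound := fun y => Real.exp (-(θ * y.2.1)) * Real.exp (-(0 * y.2.2)) * (2 / α))
    (s := Set.Ioi (α / 2)) (Ioi_mem_nhds (by linarith))
    (Eventually.of_forall fun a => by fun_prop)
    ((integrable_occB hlam hG μ hμ hθ hα.le).mono_measure (newOcc_le_occ hlam μ)) (by fun_prop)
    ?_ hb ?_
  · rw [← integral_neg]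
    refine h.2.congr_deriv (integral_congr_ae (ae_of_all _ fun y => ?_))
    simp only; ring
  · filter_upwards [ae_newOcc hlam hG μ] with y hy a ha
    have ha' : 0 < a := lt_trans (by positivity) (Set.mem_Ioi.1 ha)
    have hY : 0 ≤ y.2.2 := hy.2
    have h1 := mul_exp_neg_le (Y := y.2.2) ha'
    have h2 : 1 / a ≤ 2 / α := by
      rw [div_le_div_iff₀ ha' hα]; linarith [Set.mem_Ioi.1 ha]
    rw [Real.norm_eq_abs, abs_mul, abs_of_pos (Real.exp_pos _), zero_mul, neg_zero, Real.exp_zero,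
      mul_one, one_mul, mul_neg, abs_neg, abs_of_nonneg (by positivity), mul_comm (Real.exp (-(a * _)))]
    exact mul_le_mul_of_nonneg_left (h1.trans h2) (Real.exp_nonneg _)
  · refine ae_of_all _ fun y a _ => ?_
    exact ((((hasDerivAt_id a).mul_const y.2.2).neg).exp).const_mul _

end transforms

/-! ### Closed forms of the transforms along the curve. -/

section formulas

variable (hlam : 0 < lam) [IsProbabilityMeasure G] (hG : ∀ᵐ x ∂G, 0 ≤ x)
    (h1 : Integrable (fun x => x) G) (hrho : lam * ∫ x, x ∂G < 1)
include hlam hG h1 hrho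

lemma one_sub_lapH_pos {χ : ℝ} (hχ : 0 < χ) : 0 < 1 - lam * lapH G χ := by
  have := mul_le_mul_of_nonneg_left (lapH_le hG h1 hχ) hlam.le
  linarith

omit [IsProbabilityMeasure G] in
lemma one_sub_lapD_pos {χ : ℝ} (hχ : 0 < χ) : 0 < 1 - lam * lapD G χ := by
  have := mul_le_mul_of_nonneg_left (lapD_le hG h1 hχ.le) hlam.le
  linarith

lemma eta_pos {χ : ℝ} (hχ : 0 < χ) : 0 < eta lam G χ := by
  rw [eta_eq lam G hχ]
  exact mul_pos hχ (one_sub_lapH_pos hlam hG h1 hrho hχ)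

variable (μ : Measure ℝ) [IsProbabilityMeasure μ] (hμ : ∀ᵐ w ∂μ, 0 ≤ w)
include hμ

/-- On the curve `θ = η(χ)` the unknown constant of `occK_identity` is `f(χ) / χ`. -/
lemma occB_identity {χ : ℝ} (hχ : 0 < χ) {α : ℝ} (hα : 0 ≤ α) :
    (eta lam G χ - eta lam G α) * occB lam G μ (eta lam G χ) α =
      lam * lap G α * (lap μ α - α * (lap μ χ / χ)) := by
  have hθ := eta_pos hlam hG h1 hrho hχ
  obtain ⟨p, hp⟩ := occK_identity hlam hG μ hμ hθ
  -- Kernel method: at `α = χ` the factor in front of the transform is zero, so the right-hand side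
  -- must vanish as well.
  have hpχ : p = lap μ χ / χ := by
    have := hp χ hχ.le
    rw [← eta, sub_self, zero_mul, eq_comm, mul_eq_zero] at this
    have := this.resolve_left hlam.ne'
    field_simp; linarith
  rw [occB_eq hlam hG μ hμ hθ hα, ← hpχ]
  have := hp α hα
  rw [← eta] at this
  linear_combination (lap G α) * this

lemma occB_zero {χ : ℝ} (hχ : 0 < χ) :
    occB lam G μ (eta lam G χ) 0 = lam / eta lam G χ := by
  have hθ := eta_pos hlam hG h1 hrho hχ
  have := occB_identity hlam hG h1 hrho μ hμ hχ le_rfl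
  have e0 : eta lam G 0 = 0 := by simp [eta, lap_zero]
  simp only [e0, lap_zero] at this
  rw [eq_div_iff hθ.ne']; linarith

/-- Numerator of the transform of the occupation measure on the diagonal. -/
def diagNum (lam : ℝ) (G μ : Measure ℝ) (χ : ℝ) : ℝ :=
  lap μ (eta lam G χ) - (1 - lam * lapH G χ) * lap μ χ

omit hlam hG h1 hrho hμ [IsProbabilityMeasure G] [IsProbabilityMeasure μ] in
lemma eta_mul_div {χ : ℝ} (hχ : 0 < χ) :
    eta lam G χ * (lap μ χ / χ) = (1 - lam * lapH G χ) * lap μ χ := by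
  rw [eta_eq lam G hχ]; field_simp

/-- The value at `α = θ` is the one that occurs in `abel_newQueue`. There the kernel is θ - η(θ) =
λ(1 - Ĝ(θ)). -/
lemma occB_diag {χ : ℝ} (hχ : 0 < χ) :
    eta lam G χ * lapH G (eta lam G χ) * occB lam G μ (eta lam G χ) (eta lam G χ) =
      lap G (eta lam G χ) * diagNum lam G μ χ := by
  have hθ := eta_pos hlam hG h1 hrho hχ
  have := occB_identity hlam hG h1 hrho μ hμ hχ hθ.le
  rw [eta_mul_div (lam := lam) (G := G) μ hχ] at this
  set θ := eta lam G χ with hθd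
  rw [eta, ← mul_lapH G hθ, sub_sub_cancel] at this
  rw [diagNum, ← hθd]
  refine mul_left_cancel₀ hlam.ne' ?_
  linear_combination this

omit hlam hrho hμ [IsProbabilityMeasure μ] in
lemma hasDerivAt_eta {α : ℝ} (hα : 0 < α) :
    HasDerivAt (eta lam G) (1 - lam * lapD G α) α := by
  have := (hasDerivAt_id α).sub (((hasDerivAt_lap hG h1 hα).const_sub 1).const_mul lam)
  exact this.congr_deriv (by ring)

/-- Differentiated form of `occB_identity`. -/
lemma occB_identity_deriv (hm : Integrable (fun x => x) μ) {χ : ℝ} (hχ : 0 < χ) {α : ℝ}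
    (hα : 0 < α) :
    -(1 - lam * lapD G α) * occB lam G μ (eta lam G χ) α +
      (eta lam G χ - eta lam G α) *
        -(∫ y, Real.exp (-(eta lam G χ * y.2.1)) * (y.2.2 * Real.exp (-(α * y.2.2)))
          ∂(newOcc lam G μ)) =
      lam * -lapD G α * (lap μ α - α * (lap μ χ / χ)) +
        lam * lap G α * (-lapD μ α - lap μ χ / χ) := by
  have hθ := eta_pos hlam hG h1 hrho hχ
  have hl := ((hasDerivAt_eta (lam := lam) hG h1 hα).const_sub (eta lam G χ)).mul
    (hasDerivAt_occB hlam hG μ hμ hθ hα)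
  have hr := ((hasDerivAt_lap hG h1 hα).const_mul lam).mul
    ((hasDerivAt_lap hμ hm hα).sub ((hasDerivAt_id α).mul_const (lap μ χ / χ)))
  refine (hl.unique (hr.congr_of_eventuallyEq ?_)).trans ?_
  · filter_upwards [Ioi_mem_nhds hα] with a ha
    exact occB_identity hlam hG h1 hrho μ hμ hχ (le_of_lt ha)
  · simp

/-- At `α = χ` the identity `occB_identity` reads `0 = 0`; its derivative in `α` supplies the value.
-/
lemma occB_pole (hm : Integrable (fun x => x) μ) {χ : ℝ} (hχ : 0 < χ) :
    χ * (1 - lam * lapD G χ) * occB lam G μ (eta lam G χ) χ =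
      lam * lap G χ * (lap μ χ + χ * lapD μ χ) := by
  have := occB_identity_deriv hlam hG h1 hrho μ hμ hm hχ hχ
  rw [sub_self, zero_mul, add_zero] at this
  have e : χ * (lap μ χ / χ) = lap μ χ := by field_simp
  rw [e] at this
  linear_combination (-χ) * this + lam * lap G χ * e

lemma occD_diag (hm : Integrable (fun x => x) μ) {χ : ℝ} (hχ : 0 < χ) :
    lam * (eta lam G χ * lapH G (eta lam G χ)) * occD lam G μ (eta lam G χ) =
      lam * lapD G (eta lam G χ) * diagNum lam G μ χ +
      lam * lap G (eta lam G χ) * (lapD μ (eta lam G χ) + lap μ χ / χ) -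
      (1 - lam * lapD G (eta lam G χ)) * occB lam G μ (eta lam G χ) (eta lam G χ) := by
  have hθ := eta_pos hlam hG h1 hrho hχ
  have := occB_identity_deriv hlam hG h1 hrho μ hμ hm hχ hθ
  rw [eta_mul_div (lam := lam) (G := G) μ hχ, ← diagNum, ← occD] at this
  have e : eta lam G χ - eta lam G (eta lam G χ) =
      lam * (eta lam G χ * lapH G (eta lam G χ)) := by
    rw [mul_lapH G hθ]; simp only [eta]; ring
  rw [e] at this
  linear_combination -this

lemma occC_zero {χ : ℝ} (hχ : 0 < χ) :
    occC lam G μ (eta lam G χ) 0 = lam / eta lam G χ := by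
  have hθ := eta_pos hlam hG h1 hrho hχ
  obtain ⟨K, hK⟩ := occC_identity hlam hG μ hμ hθ
  have := hK 0 le_rfl
  simp only [lap_zero] at this
  rw [eq_div_iff hθ.ne']; linarith

/-- The unknown `K` of `occC_identity` is eliminated between `α = χ`, where the kernel vanishes, and
`α = θ`. The values of `occB` at these two points come from `occB_pole` and `occB_diag`. -/
lemma occC_diag (hm : Integrable (fun x => x) μ) {χ : ℝ} (hχ : 0 < χ) :
    lapH G (eta lam G χ) * (χ * (1 - lam * lapD G χ)) *
        occC lam G μ (eta lam G χ) (eta lam G χ) =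
      lam * lap G (eta lam G χ) * lapH G χ * (lap μ χ + χ * lapD μ χ) := by
  have hθ := eta_pos hlam hG h1 hrho hχ
  have hB := occB_diag hlam hG h1 hrho μ hμ hχ
  have hP := occB_pole hlam hG h1 hrho μ hμ hm hχ
  obtain ⟨K, hK⟩ := occC_identity hlam hG μ hμ hθ
  have k1 := hK χ hχ.le
  have k2 := hK _ hθ.le
  rw [← eta] at k1 k2
  have e : eta lam G χ - eta lam G (eta lam G χ) =
      lam * (eta lam G χ * lapH G (eta lam G χ)) := by
    rw [mul_lapH G hθ]; simp only [eta]; ring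
  rw [e] at k2
  rw [sub_self, zero_mul] at k1
  rw [diagNum] at hB
  have hu := one_sub_lapH_pos hlam hG h1 hrho hχ
  have hgχ := lap_pos hG hχ.le
  have hlG : lap G χ = 1 - χ * lapH G χ := by rw [mul_lapH G hχ]; ring
  have hlGθ := mul_lapH G hθ
  have eθ := eta_eq lam G hχ
  set θ := eta lam G χ with hθd
  set Bχ := occB lam G μ θ χ
  set Bθ := occB lam G μ θ θ
  set C := occC lam G μ θ θ
  -- After `K` and `Bθ` have been eliminated, the common factor λη(χ) cancels and `C` becomes
  -- proportional to `Bχ`.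
  have k3 : lapH G θ * lap G χ * C = lap G θ * lapH G χ * Bχ := by
    have hne : lam * χ * (1 - lam * lapH G χ) ≠ 0 := by positivity
    refine mul_left_cancel₀ hne ?_
    have a1 : lap G χ * (lam * (θ * lapH G θ) * C) = lap G χ *
      (lam * lap G θ * (lap μ θ + Bθ) - lam * Bθ - θ * lap G θ * K) := by rw [k2]
    have a2 : lap G θ * ((1 - lam * lapH G χ) * (χ * lap G χ * K)) = lap G θ *
      ((1 - lam * lapH G χ) * (lam * lap G χ * (lap μ χ + Bχ) - lam * Bχ)) := by
      rw [show χ * lap G χ * K = lam * lap G χ * (lap μ χ + Bχ) - lam * Bχ by linarith]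
    have a3 : lap G θ = 1 - θ * lapH G θ := by rw [hlGθ]; ring
    have a4 : lam * lap G χ * (lap G θ - 1) * Bθ = -lam * lap G χ *
      (lap G θ * (lap μ θ - (1 - lam * lapH G χ) * lap μ χ)) := by
      rw [← hB, a3]; ring
    have a5 : lam * (1 - lam * lapH G χ) * lap G θ * (lap G χ - 1) * Bχ =
      -(lam * (1 - lam * lapH G χ) * lap G θ * (χ * lapH G χ) * Bχ) := by rw [hlG]; ring
    have a6 : θ * (lap G χ * (lam * lapH G θ * C) + lap G χ * lap G θ * K) =
      χ * (1 - lam * lapH G χ) * (lap G χ * (lam * lapH G θ * C) + lap G χ * lap G θ * K) := by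
      rw [← eθ]
    linear_combination a1 - a2 + a4 - a5 - a6
  have hne : lap G χ ≠ 0 := hgχ.ne'
  refine mul_left_cancel₀ hne ?_
  linear_combination (χ * (1 - lam * lapD G χ)) * k3 + lap G θ * lapH G χ * hP

end formulas

/-! ### Limits of the transforms -/

/-- Mean workload in equilibrium. -/
def meanWork (lam : ℝ) (G : Measure ℝ) : ℝ := lam * g G 2 / (2 * (1 - rho lam G))

/-- Second moment of the workload in equilibrium. -/
def sqWork (lam : ℝ) (G : Measure ℝ) : ℝ :=
  2 * meanWork lam G ^ 2 + lam * g G 3 / (3 * (1 - rho lam G))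

/-- Mean number of customers in equilibrium. -/
def meanQueue (lam : ℝ) (G : Measure ℝ) : ℝ := lam * (meanWork lam G + g G 1)

/-- Second factorial moment of the number of customers in equilibrium. -/
def factQueue (lam : ℝ) (G : Measure ℝ) : ℝ :=
  lam ^ 2 * (sqWork lam G + 2 * meanWork lam G * g G 1 + g G 2)

/-- Second moment of the number of customers in equilibrium. -/
def sqQueue (lam : ℝ) (G : Measure ℝ) : ℝ := meanQueue lam G + factQueue lam G

/-- Limit of the covariance of the number of arrivals and the number of customers. -/
def covQueue (lam : ℝ) (G : Measure ℝ) : ℝ :=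
  rho lam G + lam ^ 2 * g G 2 / (1 - rho lam G) +
    lam ^ 2 * rho lam G * g G 2 / (2 * (1 - rho lam G) ^ 2)

lemma g_one (G : Measure ℝ) : g G 1 = ∫ x, x ∂G := by simp [g]

lemma lapH_pos [IsProbabilityMeasure G] (hG : ∀ᵐ x ∂G, 0 ≤ x) (hg : 0 < ∫ x, x ∂G) {α : ℝ}
    (hα : 0 < α) : 0 < lapH G α :=
  div_pos (by linarith [lap_lt_one hG hg hα]) hα

lemma tendsto_of_limit_eq {f : ℝ → ℝ} {l : Filter ℝ} {a b : ℝ} (h : Tendsto f l (𝓝 a))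
    (hab : b = a) : Tendsto f l (𝓝 b) := hab ▸ h

section limits

variable (hlam : 0 < lam) [IsProbabilityMeasure G] (hG : ∀ᵐ x ∂G, 0 ≤ x)
    (h1 : Integrable (fun x => x) G) (h2 : Integrable (fun x => x ^ 2) G)
    (h3 : Integrable (fun x => x ^ 3) G) (hg : 0 < ∫ x, x ∂G) (hrho : lam * ∫ x, x ∂G < 1)
include hG h1 h2 h3

lemma hasExp2_one_sub_lapH : HasExp2 (fun χ => 1 - lam * lapH G χ) (1 - lam * ∫ x, x ∂G)
    (lam * (1 / 2 * ∫ x, x ^ 2 ∂G)) (-(lam * (1 / 6 * ∫ x, x ^ 3 ∂G))) :=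
  ((HasExp2.const 1).sub ((hasExp2_lapH hG h1 h2 h3).const_mul lam)).coeff rfl (by ring) (by ring)

lemma hasExp2_eta : HasExp2 (eta lam G) 0 (1 - lam * ∫ x, x ∂G)
    (lam * (1 / 2 * ∫ x, x ^ 2 ∂G)) :=
  ((HasExp2.id.mul (hasExp2_one_sub_lapH hG h1 h2 h3)).coeff (by ring) (by ring) (by ring)).congr
    fun χ hχ => eta_eq lam G hχ

include hlam hrho

lemma tendsto_eta : Tendsto (eta lam G) (𝓝[>] 0) (𝓝[>] 0) :=
  tendsto_nhdsWithin_iff.2 ⟨(hasExp2_eta hG h1 h2 h3).tendsto, by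
    filter_upwards [eventually_pos_right] with χ hχ using eta_pos hlam hG h1 hrho hχ⟩

variable (μ : Measure ℝ) [IsProbabilityMeasure μ] (hμ : ∀ᵐ w ∂μ, 0 ≤ w)
    (hm1 : Integrable (fun x => x) μ) (hm2 : Integrable (fun x => x ^ 2) μ)
include hμ hm1 hm2

lemma hasExp2_diagNum : HasExp2 (diagNum lam G μ) (lam * ∫ x, x ∂G)
    (-(lam * (1 / 2 * ∫ x, x ^ 2 ∂G)))
    (-(∫ x, x ∂μ) * (lam * (1 / 2 * ∫ x, x ^ 2 ∂G)) +
      (1 / 2 * ∫ x, x ^ 2 ∂μ) * (1 - lam * ∫ x, x ∂G) ^ 2 -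
      ((1 - lam * ∫ x, x ∂G) * (1 / 2 * ∫ x, x ^ 2 ∂μ) +
        lam * (1 / 2 * ∫ x, x ^ 2 ∂G) * (-∫ x, x ∂μ) - lam * (1 / 6 * ∫ x, x ^ 3 ∂G))) :=
  (((hasExp2_lap hμ hm1 hm2).comp (hasExp2_eta hG h1 h2 h3)
    fun χ hχ => eta_pos hlam hG h1 hrho hχ).sub
    ((hasExp2_one_sub_lapH hG h1 h2 h3).mul (hasExp2_lap hμ hm1 hm2))).coeff
    (by ring) (by ring) (by ring)

include hg

/-- After insertion of the closed forms both terms share a denominator of order `χ`, and the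
numerator vanishes at `0`, so the limit is a quotient of coefficients. The law `μ` drops out: its
mean has already cancelled in the linear coefficient of `diagNum`. -/
theorem tendsto_occB_sub : Tendsto (fun χ => occB lam G μ (eta lam G χ) 0 -
    occB lam G μ (eta lam G χ) (eta lam G χ)) (𝓝[>] 0) (𝓝 (meanQueue lam G)) := by
  have hη := fun χ (hχ : 0 < χ) => eta_pos hlam hG h1 hrho hχ
  have hE := hasExp2_eta (lam := lam) hG h1 h2 h3
  have eH := (hasExp2_lapH hG h1 h2 h3).comp hE hη
  have eG := (hasExp2_lap hG h1 h2).comp hE hη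
  have eU := hasExp2_one_sub_lapH (lam := lam) hG h1 h2 h3
  have eN := hasExp2_diagNum hlam hG h1 h2 h3 hrho μ hμ hm1 hm2
  have eX := ((eH.const_mul lam).sub (eG.mul eN)).coeff (d₀ := 0) (by ring) rfl rfl
  have hr : 0 < 1 - lam * ∫ x, x ∂G := by linarith
  have hlim := eX.tendsto_div.div (eU.mul eH).tendsto (by positivity)
  refine Tendsto.congr' ?_ (tendsto_of_limit_eq hlim ?_)
  · filter_upwards [eventually_pos_right] with χ hχ
    have hB := occB_diag hlam hG h1 hrho μ hμ hχ
    have hu := one_sub_lapH_pos hlam hG h1 hrho hχ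
    have hh := lapH_pos hG hg (hη χ hχ)
    have hi : lam / eta lam G χ * eta lam G χ = lam := div_mul_cancel₀ _ (hη χ hχ).ne'
    simp only [Pi.div_apply]
    rw [occB_zero hlam hG h1 hrho μ hμ hχ, div_div, div_eq_iff (by positivity)]
    linear_combination hB - lapH G (eta lam G χ) * hi + (lam / eta lam G χ -
      occB lam G μ (eta lam G χ) (eta lam G χ)) * lapH G (eta lam G χ) * eta_eq lam G hχ
  · rw [meanQueue, meanWork, rho, g_one, g]
    generalize (∫ x, x ∂G) = g₁ at *
    have hr' := hr.ne'
    field_simp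
    ring

theorem tendsto_occD : Tendsto (fun χ => 2 * lam / eta lam G χ *
    (occB lam G μ (eta lam G χ) 0 - occB lam G μ (eta lam G χ) (eta lam G χ) -
      eta lam G χ * occD lam G μ (eta lam G χ))) (𝓝[>] 0) (𝓝 (factQueue lam G)) := by
  have hη := fun χ (hχ : 0 < χ) => eta_pos hlam hG h1 hrho hχ
  have hE := hasExp2_eta (lam := lam) hG h1 h2 h3
  have eH := (hasExp2_lapH hG h1 h2 h3).comp hE hη
  have eG := (hasExp2_lap hG h1 h2).comp hE hη
  have eD := (hasExp2_lapD hG h1 h2 h3).comp hE hη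
  have eM := (hasExp2_mul_lapD hμ hm1 hm2).comp hE hη
  have eU := hasExp2_one_sub_lapH (lam := lam) hG h1 h2 h3
  have eN := hasExp2_diagNum hlam hG h1 h2 h3 hrho μ hμ hm1 hm2
  -- Numerator of the closed form over the common denominator `(eta lam G χ * lapH G (eta lam G χ))
  -- ^ 2`, up to the factor `2`. Its constant and linear coefficients vanish, so its quadratic
  -- coefficient gives the limit; there the moments of `μ` cancel.
  have eX := (((eH.mul eH).const_mul (lam ^ 2)).sub (((eG.mul eN).mul eH).const_mul lam)).sub
    ((((((hE.mul eH).mul eD).mul eN).const_mul lam).add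
      (((eH.mul eG).mul (eM.add (eU.mul (hasExp2_lap hμ hm1 hm2)))).const_mul lam)).sub
      ((eG.mul eN).mul ((HasExp2.const 1).sub (eD.const_mul lam))))
  have eX' := eX.coeff (d₀ := 0) (d₁ := 0) (by ring) (by ring) rfl
  have hr : 0 < 1 - lam * ∫ x, x ∂G := by linarith
  have hlim := (eX'.tendsto_div_sq.div ((eU.mul eH).tendsto.pow 2) (by positivity)).const_mul 2
  refine Tendsto.congr' ?_ (tendsto_of_limit_eq hlim ?_)
  · filter_upwards [eventually_pos_right] with χ hχ
    have hB := occB_diag hlam hG h1 hrho μ hμ hχ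
    have hD := occD_diag hlam hG h1 hrho μ hμ hm1 hχ
    have hu := one_sub_lapH_pos hlam hG h1 hrho hχ
    have hh := lapH_pos hG hg (hη χ hχ)
    have hθ := hη χ hχ
    have hi : lam / eta lam G χ * eta lam G χ = lam := div_mul_cancel₀ _ hθ.ne'
    have he := eta_eq lam G hχ
    have hc := eta_mul_div (lam := lam) (G := G) μ hχ
    simp only [Pi.div_apply]
    rw [occB_zero hlam hG h1 hrho μ hμ hχ, div_div, ← mul_pow, ← mul_assoc χ, ← he]
    generalize occB lam G μ (eta lam G χ) (eta lam G χ) = B at *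
    generalize occD lam G μ (eta lam G χ) = D at *
    generalize lapH G (eta lam G χ) = h at *
    generalize lap G (eta lam G χ) = k at *
    generalize lapD G (eta lam G χ) = d at *
    generalize lapD μ (eta lam G χ) = e at *
    generalize diagNum lam G μ χ = N at *
    generalize eta lam G χ = θ at *
    have hB' : B = k * N / (θ * h) := by rw [eq_div_iff (by positivity)]; linarith
    have hD' : D = (lam * d * N + lam * k * (e + lap μ χ / χ) - (1 - lam * d) * B) /
      (lam * (θ * h)) := by rw [eq_div_iff (by positivity)]; linarith
    have hc' : lap μ χ / χ = (1 - lam * lapH G χ) * lap μ χ / θ := by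
      rw [eq_div_iff hθ.ne']; linarith
    rw [hD', hB', hc']
    field_simp
  · rw [factQueue, sqWork, meanWork, rho, g_one, g, g]
    generalize (∫ x, x ∂G) = g₁ at *
    generalize (∫ x, x ^ 2 ∂G) = g₂ at *
    generalize (∫ x, x ^ 3 ∂G) = g₃ at *
    have hr' := hr.ne'
    field_simp
    ring

/-- Each of the two terms diverges like `lam / θ`; their difference is a quotient of two expressions
of first order in `χ`. -/
theorem tendsto_occC_sub : Tendsto (fun χ => occC lam G μ (eta lam G χ) 0 -
    occC lam G μ (eta lam G χ) (eta lam G χ)) (𝓝[>] 0) (𝓝 (covQueue lam G)) := by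
  have hη := fun χ (hχ : 0 < χ) => eta_pos hlam hG h1 hrho hχ
  have hE := hasExp2_eta (lam := lam) hG h1 h2 h3
  have eH₀ := hasExp2_lapH hG h1 h2 h3
  have eH := eH₀.comp hE hη
  have eG := (hasExp2_lap hG h1 h2).comp hE hη
  have eD := (HasExp2.const 1).sub ((hasExp2_lapD hG h1 h2 h3).const_mul lam)
  have eM := (hasExp2_lap hμ hm1 hm2).add (hasExp2_mul_lapD hμ hm1 hm2)
  have eU := hasExp2_one_sub_lapH (lam := lam) hG h1 h2 h3
  have eX := (((eH.mul eD).sub ((eU.mul (eG.mul eH₀)).mul eM)).const_mul lam).coeff (d₀ := 0)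
    (by ring) rfl rfl
  have hr : 0 < 1 - lam * ∫ x, x ∂G := by linarith
  have hlim := eX.tendsto_div.div (eU.mul (eH.mul eD)).tendsto (by positivity)
  refine Tendsto.congr' ?_ (tendsto_of_limit_eq hlim ?_)
  · filter_upwards [eventually_pos_right] with χ hχ
    have hC := occC_diag hlam hG h1 hrho μ hμ hm1 hχ
    have hu := one_sub_lapH_pos hlam hG h1 hrho hχ
    have hd := one_sub_lapD_pos hlam hG h1 hrho hχ
    have hh := lapH_pos hG hg (hη χ hχ)
    simp only [Pi.div_apply]
    rw [occC_zero hlam hG h1 hrho μ hμ hχ]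
    have he := eta_eq lam G hχ
    generalize occC lam G μ (eta lam G χ) (eta lam G χ) = C at *
    generalize lapH G (eta lam G χ) = h at *
    generalize lap G (eta lam G χ) = k at *
    have hC' : C = lam * k * lapH G χ * (lap μ χ + χ * lapD μ χ) /
      (h * (χ * (1 - lam * lapD G χ))) := by rw [eq_div_iff (by positivity)]; linarith
    rw [hC', he]
    generalize 1 - lam * lapD G χ = d at *
    generalize 1 - lam * lapH G χ = u at *
    field_simp
  · rw [covQueue, rho, g_one, g]
    generalize (∫ x, x ∂G) = g₁ at *
    generalize (∫ x, x ^ 2 ∂G) = g₂ at *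
    have hr' := hr.ne'
    field_simp
    ring

end limits

/-! ### Independence of the initial work and the later arrivals and services -/

lemma initialWork_congr {x : State} {a a' σ σ' : ℕ → ℝ} (h : ∀ i < x.1, σ i = σ' i) :
    initialWork (x, a, σ) = initialWork (x, a', σ') := by
  unfold initialWork
  by_cases hx : x.1 = 0
  · simp [hx]
  · simp only [hx, if_false]
    refine departureTime_congr (fun i hi => ?_) fun i hi => h i (by omega)
    rw [entryTime_of_lt (show i < x.1 by omega), entryTime_of_lt (show i < x.1 by omega)]

/-- Joint law of the initial number of customers and of the initial work. -/
def initLaw (lam : ℝ) (G : Measure ℝ) (ν : Measure State) : Measure (ℕ × ℝ) :=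
  (law lam G ν).map fun ω => (ω.1.1, initialWork ω)

/-- Law of the initial work. -/
def workLaw (lam : ℝ) (G : Measure ℝ) (ν : Measure State) : Measure ℝ :=
  (law lam G ν).map initialWork

/-- The queue watched at an independent exponential time. -/
def abelLaw (lam : ℝ) (G : Measure ℝ) (ν : Measure State) (θ : ℝ) : Measure (Input × ℝ) :=
  (law lam G ν).prod (expMeasure θ)

section transfer

variable [Fact (0 < lam)] [IsProbabilityMeasure G] (ν : Measure State) [IsProbabilityMeasure ν]

lemma measurable_initPair : Measurable fun ω : Input => (ω.1.1, initialWork ω) := by fun_prop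

instance : IsProbabilityMeasure (initLaw lam G ν) :=
  Measure.isProbabilityMeasure_map measurable_initPair.aemeasurable

instance : IsProbabilityMeasure (workLaw lam G ν) :=
  Measure.isProbabilityMeasure_map measurable_initialWork.aemeasurable

-- The initial work reads only the first `x.1` services and no arrivals, `newServ` only the
-- remaining services; cutting the service sequence at `x.1` makes them independent.
omit [IsProbabilityMeasure ν] in
theorem map_initPair : (law lam G ν).map (fun ω => ((ω.1.1, initialWork ω), ω.2.1, newServ ω)) =
    (initLaw lam G ν).prod (seqLaw lam G) := by
  have hlam : 0 < lam := Fact.out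
  have := isProbabilityMeasure_expMeasure hlam
  refine Measure.ext_of_lintegral _ fun f hf => ?_
  have hm : Measurable fun ω : Input => ((ω.1.1, initialWork ω), ω.2.1, newServ ω) := by fun_prop
  have hH : Measurable fun y : ℕ × ℝ => ∫⁻ z, f (y, z) ∂(seqLaw lam G) :=
    Measurable.lintegral_prod_right' hf
  have e1 := lintegral_law (lam := lam) (G := G) hlam ν (hf.comp hm)
  have e2 := lintegral_law (lam := lam) (G := G) hlam ν (hH.comp measurable_initPair)
  simp only [Function.comp_apply] at e1 e2
  rw [lintegral_map hf hm, lintegral_prod _ hf.aemeasurable, initLaw,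
    lintegral_map hH measurable_initPair, e1, e2]
  refine lintegral_congr fun x => ?_
  have hc : ∀ (a σ : ℕ → ℝ), initialWork (x, a, σ) = initialWork (x, 0, σ) := fun a σ =>
    initialWork_congr fun _ _ => rfl
  have hW : Measurable fun σ : ℕ → ℝ => initialWork (x, 0, σ) :=
    measurable_initialWork.comp (f := fun σ : ℕ → ℝ => ((x, 0, σ) : Input)) (by fun_prop)
  simp only [hc, lintegral_const, measure_univ, mul_one]
  have hsp : ∀ a, ∫⁻ σ, f ((x.1, initialWork (x, 0, σ)), a, newServ (x, a, σ)) ∂(iid G) =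
      ∫⁻ σ, ∫⁻ σ', f ((x.1, initialWork (x, 0, σ)), a, σ') ∂(iid G) ∂(iid G) := fun a => by
    rw [lintegral_splice G x.1]
    · refine lintegral_congr fun σ => lintegral_congr fun σ' => ?_
      rw [initialWork_congr (σ' := σ) (a' := 0) fun i hi => splice_lt hi σ σ']
      congr 3
      ext j
      exact splice_add x.1 j σ σ'
    · refine hf.comp ((measurable_const.prodMk hW).prodMk (measurable_const.prodMk ?_))
      exact measurable_newServ.comp (f := fun σ : ℕ → ℝ => ((x, a, σ) : Input)) (by fun_prop)
  simp_rw [hsp]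
  rw [lintegral_lintegral_swap]
  · refine lintegral_congr fun σ => ?_
    rw [lintegral_seqLaw hlam (by fun_prop)]
  · refine Measurable.aemeasurable ?_
    refine Measurable.lintegral_prod_right' (f := fun p : ((ℕ → ℝ) × (ℕ → ℝ)) × (ℕ → ℝ) =>
      f ((x.1, initialWork (x, 0, p.1.2)), p.1.1, p.2)) (hf.comp ?_)
    exact ((measurable_const.prodMk (hW.comp (by fun_prop))).prodMk (by fun_prop))

lemma measurePreserving_init {β : Type*} [MeasurableSpace β] {φ : ℕ × ℝ → β}
    (hφ : Measurable φ) :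
    MeasurePreserving (fun ω => (φ (ω.1.1, initialWork ω), ω.2.1, newServ ω)) (law lam G ν)
      (((initLaw lam G ν).map φ).prod (seqLaw lam G)) := by
  have h1 : MeasurePreserving (fun ω : Input => ((ω.1.1, initialWork ω), ω.2.1, newServ ω))
    (law lam G ν) ((initLaw lam G ν).prod (seqLaw lam G)) := ⟨by fun_prop, map_initPair ν⟩
  have h2 : MeasurePreserving φ (initLaw lam G ν) ((initLaw lam G ν).map φ) := ⟨hφ, rfl⟩
  exact (h2.prod (MeasurePreserving.id (seqLaw lam G))).comp h1

variable {θ : ℝ} [Fact (0 < θ)]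

instance : IsProbabilityMeasure (expMeasure θ) := isProbabilityMeasure_expMeasure Fact.out

lemma measurePreserving_work : MeasurePreserving (fun p : Input × ℝ =>
    ((initialWork p.1, p.1.2.1, newServ p.1), p.2)) (abelLaw lam G ν θ)
      (abelSeq lam G (workLaw lam G ν) θ) := by
  have h := measurePreserving_init (lam := lam) (G := G) ν (φ := Prod.snd) measurable_snd
  have e : (initLaw lam G ν).map Prod.snd = workLaw lam G ν := by
    rw [initLaw, Measure.map_map measurable_snd measurable_initPair]; rfl
  rw [e] at h
  exact h.prod (MeasurePreserving.id (expMeasure θ))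

lemma measurePreserving_empty : MeasurePreserving (fun p : Input × ℝ =>
    (((0 : ℝ), p.1.2.1, newServ p.1), p.2)) (abelLaw lam G ν θ)
      (abelSeq lam G (Measure.dirac 0) θ) := by
  have h := measurePreserving_init (lam := lam) (G := G) ν (φ := fun _ => (0 : ℝ))
    measurable_const
  rw [Measure.map_const, measure_univ, one_smul] at h
  exact h.prod (MeasurePreserving.id (expMeasure θ))

/-- The initial number of customers is independent of everything that comes later. -/
lemma integral_number_mul {F : ℕ → ℝ} {H : ((ℕ → ℝ) × (ℕ → ℝ)) × ℝ → ℝ} (hH : Measurable H) :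
    ∫ p, F p.1.1.1 * H ((p.1.2.1, newServ p.1), p.2) ∂(abelLaw lam G ν θ) =
      (∫ ω, F ω.1.1 ∂(law lam G ν)) *
        ∫ p, H ((p.1.2.1, newServ p.1), p.2) ∂(abelLaw lam G ν θ) := by
  have hF : Measurable F := measurable_from_nat
  set N := (initLaw lam G ν).map Prod.fst with hN
  have : IsProbabilityMeasure N := Measure.isProbabilityMeasure_map measurable_fst.aemeasurable
  have h0 := (measurePreserving_init (lam := lam) (G := G) ν (φ := Prod.fst) measurable_fst).prod
    (MeasurePreserving.id (expMeasure θ))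
  have h1 : MeasurePreserving (fun p : Input × ℝ => (p.1.1.1, ((p.1.2.1, newServ p.1), p.2)))
      (abelLaw lam G ν θ) (N.prod ((seqLaw lam G).prod (expMeasure θ))) :=
    (measurePreserving_prodAssoc N (seqLaw lam G) (expMeasure θ)).comp h0
  have key : ∀ F : ℕ → ℝ, Measurable F →
      ∀ H : ((ℕ → ℝ) × (ℕ → ℝ)) × ℝ → ℝ, Measurable H →
      ∫ p, F p.1.1.1 * H ((p.1.2.1, newServ p.1), p.2) ∂(abelLaw lam G ν θ) =
      (∫ n, F n ∂N) * ∫ z, H z ∂((seqLaw lam G).prod (expMeasure θ)) := fun F hF H hH => by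
    rw [← integral_prod_mul, ← h1.map_eq, integral_map h1.measurable.aemeasurable
      (Measurable.aestronglyMeasurable (by fun_prop))]
  have k2 := key (fun _ => 1) measurable_const H hH
  simp only [one_mul, integral_const, probReal_univ, smul_eq_mul] at k2
  rw [key F hF H hH, k2, hN, initLaw, Measure.map_map measurable_fst measurable_initPair,
    integral_map (by fun_prop) hF.aestronglyMeasurable]
  rfl

end transfer

/-! ### Moments at an independent exponential time -/

/-- Cauchy-Schwarz, from the discriminant of the nonnegative quadratic `x ↦ ∫ (x * f + h) ^ 2`. -/
lemma sq_integral_mul_le {Ω : Type*} [MeasurableSpace Ω] {M : Measure Ω} {f h : Ω → ℝ}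
    (hf : MemLp f 2 M) (hh : MemLp h 2 M) :
    (∫ x, f x * h x ∂M) ^ 2 ≤ (∫ x, f x ^ 2 ∂M) * ∫ x, h x ^ 2 ∂M := by
  have i1 : Integrable (fun x => f x ^ 2) M := hf.integrable_sq
  have i2 : Integrable (fun x => h x ^ 2) M := hh.integrable_sq
  have i3 : Integrable (fun x => f x * h x) M := hf.integrable_mul hh
  have key : ∀ x : ℝ, 0 ≤ (∫ x, f x ^ 2 ∂M) * (x * x) + (2 * ∫ x, f x * h x ∂M) * x +
      ∫ x, h x ^ 2 ∂M := fun x => by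
    have e : ∫ y, (x * f y + h y) ^ 2 ∂M = (∫ x, f x ^ 2 ∂M) * (x * x) +
        (2 * ∫ x, f x * h x ∂M) * x + ∫ x, h x ^ 2 ∂M := by
      have e1 : ∀ y, (x * f y + h y) ^ 2 = x * x * f y ^ 2 + 2 * x * (f y * h y) + h y ^ 2 :=
        fun y => by ring
      have j1 : Integrable (fun y => x * x * f y ^ 2) M := i1.const_mul _
      have j2 : Integrable (fun y => 2 * x * (f y * h y)) M := i3.const_mul _
      have j3 : Integrable (fun y => x * x * f y ^ 2 + 2 * x * (f y * h y)) M := j1.add j2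
      simp_rw [e1]
      rw [integral_add j3 i2, integral_add j1 j2, integral_const_mul, integral_const_mul]
      ring
    rw [← e]
    exact integral_nonneg fun y => sq_nonneg _
  have := discrim_le_zero key
  rw [discrim] at this
  linarith

lemma tendsto_integral_mul_zero {Ω ι : Type*} [MeasurableSpace Ω] {M : ι → Measure Ω}
    {f h : Ω → ℝ} {l : Filter ι} {c : ℝ} (hf : ∀ᶠ i in l, MemLp f 2 (M i))
    (hh : ∀ᶠ i in l, MemLp h 2 (M i)) (h1 : Tendsto (fun i => ∫ x, f x ^ 2 ∂(M i)) l (𝓝 0))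
    (h2 : Tendsto (fun i => ∫ x, h x ^ 2 ∂(M i)) l (𝓝 c)) :
    Tendsto (fun i => ∫ x, f x * h x ∂(M i)) l (𝓝 0) := by
  have hs := (h1.mul h2).sqrt
  rw [zero_mul, Real.sqrt_zero] at hs
  refine squeeze_zero_norm' ?_ hs
  filter_upwards [hf, hh] with i hi hi'
  exact Real.abs_le_sqrt (sq_integral_mul_le hi hi')

/-- Initial number of customers. -/
def atNumber (p : Input × ℝ) : ℝ := p.1.1.1
/-- Number of arrivals so far. -/
def atArrivals (p : Input × ℝ) : ℝ := arrivals p.1.2.1 p.2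
/-- Number of customers present. -/
def atQueue (p : Input × ℝ) : ℝ := queueLength p.1 p.2
/-- Number of initial customers present. -/
def atOld (p : Input × ℝ) : ℝ := oldQueue p.1 p.2
/-- Number of later customers present. -/
def atNew (p : Input × ℝ) : ℝ := newQueue (initialWork p.1) p.1.2.1 (newServ p.1) p.2
/-- Number of customers that would be present if the queue had been empty initially. -/
def atEmpty (p : Input × ℝ) : ℝ := newQueue 0 p.1.2.1 (newServ p.1) p.2

@[fun_prop]
lemma measurable_atArrivals : Measurable atArrivals :=
  (measurable_from_nat (f := fun n : ℕ => (n : ℝ))).comp (measurable_arrivals.comp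
    (f := fun p : Input × ℝ => (p.1.2.1, p.2)) (by fun_prop))

@[fun_prop]
lemma measurable_atQueue : Measurable atQueue :=
  (measurable_from_nat (f := fun n : ℕ => (n : ℝ))).comp measurable_queueLength

@[fun_prop]
lemma measurable_atOld : Measurable atOld :=
  (measurable_from_nat (f := fun n : ℕ => (n : ℝ))).comp measurable_oldQueue

@[fun_prop]
lemma measurable_atNew : Measurable atNew :=
  (measurable_from_nat (f := fun n : ℕ => (n : ℝ))).comp (measurable_newQueue.comp
    (f := fun p : Input × ℝ => ((initialWork p.1, p.1.2.1, newServ p.1), p.2)) (by fun_prop))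

@[fun_prop]
lemma measurable_atEmpty : Measurable atEmpty :=
  (measurable_from_nat (f := fun n : ℕ => (n : ℝ))).comp (measurable_newQueue.comp
    (f := fun p : Input × ℝ => (((0 : ℝ), p.1.2.1, newServ p.1), p.2)) (by fun_prop))

lemma atNumber_nonneg (p : Input × ℝ) : 0 ≤ atNumber p := Nat.cast_nonneg _
lemma atArrivals_nonneg (p : Input × ℝ) : 0 ≤ atArrivals p := Nat.cast_nonneg _
lemma atQueue_nonneg (p : Input × ℝ) : 0 ≤ atQueue p := Nat.cast_nonneg _
lemma atOld_nonneg (p : Input × ℝ) : 0 ≤ atOld p := Nat.cast_nonneg _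
lemma atNew_nonneg (p : Input × ℝ) : 0 ≤ atNew p := Nat.cast_nonneg _
lemma atEmpty_nonneg (p : Input × ℝ) : 0 ≤ atEmpty p := Nat.cast_nonneg _
lemma atOld_le (p : Input × ℝ) : atOld p ≤ atNumber p := Nat.cast_le.2 (oldQueue_le _ _)

lemma Good.departureTime_nonneg {ω : Input} (h : Good ω) (hr : 0 ≤ ω.1.2) (n : ℕ) :
    0 ≤ departureTime ω n := by
  refine le_trans ?_ (h.dep_mono (Nat.zero_le n))
  rw [departureTime]
  refine add_nonneg ?_ ?_
  · rw [entryTime]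
    split_ifs
    · exact le_rfl
    · exact h.arr.nonneg _
  · rw [serviceTime]
    split_ifs
    · exact hr
    · exact h.serv _

lemma Good.initialWork_nonneg {ω : Input} (h : Good ω) (hr : 0 ≤ ω.1.2) : 0 ≤ initialWork ω := by
  rw [initialWork]
  split_ifs
  · exact le_rfl
  · exact h.departureTime_nonneg hr _

/-- Relations between the numbers of customers that hold almost surely. -/
structure Split (p : Input × ℝ) : Prop where
  good : Good p.1
  pos : 0 < p.2
  work : 0 ≤ initialWork p.1

namespace Split
variable {p : Input × ℝ} (h : Split p)
include h

lemma queue : atQueue p = atOld p + atNew p := by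
  rw [atQueue, h.good.queueLength_eq_add h.pos.le, Nat.cast_add]; rfl

lemma old_eq_zero (hw : initialWork p.1 ≤ p.2) : atOld p = 0 := by
  rw [atOld, h.good.oldQueue_eq_zero hw, Nat.cast_zero]

lemma empty_le : atEmpty p ≤ atNew p := Nat.cast_le.2 (h.good.arr.newQueue_mono h.work _ _)

lemma new_le : atNew p ≤ atArrivals p := Nat.cast_le.2 (h.good.arr.newQueue_le_arrivals _ _ _)

lemma queue_le : atQueue p ≤ atNumber p + atArrivals p := by
  rw [h.queue]; exact add_le_add (atOld_le p) h.new_le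

lemma departures : (departures p.1 p.2 : ℝ) = atNumber p + atArrivals p - atQueue p := by
  have := h.good.queueLength_add h.pos.le
  rw [atNumber, atArrivals, atQueue, ← Nat.cast_add, ← this]; push_cast; ring

end Split

section moments

variable [Fact (0 < lam)] [IsProbabilityMeasure G] (hG : ∀ᵐ x ∂G, 0 ≤ x)
    (ν : Measure State) [IsProbabilityMeasure ν] {θ : ℝ} [Fact (0 < θ)]

instance : IsProbabilityMeasure (abelLaw lam G ν θ) := by unfold abelLaw; infer_instance

section
include hG

lemma ae_initialWork (hr : ∀ᵐ s ∂ν, 0 ≤ s.2) :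
    ∀ᵐ ω ∂(law lam G ν), Good ω ∧ 0 ≤ initialWork ω := by
  have := isProbabilityMeasure_expMeasure (Fact.out : 0 < lam)
  have h1 : ∀ᵐ ω ∂(law lam G ν), 0 ≤ ω.1.2 := Measure.quasiMeasurePreserving_fst.ae hr
  filter_upwards [ae_good Fact.out hG ν, h1] with ω h h'
    using ⟨h, h.initialWork_nonneg h'⟩

omit [Fact (0 < θ)] in
lemma ae_split (hr : ∀ᵐ s ∂ν, 0 ≤ s.2) : ∀ᵐ p ∂(abelLaw lam G ν θ), Split p := by
  filter_upwards [Measure.quasiMeasurePreserving_fst.ae (ae_initialWork hG ν hr),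
    Measure.quasiMeasurePreserving_snd.ae (ae_expMeasure_pos θ)] with p h1 h2
    using ⟨h1.1, h2, h1.2⟩
end

lemma measurePreserving_arr :
    MeasurePreserving (fun ω : Input => ω.2.1) (law lam G ν) (iid (expMeasure lam)) := by
  have := isProbabilityMeasure_expMeasure (Fact.out : 0 < lam)
  exact measurePreserving_fst.comp measurePreserving_snd

lemma lintegral_abelLaw_arr {F : (ℕ → ℝ) × ℝ → ℝ≥0∞} (hF : Measurable F) :
    ∫⁻ p, F (p.1.2.1, p.2) ∂(abelLaw lam G ν θ) =
      ∫⁻ t, ∫⁻ a, F (a, t) ∂(iid (expMeasure lam)) ∂(expMeasure θ) := by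
  have := isProbabilityMeasure_expMeasure (Fact.out : 0 < lam)
  have h := (measurePreserving_arr (lam := lam) (G := G) ν).prod
    (MeasurePreserving.id (expMeasure θ))
  rw [← lintegral_prod_symm' _ hF, ← h.lintegral_comp hF]
  rfl

lemma integral_time (n : ℕ) : Integrable (fun p : Input × ℝ => p.2 ^ n) (abelLaw lam G ν θ) ∧
    ∫ p, p.2 ^ n ∂(abelLaw lam G ν θ) = n.factorial / θ ^ n := by
  have h : MeasurePreserving (Prod.snd : Input × ℝ → ℝ) (abelLaw lam G ν θ) (expMeasure θ) :=
    measurePreserving_snd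
  have hm : AEStronglyMeasurable (fun t : ℝ => t ^ n) ((abelLaw lam G ν θ).map Prod.snd) :=
    Measurable.aestronglyMeasurable (by fun_prop)
  have hθ : 0 < θ := Fact.out
  constructor
  · have := (integrable_map_measure hm measurable_snd.aemeasurable).1
      (by rw [h.map_eq]; exact integrable_pow_expMeasure hθ n)
    exact this
  · rw [← integral_pow_expMeasure hθ, ← h.map_eq, integral_map measurable_snd.aemeasurable hm]

lemma integral_arrivals_sq : Integrable (fun p => atArrivals p ^ 2) (abelLaw lam G ν θ) ∧
    ∫ p, atArrivals p ^ 2 ∂(abelLaw lam G ν θ) = 2 * lam ^ 2 / θ ^ 2 + lam / θ := by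
  have hl : 0 < lam := Fact.out
  have hθ : 0 < θ := Fact.out
  have hm : Measurable fun q : (ℕ → ℝ) × ℝ => (arrivals q.1 q.2 : ℝ≥0∞) ^ 2 :=
    ((measurable_from_nat (f := fun n : ℕ => (n : ℝ≥0∞))).comp measurable_arrivals).pow_const 2
  have h := integral_eq_of_lintegral_ofReal (M := abelLaw lam G ν θ) (N := expMeasure θ)
    (f := fun p => atArrivals p ^ 2) (h := fun _ => 2 * lam ^ 2 / θ ^ 2 + lam / θ) (by fun_prop)
    (ae_of_all _ fun p => sq_nonneg _) (integrable_const _) (ae_of_all _ fun _ => by positivity) ?_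
  · exact ⟨h.1, h.2.trans (by simp)⟩
  · rw [lintegral_const, measure_univ, mul_one,
      ← lintegral_abel_arrivals_sq hl hθ, ← lintegral_abelLaw_arr (lam := lam) (G := G) ν hm]
    refine lintegral_congr fun p => ?_
    rw [atArrivals, ENNReal.ofReal_pow (Nat.cast_nonneg _), ENNReal.ofReal_natCast]

lemma integral_time_mul_arrivals (n : ℕ) :
    Integrable (fun p => p.2 ^ n * atArrivals p) (abelLaw lam G ν θ) ∧
    ∫ p, p.2 ^ n * atArrivals p ∂(abelLaw lam G ν θ) =
      lam * ((n + 1).factorial / θ ^ (n + 1)) := by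
  have hl : 0 < lam := Fact.out
  have hθ : 0 < θ := Fact.out
  have hm' : Measurable fun q : (ℕ → ℝ) × ℝ => (arrivals q.1 q.2 : ℝ≥0∞) :=
    ((measurable_from_nat (f := fun n : ℕ => (n : ℝ≥0∞))).comp measurable_arrivals)
  have hm : Measurable fun q : (ℕ → ℝ) × ℝ => ENNReal.ofReal (q.2 ^ n) *
      (arrivals q.1 q.2 : ℝ≥0∞) := Measurable.mul (by fun_prop) hm'
  have hp : ∀ᵐ p ∂(abelLaw lam G ν θ), 0 < p.2 :=
    Measure.quasiMeasurePreserving_snd.ae (ae_expMeasure_pos θ)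
  have h := integral_eq_of_lintegral_ofReal (M := abelLaw lam G ν θ) (N := expMeasure θ)
    (f := fun p => p.2 ^ n * atArrivals p) (h := fun t => lam * t ^ (n + 1)) (by fun_prop) ?_
    ((integrable_pow_expMeasure hθ (n + 1)).const_mul lam) ?_ ?_
  · refine ⟨h.1, h.2.trans ?_⟩
    rw [integral_const_mul, integral_pow_expMeasure hθ]
  · filter_upwards [hp] with p hp
    exact mul_nonneg (by positivity) (Nat.cast_nonneg _)
  · filter_upwards [ae_expMeasure_pos θ] with t ht
    positivity
  · have e : ∫⁻ p, ENNReal.ofReal (p.2 ^ n * atArrivals p) ∂(abelLaw lam G ν θ) =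
        ∫⁻ p, ENNReal.ofReal (p.2 ^ n) * (arrivals p.1.2.1 p.2 : ℝ≥0∞) ∂(abelLaw lam G ν θ) := by
      refine lintegral_congr_ae ?_
      filter_upwards [hp] with p hp
      rw [ENNReal.ofReal_mul (by positivity), atArrivals, ENNReal.ofReal_natCast]
    rw [e, lintegral_abelLaw_arr ν hm]
    refine lintegral_congr_ae ?_
    filter_upwards [ae_expMeasure_pos θ] with t ht
    have hmt : Measurable fun a : ℕ → ℝ => (arrivals a t : ℝ≥0∞) :=
      hm'.comp (f := fun a : ℕ → ℝ => (a, t)) (by fun_prop)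
    rw [lintegral_const_mul _ hmt, lintegral_arrivals hl ht.le, ← ENNReal.ofReal_mul (by positivity)]
    congr 1; ring

/-- Centred number of arrivals. -/
def atDev (lam : ℝ) (p : Input × ℝ) : ℝ := atArrivals p - lam * p.2

lemma memLp_arrivals : MemLp atArrivals 2 (abelLaw lam G ν θ) :=
  (memLp_two_iff_integrable_sq (by fun_prop)).2 (integral_arrivals_sq ν).1

lemma memLp_dev : MemLp (atDev lam) 2 (abelLaw lam G ν θ) :=
  (memLp_arrivals ν).sub (((memLp_two_iff_integrable_sq (by fun_prop)).2
    (integral_time ν 2).1).const_mul lam)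

lemma integral_dev : ∫ p, atDev lam p ∂(abelLaw lam G ν θ) = 0 := by
  have h1 := integral_time_mul_arrivals (lam := lam) (G := G) (θ := θ) ν 0
  have h2 := integral_time (lam := lam) (G := G) (θ := θ) ν 1
  simp only [pow_zero, one_mul, pow_one, zero_add, Nat.factorial_one] at h1 h2
  unfold atDev
  rw [integral_sub h1.1 (h2.1.const_mul lam), integral_const_mul, h1.2, h2.2, sub_self]

/-- The only part of the averaged variance curve that diverges as the rate vanishes; it is the
average of the linear term `lam * t`. -/
lemma integral_dev_sq : ∫ p, atDev lam p ^ 2 ∂(abelLaw lam G ν θ) = lam / θ := by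
  have hθ : 0 < θ := Fact.out
  have h0 := integral_arrivals_sq (lam := lam) (G := G) (θ := θ) ν
  have h1 := integral_time_mul_arrivals (lam := lam) (G := G) (θ := θ) ν 1
  have h2 := integral_time (lam := lam) (G := G) (θ := θ) ν 2
  simp only [pow_one] at h1
  have e : ∀ p, atDev lam p ^ 2 = atArrivals p ^ 2 - 2 * lam * (p.2 * atArrivals p) +
      lam ^ 2 * p.2 ^ 2 := fun p => by rw [atDev]; ring
  have i1 : Integrable (fun p => 2 * lam * (p.2 * atArrivals p)) (abelLaw lam G ν θ) :=
    h1.1.const_mul _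
  have i2 : Integrable (fun p => lam ^ 2 * p.2 ^ 2) (abelLaw lam G ν θ) := h2.1.const_mul _
  have i3 : Integrable (fun p => atArrivals p ^ 2 - 2 * lam * (p.2 * atArrivals p))
    (abelLaw lam G ν θ) := h0.1.sub i1
  simp_rw [e]
  rw [integral_add i3 i2, integral_sub h0.1 i1, integral_const_mul, integral_const_mul, h0.2, h1.2,
    h2.2]
  simp only [Nat.factorial, Nat.cast_succ, Nat.cast_zero]
  field_simp
  ring

/-! ### Square integrability -/

variable (hr : ∀ᵐ s ∂ν, 0 ≤ s.2) (hq : MemLp (fun s : State => (s.1 : ℝ)) 2 ν)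

omit [IsProbabilityMeasure ν] in
lemma measurePreserving_number :
    MeasurePreserving (fun p : Input × ℝ => p.1.1) (abelLaw lam G ν θ) ν := by
  have := isProbabilityMeasure_expMeasure (Fact.out : 0 < lam)
  have h1 : MeasurePreserving (Prod.fst : Input → State) (law lam G ν) ν := by
    unfold law; exact measurePreserving_fst
  have h2 : MeasurePreserving (Prod.fst : Input × ℝ → Input) (abelLaw lam G ν θ) (law lam G ν) :=
    measurePreserving_fst
  exact h1.comp h2

omit [IsProbabilityMeasure ν] in
include hq in
lemma memLp_number : MemLp atNumber 2 (abelLaw lam G ν θ) :=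
  hq.comp_measurePreserving (measurePreserving_number ν)

lemma memLp_empty (hG : ∀ᵐ x ∂G, 0 ≤ x) (hr : ∀ᵐ s ∂ν, 0 ≤ s.2) :
    MemLp atEmpty 2 (abelLaw lam G ν θ) := by
  refine (memLp_arrivals ν).mono (by fun_prop) ?_
  filter_upwards [ae_split hG ν hr] with p hp
  rw [Real.norm_of_nonneg (atEmpty_nonneg p), Real.norm_of_nonneg (atArrivals_nonneg p)]
  exact hp.empty_le.trans hp.new_le

lemma memLp_new (hG : ∀ᵐ x ∂G, 0 ≤ x) (hr : ∀ᵐ s ∂ν, 0 ≤ s.2) :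
    MemLp atNew 2 (abelLaw lam G ν θ) := by
  refine (memLp_arrivals ν).mono (by fun_prop) ?_
  filter_upwards [ae_split hG ν hr] with p hp
  rw [Real.norm_of_nonneg (atNew_nonneg p), Real.norm_of_nonneg (atArrivals_nonneg p)]
  exact hp.new_le

omit [IsProbabilityMeasure ν] in
include hq in
lemma memLp_old : MemLp atOld 2 (abelLaw lam G ν θ) := by
  refine (memLp_number ν hq).mono (by fun_prop) (ae_of_all _ fun p => ?_)
  rw [Real.norm_of_nonneg (atOld_nonneg p), Real.norm_of_nonneg (atNumber_nonneg p)]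
  exact atOld_le p

include hq in
lemma memLp_queue (hG : ∀ᵐ x ∂G, 0 ≤ x) (hr : ∀ᵐ s ∂ν, 0 ≤ s.2) :
    MemLp atQueue 2 (abelLaw lam G ν θ) := by
  refine MemLp.ae_eq ?_ ((memLp_old ν hq).add (memLp_new ν hG hr))
  filter_upwards [ae_split hG ν hr] with p hp
  rw [hp.queue]; rfl

end moments

/-! ### Limits of moments at an exponential time of vanishing rate -/

/-- The second moment increases with time, so its value at `w` times the tail `exp (-(θ * w))` is at
most the exponential average. The rate `1 / (1 + w)` makes the loss at most `exp 1` and gives a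
bound quadratic in `w`, as required for work with two moments. -/
lemma lintegral_arrivals_sq_le (hlam : 0 < lam) {w : ℝ} (hw : 0 ≤ w) :
    ∫⁻ a, (arrivals a w : ℝ≥0∞) ^ 2 ∂(iid (expMeasure lam)) ≤
      ENNReal.ofReal (Real.exp 1 * (2 * lam ^ 2 * (1 + w) ^ 2 + lam * (1 + w))) := by
  have hθ : 0 < 1 / (1 + w) := by positivity
  have := isProbabilityMeasure_expMeasure hθ
  set θ := 1 / (1 + w) with hθd
  set H : ℝ → ℝ≥0∞ := fun t => ∫⁻ a, (arrivals a t : ℝ≥0∞) ^ 2 ∂(iid (expMeasure lam)) with hH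
  have h1 := lintegral_abel_arrivals_sq hlam hθ
  have h2 := lintegral_expMeasure_memoryless (r := θ) hw (f := fun _ => H w) measurable_const
  rw [lintegral_const, measure_univ, mul_one] at h2
  have h3 : ENNReal.ofReal (Real.exp (-(θ * w))) * H w ≤
      ENNReal.ofReal (2 * lam ^ 2 / θ ^ 2 + lam / θ) := by
    rw [← h2, ← h1]
    refine lintegral_mono fun t => ?_
    by_cases ht : w < t
    · rw [Set.indicator_of_mem (Set.mem_Ioi.2 ht)]
      refine lintegral_mono_ae ?_
      filter_upwards [ae_goodArr hlam] with a ha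
      have := ha.arrivals_mono ht.le
      gcongr
    · rw [Set.indicator_of_notMem (fun h => ht (Set.mem_Ioi.1 h))]
      exact zero_le
  have h4 : θ * w ≤ 1 := by rw [hθd, div_mul_eq_mul_div, one_mul, div_le_one (by positivity)]; linarith
  calc H w = ENNReal.ofReal (Real.exp (θ * w)) * (ENNReal.ofReal (Real.exp (-(θ * w))) * H w) := by
        rw [← mul_assoc, ← ENNReal.ofReal_mul (Real.exp_nonneg _), ← Real.exp_add]; simp
    _ ≤ ENNReal.ofReal (Real.exp 1) * ENNReal.ofReal (2 * lam ^ 2 / θ ^ 2 + lam / θ) := by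
        gcongr
    _ = _ := by
        rw [← ENNReal.ofReal_mul (Real.exp_nonneg _), hθd]
        congr 2
        field_simp

lemma integral_comp_measurePreserving {α β : Type*} [MeasurableSpace α] [MeasurableSpace β]
    {M : Measure α} {N : Measure β} {f : α → β} (h : MeasurePreserving f M N) {k : β → ℝ}
    (hk : Measurable k) : ∫ x, k (f x) ∂M = ∫ y, k y ∂N := by
  rw [← h.map_eq, integral_map h.measurable.aemeasurable hk.aestronglyMeasurable]

lemma tendsto_expMeasure_Iio (w : ℝ) :
    Tendsto (fun θ => (expMeasure θ).real (Set.Iio w)) (𝓝[>] 0) (𝓝 0) := by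
  have h : Tendsto (fun θ : ℝ => |1 - Real.exp (-(θ * w))|) (𝓝[>] 0) (𝓝 0) := by
    have : Continuous fun θ : ℝ => |1 - Real.exp (-(θ * w))| := by fun_prop
    have := this.tendsto 0
    simp only [zero_mul, neg_zero, Real.exp_zero, sub_self, abs_zero] at this
    exact this.mono_left nhdsWithin_le_nhds
  refine squeeze_zero' (Eventually.of_forall fun θ => measureReal_nonneg) ?_ h
  filter_upwards [eventually_pos_right] with θ hθ
  have := isProbabilityMeasure_expMeasure hθ
  refine (measureReal_mono Set.Iio_subset_Iic_self).trans ?_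
  rw [← cdf_eq_real, cdf_expMeasure_eq hθ]
  split_ifs
  · exact le_abs_self _
  · exact abs_nonneg _

lemma eventually_fact [Fact (0 < lam)] [IsProbabilityMeasure G] (hG : ∀ᵐ x ∂G, 0 ≤ x)
    (h1 : Integrable (fun x => x) G) (hrho : lam * ∫ x, x ∂G < 1) :
    ∀ᶠ χ in 𝓝[>] (0 : ℝ), Fact (0 < eta lam G χ) := by
  filter_upwards [eventually_pos_right] with χ hχ
  exact ⟨eta_pos Fact.out hG h1 hrho hχ⟩

section limits

variable [Fact (0 < lam)] [IsProbabilityMeasure G] (ν : Measure State) [IsProbabilityMeasure ν]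

/-- Functionals of the initial state and the path lose their influence once the initial work has
been done. -/
lemma tendsto_tail {X : Input → ℝ} (hm : Measurable X) (hX : Integrable X (law lam G ν)) :
    Tendsto (fun θ => ∫ p, Set.indicator {p : Input × ℝ | p.2 < initialWork p.1}
      (fun p => X p.1) p ∂(abelLaw lam G ν θ)) (𝓝[>] 0) (𝓝 0) := by
  have hS : MeasurableSet {p : Input × ℝ | p.2 < initialWork p.1} :=
    measurableSet_lt (by fun_prop) (by fun_prop)
  have hi : Measurable (Set.indicator {p : Input × ℝ | p.2 < initialWork p.1}
    fun p => X p.1) := (hm.comp measurable_fst).indicator hS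
  have hin : ∀ (θ : ℝ) (ω : Input), ∫ t, Set.indicator {p : Input × ℝ | p.2 < initialWork p.1}
      (fun p => X p.1) (ω, t) ∂(expMeasure θ) =
        (expMeasure θ).real (Set.Iio (initialWork ω)) * X ω := fun θ ω => by
    have : (fun t => Set.indicator {p : Input × ℝ | p.2 < initialWork p.1} (fun p => X p.1) (ω, t))
        = Set.indicator (Set.Iio (initialWork ω)) fun _ => X ω := by
      ext t
      by_cases ht : t < initialWork ω
      · rw [Set.indicator_of_mem (show (ω, t) ∈ {p : Input × ℝ | p.2 < initialWork p.1} from ht),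
          Set.indicator_of_mem (Set.mem_Iio.2 ht)]
      · rw [Set.indicator_of_notMem
          (show (ω, t) ∉ {p : Input × ℝ | p.2 < initialWork p.1} from ht),
          Set.indicator_of_notMem (fun h => ht (Set.mem_Iio.1 h))]
    rw [this, integral_indicator measurableSet_Iio, setIntegral_const, smul_eq_mul]
  -- Given the input, an exponential time of vanishing rate falls below the initial work with
  -- vanishing probability; `|X|` dominates.
  have hlim : Tendsto (fun θ => ∫ ω, (expMeasure θ).real (Set.Iio (initialWork ω)) * X ω
      ∂(law lam G ν)) (𝓝[>] 0) (𝓝 (∫ _, 0 ∂(law lam G ν))) := by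
    refine tendsto_integral_filter_of_dominated_convergence (fun ω => |X ω|) ?_ ?_ hX.abs ?_
    · filter_upwards [eventually_pos_right] with θ hθ
      have := isProbabilityMeasure_expMeasure hθ
      simp_rw [← hin]
      exact (StronglyMeasurable.integral_prod_right' hi.stronglyMeasurable).aestronglyMeasurable
    · filter_upwards [eventually_pos_right] with θ hθ
      have := isProbabilityMeasure_expMeasure hθ
      refine ae_of_all _ fun ω => ?_
      rw [Real.norm_eq_abs, abs_mul, abs_of_nonneg measureReal_nonneg]
      exact mul_le_of_le_one_left (abs_nonneg _) measureReal_le_one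
    · refine ae_of_all _ fun ω => ?_
      simpa using (tendsto_expMeasure_Iio (initialWork ω)).mul_const (X ω)
  rw [integral_zero] at hlim
  refine hlim.congr' ?_
  filter_upwards [eventually_pos_right] with θ hθ
  have : Fact (0 < θ) := ⟨hθ⟩
  have hX' : Integrable (fun p : Input × ℝ => X p.1) (abelLaw lam G ν θ) := by
    have h : MeasurePreserving (Prod.fst : Input × ℝ → Input) (abelLaw lam G ν θ) (law lam G ν) :=
      measurePreserving_fst
    exact h.integrable_comp_of_integrable hX
  have hX'' := hX'.indicator hS
  unfold abelLaw at hX'' ⊢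
  rw [integral_prod _ hX'']
  simp_rw [hin]

variable (hG : ∀ᵐ x ∂G, 0 ≤ x) (h1 : Integrable (fun x => x) G)
    (h2 : Integrable (fun x => x ^ 2) G) (h3 : Integrable (fun x => x ^ 3) G)
    (hg : 0 < ∫ x, x ∂G) (hrho : lam * ∫ x, x ∂G < 1)
    (hr : ∀ᵐ s ∂ν, 0 ≤ s.2) (hq : MemLp (fun s : State => (s.1 : ℝ)) 2 ν)
    (hW : MemLp initialWork 2 (law lam G ν))

section
include hG hr
lemma ae_workLaw : ∀ᵐ w ∂(workLaw lam G ν), 0 ≤ w := by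
  rw [workLaw, ae_map_iff measurable_initialWork.aemeasurable measurableSet_Ici]
  filter_upwards [ae_initialWork hG ν hr] with ω hω using hω.2
end

section
include hW
lemma integrable_workLaw : Integrable (fun w => w) (workLaw lam G ν) := by
  rw [workLaw, integrable_map_measure (by fun_prop) measurable_initialWork.aemeasurable]
  exact hW.integrable one_le_two

omit [Fact (0 < lam)] [IsProbabilityMeasure G] [IsProbabilityMeasure ν] in
lemma integrable_sq_workLaw : Integrable (fun w => w ^ 2) (workLaw lam G ν) := by
  rw [workLaw, integrable_map_measure (by fun_prop) measurable_initialWork.aemeasurable]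
  exact hW.integrable_sq
end

include hG hr hW in
/-- The number of arrivals during the initial work is square integrable. -/
lemma memLp_arrivals_initialWork :
    MemLp (fun ω => (arrivals ω.2.1 (initialWork ω) : ℝ)) 2 (law lam G ν) := by
  have hl : 0 < lam := Fact.out
  have hm : Measurable fun z : ℝ × (ℕ → ℝ) × (ℕ → ℝ) => (arrivals z.2.1 z.1 : ℝ≥0∞) ^ 2 :=
    ((measurable_from_nat (f := fun n : ℕ => (n : ℝ≥0∞))).comp (measurable_arrivals.comp
      (f := fun z : ℝ × (ℕ → ℝ) × (ℕ → ℝ) => (z.2.1, z.1)) (by fun_prop))).pow_const 2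
  have hm' : Measurable fun ω : Input => (arrivals ω.2.1 (initialWork ω) : ℝ) :=
    (measurable_from_nat (f := fun n : ℕ => (n : ℝ))).comp (measurable_arrivals.comp
      (f := fun ω : Input => (ω.2.1, initialWork ω)) (by fun_prop))
  have h := measurePreserving_init (lam := lam) (G := G) ν (φ := Prod.snd) measurable_snd
  have e : (initLaw lam G ν).map Prod.snd = workLaw lam G ν := by
    rw [initLaw, Measure.map_map measurable_snd measurable_initPair]; rfl
  rw [e] at h
  rw [memLp_two_iff_integrable_sq hm'.aestronglyMeasurable]
  refine ⟨(hm'.pow_const 2).aestronglyMeasurable, ?_⟩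
  rw [hasFiniteIntegral_iff_ofReal (ae_of_all _ fun ω => sq_nonneg _)]
  have e2 : ∀ ω : Input, ENNReal.ofReal ((arrivals ω.2.1 (initialWork ω) : ℝ) ^ 2) =
      (arrivals ω.2.1 (initialWork ω) : ℝ≥0∞) ^ 2 := fun ω => by
    rw [ENNReal.ofReal_pow (Nat.cast_nonneg _), ENNReal.ofReal_natCast]
  simp_rw [e2]
  have e3 := h.lintegral_comp hm
  rw [e3, lintegral_prod _ hm.aemeasurable]
  have hfin : Integrable (fun w => Real.exp 1 * (2 * lam ^ 2 * (1 + w) ^ 2 + lam * (1 + w)))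
      (workLaw lam G ν) := by
    have i1 := integrable_workLaw ν hW
    have i2 := integrable_sq_workLaw ν hW
    have : (fun w : ℝ => Real.exp 1 * (2 * lam ^ 2 * (1 + w) ^ 2 + lam * (1 + w))) =
        fun w => Real.exp 1 * ((2 * lam ^ 2 + lam) + (4 * lam ^ 2 + lam) * w +
          2 * lam ^ 2 * w ^ 2) := by ext w; ring
    rw [this]
    exact (((integrable_const _).add (i1.const_mul _)).add (i2.const_mul _)).const_mul _
  refine lt_of_le_of_lt (lintegral_mono_ae ?_) hfin.lintegral_lt_top
  filter_upwards [ae_workLaw ν hG hr] with w hw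
  refine le_trans (le_of_eq ?_) (lintegral_arrivals_sq_le hl hw)
  have e4 := lintegral_seqLaw (lam := lam) (G := G) hl
    (hm.comp (f := fun z : (ℕ → ℝ) × (ℕ → ℝ) => (w, z)) (by fun_prop))
  simp only [Function.comp_apply, lintegral_const, measure_univ, mul_one] at e4
  exact e4

/-! #### Later customers -/

section later
include hG h1 h2 h3 hg hrho hr

omit hr in
lemma tendsto_empty : Tendsto (fun χ => ∫ p, atEmpty p ∂(abelLaw lam G ν (eta lam G χ)))
    (𝓝[>] 0) (𝓝 (meanQueue lam G)) := by
  have hl : 0 < lam := Fact.out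
  have hδ : ∀ᵐ w ∂(Measure.dirac (0 : ℝ)), 0 ≤ w := by simp
  refine (tendsto_occB_sub hl hG h1 h2 h3 hg hrho (Measure.dirac 0) hδ
    (integrable_dirac (by simp)) (integrable_dirac (by simp))).congr' ?_
  filter_upwards [eventually_fact hG h1 hrho] with χ hχ
  rw [← (abel_newQueue hl hG _ hδ hχ.out).2]
  exact (integral_comp_measurePreserving (measurePreserving_empty ν) measurable_abelQueue).symm

omit hr in
lemma tendsto_empty_sq : Tendsto (fun χ => ∫ p, atEmpty p ^ 2 ∂(abelLaw lam G ν (eta lam G χ)))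
    (𝓝[>] 0) (𝓝 (sqQueue lam G)) := by
  have hl : 0 < lam := Fact.out
  have hδ : ∀ᵐ w ∂(Measure.dirac (0 : ℝ)), 0 ≤ w := by simp
  have i1 : Integrable (fun w : ℝ => w) (Measure.dirac 0) := integrable_dirac (by simp)
  have i2 : Integrable (fun w : ℝ => w ^ 2) (Measure.dirac 0) := integrable_dirac (by simp)
  refine ((tendsto_occB_sub hl hG h1 h2 h3 hg hrho _ hδ i1 i2).add
    (tendsto_occD hl hG h1 h2 h3 hg hrho _ hδ i1 i2)).congr' ?_
  filter_upwards [eventually_fact hG h1 hrho] with χ hχ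
  rw [← (abel_newQueue_sq hl hG _ hδ hχ.out).2]
  exact (integral_comp_measurePreserving (measurePreserving_empty ν) (k := fun p => abelQueue p ^ 2)
    (by fun_prop)).symm

include hW

/-- The later customers see a queue that starts with work of law `workLaw lam G ν`. The limit equals
that of `tendsto_empty_sq`, which is what makes the comparison in `tendsto_diff_sq` work. -/
lemma tendsto_new_sq : Tendsto (fun χ => ∫ p, atNew p ^ 2 ∂(abelLaw lam G ν (eta lam G χ)))
    (𝓝[>] 0) (𝓝 (sqQueue lam G)) := by
  have hl : 0 < lam := Fact.out
  have hδ := ae_workLaw (lam := lam) ν hG hr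
  refine ((tendsto_occB_sub hl hG h1 h2 h3 hg hrho _ hδ (integrable_workLaw ν hW)
    (integrable_sq_workLaw ν hW)).add (tendsto_occD hl hG h1 h2 h3 hg hrho _ hδ
    (integrable_workLaw ν hW) (integrable_sq_workLaw ν hW))).congr' ?_
  filter_upwards [eventually_fact hG h1 hrho] with χ hχ
  rw [← (abel_newQueue_sq hl hG _ hδ hχ.out).2]
  exact (integral_comp_measurePreserving (measurePreserving_work ν) (k := fun p => abelQueue p ^ 2)
    (by fun_prop)).symm

lemma tendsto_dev_mul_new : Tendsto (fun χ => ∫ p, atDev lam p * atNew p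
    ∂(abelLaw lam G ν (eta lam G χ))) (𝓝[>] 0) (𝓝 (covQueue lam G)) := by
  have hl : 0 < lam := Fact.out
  have hδ := ae_workLaw (lam := lam) ν hG hr
  refine (tendsto_occC_sub hl hG h1 h2 h3 hg hrho _ hδ (integrable_workLaw ν hW)
    (integrable_sq_workLaw ν hW)).congr' ?_
  filter_upwards [eventually_fact hG h1 hrho] with χ hχ
  rw [← (abel_arrivals_newQueue hl hG _ hδ hχ.out).2]
  exact (integral_comp_measurePreserving (measurePreserving_work ν)
    (k := fun p => (abelArrivals p - lam * p.2) * abelQueue p) (by fun_prop)).symm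

/-! #### Initial customers -/

include hq

-- An initial customer is present only before the initial work is done, so the square is at most the
-- squared initial number on an event whose probability vanishes.
omit hg hW in
lemma tendsto_old_sq : Tendsto (fun χ => ∫ p, atOld p ^ 2 ∂(abelLaw lam G ν (eta lam G χ)))
    (𝓝[>] 0) (𝓝 0) := by
  have hS : MeasurableSet {p : Input × ℝ | p.2 < initialWork p.1} :=
    measurableSet_lt (by fun_prop) (by fun_prop)
  have hm : Measurable fun ω : Input => (ω.1.1 : ℝ) ^ 2 :=
    ((measurable_from_nat (f := fun n : ℕ => (n : ℝ))).comp (by fun_prop :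
      Measurable fun ω : Input => ω.1.1)).pow_const 2
  have := isProbabilityMeasure_expMeasure (Fact.out : 0 < lam)
  have hX : Integrable (fun ω : Input => (ω.1.1 : ℝ) ^ 2) (law lam G ν) := by
    have h : MeasurePreserving (Prod.fst : Input → State) (law lam G ν) ν := by
      unfold law; exact measurePreserving_fst
    exact h.integrable_comp_of_integrable hq.integrable_sq
  have ht := (tendsto_tail ν hm hX).comp (tendsto_eta Fact.out hG h1 h2 h3 hrho)
  refine squeeze_zero' (Eventually.of_forall fun χ => integral_nonneg fun p => sq_nonneg _) ?_ ht
  filter_upwards [eventually_fact hG h1 hrho] with χ hχ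
  refine integral_mono_ae (memLp_old ν hq).integrable_sq
    ((memLp_number ν hq).integrable_sq.indicator hS) ?_
  filter_upwards [ae_split hG ν hr] with p hp
  by_cases hw : p.2 < initialWork p.1
  · rw [Set.indicator_of_mem (show p ∈ {p : Input × ℝ | p.2 < initialWork p.1} from hw)]
    exact pow_le_pow_left₀ (atOld_nonneg p) (atOld_le p) 2
  · rw [Set.indicator_of_notMem (show p ∉ {p : Input × ℝ | p.2 < initialWork p.1} from hw),
      hp.old_eq_zero (not_lt.1 hw)]
    simp

-- As long as initial customers are present, the centred arrival count is at most the number of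
-- arrivals during the initial work plus `lam` times that work. Its product with the initial number
-- is integrable by Cauchy-Schwarz, and `tendsto_tail` applies.
omit hg in
lemma tendsto_dev_mul_old : Tendsto (fun χ => ∫ p, atDev lam p * atOld p
    ∂(abelLaw lam G ν (eta lam G χ))) (𝓝[>] 0) (𝓝 0) := by
  have hl : 0 < lam := Fact.out
  have hS : MeasurableSet {p : Input × ℝ | p.2 < initialWork p.1} :=
    measurableSet_lt (by fun_prop) (by fun_prop)
  have hmq : Measurable fun ω : Input => (ω.1.1 : ℝ) :=
    (measurable_from_nat (f := fun n : ℕ => (n : ℝ))).comp (by fun_prop :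
      Measurable fun ω : Input => ω.1.1)
  have hma : Measurable fun ω : Input => (arrivals ω.2.1 (initialWork ω) : ℝ) :=
    (measurable_from_nat (f := fun n : ℕ => (n : ℝ))).comp (measurable_arrivals.comp
      (f := fun ω : Input => (ω.2.1, initialWork ω)) (by fun_prop))
  have := isProbabilityMeasure_expMeasure hl
  have hq' : MemLp (fun ω : Input => (ω.1.1 : ℝ)) 2 (law lam G ν) := by
    have h : MeasurePreserving (Prod.fst : Input → State) (law lam G ν) ν := by
      unfold law; exact measurePreserving_fst
    exact hq.comp_measurePreserving h
  set X : Input → ℝ := fun ω => ((arrivals ω.2.1 (initialWork ω) : ℝ) + lam * initialWork ω) *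
    ω.1.1 with hXd
  have hmX : Measurable X := (hma.add (measurable_initialWork.const_mul lam)).mul hmq
  have hX : Integrable X (law lam G ν) :=
    ((memLp_arrivals_initialWork ν hG hr hW).add (hW.const_mul lam)).integrable_mul hq'
  have ht := (tendsto_tail ν hmX hX).comp (tendsto_eta hl hG h1 h2 h3 hrho)
  refine squeeze_zero_norm' ?_ ht
  filter_upwards [eventually_fact hG h1 hrho] with χ hχ
  refine (norm_integral_le_integral_norm _).trans ?_
  have hX' : Integrable (fun p : Input × ℝ => X p.1) (abelLaw lam G ν (eta lam G χ)) := by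
    have h : MeasurePreserving (Prod.fst : Input × ℝ → Input) (abelLaw lam G ν (eta lam G χ))
      (law lam G ν) := measurePreserving_fst
    exact h.integrable_comp_of_integrable hX
  refine integral_mono_ae ((memLp_dev ν).integrable_mul (memLp_old ν hq)).norm
    (hX'.indicator hS) ?_
  filter_upwards [ae_split hG ν hr] with p hp
  by_cases hw : p.2 < initialWork p.1
  · rw [Set.indicator_of_mem (show p ∈ {p : Input × ℝ | p.2 < initialWork p.1} from hw),
      Real.norm_eq_abs, abs_mul, abs_of_nonneg (atOld_nonneg p)]
    have ha : atArrivals p ≤ arrivals p.1.2.1 (initialWork p.1) :=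
      Nat.cast_le.2 (hp.good.arr.arrivals_mono hw.le)
    have ha0 := atArrivals_nonneg p
    have hlt := mul_le_mul_of_nonneg_left hw.le hl.le
    have hlp := mul_pos hl hp.pos
    refine mul_le_mul ?_ (atOld_le p) (atOld_nonneg p) (by nlinarith [hp.work])
    rw [atDev, abs_le]
    constructor <;> linarith
  · rw [Set.indicator_of_notMem (show p ∉ {p : Input × ℝ | p.2 < initialWork p.1} from hw),
      hp.old_eq_zero (not_lt.1 hw)]
    simp

/-! #### All customers -/

lemma tendsto_dev_mul_queue : Tendsto (fun χ => ∫ p, atDev lam p * atQueue p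
    ∂(abelLaw lam G ν (eta lam G χ))) (𝓝[>] 0) (𝓝 (covQueue lam G)) := by
  have h := (tendsto_dev_mul_old ν hG h1 h2 h3 hrho hr hq hW).add
    (tendsto_dev_mul_new ν hG h1 h2 h3 hg hrho hr hW)
  rw [zero_add] at h
  refine h.congr' ?_
  filter_upwards [eventually_fact hG h1 hrho] with χ hχ
  have i1 : Integrable (fun p => atDev lam p * atOld p) (abelLaw lam G ν (eta lam G χ)) :=
    (memLp_dev ν).integrable_mul (memLp_old ν hq)
  have i2 : Integrable (fun p => atDev lam p * atNew p) (abelLaw lam G ν (eta lam G χ)) :=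
    (memLp_dev ν).integrable_mul (memLp_new ν hG hr)
  rw [← integral_add i1 i2]
  refine integral_congr_ae ?_
  filter_upwards [ae_split hG ν hr] with p hp
  rw [hp.queue]; ring

lemma tendsto_queue_sq : Tendsto (fun χ => ∫ p, atQueue p ^ 2 ∂(abelLaw lam G ν (eta lam G χ)))
    (𝓝[>] 0) (𝓝 (sqQueue lam G)) := by
  have hF := eventually_fact (lam := lam) hG h1 hrho
  have ho := tendsto_old_sq ν hG h1 h2 h3 hrho hr hq
  have hn := tendsto_new_sq ν hG h1 h2 h3 hg hrho hr hW
  have hon := tendsto_integral_mul_zero (hF.mono fun χ hχ => memLp_old ν hq)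
    (hF.mono fun χ hχ => memLp_new ν hG hr) ho hn
  have h := (ho.add (hon.const_mul 2)).add hn
  rw [mul_zero, add_zero, zero_add] at h
  refine h.congr' ?_
  filter_upwards [hF] with χ hχ
  have i0 : Integrable (fun p => atOld p ^ 2) (abelLaw lam G ν (eta lam G χ)) :=
    (memLp_old ν hq).integrable_sq
  have i1 : Integrable (fun p => 2 * (atOld p * atNew p)) (abelLaw lam G ν (eta lam G χ)) :=
    ((memLp_old ν hq).integrable_mul (memLp_new ν hG hr)).const_mul 2
  have i2 : Integrable (fun p => atNew p ^ 2) (abelLaw lam G ν (eta lam G χ)) :=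
    (memLp_new ν hG hr).integrable_sq
  have i3 : Integrable (fun p => atOld p ^ 2 + 2 * (atOld p * atNew p))
    (abelLaw lam G ν (eta lam G χ)) := i0.add i1
  rw [← integral_const_mul, ← integral_add i0 i1, ← integral_add i3 i2]
  refine integral_congr_ae ?_
  filter_upwards [ae_split hG ν hr] with p hp
  rw [hp.queue]; ring

/-- Coupling with the queue that starts empty. -/
lemma tendsto_diff_sq : Tendsto (fun χ => ∫ p, (atQueue p - atEmpty p) ^ 2
    ∂(abelLaw lam G ν (eta lam G χ))) (𝓝[>] 0) (𝓝 0) := by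
  have h := (tendsto_queue_sq ν hG h1 h2 h3 hg hrho hr hq hW).sub
    (tendsto_empty_sq ν hG h1 h2 h3 hg hrho)
  rw [sub_self] at h
  refine squeeze_zero' (Eventually.of_forall fun χ => integral_nonneg fun p => sq_nonneg _) ?_ h
  filter_upwards [eventually_fact hG h1 hrho] with χ hχ
  have hQ := memLp_queue (θ := eta lam G χ) (lam := lam) ν hq hG hr
  have hE := memLp_empty (θ := eta lam G χ) (lam := lam) ν hG hr
  rw [← integral_sub hQ.integrable_sq hE.integrable_sq]
  refine integral_mono_ae (hQ.sub hE).integrable_sq (hQ.integrable_sq.sub hE.integrable_sq) ?_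
  filter_upwards [ae_split hG ν hr] with p hp
  -- From 0 ≤ E ≤ Q follows (Q - E)² ≤ Q² - E², and the two second moments have the same limit.
  have e1 := hp.empty_le
  have e2 := atEmpty_nonneg p
  have e3 := atOld_nonneg p
  rw [hp.queue]
  nlinarith

/-- Asymptotic decorrelation from the initial number: the queue is replaced by the one that starts
empty, which is independent of the initial number, and the error is controlled by Cauchy-Schwarz and
`tendsto_diff_sq`. -/
lemma tendsto_number_mul_queue : Tendsto (fun χ => ∫ p, (atNumber p - ∫ s, (s.1 : ℝ) ∂ν) *
    atQueue p ∂(abelLaw lam G ν (eta lam G χ))) (𝓝[>] 0) (𝓝 0) := by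
  have hF := eventually_fact (lam := lam) hG h1 hrho
  set c := ∫ s, (s.1 : ℝ) ∂ν with hc
  have hmN : Measurable fun s : State => (s.1 : ℝ) :=
    (measurable_from_nat (f := fun n : ℕ => (n : ℝ))).comp measurable_fst
  have hlaw : ∀ k : State → ℝ, Measurable k → ∫ ω, k ω.1 ∂(law lam G ν) = ∫ s, k s ∂ν :=
    fun k hk => by
      have := isProbabilityMeasure_expMeasure (Fact.out : 0 < lam)
      have h : MeasurePreserving (Prod.fst : Input → State) (law lam G ν) ν := by
        unfold law; exact measurePreserving_fst
      exact integral_comp_measurePreserving h hk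
  have hsq : Tendsto (fun χ => ∫ p, (atNumber p - c) ^ 2 ∂(abelLaw lam G ν (eta lam G χ)))
      (𝓝[>] 0) (𝓝 (∫ s, ((s.1 : ℝ) - c) ^ 2 ∂ν)) := by
    refine tendsto_const_nhds.congr' ?_
    filter_upwards [hF] with χ hχ
    exact (integral_comp_measurePreserving (measurePreserving_number ν)
      (k := fun s : State => ((s.1 : ℝ) - c) ^ 2) (by fun_prop)).symm
  refine (tendsto_integral_mul_zero (hF.mono fun χ hχ => (memLp_queue ν hq hG hr).sub
    (memLp_empty ν hG hr)) (hF.mono fun χ hχ => (memLp_number ν hq).sub (memLp_const c))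
    (tendsto_diff_sq ν hG h1 h2 h3 hg hrho hr hq hW) hsq).congr' ?_
  filter_upwards [hF] with χ hχ
  have hQ := memLp_queue (θ := eta lam G χ) (lam := lam) ν hq hG hr
  have hE := memLp_empty (θ := eta lam G χ) (lam := lam) ν hG hr
  have hN : MemLp (fun p => atNumber p - c) 2 (abelLaw lam G ν (eta lam G χ)) :=
    (memLp_number ν hq).sub (memLp_const c)
  have hz : ∫ p, (atNumber p - c) * atEmpty p ∂(abelLaw lam G ν (eta lam G χ)) = 0 := by
    have := integral_number_mul (lam := lam) (G := G) (θ := eta lam G χ) ν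
      (F := fun n => (n : ℝ) - c) (H := fun z => (newQueue 0 z.1.1 z.1.2 z.2 : ℝ))
      ((measurable_from_nat (f := fun n : ℕ => (n : ℝ))).comp (measurable_newQueue.comp
        (f := fun z : ((ℕ → ℝ) × (ℕ → ℝ)) × ℝ => (((0 : ℝ), z.1.1, z.1.2), z.2)) (by fun_prop)))
    refine this.trans ?_
    rw [hlaw (fun s => (s.1 : ℝ) - c) (by fun_prop), integral_sub (hq.integrable one_le_two)
      (integrable_const _)]
    simp [hc]
  have i1 : Integrable (fun p => (atNumber p - c) * atQueue p) (abelLaw lam G ν (eta lam G χ)) :=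
    hN.integrable_mul hQ
  have i2 : Integrable (fun p => (atNumber p - c) * atEmpty p) (abelLaw lam G ν (eta lam G χ)) :=
    hN.integrable_mul hE
  rw [← sub_zero (∫ p, (atNumber p - c) * atQueue p ∂_), ← hz, ← integral_sub i1 i2]
  refine integral_congr_ae (ae_of_all _ fun p => ?_)
  simp only [Pi.sub_apply]; ring

end later

end limits

/-! ### An Abelian theorem -/

lemma expMeasure_real_Ioi {θ t : ℝ} (hθ : 0 < θ) (ht : 0 ≤ t) :
    (expMeasure θ).real (Set.Ioi t) = Real.exp (-(θ * t)) := by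
  have := isProbabilityMeasure_expMeasure hθ
  rw [← Set.compl_Iic, measureReal_compl measurableSet_Iic, probReal_univ, ← cdf_eq_real,
    cdf_expMeasure_eq hθ, if_pos ht, sub_sub_cancel]

/-- Converts exponential averages of a monotone function into bounds at a fixed time; letting `θ`
tend to `0` removes the exponential factor. -/
lemma exp_mul_le_integral {f : ℝ → ℝ} {θ t : ℝ} (hθ : 0 < θ) (ht : 0 ≤ t)
    (hf : Integrable f (expMeasure θ)) (h0 : ∀ s, 0 < s → 0 ≤ f s) (hm : ∀ s, t ≤ s → f t ≤ f s) :
    Real.exp (-(θ * t)) * f t ≤ ∫ s, f s ∂(expMeasure θ) := by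
  have := isProbabilityMeasure_expMeasure hθ
  have e : ∫ s, Set.indicator (Set.Ioi t) (fun _ => f t) s ∂(expMeasure θ) =
      Real.exp (-(θ * t)) * f t := by
    rw [integral_indicator measurableSet_Ioi, setIntegral_const, smul_eq_mul,
      expMeasure_real_Ioi hθ ht]
  rw [← e]
  refine integral_mono_ae ((integrable_const _).indicator measurableSet_Ioi) hf ?_
  filter_upwards [ae_expMeasure_pos θ] with s hs
  by_cases h : t < s
  · rw [Set.indicator_of_mem (Set.mem_Ioi.2 h)]; exact hm s h.le
  · rw [Set.indicator_of_notMem (fun h' => h (Set.mem_Ioi.1 h'))]; exact h0 s hs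

/-- A function that tends to `0` at infinity has Abel mean tending to `0`. -/
lemma tendsto_abel_zero {r : ℝ → ℝ} (hr : Tendsto r atTop (𝓝 0))
    (hi : ∀ θ, 0 < θ → Integrable r (expMeasure θ)) :
    Tendsto (fun θ => ∫ t, r t ∂(expMeasure θ)) (𝓝[>] 0) (𝓝 0) := by
  rw [Metric.tendsto_nhds]
  intro ε hε
  have h1 : ∀ᶠ t in atTop, |r t| < ε / 2 := by
    simpa using (Metric.tendsto_nhds.1 hr) (ε / 2) (by positivity)
  obtain ⟨T, hT⟩ := eventually_atTop.1 h1
  set C := ∫ t, |r t| ∂(expMeasure 1) with hC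
  have hC0 : 0 ≤ C := integral_nonneg fun t => abs_nonneg _
  have h2 : Tendsto (fun θ : ℝ => θ * (Real.exp (max T 0) * C)) (𝓝[>] 0) (𝓝 0) := by
    simpa using tendsto_id_right.mul_const (Real.exp (max T 0) * C)
  have h3 : ∀ᶠ θ : ℝ in 𝓝[>] 0, θ * (Real.exp (max T 0) * C) < ε / 2 :=
    h2.eventually (eventually_lt_nhds (by positivity))
  filter_upwards [eventually_pos_right, h3] with θ hθ h3
  have := isProbabilityMeasure_expMeasure hθ
  rw [dist_zero_right]
  refine (norm_integral_le_integral_norm _).trans_lt ?_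
  have hint := (hi 1 one_pos).abs
  have hint' := (integrable_expMeasure_iff one_pos _).1 hint
  have key : ∫ t, ‖r t‖ ∂(expMeasure θ) ≤ ε / 2 + θ * (Real.exp (max T 0) * C) := by
    -- Beyond `T` the integrand is negative. Before `T` the density of rate `θ` is at most `θ * exp
    -- T` times the density of rate one (with `max T 0` for `T`), so a factor `θ` is gained.
    have e1 : ∫ t, (‖r t‖ - ε / 2) ∂(expMeasure θ) ≤ θ * (Real.exp (max T 0) * C) := by
      rw [hC, integral_expMeasure one_pos, integral_expMeasure hθ, ← integral_const_mul,
        ← integral_const_mul]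
      have j1 := ((integrable_expMeasure_iff hθ _).1
        ((hi θ hθ).norm.sub (integrable_const (ε / 2)))).const_mul θ
      have j2 := (hint'.const_mul (Real.exp (max T 0))).const_mul θ
      refine setIntegral_mono_on (j1.congr (ae_of_all _ fun t => ?_))
        (j2.congr (ae_of_all _ fun t => ?_)) measurableSet_Ioi fun t ht => ?_
      · simp only [Pi.sub_apply]; ring
      · simp only [one_mul]
      · have ht' : 0 < t := ht
        by_cases hTt : T ≤ t
        · have := hT t hTt
          rw [← Real.norm_eq_abs] at this
          refine (mul_nonpos_of_nonneg_of_nonpos (by positivity) (by linarith)).trans (by positivity)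
        · have l1 : Real.exp (-(θ * t)) ≤ 1 := exp_neg_mul_le_one hθ.le ht'.le
          have l2 : 1 ≤ Real.exp (max T 0) * Real.exp (-(1 * t)) := by
            rw [← Real.exp_add, Real.one_le_exp_iff]
            have := le_max_left T 0
            linarith
          rw [Real.norm_eq_abs]
          calc θ * Real.exp (-(θ * t)) * (|r t| - ε / 2) ≤ θ * Real.exp (-(θ * t)) * |r t| := by
                refine mul_le_mul_of_nonneg_left (by linarith) (by positivity)
            _ ≤ θ * 1 * |r t| := by gcongr
            _ ≤ θ * (Real.exp (max T 0) * Real.exp (-(1 * t))) * |r t| := by gcongr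
            _ = _ := by ring
    rw [integral_sub (hi θ hθ).norm (integrable_const _)] at e1
    simp only [integral_const, probReal_univ, smul_eq_mul, one_mul] at e1
    linarith
  linarith

/-- The intercept of a linear asymptote is determined by Abel means. -/
lemma eq_of_hasLinearAsymptote {v : ℝ → ℝ} {vbar b c : ℝ} {ι : Type*} {l : Filter ι} [l.NeBot]
    {θ : ι → ℝ} (hθ : Tendsto θ l (𝓝[>] 0)) (hv : HasLinearAsymptote v vbar b)
    (hi : ∀ θ, 0 < θ → Integrable v (expMeasure θ))
    (hc : Tendsto (fun i => ∫ t, v t ∂(expMeasure (θ i)) - lam / θ i) l (𝓝 c)) : b = c := by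
  have hid : ∀ θ, 0 < θ → Integrable (fun t : ℝ => t) (expMeasure θ) := fun θ hθ => by
    simpa using integrable_pow_expMeasure hθ 1
  have hlin : ∀ θ, 0 < θ → Integrable (fun t => vbar * t + b) (expMeasure θ) := fun θ hθ => by
    have := isProbabilityMeasure_expMeasure hθ
    exact ((hid θ hθ).const_mul vbar).add (integrable_const b)
  have h0 := (tendsto_abel_zero hv fun θ hθ => (hi θ hθ).sub (hlin θ hθ)).comp hθ
  have h1 : Tendsto (fun i => (vbar - lam) / θ i + b) l (𝓝 c) := by
    have := hc.sub h0
    rw [sub_zero] at this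
    refine this.congr' ?_
    filter_upwards [hθ.eventually eventually_pos_right] with i hi'
    have := isProbabilityMeasure_expMeasure hi'
    have e1 : ∫ t : ℝ, t ∂(expMeasure (θ i)) = 1 / θ i := by
      simpa using integral_pow_expMeasure hi' 1
    simp only [Function.comp_apply]
    rw [integral_sub (hi _ hi') (hlin _ hi'), integral_add ((hid _ hi').const_mul vbar)
      (integrable_const b), integral_const_mul vbar (fun t : ℝ => t), e1]
    simp only [integral_const, probReal_univ, smul_eq_mul, one_mul]
    ring
  have hθ0 : Tendsto θ l (𝓝 0) := hθ.mono_right nhdsWithin_le_nhds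
  -- The slope is not given. An average that stays bounded after subtraction of `lam / θ` forces it
  -- to be `lam`.
  have h2 : vbar - lam = 0 := by
    have := hθ0.mul (h1.sub_const b)
    rw [zero_mul] at this
    refine tendsto_nhds_unique (tendsto_const_nhds.congr' ?_) this
    filter_upwards [hθ.eventually eventually_pos_right] with i hi'
    field_simp
    ring
  rw [h2] at h1
  simp only [zero_div, zero_add] at h1
  exact tendsto_nhds_unique tendsto_const_nhds h1

/-! ### The mean number of customers -/

section mean

variable [Fact (0 < lam)] [IsProbabilityMeasure G] (hG : ∀ᵐ x ∂G, 0 ≤ x)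
    (h1 : Integrable (fun x => x) G) (h2 : Integrable (fun x => x ^ 2) G)
    (h3 : Integrable (fun x => x ^ 3) G) (hg : 0 < ∫ x, x ∂G) (hrho : lam * ∫ x, x ∂G < 1)
    (ν : Measure State) [IsProbabilityMeasure ν]
    (hr : ∀ᵐ s ∂ν, 0 ≤ s.2) (hq : MemLp (fun s : State => (s.1 : ℝ)) 2 ν)
    (hW : MemLp initialWork 2 (law lam G ν))

lemma measurable_at {k : Input × ℝ → ℝ} (hk : Measurable k) (t : ℝ) :
    Measurable fun ω : Input => k (ω, t) := hk.comp (by fun_prop)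

include hG hr in
lemma ae_split_at {t : ℝ} (ht : 0 < t) : ∀ᵐ ω ∂(law lam G ν), Split (ω, t) := by
  filter_upwards [ae_initialWork hG ν hr] with ω hω using ⟨hω.1, ht, hω.2⟩

lemma memLp_arrivals_at (t : ℝ) : MemLp (fun ω => atArrivals (ω, t)) 2 (law lam G ν) := by
  have hl : 0 < lam := Fact.out
  have hm := measurable_at measurable_atArrivals t
  rw [memLp_two_iff_integrable_sq hm.aestronglyMeasurable]
  refine ⟨(hm.pow_const 2).aestronglyMeasurable, ?_⟩
  rw [hasFiniteIntegral_iff_ofReal (ae_of_all _ fun ω => sq_nonneg _)]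
  have hm' : Measurable fun a : ℕ → ℝ => (arrivals a t : ℝ≥0∞) ^ 2 :=
    ((measurable_from_nat (f := fun n : ℕ => (n : ℝ≥0∞))).comp
      (measurable_arrivals_const t)).pow_const 2
  refine lt_of_eq_of_lt ?_ (lintegral_arrivals_sq_lt_top hl t)
  rw [← (measurePreserving_arr (lam := lam) (G := G) ν).lintegral_comp hm']
  refine lintegral_congr fun ω => ?_
  rw [atArrivals, ENNReal.ofReal_pow (Nat.cast_nonneg _), ENNReal.ofReal_natCast]

lemma integral_arrivals_at {t : ℝ} (ht : 0 ≤ t) :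
    ∫ ω, atArrivals (ω, t) ∂(law lam G ν) = lam * t := by
  have hl : 0 < lam := Fact.out
  have hm := measurable_at measurable_atArrivals t
  have hm' : Measurable fun a : ℕ → ℝ => (arrivals a t : ℝ≥0∞) :=
    (measurable_from_nat (f := fun n : ℕ => (n : ℝ≥0∞))).comp (measurable_arrivals_const t)
  rw [integral_eq_lintegral_of_nonneg_ae (ae_of_all _ fun ω => atArrivals_nonneg _)
    hm.aestronglyMeasurable]
  have : ∫⁻ ω, ENNReal.ofReal (atArrivals (ω, t)) ∂(law lam G ν) = ENNReal.ofReal (lam * t) := by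
    rw [← lintegral_arrivals hl ht,
      ← (measurePreserving_arr (lam := lam) (G := G) ν).lintegral_comp hm']
    refine lintegral_congr fun ω => ?_
    rw [atArrivals, ENNReal.ofReal_natCast]
  rw [this, ENNReal.toReal_ofReal (by positivity)]

omit [Fact (0 < lam)] [IsProbabilityMeasure G] [IsProbabilityMeasure ν] in
lemma measurePreserving_state [Fact (0 < lam)] [IsProbabilityMeasure G] [IsProbabilityMeasure ν] :
    MeasurePreserving (Prod.fst : Input → State) (law lam G ν) ν := by
  have := isProbabilityMeasure_expMeasure (Fact.out : 0 < lam)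
  unfold law; exact measurePreserving_fst

lemma measurable_number : Measurable fun s : State => (s.1 : ℝ) :=
  (measurable_from_nat (f := fun n : ℕ => (n : ℝ))).comp measurable_fst

include hq in
lemma memLp_number_at (t : ℝ) : MemLp (fun ω => atNumber (ω, t)) 2 (law lam G ν) :=
  hq.comp_measurePreserving (measurePreserving_state ν)

include hG hr hq in
lemma memLp_queue_at {t : ℝ} (ht : 0 < t) :
    MemLp (fun ω => atQueue (ω, t)) 2 (law lam G ν) := by
  refine ((memLp_number_at ν hq t).add (memLp_arrivals_at ν t)).mono
    (measurable_at measurable_atQueue t).aestronglyMeasurable ?_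
  filter_upwards [ae_split_at hG ν hr ht] with ω hω
  rw [Real.norm_of_nonneg (atQueue_nonneg _)]
  exact hω.queue_le.trans (le_abs_self _)

include hG hr in
lemma memLp_empty_at {t : ℝ} (ht : 0 < t) :
    MemLp (fun ω => atEmpty (ω, t)) 2 (law lam G ν) := by
  refine (memLp_arrivals_at ν t).mono (measurable_at measurable_atEmpty t).aestronglyMeasurable ?_
  filter_upwards [ae_split_at hG ν hr ht] with ω hω
  rw [Real.norm_of_nonneg (atEmpty_nonneg _), Real.norm_of_nonneg (atArrivals_nonneg _)]
  exact hω.empty_le.trans hω.new_le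

/-- Mean number of customers at time `t` in the queue that starts empty. -/
def emptyMean (lam : ℝ) (G : Measure ℝ) (t : ℝ) : ℝ :=
  ∫ z, (newQueue 0 z.1 z.2 t : ℝ) ∂(seqLaw lam G)

lemma measurePreserving_later :
    MeasurePreserving (fun ω => (ω.2.1, newServ ω)) (law lam G ν) (seqLaw lam G) := by
  have h := measurePreserving_init (lam := lam) (G := G) ν (φ := fun _ => (0 : ℝ))
    measurable_const
  rw [Measure.map_const, measure_univ, one_smul] at h
  exact measurePreserving_snd.comp h

lemma measurable_newQueue_at (t : ℝ) :
    Measurable fun z : (ℕ → ℝ) × (ℕ → ℝ) => newQueue 0 z.1 z.2 t :=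
  measurable_newQueue.comp (f := fun z : (ℕ → ℝ) × (ℕ → ℝ) => (((0 : ℝ), z), t)) (by fun_prop)

lemma integral_empty_at (t : ℝ) :
    ∫ ω, atEmpty (ω, t) ∂(law lam G ν) = emptyMean lam G t :=
  integral_comp_measurePreserving (measurePreserving_later ν)
    ((measurable_from_nat (f := fun n : ℕ => (n : ℝ))).comp (measurable_newQueue_at t))

-- Forgetting at time `t` all customers present, and restarting empty with the later arrivals, can
-- only reduce the number of customers at `t + s`.
omit [Fact (0 < lam)] [IsProbabilityMeasure G] in
lemma Good.newQueue_shift_le {ω : Input} (hω : Good ω) (h0 : ω.1 = (0, 0)) {s t : ℝ}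
    (hs : 0 ≤ s) (ht : 0 ≤ t) :
    newQueue 0 (ins (shiftInput t ω)).2.1 (newServ (ins (shiftInput t ω))) s ≤
      newQueue 0 ω.2.1 (newServ ω) (t + s) := by
  have hW0 : initialWork ω = 0 := by simp [initialWork, h0]
  have e1 : queueLength ω (t + s) = newQueue 0 ω.2.1 (newServ ω) (t + s) := by
    rw [hω.queueLength_eq_add (by positivity), hω.oldQueue_eq_zero (by rw [hW0]; positivity), hW0,
      zero_add]
  have e2 : queueLength (ins (shiftInput t ω)) s = queueLength ω (t + s) :=
    congrArg Prod.fst (hω.stateAt_shift ht hs)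
  have hW1 : 0 ≤ initialWork (ins (shiftInput t ω)) := by
    rw [hω.initialWork_shift ht, workAt]; exact le_max_right _ _
  rw [← e1, ← e2, (hω.shift t).queueLength_eq_add hs]
  exact ((hω.shift t).arr.newQueue_mono hW1 _ _).trans (Nat.le_add_left _ _)

lemma lintegral_later (ν : Measure State) [IsProbabilityMeasure ν] (t : ℝ) :
    ∫⁻ ω, (newQueue 0 ω.2.1 (newServ ω) t : ℝ≥0∞) ∂(law lam G ν) =
      ∫⁻ z, (newQueue 0 z.1 z.2 t : ℝ≥0∞) ∂(seqLaw lam G) := by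
  have hm : Measurable fun z : (ℕ → ℝ) × (ℕ → ℝ) => (newQueue 0 z.1 z.2 t : ℝ≥0∞) :=
    (measurable_from_nat (f := fun n : ℕ => (n : ℝ≥0∞))).comp (measurable_newQueue_at t)
  exact (measurePreserving_later (lam := lam) (G := G) ν).lintegral_comp hm

lemma ae_law_dirac : ∀ᵐ ω ∂(law lam G (Measure.dirac ((0, 0) : State))), ω.1 = (0, 0) := by
  refine (measurePreserving_state (lam := lam) (G := G)
    (Measure.dirac ((0, 0) : State))).quasiMeasurePreserving.ae (p := fun s => s = (0, 0)) ?_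
  simp [ae_dirac_eq]

instance (ν : Measure State) [IsProbabilityMeasure ν] (t : ℝ) :
    IsProbabilityMeasure (stateLaw lam G ν t) :=
  Measure.isProbabilityMeasure_map (measurable_stateAt_const t).aemeasurable

include hG in
/-- The queue that starts empty is stochastically increasing. -/
lemma lintegral_empty_mono {s t : ℝ} (hs : 0 ≤ s) (ht : 0 ≤ t) :
    ∫⁻ z, (newQueue 0 z.1 z.2 s : ℝ≥0∞) ∂(seqLaw lam G) ≤
      ∫⁻ z, (newQueue 0 z.1 z.2 (t + s) : ℝ≥0∞) ∂(seqLaw lam G) := by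
  have hl : 0 < lam := Fact.out
  have hm : Measurable fun z : (ℕ → ℝ) × (ℕ → ℝ) => (newQueue 0 z.1 z.2 s : ℝ≥0∞) :=
    (measurable_from_nat (f := fun n : ℕ => (n : ℝ≥0∞))).comp (measurable_newQueue_at s)
  have hm' : Measurable fun ω : Input => (newQueue 0 ω.2.1 (newServ ω) s : ℝ≥0∞) :=
    hm.comp (f := fun ω : Input => (ω.2.1, newServ ω)) (by fun_prop)
  have e := lintegral_markov hl hG (Measure.dirac ((0, 0) : State)) ht hm'
    (fun ω h => by simp only [newServ_cons ω h])
  rw [← lintegral_later (stateLaw lam G (Measure.dirac ((0, 0) : State)) t), ← e,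
    ← lintegral_later (Measure.dirac ((0, 0) : State))]
  refine lintegral_mono_ae ?_
  filter_upwards [ae_good hl hG _, ae_law_dirac] with ω hω h0
  exact Nat.cast_le.2 (hω.newQueue_shift_le h0 hs ht)

include hG in
lemma emptyMean_mono {s t : ℝ} (hs : 0 < s) (hst : s ≤ t) :
    emptyMean lam G s ≤ emptyMean lam G t := by
  have hm : ∀ u, Measurable fun z : (ℕ → ℝ) × (ℕ → ℝ) => (newQueue 0 z.1 z.2 u : ℝ) := fun u =>
    (measurable_from_nat (f := fun n : ℕ => (n : ℝ))).comp (measurable_newQueue_at u)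
  have e : ∀ u, emptyMean lam G u =
      (∫⁻ z, (newQueue 0 z.1 z.2 u : ℝ≥0∞) ∂(seqLaw lam G)).toReal := fun u => by
    rw [emptyMean, integral_eq_lintegral_of_nonneg_ae (ae_of_all _ fun z => Nat.cast_nonneg _)
      (hm u).aestronglyMeasurable]
    simp_rw [ENNReal.ofReal_natCast]
  have hi : ∀ u, 0 < u → ∫⁻ z, (newQueue 0 z.1 z.2 u : ℝ≥0∞) ∂(seqLaw lam G) ≠ ∞ := fun u hu => by
    have hd : ∀ᵐ s ∂(Measure.dirac ((0, 0) : State)), (0 : ℝ) ≤ s.2 := by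
      rw [ae_dirac_iff (measurableSet_le (by fun_prop) (by fun_prop))]
    have := ((memLp_empty_at (lam := lam) hG (Measure.dirac ((0, 0) : State)) hd hu).integrable
      one_le_two).lintegral_lt_top.ne
    rw [← lintegral_later (Measure.dirac ((0, 0) : State))]
    refine ne_of_eq_of_ne (lintegral_congr fun ω => ?_) this
    rw [atEmpty, ENNReal.ofReal_natCast]
  rw [e, e]
  have := lintegral_empty_mono (lam := lam) (G := G) hG hs.le (sub_nonneg.2 hst)
  rw [sub_add_cancel] at this
  exact ENNReal.toReal_mono (hi t (hs.trans_le hst)) this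

omit [Fact (0 < lam)] [IsProbabilityMeasure G] in
lemma emptyMean_nonneg (t : ℝ) : 0 ≤ emptyMean lam G t := integral_nonneg fun _ => Nat.cast_nonneg _

include hG hr in
lemma integral_emptyMean {θ : ℝ} [Fact (0 < θ)] : Integrable (emptyMean lam G) (expMeasure θ) ∧
    ∫ t, emptyMean lam G t ∂(expMeasure θ) = ∫ p, atEmpty p ∂(abelLaw lam G ν θ) := by
  have hi := (memLp_empty (θ := θ) (lam := lam) ν hG hr).integrable one_le_two
  unfold abelLaw at hi ⊢
  have := hi.integral_prod_right
  simp_rw [integral_empty_at] at this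
  refine ⟨this, ?_⟩
  rw [integral_prod_symm _ hi]
  simp_rw [integral_empty_at]

-- The mean is increasing in time, so `exp_mul_le_integral` bounds it by its exponential averages,
-- whose limit is `meanQueue lam G`.
include hG h1 h2 h3 hg hrho in
lemma emptyMean_le {t : ℝ} (ht : 0 < t) : emptyMean lam G t ≤ meanQueue lam G := by
  have hl : 0 < lam := Fact.out
  have hd : ∀ᵐ s ∂(Measure.dirac ((0, 0) : State)), (0 : ℝ) ≤ s.2 := by
    rw [ae_dirac_iff (measurableSet_le (by fun_prop) (by fun_prop))]
  have hlim := tendsto_empty (Measure.dirac ((0, 0) : State)) hG h1 h2 h3 hg hrho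
  have hE : Tendsto (fun χ => Real.exp (-(eta lam G χ * t)) * emptyMean lam G t) (𝓝[>] 0)
      (𝓝 (emptyMean lam G t)) := by
    have hη : Tendsto (eta lam G) (𝓝[>] 0) (𝓝 0) :=
      (tendsto_eta hl hG h1 h2 h3 hrho).mono_right nhdsWithin_le_nhds
    have hc : Continuous fun θ : ℝ => Real.exp (-(θ * t)) * emptyMean lam G t := by fun_prop
    have := (hc.tendsto 0).comp hη
    simp only [zero_mul, neg_zero, Real.exp_zero, one_mul] at this
    exact this
  refine le_of_tendsto_of_tendsto hE hlim ?_
  filter_upwards [eventually_fact (lam := lam) hG h1 hrho] with χ hχ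
  have h := integral_emptyMean (lam := lam) hG (Measure.dirac ((0, 0) : State)) hd
    (θ := eta lam G χ)
  rw [← h.2]
  exact exp_mul_le_integral hχ.out ht.le h.1 (fun s _ => emptyMean_nonneg s)
    fun s hs => emptyMean_mono hG ht hs

/-! ### The variance curve -/

/-- Mean number of customers at time `t`. -/
def queueMean (lam : ℝ) (G : Measure ℝ) (ν : Measure State) (t : ℝ) : ℝ :=
  ∫ ω, atQueue (ω, t) ∂(law lam G ν)

/-- Centred number of departures, up to the mean number of customers. -/
def atCentred (lam c : ℝ) (p : Input × ℝ) : ℝ := (atNumber p - c) + atDev lam p - atQueue p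

section
include hG hr hq

lemma memLp_centred_at (c : ℝ) {t : ℝ} (ht : 0 < t) :
    MemLp (fun ω => atCentred lam c (ω, t)) 2 (law lam G ν) :=
  (((memLp_number_at ν hq t).sub (memLp_const c)).add
    ((memLp_arrivals_at ν t).sub (memLp_const (lam * t)))).sub (memLp_queue_at hG ν hr hq ht)

/-- At a fixed time the number of departures differs from `atCentred` by a constant, and `atCentred`
has mean `-queueMean`, as the other two terms are centred. -/
lemma varianceCurve_eq {t : ℝ} (ht : 0 < t) : varianceCurve lam G ν t =
    (∫ ω, atCentred lam (∫ s, (s.1 : ℝ) ∂ν) (ω, t) ^ 2 ∂(law lam G ν)) -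
      queueMean lam G ν t ^ 2 := by
  set c := ∫ s, (s.1 : ℝ) ∂ν with hc
  have i1 := (memLp_number_at (lam := lam) (G := G) ν hq t).integrable one_le_two
  have i2 := (memLp_arrivals_at (lam := lam) (G := G) ν t).integrable one_le_two
  have i3 := (memLp_queue_at (lam := lam) hG ν hr hq ht).integrable one_le_two
  have e1 : ∫ ω, atNumber (ω, t) ∂(law lam G ν) = c :=
    integral_comp_measurePreserving (measurePreserving_state ν) measurable_number
  have e2 := integral_arrivals_at (lam := lam) (G := G) ν ht.le
  have hmean : ∫ ω, atCentred lam c (ω, t) ∂(law lam G ν) = -queueMean lam G ν t := by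
    have j1 : Integrable (fun ω => atNumber (ω, t) - c) (law lam G ν) :=
      i1.sub (integrable_const c)
    have j2 : Integrable (fun ω => atArrivals (ω, t) - lam * t) (law lam G ν) :=
      i2.sub (integrable_const _)
    have j3 : Integrable (fun ω => (atNumber (ω, t) - c) + (atArrivals (ω, t) - lam * t))
      (law lam G ν) := j1.add j2
    simp only [atCentred, atDev]
    rw [integral_sub j3 i3, integral_add j1 j2, integral_sub i1 (integrable_const c),
      integral_sub i2 (integrable_const _), e1, e2, queueMean]
    simp
  have hae : (fun ω : Input => (departures ω t : ℝ)) =ᵐ[law lam G ν]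
      fun ω => atCentred lam c (ω, t) + (c + lam * t) := by
    filter_upwards [ae_split_at hG ν hr ht] with ω hω
    rw [hω.departures, atCentred, atDev]; ring
  have hL := memLp_centred_at (lam := lam) hG ν hr hq c ht
  rw [varianceCurve, variance_congr hae, variance_add_const hL.aestronglyMeasurable,
    variance_eq_sub hL, hmean, neg_sq]
  rfl

end

/-! ### Exponential averages of the variance curve. -/

section abel

variable {θ : ℝ} [Fact (0 < θ)]

include hG hr hq

lemma memLp_centred (c : ℝ) : MemLp (atCentred lam c) 2 (abelLaw lam G ν θ) :=
  (((memLp_number ν hq).sub (memLp_const c)).add (memLp_dev ν)).sub (memLp_queue ν hq hG hr)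

lemma integral_queueMean : Integrable (queueMean lam G ν) (expMeasure θ) ∧
    ∫ t, queueMean lam G ν t ∂(expMeasure θ) = ∫ p, atQueue p ∂(abelLaw lam G ν θ) := by
  have hi := (memLp_queue (θ := θ) (lam := lam) ν hq hG hr).integrable one_le_two
  unfold abelLaw at hi ⊢
  exact ⟨hi.integral_prod_right, (integral_prod_symm _ hi).symm⟩

lemma integrable_queueMean_sq : Integrable (fun t => queueMean lam G ν t ^ 2) (expMeasure θ) := by
  have hi := (memLp_queue (θ := θ) (lam := lam) ν hq hG hr).integrable_sq
  have hm := (integral_queueMean (θ := θ) (lam := lam) hG ν hr hq).1.aestronglyMeasurable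
  unfold abelLaw at hi
  refine hi.integral_prod_right.mono' (hm.pow 2) ?_
  filter_upwards [ae_expMeasure_pos θ] with t ht
  rw [Real.norm_of_nonneg (sq_nonneg _)]
  have := sq_integral_mul_le (memLp_queue_at (lam := lam) hG ν hr hq ht)
    (memLp_const (1 : ℝ) (p := 2) (μ := law lam G ν))
  simpa [queueMean] using this

lemma integral_varianceCurve : Integrable (varianceCurve lam G ν) (expMeasure θ) ∧
    ∫ t, varianceCurve lam G ν t ∂(expMeasure θ) =
      (∫ p, atCentred lam (∫ s, (s.1 : ℝ) ∂ν) p ^ 2 ∂(abelLaw lam G ν θ)) -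
        ∫ t, queueMean lam G ν t ^ 2 ∂(expMeasure θ) := by
  have hi := (memLp_centred (θ := θ) (lam := lam) hG ν hr hq (∫ s, (s.1 : ℝ) ∂ν)).integrable_sq
  have h2 := integrable_queueMean_sq (θ := θ) (lam := lam) hG ν hr hq
  have hae : (fun t => (∫ ω, atCentred lam (∫ s, (s.1 : ℝ) ∂ν) (ω, t) ^ 2 ∂(law lam G ν)) -
      queueMean lam G ν t ^ 2) =ᵐ[expMeasure θ] varianceCurve lam G ν := by
    filter_upwards [ae_expMeasure_pos θ] with t ht using (varianceCurve_eq hG ν hr hq ht).symm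
  unfold abelLaw at hi ⊢
  refine ⟨(hi.integral_prod_right.sub h2).congr hae, ?_⟩
  rw [← integral_congr_ae hae, integral_sub hi.integral_prod_right h2, integral_prod_symm _ hi]

/-- Expansion of the square. The product of the two centred terms has mean zero, because the initial
number is independent of the arrivals and of the exponential time. -/
lemma integral_centred_sq :
    ∫ p, atCentred lam (∫ s, (s.1 : ℝ) ∂ν) p ^ 2 ∂(abelLaw lam G ν θ) =
      numberVariance ν + lam / θ + ∫ p, atQueue p ^ 2 ∂(abelLaw lam G ν θ) -
        2 * (∫ p, (atNumber p - ∫ s, (s.1 : ℝ) ∂ν) * atQueue p ∂(abelLaw lam G ν θ)) -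
        2 * ∫ p, atDev lam p * atQueue p ∂(abelLaw lam G ν θ) := by
  set c := ∫ s, (s.1 : ℝ) ∂ν with hc
  have hN : MemLp (fun p => atNumber p - c) 2 (abelLaw lam G ν θ) :=
    (memLp_number ν hq).sub (memLp_const c)
  have hA := memLp_dev (lam := lam) (G := G) (θ := θ) ν
  have hQ := memLp_queue (lam := lam) (G := G) (θ := θ) ν hq hG hr
  have eN : ∫ p, (atNumber p - c) ^ 2 ∂(abelLaw lam G ν θ) = numberVariance ν := by
    rw [numberVariance, variance_eq_integral measurable_number.aemeasurable]
    exact integral_comp_measurePreserving (measurePreserving_number ν)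
      (k := fun s : State => ((s.1 : ℝ) - c) ^ 2) ((measurable_number.sub_const c).pow_const 2)
  have eNA : ∫ p, (atNumber p - c) * atDev lam p ∂(abelLaw lam G ν θ) = 0 := by
    have := integral_number_mul (lam := lam) (G := G) (θ := θ) ν
      (F := fun n => (n : ℝ) - c) (H := fun z => (arrivals z.1.1 z.2 : ℝ) - lam * z.2)
      (((measurable_from_nat (f := fun n : ℕ => (n : ℝ))).comp (measurable_arrivals.comp
        (f := fun z : ((ℕ → ℝ) × (ℕ → ℝ)) × ℝ => (z.1.1, z.2)) (by fun_prop))).sub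
        (by fun_prop))
    refine this.trans ?_
    have := integral_dev (lam := lam) (G := G) (θ := θ) ν
    simp only [atDev, atArrivals] at this
    rw [this, mul_zero]
  have i1 := hN.integrable_sq
  have i2 := hA.integrable_sq
  have i3 := hQ.integrable_sq
  have i4 : Integrable (fun p => 2 * ((atNumber p - c) * atDev lam p)) (abelLaw lam G ν θ) :=
    (hN.integrable_mul hA).const_mul 2
  have i5 : Integrable (fun p => 2 * ((atNumber p - c) * atQueue p)) (abelLaw lam G ν θ) :=
    (hN.integrable_mul hQ).const_mul 2
  have i6 : Integrable (fun p => 2 * (atDev lam p * atQueue p)) (abelLaw lam G ν θ) :=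
    (hA.integrable_mul hQ).const_mul 2
  have e : ∀ p, atCentred lam c p ^ 2 = (atNumber p - c) ^ 2 + atDev lam p ^ 2 + atQueue p ^ 2 +
      2 * ((atNumber p - c) * atDev lam p) - 2 * ((atNumber p - c) * atQueue p) -
      2 * (atDev lam p * atQueue p) := fun p => by rw [atCentred]; ring
  have j1 : Integrable (fun p => (atNumber p - c) ^ 2 + atDev lam p ^ 2)
    (abelLaw lam G ν θ) := i1.add i2
  have j2 : Integrable (fun p => (atNumber p - c) ^ 2 + atDev lam p ^ 2 + atQueue p ^ 2)
    (abelLaw lam G ν θ) := j1.add i3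
  have j3 : Integrable (fun p => (atNumber p - c) ^ 2 + atDev lam p ^ 2 + atQueue p ^ 2 +
    2 * ((atNumber p - c) * atDev lam p)) (abelLaw lam G ν θ) := j2.add i4
  have j4 : Integrable (fun p => (atNumber p - c) ^ 2 + atDev lam p ^ 2 + atQueue p ^ 2 +
    2 * ((atNumber p - c) * atDev lam p) - 2 * ((atNumber p - c) * atQueue p))
    (abelLaw lam G ν θ) := j3.sub i5
  simp_rw [e]
  rw [integral_sub j4 i6, integral_sub j3 i5, integral_add j2 i4, integral_add j1 i3,
    integral_add i1 i2, integral_const_mul, integral_const_mul, integral_const_mul, eN, eNA,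
    integral_dev_sq]
  ring

end abel

/-! ### Passage to the limit and the intercept. -/

include hG h1 h2 h3 hg hrho hr hq hW

lemma tendsto_queue : Tendsto (fun χ => ∫ p, atQueue p ∂(abelLaw lam G ν (eta lam G χ)))
    (𝓝[>] 0) (𝓝 (meanQueue lam G)) := by
  have hF := eventually_fact (lam := lam) hG h1 hrho
  have h := tendsto_integral_mul_zero (h := fun _ => (1 : ℝ)) (c := 1)
    (hF.mono fun χ hχ => (memLp_queue ν hq hG hr).sub (memLp_empty ν hG hr))
    (hF.mono fun χ hχ => memLp_const 1) (tendsto_diff_sq ν hG h1 h2 h3 hg hrho hr hq hW)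
    (tendsto_const_nhds.congr' (hF.mono fun χ hχ => by simp))
  have h' := h.add (tendsto_empty ν hG h1 h2 h3 hg hrho)
  rw [zero_add] at h'
  refine h'.congr' ?_
  filter_upwards [hF] with χ hχ
  have iQ := (memLp_queue (θ := eta lam G χ) (lam := lam) ν hq hG hr).integrable one_le_two
  have iE := (memLp_empty (θ := eta lam G χ) (lam := lam) ν hG hr).integrable one_le_two
  simp only [Pi.sub_apply, mul_one]
  rw [integral_sub iQ iE, sub_add_cancel]

/-- The mean number of customers converges to its equilibrium value, in the sense of Abel. -/
lemma tendsto_queueMean_sq : Tendsto (fun χ => ∫ t, queueMean lam G ν t ^ 2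
    ∂(expMeasure (eta lam G χ))) (𝓝[>] 0) (𝓝 (meanQueue lam G ^ 2)) := by
  set m := meanQueue lam G with hm
  have hF := eventually_fact (lam := lam) hG h1 hrho
  have hm0 : 0 ≤ m := (emptyMean_nonneg 1).trans (emptyMean_le hG h1 h2 h3 hg hrho one_pos)
  -- Averages of the mean alone would not control its square. With q, e the means of the queue and
  -- of the empty queue, 0 ≤ e ≤ m gives (q - m)² ≤ 2(q - e)² + 2(m - e)² ≤ 2(q - e)² + 2m(m - e),
  -- and (q - e)² is at most the mean squared difference of the two queues. The bound is linear in
  -- e, so its averages are known.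
  have hE : Tendsto (fun χ => 2 * (m * (m - ∫ p, atEmpty p ∂(abelLaw lam G ν (eta lam G χ)))) +
      2 * ∫ p, (atQueue p - atEmpty p) ^ 2 ∂(abelLaw lam G ν (eta lam G χ))) (𝓝[>] 0) (𝓝 0) := by
    have := (((tendsto_empty ν hG h1 h2 h3 hg hrho).const_sub m).const_mul m).const_mul 2
    simpa [hm] using this.add ((tendsto_diff_sq ν hG h1 h2 h3 hg hrho hr hq hW).const_mul 2)
  have hvar : Tendsto (fun χ => ∫ t, (queueMean lam G ν t - m) ^ 2 ∂(expMeasure (eta lam G χ)))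
      (𝓝[>] 0) (𝓝 0) := by
    refine squeeze_zero' (Eventually.of_forall fun χ => integral_nonneg fun _ => sq_nonneg _) ?_ hE
    filter_upwards [hF] with χ hχ
    have hQ := memLp_queue (θ := eta lam G χ) (lam := lam) ν hq hG hr
    have hEm := memLp_empty (θ := eta lam G χ) (lam := lam) ν hG hr
    have hD := (hQ.sub hEm).integrable_sq
    simp only [Pi.sub_apply] at hD
    have k1 := integral_emptyMean (θ := eta lam G χ) (lam := lam) hG ν hr
    have k2 := integral_queueMean (θ := eta lam G χ) (lam := lam) hG ν hr hq
    have k3 := integrable_queueMean_sq (θ := eta lam G χ) (lam := lam) hG ν hr hq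
    have hD' := hD
    unfold abelLaw at hD'
    have i1 : Integrable (fun t => 2 * (m * (m - emptyMean lam G t)))
      (expMeasure (eta lam G χ)) := (((integrable_const m).sub k1.1).const_mul m).const_mul 2
    have i2 : Integrable (fun t => 2 * ∫ ω, (atQueue (ω, t) - atEmpty (ω, t)) ^ 2
      ∂(law lam G ν)) (expMeasure (eta lam G χ)) := hD'.integral_prod_right.const_mul 2
    have i3 : Integrable (fun t => (queueMean lam G ν t - m) ^ 2) (expMeasure (eta lam G χ)) := by
      have : (fun t => (queueMean lam G ν t - m) ^ 2) = fun t =>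
        queueMean lam G ν t ^ 2 - 2 * m * queueMean lam G ν t + m ^ 2 := by ext t; ring
      rw [this]
      exact (k3.sub (k2.1.const_mul _)).add (integrable_const _)
    have e : 2 * (m * (m - ∫ p, atEmpty p ∂(abelLaw lam G ν (eta lam G χ)))) +
        2 * ∫ p, (atQueue p - atEmpty p) ^ 2 ∂(abelLaw lam G ν (eta lam G χ)) =
        ∫ t, (2 * (m * (m - emptyMean lam G t)) + 2 * ∫ ω, (atQueue (ω, t) - atEmpty (ω, t)) ^ 2
          ∂(law lam G ν)) ∂(expMeasure (eta lam G χ)) := by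
      rw [integral_add i1 i2, integral_const_mul, integral_const_mul, integral_const_mul,
        integral_sub (integrable_const m) k1.1, k1.2]
      unfold abelLaw
      rw [integral_prod_symm _ hD']
      simp
    rw [e]
    refine integral_mono_ae i3 (i1.add i2) ?_
    filter_upwards [ae_expMeasure_pos (eta lam G χ)] with t ht
    have mQ := memLp_queue_at (lam := lam) hG ν hr hq ht
    have mE := memLp_empty_at (lam := lam) hG ν hr ht
    have cs := sq_integral_mul_le (mQ.sub mE) (memLp_const (1 : ℝ) (p := 2) (μ := law lam G ν))
    simp only [Pi.sub_apply, mul_one, one_pow, integral_const, probReal_univ, smul_eq_mul] at cs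
    rw [integral_sub (mQ.integrable one_le_two) (mE.integrable one_le_two), integral_empty_at,
      ← queueMean] at cs
    have l1 := emptyMean_nonneg (lam := lam) (G := G) t
    have l2 := emptyMean_le (lam := lam) hG h1 h2 h3 hg hrho ht
    nlinarith [sq_nonneg (queueMean lam G ν t - 2 * emptyMean lam G t + m)]
  have hlim := (hvar.add ((tendsto_queue hG h1 h2 h3 hg hrho ν hr hq hW).const_mul (2 * m))).sub_const
    (m ^ 2)
  have hval : 0 + 2 * m * meanQueue lam G - m ^ 2 = m ^ 2 := by rw [← hm]; ring
  rw [hval] at hlim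
  refine hlim.congr' ?_
  filter_upwards [hF] with χ hχ
  have k2 := integral_queueMean (θ := eta lam G χ) (lam := lam) hG ν hr hq
  have k3 := integrable_queueMean_sq (θ := eta lam G χ) (lam := lam) hG ν hr hq
  have e : ∀ t, (queueMean lam G ν t - m) ^ 2 =
      queueMean lam G ν t ^ 2 - 2 * m * queueMean lam G ν t + m ^ 2 := fun t => by ring
  have i1 : Integrable (fun t => 2 * m * queueMean lam G ν t) (expMeasure (eta lam G χ)) :=
    k2.1.const_mul _
  have i2 : Integrable (fun t => queueMean lam G ν t ^ 2 - 2 * m * queueMean lam G ν t)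
    (expMeasure (eta lam G χ)) := k3.sub i1
  simp_rw [e]
  rw [integral_add i2 (integrable_const _), integral_sub k3 i1, integral_const_mul, k2.2]
  simp only [integral_const, probReal_univ, smul_eq_mul, one_mul]
  ring

/-- The intercept of the variance curve. -/
theorem intercept {vbar b : ℝ} (hv : HasLinearAsymptote (varianceCurve lam G ν) vbar b) :
    b = numberVariance ν + (sqQueue lam G - meanQueue lam G ^ 2) - 2 * covQueue lam G := by
  have hF := eventually_fact (lam := lam) hG h1 hrho
  refine eq_of_hasLinearAsymptote (lam := lam) (tendsto_eta Fact.out hG h1 h2 h3 hrho) hv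
    (fun θ hθ => ?_) ?_
  · have : Fact (0 < θ) := ⟨hθ⟩
    exact (integral_varianceCurve hG ν hr hq).1
  have hlim := (((((tendsto_queue_sq ν hG h1 h2 h3 hg hrho hr hq hW).const_add
    (numberVariance ν)).sub ((tendsto_number_mul_queue ν hG h1 h2 h3 hg hrho hr hq hW).const_mul
    2)).sub ((tendsto_dev_mul_queue ν hG h1 h2 h3 hg hrho hr hq hW).const_mul 2)).sub
    (tendsto_queueMean_sq hG h1 h2 h3 hg hrho ν hr hq hW))
  have hval : numberVariance ν + sqQueue lam G - 2 * 0 - 2 * covQueue lam G - meanQueue lam G ^ 2 =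
    numberVariance ν + (sqQueue lam G - meanQueue lam G ^ 2) - 2 * covQueue lam G := by ring
  rw [hval] at hlim
  refine hlim.congr' ?_
  filter_upwards [hF] with χ hχ
  rw [(integral_varianceCurve hG ν hr hq).2, integral_centred_sq hG ν hr hq]
  ring

end mean

/-! ### The workload at an independent exponential time -/

/-- A functional of the workload between two successive arrivals. -/
def gapTerm (φ : ℝ → ℝ≥0∞) (y : ℝ × ℝ) (p : (ℕ → ℝ) × (ℕ → ℝ)) (t : ℝ) : ℝ≥0∞ :=
  Set.indicator (Set.Ico y.1 (y.1 + p.1 0)) (fun t => φ (max (y.2 - (t - y.1)) 0)) t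

/-- Exactly one gap between successive arrivals contains `t`, and in it the workload decreases at
unit rate down to zero. -/
lemma GoodArr.tsum_gapTerm {w : ℝ} {a s : ℕ → ℝ} (h : GoodArr a) (φ : ℝ → ℝ≥0∞) {t : ℝ}
    (ht : 0 ≤ t) :
    ∑' n, gapTerm φ (chainState n (w, a, s)) (shiftSeq n (a, s)) t = φ (workAt w a s t) := by
  rw [tsum_eq_single (arrivals a t)]
  · have := (h.arrivals_eq_iff ht (arrivals a t)).1 rfl
    rw [epoch_succ] at this
    rw [gapTerm, Set.indicator_of_mem]
    · rfl
    · exact this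
  · intro n hn
    rw [gapTerm, Set.indicator_of_notMem]
    intro hmem
    refine hn ((h.arrivals_eq_iff ht n).2 ?_).symm
    rw [epoch_succ]
    exact hmem

section gap
variable {φ : ℝ → ℝ≥0∞} (hφ : Measurable φ)
include hφ

lemma measurable_gapTerm : Measurable
    fun q : ((ℝ × ℝ) × (ℕ → ℝ) × (ℕ → ℝ)) × ℝ => gapTerm φ q.1.1 q.1.2 q.2 := by
  have : (fun q : ((ℝ × ℝ) × (ℕ → ℝ) × (ℕ → ℝ)) × ℝ => gapTerm φ q.1.1 q.1.2 q.2) =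
      Set.indicator ({q | q.1.1.1 ≤ q.2} ∩ {q | q.2 < q.1.1.1 + q.1.2.1 0})
        fun q => φ (max (q.1.1.2 - (q.2 - q.1.1.1)) 0) := by
    ext q
    by_cases h : q.1.1.1 ≤ q.2 ∧ q.2 < q.1.1.1 + q.1.2.1 0
    · rw [gapTerm, Set.indicator_of_mem (show q.2 ∈ Set.Ico _ _ from h), Set.indicator_of_mem]
      exact ⟨h.1, h.2⟩
    · rw [gapTerm, Set.indicator_of_notMem
        (show q.2 ∉ Set.Ico q.1.1.1 (q.1.1.1 + q.1.2.1 0) from fun h' => h h'),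
        Set.indicator_of_notMem]
      exact fun h' => h ⟨h'.1, h'.2⟩
  rw [this]
  refine Measurable.indicator (hφ.comp (by fun_prop)) (MeasurableSet.inter ?_ ?_)
  · exact measurableSet_le (by fun_prop) (by fun_prop)
  · exact measurableSet_lt (by fun_prop) (by fun_prop)

/-- Two lacks of memory: the exponential time restarts at the arrival epoch with a discount, and the
gap survives to age `u` with probability `exp (-(lam * u))`. -/
lemma lintegral_gapTerm (hlam : 0 < lam) [IsProbabilityMeasure G] {θ : ℝ} (hθ : 0 < θ)
    {y : ℝ × ℝ} (hy : 0 ≤ y.1) :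
    ∫⁻ p, ∫⁻ t, gapTerm φ y p t ∂(expMeasure θ) ∂(seqLaw lam G) =
      ENNReal.ofReal (Real.exp (-(θ * y.1))) *
        ∫⁻ u, ENNReal.ofReal (Real.exp (-(lam * u))) * φ (max (y.2 - u) 0) ∂(expMeasure θ) := by
  have : Fact (0 < lam) := ⟨hlam⟩
  have := isProbabilityMeasure_expMeasure hlam
  have := isProbabilityMeasure_expMeasure hθ
  have hm := measurable_gapTerm hφ
  have hs : ∀ p : (ℕ → ℝ) × (ℕ → ℝ), ∫⁻ t, gapTerm φ y p t ∂(expMeasure θ) =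
      ENNReal.ofReal (Real.exp (-(θ * y.1))) *
        ∫⁻ u, Set.indicator (Set.Ioi u) (fun _ => φ (max (y.2 - u) 0)) (p.1 0)
          ∂(expMeasure θ) := fun p => by
    have e : ∀ u, Set.indicator (Set.Ioi u) (fun _ => φ (max (y.2 - u) 0)) (p.1 0) =
        Set.indicator (Set.Iio (p.1 0)) (fun u => φ (max (y.2 - u) 0)) u := fun u => by
      by_cases h : u < p.1 0
      · rw [Set.indicator_of_mem (Set.mem_Ioi.2 h), Set.indicator_of_mem (Set.mem_Iio.2 h)]
      · rw [Set.indicator_of_notMem (fun h' => h (Set.mem_Ioi.1 h')),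
          Set.indicator_of_notMem (fun h' => h (Set.mem_Iio.1 h'))]
    simp_rw [e]
    have hmi : Measurable fun u => Set.indicator (Set.Iio (p.1 0))
        (fun u => φ (max (y.2 - u) 0)) u :=
      (hφ.comp (by fun_prop : Measurable fun u => max (y.2 - u) 0)).indicator measurableSet_Iio
    rw [← lintegral_expMeasure_memoryless hy hmi]
    refine lintegral_congr_ae ?_
    filter_upwards [ae_ne_expMeasure θ y.1] with t ht
    by_cases h : y.1 < t
    · rw [Set.indicator_of_mem (Set.mem_Ioi.2 h), gapTerm]
      by_cases h' : t < y.1 + p.1 0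
      · rw [Set.indicator_of_mem (show t ∈ Set.Ico _ _ from ⟨h.le, h'⟩),
          Set.indicator_of_mem (Set.mem_Iio.2 (by linarith))]
      · rw [Set.indicator_of_notMem (fun hh => h' hh.2),
          Set.indicator_of_notMem (fun hh => h' (by linarith [Set.mem_Iio.1 hh]))]
    · rw [Set.indicator_of_notMem (fun h' => h (Set.mem_Ioi.1 h')), gapTerm,
        Set.indicator_of_notMem (fun hh => h (lt_of_le_of_ne hh.1 ht.symm))]
  simp_rw [hs]
  have hmu : Measurable fun q : ℝ × ℝ =>
      Set.indicator (Set.Ioi q.2) (fun _ => φ (max (y.2 - q.2) 0)) q.1 := by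
    have : (fun q : ℝ × ℝ => Set.indicator (Set.Ioi q.2) (fun _ => φ (max (y.2 - q.2) 0)) q.1) =
        Set.indicator {q : ℝ × ℝ | q.2 < q.1} fun q => φ (max (y.2 - q.2) 0) := by
      ext q
      by_cases h : q.2 < q.1
      · rw [Set.indicator_of_mem (Set.mem_Ioi.2 h), Set.indicator_of_mem]; exact h
      · rw [Set.indicator_of_notMem (fun h' => h (Set.mem_Ioi.1 h')), Set.indicator_of_notMem]
        exact h
    rw [this]
    exact (hφ.comp (by fun_prop)).indicator (measurableSet_lt (by fun_prop) (by fun_prop))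
  have hmi : Measurable fun a : ℝ => ∫⁻ u, Set.indicator (Set.Ioi u)
      (fun _ => φ (max (y.2 - u) 0)) a ∂(expMeasure θ) := Measurable.lintegral_prod_right' hmu
  have hmp : Measurable fun p : (ℕ → ℝ) × (ℕ → ℝ) => ∫⁻ u, Set.indicator (Set.Ioi u)
      (fun _ => φ (max (y.2 - u) 0)) (p.1 0) ∂(expMeasure θ) :=
    hmi.comp (by fun_prop : Measurable fun p : (ℕ → ℝ) × (ℕ → ℝ) => p.1 0)
  rw [lintegral_const_mul _ hmp, lintegral_seqLaw hlam hmp]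
  simp only [lintegral_const, measure_univ, mul_one]
  rw [lintegral_eval (expMeasure lam) 0 hmi, lintegral_lintegral_swap hmu.aemeasurable]
  congr 1
  refine lintegral_congr_ae ?_
  filter_upwards [ae_expMeasure_pos θ] with u hu
  have := lintegral_expMeasure_memoryless (r := lam) hu.le (f := fun _ => φ (max (y.2 - u) 0))
    measurable_const
  rwa [lintegral_const, measure_univ, mul_one] at this

theorem lintegral_abel_workAt (hlam : 0 < lam) [IsProbabilityMeasure G] (μ : Measure ℝ)
    [SFinite μ] {θ : ℝ} (hθ : 0 < θ) :
    ∫⁻ z, ∫⁻ t, φ (workAt z.1 z.2.1 z.2.2 t) ∂(expMeasure θ) ∂(μ.prod (seqLaw lam G)) =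
      ∫⁻ y, ENNReal.ofReal (Real.exp (-(θ * y.2.1))) *
        ∫⁻ u, ENNReal.ofReal (Real.exp (-(lam * u))) * φ (max (y.2.2 - u) 0) ∂(expMeasure θ)
        ∂(occ lam G μ) := by
  have : Fact (0 < lam) := ⟨hlam⟩
  have := isProbabilityMeasure_expMeasure hlam
  have := isProbabilityMeasure_expMeasure hθ
  have hm := measurable_gapTerm hφ
  have hg : ∀ᵐ z ∂(μ.prod (seqLaw lam G)), GoodArr z.2.1 :=
    Measure.quasiMeasurePreserving_snd.ae (Measure.quasiMeasurePreserving_fst.ae (ae_goodArr hlam))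
  have hi : Measurable fun q : (ℕ × ℝ × ℝ) × ℝ => ENNReal.ofReal (Real.exp (-(lam * q.2))) *
      φ (max (q.1.2.2 - q.2) 0) := Measurable.mul (by fun_prop) (hφ.comp (by fun_prop))
  have hi' : Measurable fun y : ℕ × ℝ × ℝ => ∫⁻ u, ENNReal.ofReal (Real.exp (-(lam * u))) *
      φ (max (y.2.2 - u) 0) ∂(expMeasure θ) := Measurable.lintegral_prod_right' hi
  have hgm : ∀ n, Measurable fun q : (ℝ × (ℕ → ℝ) × (ℕ → ℝ)) × ℝ =>
      gapTerm φ (chainState n q.1) (shiftSeq n q.1.2) q.2 := fun n =>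
    hm.comp (f := fun q : (ℝ × (ℕ → ℝ) × (ℕ → ℝ)) × ℝ =>
      ((chainState n q.1, shiftSeq n q.1.2), q.2)) (by fun_prop)
  have e1 : ∫⁻ z, ∫⁻ t, φ (workAt z.1 z.2.1 z.2.2 t) ∂(expMeasure θ) ∂(μ.prod (seqLaw lam G)) =
      ∫⁻ z, ∑' n, ∫⁻ t, gapTerm φ (chainState n z) (shiftSeq n z.2) t ∂(expMeasure θ)
        ∂(μ.prod (seqLaw lam G)) := by
    refine lintegral_congr_ae ?_
    filter_upwards [hg] with z hz
    have hgz : ∀ n, Measurable fun t => gapTerm φ (chainState n z) (shiftSeq n z.2) t :=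
      fun n => (hgm n).comp (f := fun t : ℝ => (z, t)) (by fun_prop)
    rw [← lintegral_tsum fun n => (hgz n).aemeasurable]
    refine lintegral_congr_ae ?_
    filter_upwards [ae_expMeasure_pos θ] with t ht
    exact (hz.tsum_gapTerm φ ht.le).symm
  have hgi : ∀ n, Measurable fun z : ℝ × (ℕ → ℝ) × (ℕ → ℝ) =>
      ∫⁻ t, gapTerm φ (chainState n z) (shiftSeq n z.2) t ∂(expMeasure θ) :=
    fun n => Measurable.lintegral_prod_right' (hgm n)
  have hI : Measurable fun y : ℕ × ℝ × ℝ => ENNReal.ofReal (Real.exp (-(θ * y.2.1))) *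
      ∫⁻ u, ENNReal.ofReal (Real.exp (-(lam * u))) * φ (max (y.2.2 - u) 0) ∂(expMeasure θ) :=
    Measurable.mul (by fun_prop) hi'
  have hF : Measurable fun q : (ℝ × ℝ) × (ℕ → ℝ) × (ℕ → ℝ) =>
      ∫⁻ t, gapTerm φ q.1 q.2 t ∂(expMeasure θ) := Measurable.lintegral_prod_right' hm
  rw [e1, lintegral_tsum fun n => (hgi n).aemeasurable, lintegral_occ _ hI]
  refine tsum_congr fun n => ?_
  refine (lintegral_chain hlam μ n hF).trans ?_
  refine lintegral_congr_ae ?_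
  filter_upwards [hg] with z hz
  exact lintegral_gapTerm hφ hlam hθ (hz.nonneg n)

end gap

/-- Workload at the exponential time. -/
def abelWork (p : (ℝ × (ℕ → ℝ) × (ℕ → ℝ)) × ℝ) : ℝ := workAt p.1.1 p.1.2.1 p.1.2.2 p.2

@[fun_prop]
lemma measurable_abelWork : Measurable abelWork := measurable_workAt

/-- The density of one exponential times the survival probability of the other is the same function
whichever of `θ` and `lam` plays which role, up to the factor `θ / lam`. So the workload at the
exponential time and the one met by the next arrival share a transform. -/
lemma integral_expMeasure_stepK (hlam : 0 < lam) {θ : ℝ} (hθ : 0 < θ) (α Y : ℝ) :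
    ∫ u, Real.exp (-(lam * u)) * Real.exp (-(α * max (Y - u) 0)) ∂(expMeasure θ) =
      θ / lam * stepK lam θ α Y := by
  rw [stepK, integral_expMeasure hθ, integral_expMeasure hlam, ← integral_const_mul]
  refine integral_congr_ae (ae_of_all _ fun u => ?_)
  simp only
  field_simp

theorem abel_work (hlam : 0 < lam) [IsProbabilityMeasure G] (hG : ∀ᵐ x ∂G, 0 ≤ x)
    (μ : Measure ℝ) [IsProbabilityMeasure μ] (hμ : ∀ᵐ w ∂μ, 0 ≤ w) {θ : ℝ} (hθ : 0 < θ)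
    {α : ℝ} (hα : 0 ≤ α) :
    ∫ p, Real.exp (-(α * abelWork p)) ∂(abelSeq lam G μ θ) = θ / lam * occK lam G μ θ α := by
  have : Fact (0 < lam) := ⟨hlam⟩
  have := isProbabilityMeasure_expMeasure hθ
  have hs0 : ∀ Y, 0 ≤ stepK lam θ α Y := fun Y => stepK_nonneg _ _ _ _
  rw [occK, ← integral_const_mul]
  refine (integral_eq_of_lintegral_ofReal (N := occ lam G μ) (by fun_prop)
    (ae_of_all _ fun p => Real.exp_nonneg _)
    ((integrable_occK hlam hG μ hμ hθ hα).const_mul _) (ae_of_all _ fun y => ?_) ?_).2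
  · have := hs0 y.2.2
    positivity
  · have hφ : Measurable fun w : ℝ => ENNReal.ofReal (Real.exp (-(α * w))) := by fun_prop
    have hm : Measurable fun p : (ℝ × (ℕ → ℝ) × (ℕ → ℝ)) × ℝ =>
      ENNReal.ofReal (Real.exp (-(α * abelWork p))) := by fun_prop
    have h := lintegral_abel_workAt (G := G) hφ hlam μ hθ
    rw [abelSeq, lintegral_prod _ hm.aemeasurable]
    refine h.trans (lintegral_congr fun y => ?_)
    have hint : Integrable (fun u => Real.exp (-(lam * u)) * Real.exp (-(α * max (y.2.2 - u) 0)))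
        (expMeasure θ) := by
      refine Integrable.of_bound (by fun_prop) 1 ?_
      filter_upwards [ae_expMeasure_pos θ] with u hu
      rw [Real.norm_of_nonneg (by positivity)]
      exact mul_le_one₀ (exp_neg_mul_le_one hlam.le hu.le) (Real.exp_nonneg _)
        (exp_neg_mul_le_one hα (le_max_right _ _))
    have e : ∫⁻ u, ENNReal.ofReal (Real.exp (-(lam * u))) *
        ENNReal.ofReal (Real.exp (-(α * max (y.2.2 - u) 0))) ∂(expMeasure θ) =
        ENNReal.ofReal (θ / lam * stepK lam θ α y.2.2) := by
      rw [← integral_expMeasure_stepK hlam hθ, ofReal_integral_eq_lintegral_ofReal hint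
        (ae_of_all _ fun u => by positivity)]
      exact lintegral_congr fun u => (ENNReal.ofReal_mul (Real.exp_nonneg _)).symm
    rw [e, ← ENNReal.ofReal_mul (Real.exp_nonneg _)]
    congr 1; ring

/-! ### Evolution of the law of the workload -/

lemma Good.stateAt_snd_nonneg {ω : Input} (h : Good ω) (t : ℝ) : 0 ≤ (stateAt ω t).2 := by
  simp only [stateAt]
  split_ifs
  · exact le_rfl
  · have := (not_congr (h.lt_departures_iff t (departures ω t))).1 (lt_irrefl _)
    linarith [not_le.1 this]

section workload

variable [Fact (0 < lam)] [IsProbabilityMeasure G] (hG : ∀ᵐ x ∂G, 0 ≤ x)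
include hG

lemma ae_stateLaw (ν : Measure State) [IsProbabilityMeasure ν] (t : ℝ) :
    ∀ᵐ s ∂(stateLaw lam G ν t), 0 ≤ s.2 := by
  rw [stateLaw, ae_map_iff (measurable_stateAt_const t).aemeasurable
    (measurableSet_le measurable_const measurable_snd)]
  filter_upwards [ae_good Fact.out hG ν] with ω hω using hω.stateAt_snd_nonneg t

lemma workLaw_stateLaw (ν : Measure State) [IsProbabilityMeasure ν] {t : ℝ} (ht : 0 ≤ t) :
    workLaw lam G (stateLaw lam G ν t) = ((workLaw lam G ν).prod (seqLaw lam G)).map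
      fun z => workAt z.1 z.2.1 z.2.2 t := by
  have hm : Measurable fun z : ℝ × (ℕ → ℝ) × (ℕ → ℝ) => workAt z.1 z.2.1 z.2.2 t :=
    measurable_workAt.comp (f := fun z : ℝ × (ℕ → ℝ) × (ℕ → ℝ) => (z, t)) (by fun_prop)
  have hp := measurePreserving_init (lam := lam) (G := G) ν (φ := Prod.snd) measurable_snd
  have e : (initLaw lam G ν).map Prod.snd = workLaw lam G ν := by
    rw [initLaw, Measure.map_map measurable_snd measurable_initPair]; rfl
  rw [e] at hp
  refine Measure.ext_of_lintegral _ fun f hf => ?_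
  rw [workLaw, lintegral_map hf measurable_initialWork, lintegral_map hf hm]
  have hfi : Measurable fun ω => f (initialWork ω) := hf.comp measurable_initialWork
  rw [← lintegral_markov Fact.out hG ν ht hfi fun ω h => by rw [initialWork_cons ω h],
    ← hp.lintegral_comp (f := fun z => f (workAt z.1 z.2.1 z.2.2 t)) (hf.comp hm)]
  refine lintegral_congr_ae ?_
  filter_upwards [ae_good Fact.out hG ν] with ω hω
  simp only [hω.initialWork_shift ht]

lemma lap_workLaw_stateLaw (ν : Measure State) [IsProbabilityMeasure ν] {t : ℝ} (ht : 0 ≤ t)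
    (α : ℝ) : lap (workLaw lam G (stateLaw lam G ν t)) α =
      ∫ z, Real.exp (-(α * workAt z.1 z.2.1 z.2.2 t)) ∂((workLaw lam G ν).prod (seqLaw lam G)) := by
  have hm : Measurable fun z : ℝ × (ℕ → ℝ) × (ℕ → ℝ) => workAt z.1 z.2.1 z.2.2 t :=
    measurable_workAt.comp (f := fun z : ℝ × (ℕ → ℝ) × (ℕ → ℝ) => (z, t)) (by fun_prop)
  rw [lap, workLaw_stateLaw hG ν ht, integral_map hm.aemeasurable
    (Measurable.aestronglyMeasurable (by fun_prop))]

/-- Abel mean of the transform of the workload. -/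
theorem abel_lap (ν : Measure State) [IsProbabilityMeasure ν] (hr : ∀ᵐ s ∂ν, 0 ≤ s.2) {θ : ℝ}
    (hθ : 0 < θ) {α : ℝ} (hα : 0 ≤ α) :
    Integrable (fun t => lap (workLaw lam G (stateLaw lam G ν t)) α) (expMeasure θ) ∧
    ∫ t, lap (workLaw lam G (stateLaw lam G ν t)) α ∂(expMeasure θ) =
      θ / lam * occK lam G (workLaw lam G ν) θ α := by
  have := isProbabilityMeasure_expMeasure hθ
  have hi : Integrable (fun p => Real.exp (-(α * abelWork p)))
      (abelSeq lam G (workLaw lam G ν) θ) := by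
    unfold abelSeq
    refine Integrable.of_bound (Measurable.aestronglyMeasurable (by fun_prop)) 1
      (ae_of_all _ fun p => ?_)
    rw [Real.norm_of_nonneg (Real.exp_nonneg _)]
    exact exp_neg_mul_le_one hα (le_max_right _ _)
  have hc : (fun t => lap (workLaw lam G (stateLaw lam G ν t)) α) =ᵐ[expMeasure θ] fun t =>
      ∫ z, Real.exp (-(α * abelWork (z, t))) ∂((workLaw lam G ν).prod (seqLaw lam G)) := by
    filter_upwards [ae_expMeasure_pos θ] with t ht
    exact lap_workLaw_stateLaw hG ν ht.le α
  rw [← abel_work Fact.out hG _ (ae_workLaw ν hG hr) hθ hα, integral_congr_ae hc,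
    integrable_congr hc]
  unfold abelSeq at hi ⊢
  exact ⟨hi.integral_prod_right, (integral_prod_symm _ hi).symm⟩

omit hG in
lemma workLaw_dirac : workLaw lam G (Measure.dirac ((0, 0) : State)) = Measure.dirac 0 := by
  have h : initialWork =ᵐ[law lam G (Measure.dirac ((0, 0) : State))] fun _ => (0 : ℝ) := by
    filter_upwards [ae_law_dirac] with ω hω
    simp [initialWork, hω]
  rw [workLaw, Measure.map_congr h, Measure.map_const, measure_univ, one_smul]

omit hG in
lemma ae_dirac_nonneg : ∀ᵐ s ∂(Measure.dirac ((0, 0) : State)), (0 : ℝ) ≤ s.2 := by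
  rw [ae_dirac_iff (measurableSet_le (by fun_prop) (by fun_prop))]

/-- The workload of the queue that starts empty is stochastically increasing. -/
lemma lap_workLaw_anti {α : ℝ} (hα : 0 ≤ α) {s t : ℝ} (hs : 0 ≤ s) (hst : s ≤ t) :
    lap (workLaw lam G (stateLaw lam G (Measure.dirac ((0, 0) : State)) t)) α ≤
      lap (workLaw lam G (stateLaw lam G (Measure.dirac ((0, 0) : State)) s)) α := by
  set δ : Measure State := Measure.dirac ((0, 0) : State) with hδ
  set M := workLaw lam G (stateLaw lam G δ (t - s)) with hM
  have hts : 0 ≤ t - s := by linarith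
  have hw : ∀ᵐ w ∂M, 0 ≤ w := ae_workLaw _ hG (ae_stateLaw hG δ (t - s))
  have hm : Measurable fun z : ℝ × (ℕ → ℝ) × (ℕ → ℝ) => workAt z.1 z.2.1 z.2.2 s :=
    measurable_workAt.comp (f := fun z : ℝ × (ℕ → ℝ) × (ℕ → ℝ) => (z, s)) (by fun_prop)
  have hm0 : Measurable fun z : (ℕ → ℝ) × (ℕ → ℝ) => workAt 0 z.1 z.2 s :=
    hm.comp (f := fun z : (ℕ → ℝ) × (ℕ → ℝ) => ((0 : ℝ), z)) (by fun_prop)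
  have hm0' : Measurable fun z : ℝ × (ℕ → ℝ) × (ℕ → ℝ) => workAt 0 z.2.1 z.2.2 s :=
    hm0.comp measurable_snd
  have hb : ∀ (w : ℝ) (a σ : ℕ → ℝ), ‖Real.exp (-(α * workAt w a σ s))‖ ≤ 1 := fun w a σ => by
    rw [Real.norm_of_nonneg (Real.exp_nonneg _)]
    exact exp_neg_mul_le_one hα (le_max_right _ _)
  -- The queue at `t` is run for time `s` from the state reached at `t - s`. The empty start has the
  -- least work, and `workAt` is monotone in the initial work.
  have e1 : lap (workLaw lam G (stateLaw lam G δ t)) α =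
      ∫ z, Real.exp (-(α * workAt z.1 z.2.1 z.2.2 s)) ∂(M.prod (seqLaw lam G)) := by
    rw [← lap_workLaw_stateLaw hG _ hs, stateLaw_stateLaw Fact.out hG δ hts hs, sub_add_cancel]
  have e2 : ∀ μ : Measure ℝ, IsProbabilityMeasure μ → ∫ z, Real.exp (-(α * workAt 0 z.1 z.2 s))
      ∂(seqLaw lam G) = ∫ z : ℝ × (ℕ → ℝ) × (ℕ → ℝ), Real.exp (-(α * workAt 0 z.2.1 z.2.2 s))
      ∂(μ.prod (seqLaw lam G)) := fun μ hμ =>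
    (integral_comp_measurePreserving (measurePreserving_snd (μ := μ) (ν := seqLaw lam G))
      (k := fun z : (ℕ → ℝ) × (ℕ → ℝ) => Real.exp (-(α * workAt 0 z.1 z.2 s))) (by fun_prop)).symm
  have e3 : lap (workLaw lam G (stateLaw lam G δ s)) α =
      ∫ z, Real.exp (-(α * workAt 0 z.2.1 z.2.2 s)) ∂(M.prod (seqLaw lam G)) := by
    rw [lap_workLaw_stateLaw hG _ hs, hδ, workLaw_dirac, ← e2 M inferInstance,
      e2 (Measure.dirac 0) inferInstance]
    refine integral_congr_ae ?_
    have h0 : ∀ᵐ w ∂(Measure.dirac (0 : ℝ)), w = 0 := by simp [ae_dirac_eq]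
    filter_upwards [Measure.quasiMeasurePreserving_fst.ae h0] with z hz
    rw [hz]
  rw [e1, e3]
  refine integral_mono_ae (Integrable.of_bound (Measurable.aestronglyMeasurable (by fun_prop)) 1
      (ae_of_all _ fun z => hb _ _ _))
    (Integrable.of_bound (Measurable.aestronglyMeasurable (by fun_prop)) 1 (ae_of_all _ fun z => hb _ _ _)) ?_
  filter_upwards [Measure.quasiMeasurePreserving_fst.ae hw] with z hz
  refine Real.exp_le_exp.2 (neg_le_neg (mul_le_mul_of_nonneg_left ?_ hα))
  exact workAt_mono hz _ _ _

variable (h1 : Integrable (fun x => x) G) (h2 : Integrable (fun x => x ^ 2) G)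
    (h3 : Integrable (fun x => x ^ 3) G) (hrho : lam * ∫ x, x ∂G < 1)
include h1 hrho

/-- Consequence of the identity for the workload at the singular argument. -/
lemma occK_eta (μ : Measure ℝ) [IsProbabilityMeasure μ] (hμ : ∀ᵐ w ∂μ, 0 ≤ w) {χ α : ℝ}
    (hχ : 0 < χ) (hα : 0 ≤ α) :
    (eta lam G χ - eta lam G α) * (eta lam G χ / lam * occK lam G μ (eta lam G χ) α) =
      eta lam G χ * (lap μ α - α * (lap μ χ / χ)) := by
  have hl : 0 < lam := Fact.out
  obtain ⟨p, hp⟩ := occK_identity hl hG μ hμ (eta_pos hl hG h1 hrho hχ)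
  have hp1 := hp χ hχ.le
  have hp2 := hp α hα
  have e : lap μ χ = χ * p := by
    have : lam * (lap μ χ - χ * p) = 0 := by rw [← hp1, eta]; ring
    linarith [(mul_eq_zero.1 this).resolve_left hl.ne']
  change (eta lam G χ - eta lam G α) * _ = _ at hp2
  rw [mul_left_comm, hp2, e]
  field_simp

include h2 h3

omit [Fact (0 < lam)] h1 h2 h3 hrho in
lemma tendsto_eta_div (h1 : Integrable (fun x => x) G) (h2 : Integrable (fun x => x ^ 2) G)
    (h3 : Integrable (fun x => x ^ 3) G) :
    Tendsto (fun χ => eta lam G χ / χ) (𝓝[>] 0) (𝓝 (1 - lam * ∫ x, x ∂G)) :=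
  (hasExp2_eta hG h1 h2 h3).tendsto_div

/-- Lower bound for the transform of the workload of the queue that starts empty. -/
lemma le_lap_workLaw {α t : ℝ} (hα : 0 < α) (ht : 0 ≤ t) :
    (1 - lam * ∫ x, x ∂G) * (α / eta lam G α) ≤
    lap (workLaw lam G (stateLaw lam G (Measure.dirac ((0, 0) : State)) t)) α := by
  have hl : 0 < lam := Fact.out
  set δ : Measure State := Measure.dirac ((0, 0) : State) with hδ
  have hw : ∀ t, ∀ᵐ w ∂(workLaw lam G (stateLaw lam G δ t)), 0 ≤ w := fun t =>
    ae_workLaw _ hG (ae_stateLaw hG δ t)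
  have hηα := eta_pos hl hG h1 hrho hα
  have hη0 := tendsto_eta hl hG h1 h2 h3 hrho
  have hη : Tendsto (eta lam G) (𝓝[>] 0) (𝓝 0) := hη0.mono_right nhdsWithin_le_nhds
  set l := fun t => lap (workLaw lam G (stateLaw lam G δ t)) α with hldef
  -- Limit of the averages of `l` for fixed `α`: it is the Pollaczek-Khinchine transform. As `l`
  -- decreases in time, it never falls below this limit.
  have hK : Tendsto (fun χ => eta lam G χ / lam *
      occK lam G (workLaw lam G δ) (eta lam G χ) α) (𝓝[>] 0)
      (𝓝 ((0 - α * (1 - lam * ∫ x, x ∂G)) / (0 - eta lam G α))) := by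
    refine Tendsto.congr' ?_ ((hη.sub ((tendsto_eta_div hG h1 h2 h3).const_mul α)).div
      (hη.sub_const (eta lam G α)) (by linarith))
    filter_upwards [eventually_pos_right, hη.eventually (gt_mem_nhds hηα)] with χ hχ hlt
    have h := occK_eta hG h1 hrho (workLaw lam G δ) (ae_workLaw _ hG ae_dirac_nonneg) hχ hα.le
    rw [hδ, workLaw_dirac] at h ⊢
    have e : ∀ β, lap (Measure.dirac 0) β = 1 := fun β => by simp [lap]
    rw [e, e] at h
    simp only [Pi.div_apply]
    rw [div_eq_iff (by linarith), mul_comm _ (eta lam G χ - eta lam G α), h]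
    ring
  have hE : Tendsto (fun χ => Real.exp (-(eta lam G χ * t)) * (1 - l t)) (𝓝[>] 0)
      (𝓝 (1 - l t)) := by
    have hc : Continuous fun θ : ℝ => Real.exp (-(θ * t)) * (1 - l t) := by fun_prop
    have := (hc.tendsto 0).comp hη
    simp only [zero_mul, neg_zero, Real.exp_zero, one_mul] at this
    exact this
  have := le_of_tendsto_of_tendsto hE (hK.const_sub 1) ?_
  · have e : (0 - α * (1 - lam * ∫ x, x ∂G)) / (0 - eta lam G α) =
      (1 - lam * ∫ x, x ∂G) * (α / eta lam G α) := by
      have := hηα.ne'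
      rw [zero_sub, zero_sub, neg_div_neg_eq]; ring
    rw [e] at this
    linarith
  · filter_upwards [eventually_pos_right] with χ hχ
    have hθ := eta_pos hl hG h1 hrho hχ
    have := isProbabilityMeasure_expMeasure hθ
    have ha := abel_lap (lam := lam) hG δ ae_dirac_nonneg hθ hα.le
    have hb := exp_mul_le_integral hθ ht (f := fun t => 1 - l t) ((integrable_const 1).sub ha.1)
      (fun s _ => sub_nonneg.2 (lap_le_one (hw s) hα.le))
      fun s hs => sub_le_sub_left (lap_workLaw_anti (lam := lam) hG hα.le ht hs) 1
    refine hb.trans_eq ?_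
    rw [integral_sub (integrable_const 1) ha.1, ha.2]
    simp

/-- The workload of the queue that starts empty is tight. -/
lemma exists_workLaw_Ioi_le {ε : ℝ} (hε : 0 < ε) : ∃ K : ℝ, 0 ≤ K ∧ ∀ t, 0 ≤ t →
    (workLaw lam G (stateLaw lam G (Measure.dirac ((0, 0) : State)) t)).real (Set.Ioi K) ≤ ε := by
  have hr : 0 < 1 - lam * ∫ x, x ∂G := by linarith
  have hlim : Tendsto (fun α => (1 - lam * ∫ x, x ∂G) * (α / eta lam G α)) (𝓝[>] 0) (𝓝 1) := by
    have := ((tendsto_eta_div (lam := lam) hG h1 h2 h3).inv₀ hr.ne').const_mul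
      (1 - lam * ∫ x, x ∂G)
    rw [mul_inv_cancel₀ hr.ne'] at this
    simpa only [inv_div] using this
  have hc : 0 < 1 - Real.exp (-1) := by
    have := Real.exp_lt_exp.2 (show (-1 : ℝ) < 0 by norm_num)
    rw [Real.exp_zero] at this; linarith
  -- The lower bound of `le_lap_workLaw` tends to `1` as `α` tends to `0`, so `1 - lap` can be made
  -- at most `(1 - exp (-1)) * ε` for all times at once. Beyond `1 / α` the function `1 - exp (-(α *
  -- w))` exceeds `1 - exp (-1)`, and Markov's inequality applies with `K = 1 / α`.
  obtain ⟨α, hα, hαl⟩ := (eventually_pos_right.and (hlim.eventually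
    (lt_mem_nhds (show 1 - (1 - Real.exp (-1)) * ε < 1 by nlinarith)))).exists
  refine ⟨1 / α, by positivity, fun t ht => ?_⟩
  have hl := le_lap_workLaw hG h1 h2 h3 hrho hα ht
  set M := workLaw lam G (stateLaw lam G (Measure.dirac ((0, 0) : State)) t) with hM
  have hw : ∀ᵐ w ∂M, 0 ≤ w := ae_workLaw _ hG (ae_stateLaw hG _ t)
  have hi := integrable_lap hw hα.le
  have : (1 - Real.exp (-1)) * M.real (Set.Ioi (1 / α)) ≤ 1 - lap M α := by
    have e1 : (1 - Real.exp (-1)) * M.real (Set.Ioi (1 / α)) =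
        ∫ w, Set.indicator (Set.Ioi (1 / α)) (fun _ => 1 - Real.exp (-1)) w ∂M := by
      rw [integral_indicator measurableSet_Ioi, setIntegral_const, smul_eq_mul, mul_comm]
    have e2 : 1 - lap M α = ∫ w, (1 - Real.exp (-(α * w))) ∂M := by
      rw [integral_sub (integrable_const 1) hi, lap]; simp
    rw [e1, e2]
    refine integral_mono_ae ((integrable_const _).indicator measurableSet_Ioi)
      ((integrable_const 1).sub hi) ?_
    filter_upwards [hw] with w hw
    by_cases h : 1 / α < w
    · rw [Set.indicator_of_mem (Set.mem_Ioi.2 h)]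
      have : 1 ≤ α * w := by rw [div_lt_iff₀ hα] at h; linarith
      have := Real.exp_le_exp.2 (neg_le_neg this)
      linarith
    · rw [Set.indicator_of_notMem (fun h' => h (Set.mem_Ioi.1 h'))]
      exact sub_nonneg.2 (exp_neg_mul_le_one hα.le hw)
  have : (1 - Real.exp (-1)) * M.real (Set.Ioi (1 / α)) ≤ (1 - Real.exp (-1)) * ε := by linarith
  exact le_of_mul_le_mul_left this hc

end workload

/-! ### Setwise uniform limits of probability measures -/

section setwise

variable {X : Type*} [MeasurableSpace X]

/-- A family of probability measures that is Cauchy uniformly over the measurable sets has a limit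
in the same sense. -/
theorem exists_uniform_limit (μ : ℝ → Measure X) [∀ t, IsProbabilityMeasure (μ t)]
    (h : ∀ ε : ℝ, 0 < ε → ∃ T, ∀ s, T ≤ s → ∀ t, T ≤ t → ∀ B, MeasurableSet B →
      |(μ s).real B - (μ t).real B| ≤ ε) :
    ∃ π : Measure X, IsProbabilityMeasure π ∧ ∀ ε : ℝ, 0 < ε → ∃ T, ∀ t, T ≤ t →
      ∀ B, MeasurableSet B → |(μ t).real B - π.real B| ≤ ε := by
  have hlim : ∀ B, MeasurableSet B → ∃ l, Tendsto (fun t => (μ t).real B) atTop (𝓝 l) :=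
    fun B hB => by
      refine cauchy_map_iff_exists_tendsto.1 (Metric.cauchy_iff.2 ⟨inferInstance, fun ε hε => ?_⟩)
      obtain ⟨T, hT⟩ := h (ε / 2) (by positivity)
      refine ⟨(fun t => (μ t).real B) '' Set.Ici T, image_mem_map (Ici_mem_atTop T), ?_⟩
      rintro _ ⟨s, hs, rfl⟩ _ ⟨t, ht, rfl⟩
      exact (hT s hs t ht B hB).trans_lt (by linarith)
  choose! L hL using hlim
  have hnn : ∀ B, MeasurableSet B → 0 ≤ L B := fun B hB =>
    ge_of_tendsto' (hL B hB) fun t => measureReal_nonneg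
  have hunif : ∀ ε : ℝ, 0 < ε → ∃ T, ∀ t, T ≤ t → ∀ B, MeasurableSet B →
      |(μ t).real B - L B| ≤ ε := fun ε hε => by
    obtain ⟨T, hT⟩ := h ε hε
    refine ⟨T, fun t ht B hB => ?_⟩
    refine le_of_tendsto ((tendsto_const_nhds.sub (hL B hB)).abs) ?_
    filter_upwards [Ici_mem_atTop T] with s hs using hT t ht s hs B hB
  -- Countable additivity of the limit: partial unions exhaust the union for the single measure `μ
  -- T`, and closeness of `μ T` to `L` uniformly over all sets carries this over to `L`.
  have hsum : ∀ f : ℕ → Set X, (∀ i, MeasurableSet (f i)) → Pairwise (Function.onFun Disjoint f) →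
      HasSum (fun i => L (f i)) (L (⋃ i, f i)) := fun f hf hd => by
    have hpart : ∀ n, ∑ i ∈ Finset.range n, L (f i) = L (⋃ i ∈ Finset.range n, f i) := fun n => by
      refine tendsto_nhds_unique (tendsto_finsetSum _ fun i _ => hL (f i) (hf i)) ?_
      refine (hL _ (Finset.measurableSet_biUnion _ fun i _ => hf i)).congr fun t => ?_
      rw [measureReal_biUnion_finset (fun i _ j _ hij => hd hij) fun i _ => hf i]
    rw [hasSum_iff_tendsto_nat_of_nonneg fun i => hnn _ (hf i)]
    simp_rw [hpart]
    have hU := MeasurableSet.iUnion hf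
    have hP : ∀ n, MeasurableSet (⋃ i ∈ Finset.range n, f i) := fun n =>
      Finset.measurableSet_biUnion _ fun i _ => hf i
    refine Metric.tendsto_nhds.2 fun ε hε => ?_
    obtain ⟨T, hT⟩ := hunif (ε / 4) (by positivity)
    have hc : Tendsto (fun n => (μ T).real (⋃ i ∈ Finset.range n, f i)) atTop
        (𝓝 ((μ T).real (⋃ i, f i))) := by
      have := (hasSum_iff_tendsto_nat_of_nonneg
        (fun i => ENNReal.toReal_nonneg (a := (μ T) (f i))) _).1
        ((summable_measure_toReal (μ := μ T) hf hd).hasSum)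
      have e : ∑' i, (μ T).real (f i) = (μ T).real (⋃ i, f i) := by
        rw [measureReal_def (s := ⋃ i, f i), measure_iUnion hd hf, ENNReal.tsum_toReal_eq fun i => measure_ne_top _ _]
        rfl
      rw [e] at this
      refine this.congr fun n => ?_
      rw [measureReal_biUnion_finset (fun i _ j _ hij => hd hij) fun i _ => hf i]
      rfl
    filter_upwards [Metric.tendsto_nhds.1 hc (ε / 4) (by positivity)] with n hn
    have a1 := abs_le.1 (hT T le_rfl _ (hP n))
    have a2 := abs_le.1 (hT T le_rfl _ hU)
    rw [Real.dist_eq] at hn ⊢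
    have a3 := abs_lt.1 hn
    exact abs_lt.2 ⟨by linarith [a1.2, a2.1, a3.1], by linarith [a1.1, a2.2, a3.2]⟩
  have h0 : L ∅ = 0 := tendsto_nhds_unique (hL _ MeasurableSet.empty) (by simp)
  have h1 : L Set.univ = 1 := tendsto_nhds_unique (hL _ MeasurableSet.univ) (by simp)
  set π : Measure X := Measure.ofMeasurable (fun B _ => ENNReal.ofReal (L B)) (by simp [h0])
    (fun f hf hd => by
      have hs := hsum f hf hd
      rw [← hs.tsum_eq, ENNReal.ofReal_tsum_of_nonneg (fun i => hnn _ (hf i)) hs.summable]) with hπ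
  have hπB : ∀ B, MeasurableSet B → π B = ENNReal.ofReal (L B) := fun B hB =>
    Measure.ofMeasurable_apply B hB
  refine ⟨π, ⟨by rw [hπB _ MeasurableSet.univ, h1, ENNReal.ofReal_one]⟩, fun ε hε => ?_⟩
  obtain ⟨T, hT⟩ := hunif ε hε
  refine ⟨T, fun t ht B hB => ?_⟩
  rw [measureReal_def π, hπB B hB, ENNReal.toReal_ofReal (hnn B hB)]
  exact hT t ht B hB

/-- Layer-cake formula: only levels between `0` and `1` count, and each of them costs at most `ε`.
-/
lemma lintegral_le_add_of_measure_le {μ ν : Measure X} {ε : ℝ≥0∞}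
    (h : ∀ B, MeasurableSet B → μ B ≤ ν B + ε) {f : X → ℝ} (hf : Measurable f)
    (h0 : ∀ x, 0 ≤ f x) (h1 : ∀ x, f x ≤ 1) :
    ∫⁻ x, ENNReal.ofReal (f x) ∂μ ≤ ∫⁻ x, ENNReal.ofReal (f x) ∂ν + ε := by
  rw [lintegral_eq_lintegral_meas_lt μ (ae_of_all _ h0) hf.aemeasurable,
    lintegral_eq_lintegral_meas_lt ν (ae_of_all _ h0) hf.aemeasurable]
  have hm : ∀ t, MeasurableSet {x | t < f x} := fun t => measurableSet_lt measurable_const hf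
  calc ∫⁻ t in Set.Ioi 0, μ {x | t < f x}
      ≤ ∫⁻ t in Set.Ioi 0, (ν {x | t < f x} + Set.indicator (Set.Ioc 0 1) (fun _ => ε) t) := by
        refine setLIntegral_mono_ae' measurableSet_Ioi (ae_of_all _ fun t ht => ?_)
        by_cases h' : t ≤ 1
        · rw [Set.indicator_of_mem (show t ∈ Set.Ioc (0 : ℝ) 1 from ⟨ht, h'⟩)]
          exact h _ (hm t)
        · have : {x | t < f x} = ∅ := by
            ext x
            simp only [Set.mem_ofPred_eq, Set.mem_empty_iff_false, iff_false, not_lt]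
            exact (h1 x).trans (not_le.1 h').le
          rw [this, measure_empty]
          exact bot_le
    _ ≤ (∫⁻ t in Set.Ioi 0, ν {x | t < f x}) + ε := by
        rw [lintegral_add_right _ (measurable_const.indicator measurableSet_Ioc)]
        gcongr
        rw [lintegral_indicator measurableSet_Ioc, setLIntegral_const]
        refine (mul_le_mul_right (Measure.restrict_le_self _) ε).trans ?_
        simp

end setwise

lemma abs_measureReal_sub_le {Ω : Type*} [MeasurableSpace Ω] (P : Measure Ω) [IsFiniteMeasure P]
    {A A' C : Set Ω} (h : ∀ᵐ ω ∂P, ω ∉ C → (ω ∈ A ↔ ω ∈ A')) :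
    |P.real A - P.real A'| ≤ P.real C := by
  have key : ∀ S S' : Set Ω, (∀ᵐ ω ∂P, ω ∉ C → ω ∈ S → ω ∈ S') → P.real S ≤ P.real S' + P.real C :=
    fun S S' hS => by
      refine (ENNReal.toReal_mono (measure_ne_top P (S' ∪ C)) (measure_mono_ae ?_)).trans
        (measureReal_union_le _ _)
      filter_upwards [hS] with ω hω hω'
      by_cases hC : ω ∈ C
      · exact Or.inr hC
      · exact Or.inl (hω hC hω')
  have k1 := key A A' (h.mono fun ω hω hC => (hω hC).1)
  have k2 := key A' A (h.mono fun ω hω hC => (hω hC).2)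
  exact abs_le.2 ⟨by linarith, by linarith⟩

/-! ### Coupling with the queue that starts empty -/

/-- Before time `t` some exogenous arrival finds that all earlier ones, and a further amount `K` of
work, could have been served. -/
def Renewed (K t : ℝ) (z : (ℕ → ℝ) × (ℕ → ℝ)) : Prop :=
  ∃ j, epoch z.1 (j + 1) ≤ t ∧ K + epoch z.2 j ≤ epoch z.1 (j + 1)

lemma measurableSet_renewed (K t : ℝ) : MeasurableSet {z | Renewed K t z} := by
  have he : ∀ n, Measurable fun z : (ℕ → ℝ) × (ℕ → ℝ) => epoch z.1 n := fun n => by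
    unfold epoch; fun_prop
  have he' : ∀ n, Measurable fun z : (ℕ → ℝ) × (ℕ → ℝ) => epoch z.2 n := fun n => by
    unfold epoch; fun_prop
  have : {z | Renewed K t z} = ⋃ j, {z : (ℕ → ℝ) × (ℕ → ℝ) | epoch z.1 (j + 1) ≤ t} ∩
      {z | K + epoch z.2 j ≤ epoch z.1 (j + 1)} := by
    ext z; simp [Renewed]
  rw [this]
  exact MeasurableSet.iUnion fun j => (measurableSet_le (he _) measurable_const).inter
    (measurableSet_le ((he' j).const_add K) (he _))

section coupling

variable [Fact (0 < lam)] [IsProbabilityMeasure G] (hG : ∀ᵐ x ∂G, 0 ≤ x)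

/-- By the strong law the arrival epochs outgrow the accumulated service times with drift `1 / lam`
minus the mean service time, which is positive for a stable queue. Any amount `K` is eventually
absorbed. -/
lemma ae_exists_renewed (h1 : Integrable (fun x => x) G) (hrho : lam * ∫ x, x ∂G < 1) (K : ℝ) :
    ∀ᵐ z ∂(seqLaw lam G), ∃ n : ℕ, Renewed K n z := by
  have hl : 0 < lam := Fact.out
  have := isProbabilityMeasure_expMeasure hl
  have hint : Integrable (fun x => x) (expMeasure lam) := by
    simpa using integrable_pow_expMeasure hl 1
  have e1 : ∫ x, x ∂(expMeasure lam) = 1 / lam := by simpa using integral_pow_expMeasure hl 1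
  filter_upwards [Measure.quasiMeasurePreserving_fst.ae (iid_slln (expMeasure lam) hint),
    Measure.quasiMeasurePreserving_snd.ae (iid_slln G h1)] with z ha hs
  rw [e1] at ha
  have hpos : 0 < 1 / lam - ∫ x, x ∂G := by
    rw [sub_pos, lt_div_iff₀ hl, mul_comm]; exact hrho
  have hd := (ha.comp (tendsto_add_atTop_nat 1))
  have hK : Tendsto (fun n : ℕ => K / (n : ℝ)) atTop (𝓝 0) :=
    tendsto_const_nhds.div_atTop tendsto_natCast_atTop_atTop
  have hq : Tendsto (fun n : ℕ => ((n : ℝ) + 1) / n) atTop (𝓝 1) := by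
    have : Tendsto (fun n : ℕ => 1 + 1 / (n : ℝ)) atTop (𝓝 (1 + 0)) :=
      tendsto_const_nhds.add tendsto_one_div_atTop_nhds_zero_nat
    rw [add_zero] at this
    refine this.congr' ?_
    filter_upwards [eventually_gt_atTop 0] with n hn
    field_simp
  have hlim := ((hd.mul hq).sub hs).sub hK
  rw [mul_one, sub_zero] at hlim
  obtain ⟨j, hj, hj0⟩ := ((hlim.eventually (lt_mem_nhds hpos)).and (eventually_gt_atTop 0)).exists
  obtain ⟨n, hn⟩ := exists_nat_ge (epoch z.1 (j + 1))
  refine ⟨n, j, hn, ?_⟩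
  have hjp : (0 : ℝ) < j := Nat.cast_pos.2 hj0
  have e : (epoch z.1 (j + 1) - epoch z.2 j - K) / j =
      ((∑ i ∈ Finset.range (j + 1), z.1 i) / ((j + 1 : ℕ) : ℝ)) * (((j : ℝ) + 1) / j) -
        (∑ i ∈ Finset.range j, z.2 i) / (j : ℝ) - K / j := by
    unfold epoch; push_cast; field_simp
  simp only [Function.comp_apply] at hj
  rw [← e, div_pos_iff_of_pos_right hjp] at hj
  linarith

lemma exists_renewed_compl_le (h1 : Integrable (fun x => x) G) (hrho : lam * ∫ x, x ∂G < 1) (K : ℝ)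
    {ε : ℝ} (hε : 0 < ε) :
    ∃ T : ℝ, 0 ≤ T ∧ (seqLaw lam G).real {z | ¬ Renewed K T z} ≤ ε := by
  have hmono : Monotone fun n : ℕ => {z | Renewed K n z} := fun m n hmn z hz => by
    obtain ⟨j, hj, hj'⟩ := hz
    exact ⟨j, hj.trans (Nat.cast_le.2 hmn), hj'⟩
  have hU : (seqLaw lam G) (⋃ n : ℕ, {z | Renewed K n z}) = 1 := by
    rw [← prob_compl_eq_zero_iff (MeasurableSet.iUnion fun n : ℕ => measurableSet_renewed K n),
      ← mem_ae_iff]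
    filter_upwards [ae_exists_renewed h1 hrho K] with z hz using Set.mem_iUnion.2 hz
  have ht := tendsto_measure_iUnion_atTop (μ := seqLaw lam G) hmono
  rw [hU] at ht
  have ht' : Tendsto (fun n : ℕ => (seqLaw lam G).real {z | Renewed K n z}) atTop (𝓝 1) :=
    (ENNReal.tendsto_toReal ENNReal.one_ne_top).comp ht
  obtain ⟨n, hn⟩ := (ht'.eventually (lt_mem_nhds (show 1 - ε < 1 by linarith))).exists
  refine ⟨n, Nat.cast_nonneg n, ?_⟩
  have := probReal_compl_eq_one_sub (μ := seqLaw lam G) (measurableSet_renewed K n)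
  change (seqLaw lam G).real {z | Renewed K n z}ᶜ ≤ ε
  rw [this]; linarith

include hG

/-- Coupling through common arrivals and services: the states agree at `t` unless the initial work
exceeds `K` or the common input has not yet absorbed `K`. -/
lemma abs_stateLaw_sub_le (ν : Measure State) [IsProbabilityMeasure ν] (hr : ∀ᵐ s ∂ν, 0 ≤ s.2)
    {t : ℝ} (ht : 0 ≤ t) (K : ℝ) {B : Set State} (hB : MeasurableSet B) :
    |(stateLaw lam G ν t).real B -
      (stateLaw lam G (Measure.dirac ((0, 0) : State)) t).real B| ≤
    (workLaw lam G ν).real (Set.Ioi K) + (seqLaw lam G).real {z | ¬ Renewed K t z} := by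
  have hl : 0 < lam := Fact.out
  set S := (fun z : (ℕ → ℝ) × (ℕ → ℝ) => stateAt ((0, 0), z) t) ⁻¹' B with hS
  have hSm : MeasurableSet S := ((measurable_stateAt_const t).comp
    (f := fun z : (ℕ → ℝ) × (ℕ → ℝ) => (((0, 0), z) : Input)) (by fun_prop)) hB
  have e0 : ∀ (μ : Measure State) [IsProbabilityMeasure μ], (law lam G μ).real
      ((fun ω => (ω.2.1, newServ ω)) ⁻¹' S) = (seqLaw lam G).real S := fun μ _ => by
    rw [measureReal_def, (measurePreserving_later μ).measure_preimage hSm.nullMeasurableSet,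
      measureReal_def]
  have e1 : (stateLaw lam G (Measure.dirac ((0, 0) : State)) t).real B =
      (law lam G ν).real ((fun ω => (ω.2.1, newServ ω)) ⁻¹' S) := by
    rw [e0 ν, ← e0 (Measure.dirac ((0, 0) : State)), stateLaw,
      map_measureReal_apply (measurable_stateAt_const t) hB]
    refine measureReal_congr ?_
    filter_upwards [ae_law_dirac] with ω hω
    have : ((0, 0), ω.2.1, newServ ω) = ω := by
      obtain ⟨x, a, σ⟩ := ω
      simp only at hω
      subst hω
      have : newServ ((0, 0), a, σ) = σ := funext fun j => congrArg σ (zero_add j)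
      rw [this]
    refine propext ?_
    change stateAt ω t ∈ B ↔ stateAt ((0, 0), ω.2.1, newServ ω) t ∈ B
    rw [this]
  rw [e1, stateLaw, map_measureReal_apply (measurable_stateAt_const t) hB]
  have eC : (workLaw lam G ν).real (Set.Ioi K) =
      (law lam G ν).real (initialWork ⁻¹' Set.Ioi K) := by
    rw [workLaw, map_measureReal_apply measurable_initialWork measurableSet_Ioi]
  have eR : (seqLaw lam G).real {z | ¬ Renewed K t z} =
      (law lam G ν).real ((fun ω => (ω.2.1, newServ ω)) ⁻¹' {z | ¬ Renewed K t z}) := by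
    rw [measureReal_def, measureReal_def]
    exact congrArg _ ((measurePreserving_later ν).measure_preimage
      (measurableSet_renewed K t).compl.nullMeasurableSet).symm
  rw [eC, eR]
  refine (abs_measureReal_sub_le (C := initialWork ⁻¹' Set.Ioi K ∪
    (fun ω => (ω.2.1, newServ ω)) ⁻¹' {z | ¬ Renewed K t z}) _ ?_).trans
    (measureReal_union_le _ _)
  filter_upwards [ae_initialWork hG ν hr] with ω hω hC
  rw [Set.mem_union, not_or] at hC
  have hK : initialWork ω ≤ K := not_lt.1 hC.1
  have hR : Renewed K t (ω.2.1, newServ ω) := not_not.1 hC.2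
  have := hω.1.stateAt_emptied ht hω.2 hK hR
  change stateAt ω t ∈ B ↔ stateAt (emptied ω) t ∈ B
  rw [this]

-- Running the queue integrates the initial law against transition probabilities, which lie in `[0,
-- 1]`, so a setwise error bound is not enlarged.
omit hG in
lemma stateLaw_le_add {ν ν' : Measure State} {ε : ℝ≥0∞}
    (h : ∀ B, MeasurableSet B → ν B ≤ ν' B + ε) (t : ℝ) {B : Set State} (hB : MeasurableSet B) :
    stateLaw lam G ν t B ≤ stateLaw lam G ν' t B + ε := by
  have hl : 0 < lam := Fact.out
  have := isProbabilityMeasure_expMeasure hl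
  set P := (iid (expMeasure lam)).prod (iid G) with hP
  set C := (fun ω => stateAt ω t) ⁻¹' B with hC
  have hCm : MeasurableSet C := measurable_stateAt_const t hB
  have key : ∀ μ : Measure State, stateLaw lam G μ t B =
      ∫⁻ x, ENNReal.ofReal (P.real (Prod.mk x ⁻¹' C)) ∂μ := fun μ => by
    rw [stateLaw, Measure.map_apply (measurable_stateAt_const t) hB, law]
    change (μ.prod P) C = _
    rw [Measure.prod_apply hCm]
    exact lintegral_congr fun x => (ofReal_measureReal).symm
  rw [key, key]
  exact lintegral_le_add_of_measure_le h (measurable_measure_prodMk_left hCm).ennreal_toReal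
    (fun x => measureReal_nonneg) fun x => measureReal_le_one

/-- Existence of a stationary law. -/
theorem exists_isStationary (h1 : Integrable (fun x => x) G) (h2 : Integrable (fun x => x ^ 2) G)
    (h3 : Integrable (fun x => x ^ 3) G) (hrho : lam * ∫ x, x ∂G < 1) :
    ∃ π, IsStationary lam G π := by
  have hl : 0 < lam := Fact.out
  set δ : Measure State := Measure.dirac ((0, 0) : State) with hδ
  obtain ⟨π, hπ, hlim⟩ := exists_uniform_limit (fun t => stateLaw lam G δ t) fun ε hε => by
    obtain ⟨K, _, hK⟩ := exists_workLaw_Ioi_le hG h1 h2 h3 hrho (show 0 < ε / 4 by positivity)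
    obtain ⟨T, hT0, hT⟩ := exists_renewed_compl_le h1 hrho K (show 0 < ε / 4 by positivity)
    -- The queue at `s` is run for the fixed time `T` from the state at `s - T`, whose work is tight
    -- uniformly in `s`; it is compared with the empty start run for the same time.
    have key : ∀ s, T ≤ s → ∀ B, MeasurableSet B →
        |(stateLaw lam G δ s).real B - (stateLaw lam G δ T).real B| ≤ ε / 2 := fun s hs B hB => by
      have hs' : 0 ≤ s - T := by linarith
      have := abs_stateLaw_sub_le (lam := lam) hG (stateLaw lam G δ (s - T)) (ae_stateLaw hG δ _) hT0 K hB
      rw [stateLaw_stateLaw hl hG δ hs' hT0, sub_add_cancel] at this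
      refine this.trans ?_
      linarith [hK (s - T) hs']
    refine ⟨T, fun s hs t ht B hB => ?_⟩
    have a := abs_le.1 (key s hs B hB)
    have b := abs_le.1 (key t ht B hB)
    exact abs_le.2 ⟨by linarith [a.1, b.2], by linarith [a.2, b.1]⟩
  refine ⟨π, hπ, fun t ht => ?_⟩
  change stateLaw lam G π t = π
  -- `π` is close to the law of the empty start at a late time, so after a further time `t` it is
  -- close to a still later law, which is again close to `π`. A one-sided inequality is enough for
  -- probability measures.
  have hle : ∀ B, MeasurableSet B → stateLaw lam G π t B ≤ π B := fun B hB => by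
    refine ENNReal.le_of_forall_pos_le_add fun ε hε _ => ?_
    have hε' : (0 : ℝ) < ε / 2 := by positivity
    obtain ⟨T, hT⟩ := hlim (ε / 2) hε'
    have hs : 0 ≤ max T 0 := le_max_right _ _
    have toE : ∀ {μ μ' : Measure State} [IsProbabilityMeasure μ] [IsProbabilityMeasure μ']
        {B : Set State}, μ.real B ≤ μ'.real B + ε / 2 → μ B ≤ μ' B + ENNReal.ofReal (ε / 2) :=
      fun {μ μ'} _ _ {B} hh => by
        rw [← ofReal_measureReal (μ := μ), ← ofReal_measureReal (μ := μ'),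
          ← ENNReal.ofReal_add measureReal_nonneg hε'.le]
        exact ENNReal.ofReal_le_ofReal hh
    have s1 := stateLaw_le_add (lam := lam) (G := G) (ν := π)
      (ν' := stateLaw lam G δ (max T 0)) (fun B hB => toE (B := B) (by
        linarith [(abs_le.1 (hT (max T 0) (le_max_left _ _) B hB)).1])) t hB
    rw [stateLaw_stateLaw hl hG δ hs ht] at s1
    have s2 : stateLaw lam G δ (max T 0 + t) B ≤ π B + ENNReal.ofReal (ε / 2) := toE (by
      linarith [(abs_le.1 (hT (max T 0 + t) (by linarith [le_max_left T 0]) B hB)).2])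
    refine s1.trans ((add_le_add_left s2 _).trans_eq ?_)
    rw [add_assoc, ← ENNReal.ofReal_add hε'.le hε'.le, add_halves, ENNReal.ofReal_coe_nnreal]
  exact Measure.eq_of_le_of_isProbabilityMeasure (Measure.le_iff.2 hle)

end coupling

/-! ### Moments of a stationary law -/

lemma HasExp2.inv {F : ℝ → ℝ} {c₀ c₁ c₂ : ℝ} (hF : HasExp2 F c₀ c₁ c₂) (h0 : c₀ ≠ 0) :
    HasExp2 (fun x => (F x)⁻¹) c₀⁻¹ (-(c₁ / c₀ ^ 2)) (c₁ ^ 2 / c₀ ^ 3 - c₂ / c₀ ^ 2) := by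
  have hX := ((HasExp2.const 1).sub (hF.mul (((HasExp2.id.const_mul (-(c₁ / c₀ ^ 2))).add
    (HasExp2.const c₀⁻¹))))).coeff (d₀ := 0) (d₁ := 0)
    (d₂ := c₀ * (c₁ ^ 2 / c₀ ^ 3 - c₂ / c₀ ^ 2)) (by field_simp; ring) (by field_simp; ring)
    (by field_simp; ring)
  have hlim := hX.tendsto_div_sq.div hF.tendsto h0
  rw [mul_div_cancel_left₀ _ h0] at hlim
  refine Tendsto.congr' ?_ hlim
  filter_upwards [eventually_pos_right, hF.tendsto.eventually_ne h0] with x hx hFx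
  simp only [Pi.div_apply]
  field_simp
  ring

/-- Fatou's lemma, used to obtain second moments of the stationary workload and of the stationary
number from bounded approximations. -/
lemma integrable_of_lintegral_bound {X : Type*} [MeasurableSpace X] {μ : Measure X} {f : X → ℝ}
    {F : ℕ → X → ℝ} {C : ℕ → ℝ} {c : ℝ} (hF : ∀ n, Measurable (F n)) (hf : Measurable f)
    (h0 : ∀ n x, 0 ≤ F n x) (hlim : ∀ x, Tendsto (fun n => F n x) atTop (𝓝 (f x)))
    (hi : ∀ n, Integrable (F n) μ) (hC : ∀ n, ∫ x, F n x ∂μ ≤ C n)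
    (hc : Tendsto C atTop (𝓝 c)) : Integrable f μ := by
  refine ⟨hf.aestronglyMeasurable, ?_⟩
  have hf0 : ∀ x, 0 ≤ f x := fun x => ge_of_tendsto' (hlim x) fun n => h0 n x
  rw [hasFiniteIntegral_iff_ofReal (ae_of_all _ hf0)]
  have e : ∀ x, ENNReal.ofReal (f x) = liminf (fun n => ENNReal.ofReal (F n x)) atTop := fun x =>
    ((ENNReal.continuous_ofReal.tendsto _).comp (hlim x)).liminf_eq.symm
  simp_rw [e]
  refine (lintegral_liminf_le fun n => (hF n).ennreal_ofReal).trans_lt ?_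
  have hb : liminf (fun n => ∫⁻ x, ENNReal.ofReal (F n x) ∂μ) atTop ≤
      liminf (fun n => ENNReal.ofReal (C n)) atTop := by
    refine liminf_le_liminf (Eventually.of_forall fun n => ?_)
    rw [← ofReal_integral_eq_lintegral_ofReal (hi n) (ae_of_all _ (h0 n))]
    exact ENNReal.ofReal_le_ofReal (hC n)
  refine hb.trans_lt ?_
  have hC' : Tendsto (fun n => ENNReal.ofReal (C n)) atTop (𝓝 (ENNReal.ofReal c)) :=
    (ENNReal.continuous_ofReal.tendsto _).comp hc
  rw [hC'.liminf_eq]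
  exact ENNReal.ofReal_lt_top

lemma tendsto_lap {μ : Measure ℝ} [IsProbabilityMeasure μ] (hμ : ∀ᵐ w ∂μ, 0 ≤ w) :
    Tendsto (lap μ) (𝓝[>] 0) (𝓝 1) := by
  have e : (1 : ℝ) = ∫ _, 1 ∂μ := by simp
  rw [e]
  refine tendsto_integral_filter_of_dominated_convergence (fun _ => (1 : ℝ))
    (Eventually.of_forall fun α => by fun_prop) ?_ (integrable_const _) (ae_of_all _ fun w => ?_)
  · filter_upwards [eventually_pos_right] with α hα
    filter_upwards [hμ] with w hw
    rw [Real.norm_of_nonneg (Real.exp_nonneg _)]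
    exact exp_neg_mul_le_one hα.le hw
  · have : Continuous fun α : ℝ => Real.exp (-(α * w)) := by fun_prop
    simpa using (this.tendsto 0).mono_left nhdsWithin_le_nhds

section stationary

variable [Fact (0 < lam)] [IsProbabilityMeasure G] (hG : ∀ᵐ x ∂G, 0 ≤ x)
    (h1 : Integrable (fun x => x) G) (h2 : Integrable (fun x => x ^ 2) G)
    (h3 : Integrable (fun x => x ^ 3) G) (hrho : lam * ∫ x, x ∂G < 1)
    {π : Measure State} (hπ : IsStationary lam G π)

include hπ

omit [Fact (0 < lam)] [IsProbabilityMeasure G] in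
lemma IsStationary.stateLaw_eq {t : ℝ} (ht : 0 ≤ t) : stateLaw lam G π t = π := hπ.map_stateAt t ht

include hG in
lemma IsStationary.ae_nonneg : ∀ᵐ s ∂π, 0 ≤ s.2 := by
  have := hπ.isProbabilityMeasure
  have h := ae_stateLaw (lam := lam) hG π 0
  rwa [hπ.stateLaw_eq le_rfl] at h

include hG h1 h2 h3 hrho

/-- Transform of the stationary workload. -/
theorem IsStationary.lap_workLaw {α : ℝ} (hα : 0 < α) : lap (workLaw lam G π) α =
    (1 - lam * ∫ x, x ∂G) * (1 - lam * lapH G α)⁻¹ := by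
  have := hπ.isProbabilityMeasure
  have hl : 0 < lam := Fact.out
  have hr := hπ.ae_nonneg hG
  have hw := ae_workLaw (lam := lam) π hG hr
  set f := lap (workLaw lam G π) with hf
  -- Under stationarity the exponential average of the transform is the transform itself. Then
  -- `occK_eta` says that η(α)f(α)/α does not depend on `α`, and letting the argument tend to `0`
  -- evaluates the constant.
  have key : ∀ α χ, 0 < α → 0 < χ → eta lam G α / α * f α = eta lam G χ / χ * f χ :=
    fun α χ hα hχ => by
      have hθ := eta_pos hl hG h1 hrho hχ
      have := isProbabilityMeasure_expMeasure hθ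
      have h := (abel_lap (lam := lam) hG π hr hθ hα.le).2
      have e : ∫ t, lap (workLaw lam G (stateLaw lam G π t)) α ∂(expMeasure (eta lam G χ)) =
          f α := by
        have : (fun t => lap (workLaw lam G (stateLaw lam G π t)) α)
            =ᵐ[expMeasure (eta lam G χ)] fun _ => f α := by
          filter_upwards [ae_expMeasure_pos (eta lam G χ)] with t ht
          rw [hπ.stateLaw_eq ht.le]
        rw [integral_congr_ae this]; simp
      have h' := occK_eta (lam := lam) hG h1 hrho (workLaw lam G π) hw hχ hα.le
      rw [← h, e] at h'
      have hα' := hα.ne'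
      have hχ' := hχ.ne'
      field_simp at h' ⊢
      linarith
  have hlim : Tendsto (fun χ => eta lam G χ / χ * f χ) (𝓝[>] 0) (𝓝 (1 - lam * ∫ x, x ∂G)) := by
    simpa using (tendsto_eta_div (lam := lam) hG h1 h2 h3).mul (tendsto_lap hw)
  have hc : eta lam G α / α * f α = 1 - lam * ∫ x, x ∂G :=
    tendsto_nhds_unique (tendsto_const_nhds.congr' (by
      filter_upwards [eventually_pos_right] with χ hχ using key α χ hα hχ)) hlim
  have hp := one_sub_lapH_pos hl hG h1 hrho hα
  rw [eta_eq lam G hα, mul_div_cancel_left₀ _ hα.ne'] at hc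
  rw [← hc]
  field_simp

/-- The stationary workload is square integrable. -/
theorem IsStationary.memLp_initialWork : MemLp initialWork 2 (law lam G π) := by
  have := hπ.isProbabilityMeasure
  have hl : 0 < lam := Fact.out
  have hr := hπ.ae_nonneg hG
  have hw := ae_workLaw (lam := lam) π hG hr
  set M := workLaw lam G π with hM
  set c₀ := 1 - lam * ∫ x, x ∂G with hc₀
  have hr0 : 0 < c₀ := by linarith
  have hE := (((hasExp2_one_sub_lapH (lam := lam) hG h1 h2 h3).inv hr0.ne').const_mul c₀).congr
    fun α hα => hπ.lap_workLaw hG h1 h2 h3 hrho hα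
  rw [mul_inv_cancel₀ hr0.ne'] at hE
  have hid2 : HasExp2 (fun x : ℝ => 2 * x) 0 2 0 :=
    (HasExp2.id.const_mul 2).coeff (by ring) (by ring) (by ring)
  -- The second difference 1 - 2f(α) + f(2α) is the mean of (1 - exp(-αW))². The expansion of the
  -- explicit transform shows it to be of order α², and Fatou's lemma along `α = 1 / (n + 1)` bounds
  -- the mean of W².
  have hX := (((HasExp2.const 1).sub (hE.const_mul 2)).add
    (hE.comp hid2 fun x hx => by positivity)).coeff (d₀ := 0) (d₁ := 0) (by ring) (by ring) rfl
  have hα : Tendsto (fun n : ℕ => 1 / ((n : ℝ) + 1)) atTop (𝓝[>] 0) :=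
    tendsto_nhdsWithin_iff.2 ⟨tendsto_one_div_add_atTop_nhds_zero_nat,
      Eventually.of_forall fun n => by simp only [Set.mem_Ioi]; positivity⟩
  have hi : ∀ α, 0 < α → Integrable (fun w => ((1 - Real.exp (-(α * w))) / α) ^ 2) M ∧
      ∫ w, ((1 - Real.exp (-(α * w))) / α) ^ 2 ∂M =
        (1 - 2 * lap M α + lap M (2 * α)) / α ^ 2 := fun α hα => by
    have e : ∀ w, ((1 - Real.exp (-(α * w))) / α) ^ 2 =
        (1 - 2 * Real.exp (-(α * w)) + Real.exp (-(2 * α * w))) / α ^ 2 := fun w => by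
      rw [show -(2 * α * w) = -(α * w) + -(α * w) by ring, Real.exp_add]
      field_simp
      ring
    have i1 := (integrable_lap hw hα.le).const_mul 2
    have i2 := integrable_lap hw (show 0 ≤ 2 * α by positivity)
    have i3 : Integrable (fun w => 1 - 2 * Real.exp (-(α * w))) M := (integrable_const 1).sub i1
    simp_rw [e]
    refine ⟨(i3.add i2).div_const _, ?_⟩
    rw [integral_div, integral_add i3 i2, integral_sub (integrable_const 1) i1,
      integral_const_mul]
    simp [lap]
  have hsq : Integrable (fun w => w ^ 2) M := by
    refine integrable_of_lintegral_bound (F := fun n w =>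
      ((1 - Real.exp (-(1 / ((n : ℝ) + 1) * w))) / (1 / ((n : ℝ) + 1))) ^ 2)
      (fun n => by fun_prop) (by fun_prop) (fun n w => sq_nonneg _) (fun w => ?_)
      (fun n => (hi _ (by positivity)).1) (fun n => (hi _ (by positivity)).2.le)
      (hX.tendsto_div_sq.comp hα)
    have hd : HasDerivAt (fun α : ℝ => 1 - Real.exp (-(α * w))) w 0 := by
      have := (((hasDerivAt_id (0 : ℝ)).mul_const w).neg.exp).const_sub 1
      simpa using this
    have hs := (hasDerivAt_iff_tendsto_slope.1 hd).mono_left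
      (nhdsWithin_mono 0 fun x (hx : 0 < x) => hx.ne')
    refine ((hs.comp hα).pow 2).congr fun n => ?_
    simp [slope_def_field]
  refine (memLp_two_iff_integrable_sq measurable_initialWork.aestronglyMeasurable).2 ?_
  rw [hM, workLaw, integrable_map_measure (by fun_prop) measurable_initialWork.aemeasurable] at hsq
  exact hsq

variable (hg : 0 < ∫ x, x ∂G)

omit hG h1 h2 h3 hrho in
lemma IsStationary.measurePreserving_queue {θ : ℝ} [Fact (0 < θ)] :
    MeasurePreserving (fun p : Input × ℝ => (queueLength p.1 p.2, p.2)) (abelLaw lam G π θ)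
      ((π.map Prod.fst).prod (expMeasure θ)) := by
  have := hπ.isProbabilityMeasure
  have : IsProbabilityMeasure (π.map Prod.fst) :=
    Measure.isProbabilityMeasure_map measurable_fst.aemeasurable
  refine ⟨by fun_prop, (Measure.prod_eq fun A B hA hB => ?_).symm⟩
  have hm : MeasurableSet ((fun p : Input × ℝ => (queueLength p.1 p.2, p.2)) ⁻¹' (A ×ˢ B)) :=
    (by fun_prop : Measurable fun p : Input × ℝ => (queueLength p.1 p.2, p.2)) (hA.prod hB)
  rw [Measure.map_apply (by fun_prop) (hA.prod hB), abelLaw, Measure.prod_apply_symm hm]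
  have e : ∀ᵐ t ∂(expMeasure θ), law lam G π ((fun ω => (ω, t)) ⁻¹'
      ((fun p : Input × ℝ => (queueLength p.1 p.2, p.2)) ⁻¹' (A ×ˢ B))) =
      Set.indicator B (fun _ => π.map Prod.fst A) t := by
    filter_upwards [ae_expMeasure_pos θ] with t ht
    by_cases h : t ∈ B
    · rw [Set.indicator_of_mem h, Measure.map_apply measurable_fst hA]
      conv_rhs => rw [← hπ.stateLaw_eq ht.le]
      rw [stateLaw, Measure.map_apply (measurable_stateAt_const t) (measurable_fst hA)]
      congr 1
      ext ω
      simp [h, stateAt]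
    · rw [Set.indicator_of_notMem h]
      convert measure_empty (μ := law lam G π)
      ext ω
      simp [h]
  rw [lintegral_congr_ae e, lintegral_indicator_const hB]

omit hG h1 h2 h3 hrho in
lemma IsStationary.integral_queue {θ : ℝ} [Fact (0 < θ)] (F : ℕ → ℝ) :
    ∫ p, F (queueLength p.1 p.2) ∂(abelLaw lam G π θ) = ∫ s, F s.1 ∂π := by
  have := hπ.isProbabilityMeasure
  have : IsProbabilityMeasure (π.map Prod.fst) :=
    Measure.isProbabilityMeasure_map measurable_fst.aemeasurable
  have hF : Measurable F := measurable_from_nat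
  refine (integral_comp_measurePreserving (measurePreserving_fst.comp
    (hπ.measurePreserving_queue (θ := θ))) hF).trans ?_
  rw [integral_map measurable_fst.aemeasurable hF.aestronglyMeasurable]

include hg

/-- The stationary number of customers is square integrable. -/
theorem IsStationary.memLp_number : MemLp (fun s : State => (s.1 : ℝ)) 2 π := by
  have := hπ.isProbabilityMeasure
  have hr := hπ.ae_nonneg hG
  have hW := hπ.memLp_initialWork hG h1 h2 h3 hrho
  have hF := eventually_fact (lam := lam) hG h1 hrho
  have hη : Tendsto (eta lam G) (𝓝[>] 0) (𝓝[>] 0) := tendsto_eta Fact.out hG h1 h2 h3 hrho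
  refine (memLp_two_iff_integrable_sq measurable_number.aestronglyMeasurable).2 ?_
  have hmn : ∀ n : ℕ, Measurable fun s : State => (min (s.1 : ℝ) n) ^ 2 := fun n =>
    (measurable_number.min measurable_const).pow_const 2
  refine integrable_of_lintegral_bound (F := fun n s => (min (s.1 : ℝ) n) ^ 2)
    (C := fun _ => sqQueue lam G) hmn (measurable_number.pow_const 2) (fun n s => sq_nonneg _)
    (fun s => ?_) (fun n => ?_) (fun n => ?_) tendsto_const_nhds
  · refine tendsto_const_nhds.congr' ?_
    filter_upwards [eventually_ge_atTop s.1] with n hn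
    rw [min_eq_left (Nat.cast_le.2 hn)]
  · refine Integrable.of_bound (hmn n).aestronglyMeasurable ((n : ℝ) ^ 2) (ae_of_all _ fun s => ?_)
    rw [Real.norm_of_nonneg (sq_nonneg _)]
    gcongr
    exact min_le_right _ _
  -- Once the initial work is done all customers present are later ones, whose second moment tends
  -- to `sqQueue lam G`. Before that the truncated square is at most `n ^ 2`, on an event of
  -- vanishing probability. The resulting bound is free of `n`.
  · have hlim := (tendsto_new_sq π hG h1 h2 h3 hg hrho hr hW).add ((tendsto_tail (lam := lam) (G := G) π
      (X := fun _ => (n : ℝ) ^ 2) measurable_const (integrable_const _)).comp hη)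
    rw [add_zero] at hlim
    refine ge_of_tendsto hlim ?_
    filter_upwards [hF] with χ hχ
    have hS : MeasurableSet {p : Input × ℝ | p.2 < initialWork p.1} :=
      measurableSet_lt (by fun_prop) (by fun_prop)
    have i1 := (memLp_new (lam := lam) (θ := eta lam G χ) π hG hr).integrable_sq
    have i2 : Integrable (Set.indicator {p : Input × ℝ | p.2 < initialWork p.1}
      (fun _ => (n : ℝ) ^ 2)) (abelLaw lam G π (eta lam G χ)) := (integrable_const _).indicator hS
    rw [← hπ.integral_queue (θ := eta lam G χ) fun k => (min (k : ℝ) n) ^ 2]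
    simp only [Function.comp_apply]
    rw [← integral_add i1 i2]
    refine integral_mono_of_nonneg (ae_of_all _ fun p => sq_nonneg _) (i1.add i2) ?_
    filter_upwards [ae_split (lam := lam) hG π hr] with p hp
    by_cases h : p.2 < initialWork p.1
    · rw [Set.indicator_of_mem
        (show p ∈ {p : Input × ℝ | p.2 < initialWork p.1} from h)]
      have : (min (queueLength p.1 p.2 : ℝ) n) ^ 2 ≤ (n : ℝ) ^ 2 := by
        gcongr; exact min_le_right _ _
      nlinarith [sq_nonneg (atNew p)]
    · rw [Set.indicator_of_notMem
        (show p ∉ {p : Input × ℝ | p.2 < initialWork p.1} from h), add_zero]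
      have e := hp.queue
      rw [hp.old_eq_zero (not_lt.1 h), zero_add, atQueue] at e
      rw [← e]
      gcongr
      exact min_le_left _ _

/-- Under stationarity the exponential averages of moments of the queue length are constant, so they
equal their limits. -/
theorem IsStationary.numberVariance_eq :
    numberVariance π = sqQueue lam G - meanQueue lam G ^ 2 := by
  have := hπ.isProbabilityMeasure
  have hr := hπ.ae_nonneg hG
  have hW := hπ.memLp_initialWork hG h1 h2 h3 hrho
  have hq := hπ.memLp_number hG h1 h2 h3 hrho hg
  have hF := eventually_fact (lam := lam) hG h1 hrho
  have hm : ∫ s, (s.1 : ℝ) ∂π = meanQueue lam G :=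
    tendsto_nhds_unique (tendsto_const_nhds.congr' (by
      filter_upwards [hF] with χ hχ
      exact (hπ.integral_queue (θ := eta lam G χ) fun k => (k : ℝ)).symm))
      (tendsto_queue hG h1 h2 h3 hg hrho π hr hq hW)
  have hs : ∫ s, (s.1 : ℝ) ^ 2 ∂π = sqQueue lam G :=
    tendsto_nhds_unique (tendsto_const_nhds.congr' (by
      filter_upwards [hF] with χ hχ
      exact (hπ.integral_queue (θ := eta lam G χ) fun k => (k : ℝ) ^ 2).symm))
      (tendsto_queue_sq π hG h1 h2 h3 hg hrho hr hq hW)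
  rw [numberVariance, variance_eq_sub hq, ← hm, ← hs]
  rfl

end stationary

/-! ### Square integrability of the initial work -/

/-- Sum of the service times of as many customers as are present initially. -/
def initialSum (ω : Input) : ℝ := ∑ i ∈ Finset.range ω.1.1, ω.2.2 i

@[fun_prop]
lemma measurable_initialSum : Measurable initialSum :=
  measurable_index (f := fun k (ω : Input) => ∑ i ∈ Finset.range k, ω.2.2 i)
    (fun k => by fun_prop) (by fun_prop : Measurable fun ω : Input => ω.1.1)

lemma Good.departureTime_le {ω : Input} (h : Good ω) (hr : 0 ≤ ω.1.2) {n : ℕ} (hn : n < ω.1.1) :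
    departureTime ω n ≤ ω.1.2 + ∑ i ∈ Finset.range (n + 1), ω.2.2 i := by
  have hq : 0 < initialNumber ω := by unfold initialNumber; omega
  induction n with
  | zero =>
    simp only [departureTime, entryTime_of_lt hn, serviceTime, hq, and_self, if_true, zero_add,
      Finset.sum_range_one]
    linarith [h.serv 0]
  | succ n ih =>
    rw [departureTime_succ, entryTime_of_lt hn, max_eq_left (h.departureTime_nonneg hr n),
      Finset.sum_range_succ, ← add_assoc]
    simpa using ih (by omega)

lemma Good.initialWork_le {ω : Input} (h : Good ω) (hr : 0 ≤ ω.1.2) :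
    initialWork ω ≤ ω.1.2 + initialSum ω := by
  unfold initialWork initialSum
  split_ifs with h0
  · simp [h0, hr]
  · have := h.departureTime_le hr (n := ω.1.1 - 1) (by omega)
    rwa [Nat.sub_add_cancel (Nat.pos_of_ne_zero h0)] at this

section

variable [Fact (0 < lam)] [IsProbabilityMeasure G] (hG : ∀ᵐ x ∂G, 0 ≤ x)
    (h2 : Integrable (fun x => x ^ 2) G) (ν : Measure State) [IsProbabilityMeasure ν]
    (hq : MemLp (fun s : State => (s.1 : ℝ)) 2 ν)

include h2 hq

-- Given the initial number q, Cauchy-Schwarz bounds the squared sum by q times the sum of squares,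
-- whose mean is q² g₂.
omit [IsProbabilityMeasure ν] in
lemma memLp_initialSum : MemLp initialSum 2 (law lam G ν) := by
  have hl : 0 < lam := Fact.out
  have := isProbabilityMeasure_expMeasure hl
  refine (memLp_two_iff_integrable_sq measurable_initialSum.aestronglyMeasurable).2
    ⟨by fun_prop, ?_⟩
  rw [hasFiniteIntegral_iff_ofReal (ae_of_all _ fun ω => sq_nonneg _)]
  set c : ℝ≥0∞ := ∫⁻ x, ENNReal.ofReal (x ^ 2) ∂G with hc
  have hcf : c < ∞ := (hasFiniteIntegral_iff_ofReal (ae_of_all _ fun x => sq_nonneg x)).1 h2.2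
  have hqf : ∫⁻ s : State, ENNReal.ofReal ((s.1 : ℝ) ^ 2) ∂ν < ∞ :=
    (hasFiniteIntegral_iff_ofReal (ae_of_all _ fun x => sq_nonneg _)).1 hq.integrable_sq.2
  rw [lintegral_law hl ν (by fun_prop)]
  have hb : ∀ s : State, ∫⁻ σ, ENNReal.ofReal (initialSum (s, 0, σ) ^ 2) ∂(iid G) ≤
      ENNReal.ofReal ((s.1 : ℝ) ^ 2) * c := fun s => by
    calc ∫⁻ σ, ENNReal.ofReal (initialSum (s, 0, σ) ^ 2) ∂(iid G)
        ≤ ∫⁻ σ, ENNReal.ofReal (s.1 : ℝ) *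
            ∑ i ∈ Finset.range s.1, ENNReal.ofReal (σ i ^ 2) ∂(iid G) := by
          refine lintegral_mono fun σ => ?_
          rw [← ENNReal.ofReal_sum_of_nonneg fun i _ => sq_nonneg _,
            ← ENNReal.ofReal_mul (Nat.cast_nonneg _)]
          refine ENNReal.ofReal_le_ofReal ?_
          simpa [initialSum] using sq_sum_le_card_mul_sum_sq (s := Finset.range s.1) (f := σ)
      _ = ENNReal.ofReal ((s.1 : ℝ) ^ 2) * c := by
          rw [lintegral_const_mul _ (by fun_prop), lintegral_finsetSum _ fun i _ => by fun_prop]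
          have : ∀ i, ∫⁻ σ : ℕ → ℝ, ENNReal.ofReal (σ i ^ 2) ∂(iid G) = c := fun i =>
            lintegral_eval G i (f := fun x => ENNReal.ofReal (x ^ 2)) (by fun_prop)
          simp only [this, Finset.sum_const, Finset.card_range, nsmul_eq_mul]
          rw [pow_two, ENNReal.ofReal_mul (Nat.cast_nonneg _), ENNReal.ofReal_natCast, mul_assoc]
  refine lt_of_le_of_lt (lintegral_mono fun s => ?_) (b := ∫⁻ s : State,
    ENNReal.ofReal ((s.1 : ℝ) ^ 2) * c ∂ν) ?_
  · refine (lintegral_mono fun a => hb s).trans ?_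
    rw [lintegral_const, measure_univ, mul_one]
  · rw [lintegral_mul_const _ (by fun_prop)]
    exact ENNReal.mul_lt_top hqf hcf

include hG

lemma memLp_initialWork (hr : ∀ᵐ s ∂ν, 0 ≤ s.2) (hR : MemLp (fun s : State => s.2) 2 ν) :
    MemLp initialWork 2 (law lam G ν) := by
  have hR' : MemLp (fun ω : Input => ω.1.2) 2 (law lam G ν) :=
    hR.comp_measurePreserving (measurePreserving_state ν)
  refine (hR'.add (memLp_initialSum h2 ν hq)).mono measurable_initialWork.aestronglyMeasurable ?_
  filter_upwards [ae_initialWork (lam := lam) hG ν hr,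
    (measurePreserving_state (lam := lam) (G := G) ν).quasiMeasurePreserving.ae hr] with ω hω hω'
  rw [Real.norm_of_nonneg hω.2]
  exact (hω.1.initialWork_le hω').trans (le_abs_self _)

end

/-! ### The parameters -/

section parameters

variable [IsProbabilityMeasure G] (h1 : Integrable (fun x => x) G)
    (h2 : Integrable (fun x => x ^ 2) G)

include h1 h2

lemma integral_sub_sq : ∫ x, (x - g G 1) ^ 2 ∂G = g G 2 - g G 1 ^ 2 := by
  have e : ∀ x, (x - g G 1) ^ 2 = x ^ 2 - 2 * g G 1 * x + g G 1 ^ 2 := fun x => by ring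
  have i1 : Integrable (fun x => 2 * g G 1 * x) G := h1.const_mul _
  have i2 : Integrable (fun x => x ^ 2 - 2 * g G 1 * x) G := h2.sub i1
  simp_rw [e]
  rw [integral_add i2 (integrable_const _), integral_sub h2 i1, integral_const_mul, ← g_one]
  simp only [integral_const, probReal_univ, smul_eq_mul, one_mul, g]
  ring

lemma sq_le_g_two : g G 1 ^ 2 ≤ g G 2 := by
  have : 0 ≤ ∫ x, (x - g G 1) ^ 2 ∂G := integral_nonneg fun x => sq_nonneg _
  rw [integral_sub_sq h1 h2] at this
  linarith

/-- Zero variance makes the service time almost surely constant. This settles the deterministic case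
of `skew_mul_cv`, where the skewness is `0 / 0`. -/
lemma g_three_of_deterministic (h : g G 2 = g G 1 ^ 2) : g G 3 = g G 1 ^ 3 := by
  have h0 := integral_sub_sq h1 h2
  rw [h, sub_self] at h0
  have hi : Integrable (fun x => (x - g G 1) ^ 2) G := by
    have := (memLp_two_iff_integrable_sq (f := fun x : ℝ => x) (by fun_prop)).2 h2
    exact (this.sub (memLp_const (g G 1))).integrable_sq
  rw [integral_eq_zero_iff_of_nonneg (fun x => sq_nonneg _) hi] at h0
  have : (fun x => x ^ 3) =ᵐ[G] fun _ => g G 1 ^ 3 := by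
    filter_upwards [h0] with x hx
    have : x - g G 1 = 0 := by simpa using hx
    rw [sub_eq_zero.1 this]
  rw [g, integral_congr_ae this]
  simp

variable (hg : 0 < g G 1)
include hg

lemma cv_sq : cv G ^ 2 = g G 2 / g G 1 ^ 2 - 1 := by
  refine Real.sq_sqrt ?_
  rw [sub_nonneg, one_le_div (by positivity)]
  exact sq_le_g_two h1 h2

/-- The power `3 / 2` in the skewness cancels against the cube of `cv`, so the intercepts become
rational functions of `lam` and the moments. -/
lemma skew_mul_cv : skew G * cv G ^ 3 =
    (2 * g G 1 ^ 3 - 3 * g G 1 * g G 2 + g G 3) / g G 1 ^ 3 := by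
  have hle := sq_le_g_two h1 h2
  rcases hle.eq_or_lt with h | h
  · have hc : cv G = 0 := by
      have := cv_sq h1 h2 hg
      rw [← h, div_self (by positivity), sub_self] at this
      exact pow_eq_zero_iff two_ne_zero |>.1 this
    rw [hc, g_three_of_deterministic h1 h2 h.symm, ← h]
    ring
  · have hd : 0 < g G 2 - g G 1 ^ 2 := by linarith
    have e1 : (g G 2 - g G 1 ^ 2) ^ (3 / 2 : ℝ) = Real.sqrt (g G 2 - g G 1 ^ 2) ^ 3 := by
      rw [Real.sqrt_eq_rpow, ← Real.rpow_natCast (_ ^ _) 3, ← Real.rpow_mul hd.le]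
      norm_num
    have e2 : cv G = Real.sqrt (g G 2 - g G 1 ^ 2) / g G 1 := by
      rw [cv, show g G 2 / g G 1 ^ 2 - 1 = (g G 2 - g G 1 ^ 2) / g G 1 ^ 2 by field_simp,
        Real.sqrt_div hd.le, Real.sqrt_sq hg.le]
    have hs : Real.sqrt (g G 2 - g G 1 ^ 2) ≠ 0 := (Real.sqrt_pos.2 hd).ne'
    rw [skew, e1, e2]
    field_simp

variable (hrho : rho lam G < 1)
include hrho

/-- The right-hand side is what `intercept` gives when the initial number has the equilibrium
variance. -/
lemma be_eq : be lam G = 2 * (sqQueue lam G - meanQueue lam G ^ 2) - 2 * covQueue lam G := by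
  have e2 := cv_sq h1 h2 hg
  have e3 := skew_mul_cv h1 h2 hg
  have e4 : cv G ^ 4 = (cv G ^ 2) ^ 2 := by ring
  have hl : lam = rho lam G / g G 1 := by rw [rho]; field_simp
  simp only [be, Le, sqQueue, factQueue, sqWork, meanQueue, meanWork, covQueue,
    mul_assoc (4 : ℝ), e3, e4, e2]
  generalize rho lam G = ρ at hl hrho ⊢
  generalize g G 1 = m at hl hg ⊢
  -- With `r = 1 - ρ` and `lam = ρ / m` all denominators are powers of `r` and `m`, and a polynomial
  -- identity remains.
  obtain ⟨r, rfl⟩ : ∃ r, ρ = 1 - r := ⟨1 - ρ, by ring⟩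
  have hr : r ≠ 0 := by rintro rfl; linarith
  subst hl
  rw [sub_sub_cancel]
  field_simp
  ring

/-- The left-hand side is what `intercept` gives when the initial number has variance zero. -/
lemma intercept_empty : sqQueue lam G - meanQueue lam G ^ 2 - 2 * covQueue lam G =
    -(1 - L0 lam G) * (rho lam G / (1 - rho lam G) ^ 2) := by
  have e2 := cv_sq h1 h2 hg
  have e3 := skew_mul_cv h1 h2 hg
  have e4 : cv G ^ 4 = (cv G ^ 2) ^ 2 := by ring
  have hl : lam = rho lam G / g G 1 := by rw [rho]; field_simp
  simp only [L0, sqQueue, factQueue, sqWork, meanQueue, meanWork, covQueue,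
    mul_assoc (4 : ℝ), e3, e4, e2]
  generalize rho lam G = ρ at hl hrho ⊢
  generalize g G 1 = m at hl hg ⊢
  obtain ⟨r, rfl⟩ : ∃ r, ρ = 1 - r := ⟨1 - ρ, by ring⟩
  have hr : r ≠ 0 := by rintro rfl; linarith
  subst hl
  rw [sub_sub_cancel]
  field_simp
  ring

end parameters

end MG1
end

/-! ### The theorem. -/

theorem mainTheorem4 (lam : ℝ) (G : Measure ℝ) [IsProbabilityMeasure G]
    (hlam : 0 < lam) (hG : ∀ᵐ x ∂G, 0 ≤ x)
    (hg3 : Integrable (fun x : ℝ => x ^ 3) G)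
    (hg1 : 0 < MG1.g G 1) (hrho : MG1.rho lam G < 1) :
    (∃ π : Measure MG1.State, MG1.IsStationary lam G π) ∧
    ∀ π : Measure MG1.State, MG1.IsStationary lam G π →
      -- the stationary number of customers has a finite variance
      MemLp (fun s : MG1.State => (s.1 : ℝ)) 2 π ∧
      -- the y-intercept of the stationary queue
      (∀ vbar b : ℝ,
        MG1.HasLinearAsymptote (MG1.varianceCurve lam G π) vbar b → b = MG1.be lam G) ∧
      -- arbitrary number of initial customers, all of them with fresh service times
      (∀ (θ : Measure ℕ) [IsProbabilityMeasure θ],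
        MemLp (fun n : ℕ => (n : ℝ)) 2 θ →
        ∀ vbar b : ℝ,
          MG1.HasLinearAsymptote (MG1.varianceCurve lam G (θ.prod G)) vbar b →
          b = variance (fun n : ℕ => (n : ℝ)) θ - MG1.numberVariance π + MG1.be lam G) ∧
      -- the same when a customer may be in the middle of its service at time `0`
      (∀ (ν : Measure MG1.State) [IsProbabilityMeasure ν],
        (∀ᵐ s ∂ν, 0 ≤ s.2) →
        MemLp (fun s : MG1.State => (s.1 : ℝ)) 2 ν →
        MemLp (fun s : MG1.State => s.2) 2 ν →
        ∀ vbar b : ℝ,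
          MG1.HasLinearAsymptote (MG1.varianceCurve lam G ν) vbar b →
          b = MG1.numberVariance ν - MG1.numberVariance π + MG1.be lam G) ∧
      -- empty start
      (∀ vbar b : ℝ,
        MG1.HasLinearAsymptote
          (MG1.varianceCurve lam G (Measure.dirac ((0, 0) : MG1.State))) vbar b →
        b = -(1 - MG1.L0 lam G) * (MG1.rho lam G / (1 - MG1.rho lam G) ^ 2)) := by
  have : Fact (0 < lam) := ⟨hlam⟩
  -- On the half-line the lower powers are dominated by `1 + x ^ 3`.
  have hpow : ∀ k : ℕ, k ≤ 3 → Integrable (fun x : ℝ => x ^ k) G := fun k hk => by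
    refine ((integrable_const (1 : ℝ)).add hg3).mono' (by fun_prop) ?_
    filter_upwards [hG] with x hx
    rw [Real.norm_of_nonneg (by positivity), Pi.add_apply]
    rcases le_total x 1 with h | h
    · linarith [pow_le_one₀ hx h (n := k), pow_nonneg hx 3]
    · linarith [pow_le_pow_right₀ h hk]
  have h1 : Integrable (fun x : ℝ => x) G := by simpa using hpow 1 (by norm_num)
  have h2 := hpow 2 (by norm_num)
  have hg : 0 < ∫ x, x ∂G := by rwa [MG1.g_one] at hg1
  have hr : lam * ∫ x, x ∂G < 1 := by rwa [MG1.rho, MG1.g_one] at hrho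
  refine ⟨MG1.exists_isStationary hG h1 h2 hg3 hr, fun π hπ => ?_⟩
  have hprob := hπ.isProbabilityMeasure
  have hq := hπ.memLp_number hG h1 h2 hg3 hr hg
  have hvar := hπ.numberVariance_eq hG h1 h2 hg3 hr hg
  have hbe := MG1.be_eq (lam := lam) h1 h2 hg1 hrho
  -- Covers every start with square integrable number and residual service time: these make the
  -- initial work square integrable, and the equilibrium constants are rewritten through
  -- `numberVariance π` and `be`.
  have general : ∀ (ν : Measure MG1.State) [IsProbabilityMeasure ν], (∀ᵐ s ∂ν, 0 ≤ s.2) →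
      MemLp (fun s : MG1.State => (s.1 : ℝ)) 2 ν → MemLp (fun s : MG1.State => s.2) 2 ν →
      ∀ vbar b : ℝ, MG1.HasLinearAsymptote (MG1.varianceCurve lam G ν) vbar b →
        b = MG1.numberVariance ν - MG1.numberVariance π + MG1.be lam G :=
    fun ν _ hν hN hR vbar b hb => by
      have := MG1.intercept hG h1 h2 hg3 hg hr ν hν hN (MG1.memLp_initialWork hG h2 ν hN hν hR) hb
      rw [this, hvar, hbe]
      ring
  refine ⟨hq, fun vbar b hb => ?_, fun θ _ hθ vbar b hb => ?_, general, fun vbar b hb => ?_⟩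
  -- The stationary case bypasses `general`: square integrability of the work comes from its
  -- transform, without a moment condition on the residual service time.
  · have := MG1.intercept hG h1 h2 hg3 hg hr π (hπ.ae_nonneg hG) hq
      (hπ.memLp_initialWork hG h1 h2 hg3 hr) hb
    rw [this, hvar, hbe]
    ring
  -- An independent residual time of law `G` is a fresh service for customer `0`; when nobody is
  -- present initially it is not read by `serviceTime`.
  · have hid : MemLp (fun x : ℝ => x) 2 G :=
      (memLp_two_iff_integrable_sq measurable_id.aestronglyMeasurable).2 h2
    have := general (θ.prod G) (Measure.quasiMeasurePreserving_snd.ae hG)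
      (hθ.comp_measurePreserving measurePreserving_fst)
      (hid.comp_measurePreserving measurePreserving_snd) vbar b hb
    rwa [MG1.numberVariance, MeasurePreserving.variance_fun_comp (X := Prod.fst)
      measurePreserving_fst (f := fun n : ℕ => (n : ℝ)) measurable_from_nat.aemeasurable] at this
  · have := general (Measure.dirac ((0, 0) : MG1.State)) MG1.ae_dirac_nonneg
      ((memLp_const _).ae_eq (ae_eq_dirac _).symm) ((memLp_const _).ae_eq (ae_eq_dirac _).symm)
      vbar b hb
    rw [this, hvar, hbe, ← MG1.intercept_empty h1 h2 hg1 hrho, MG1.numberVariance, variance_dirac]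
    ring
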